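/- Let $\mathfrak h_3$ be the Siegel space of symmetric complex $3\times 3$ matrices with positive definite imaginary part. For $\delta=(\delta',\delta'')\in(\tfrac12\mathbb Z/\mathbb Z)^3\oplus(\tfrac12\mathbb Z/\mathbb Z)^3\cong\mathbb F_2^3\oplus\mathbb F_2^3$ let $$\vartheta_\delta(\Omega,z)=\sum_{m\in\mathbb Z^3}\exp\Big(\pi i\big((m+\delta')\,\Omega\,(m+\delta')^T+2(m+\delta')(z+\delta'')^T\big)\Big),$$ where $\delta',\delta''$ are represented by vectors with entries in $\{0,\tfrac12\}$. The characteristic $\delta$ is even if the pairing of $\delta'$ and $\delta''$ in $\mathbb F_2$ is $0$. Let $\alpha$ be an even characteristic and let $D_\alpha=\{\Omega\in\mathfrak h_3:\vartheta_\alpha(\Omega,0)=0\}$ be the zero locus of its thetanull. Let $\mathfrak h_3^{red}\subset\mathfrak h_3$ be the locus of normalized period matrices of framed principally polarized abelian threefolds that are reducible, i.e. isomorphic, as polarized abelian varieties, to a product of two principally polarized abelian varieties of positive dimension. Let $\mathfrak h_3^{red,sing}$ be its singular locus, i.e. the set of points of $\mathfrak h_3^{red}$ near which it is not a complex submanifold,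 and put $D_\alpha^{red}=D_\alpha\cap\mathfrak h_3^{red}$. Irreducible components are those of analytic subsets of $\mathfrak h_3$. 1. If $p\in D_\alpha\cap\mathfrak h_3^{red,sing}$, then exactly three irreducible components of $\mathfrak h_3^{red}$ pass through $p$, and $D_\alpha$ contains exactly two of them. 2. $D_\alpha^{red}$ is a simple normal crossings divisor in $D_\alpha$: it is a closed analytic subset; every irreducible component of it is smooth; and near every $p\in D_\alpha^{red}$ the locus $D_\alpha$ is a complex submanifold of $\mathfrak h_3$ with local holomorphic coordinates centred at $p$ (part of a system of holomorphic coordinates of $\mathfrak h_3$) in which $D_\alpha^{red}$ is the zero set of a product of distinct coordinates. -/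

import Mathlib

noncomputable section

/-! Holomorphic charts, analytic subsets, irreducible components, singular points and
simple normal crossings in an open subset `U` of a complex normed space `E`. -/

section AnalyticGeometry

variable {E : Type} [NormedAddCommGroup E] [NormedSpace ℂ E]

/-- `e` is a biholomorphic map from an open subset of `E` onto an open subset of `ℂⁿ`,
that is, a system of local holomorphic coordinates on its source. -/
def IsHolomorphicChart {n : ℕ} (e : OpenPartialHomeomorph E (Fin n → ℂ)) : Prop :=
  DifferentiableOn ℂ e e.source ∧ DifferentiableOn ℂ e.symm e.target

/-- `Z` is a (closed) analytic subset of the open set `U`: around every point of `U` it is the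
common zero set of finitely many holomorphic functions. -/
def IsAnalyticSubset (U Z : Set E) : Prop :=
  Z ⊆ U ∧ ∀ p ∈ U, ∃ V : Set E, IsOpen V ∧ p ∈ V ∧ V ⊆ U ∧
    ∃ (n : ℕ) (f : Fin n → E → ℂ), (∀ i, DifferentiableOn ℂ (f i) V) ∧
      ∀ q ∈ V, (q ∈ Z ↔ ∀ i, f i q = 0)

/-- `Z` is a nonempty analytic subset of `U` that is not the union of two proper analytic
subsets. -/
def IsIrreducibleAnalytic (U Z : Set E) : Prop :=
  IsAnalyticSubset U Z ∧ Z.Nonempty ∧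
    ∀ Z₁ Z₂ : Set E, IsAnalyticSubset U Z₁ → IsAnalyticSubset U Z₂ → Z = Z₁ ∪ Z₂ →
      Z = Z₁ ∨ Z = Z₂

/-- `C` is an irreducible component of `A`: a maximal irreducible analytic subset of `U`
contained in `A`. -/
def IsAnalyticComponent (U A C : Set E) : Prop :=
  Maximal (fun Z => IsIrreducibleAnalytic U Z ∧ Z ⊆ A) C

/-- `p` is a point of `Z` near which `Z` is a complex submanifold: in suitable local holomorphic
coordinates, `Z` is the vanishing locus of some of the coordinates. -/
def IsRegularPoint (Z : Set E) (p : E) : Prop :=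
  p ∈ Z ∧ ∃ (n : ℕ) (e : OpenPartialHomeomorph E (Fin n → ℂ)) (S : Finset (Fin n)),
    IsHolomorphicChart e ∧ p ∈ e.source ∧ ∀ q ∈ e.source, (q ∈ Z ↔ ∀ i ∈ S, e q i = 0)

/-- The points of `Z` at which `Z` is not a complex submanifold. -/
def singularLocus (Z : Set E) : Set E := {p | p ∈ Z ∧ ¬ IsRegularPoint Z p}

/-- `D` is a (reduced) simple normal crossings divisor in `X`, where `D ⊆ X ⊆ U`.
`D` is a closed analytic subset; near each `p ∈ D` there are holomorphic coordinates of the ambient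
space, centred at `p`, in which `X` is the submanifold where the coordinates indexed by `S` vanish
(so that the other coordinates are holomorphic coordinates of `X`), and in which `D` is cut out in
`X` by the product of the coordinates of `X` indexed by `T`; and every irreducible component of
`D` is smooth. -/
def IsSNCDivisorIn (U X D : Set E) : Prop :=
  X ⊆ U ∧ D ⊆ X ∧ IsAnalyticSubset U D ∧
  (∀ p ∈ D, ∃ (n : ℕ) (e : OpenPartialHomeomorph E (Fin n → ℂ)) (S T : Finset (Fin n)),
    IsHolomorphicChart e ∧ p ∈ e.source ∧ e p = 0 ∧ Disjoint S T ∧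
    (∀ q ∈ e.source, (q ∈ X ↔ ∀ i ∈ S, e q i = 0)) ∧
    (∀ q ∈ e.source, (q ∈ D ↔ q ∈ X ∧ ∏ i ∈ T, e q i = 0))) ∧
  (∀ C, IsAnalyticComponent U D C → ∀ p ∈ C, IsRegularPoint C p)

end AnalyticGeometry

/-! Principally polarized abelian varieties. -/

/-- A principally polarized abelian variety with universal cover `V`: the torus `V / lattice`
together with its polarization, given by the real alternating form on `V` (the imaginary part of a
positive definite Hermitian form) whose restriction to `H₁ = lattice` has matrix `(0 I; -I 0)`
in some integral basis. A basis of the lattice over `ℤ` is written as a basis of `V` over `ℝ`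
whose `ℤ`-span is the lattice; in particular, the lattice is discrete of full rank. -/
structure PPAV (V : Type) [AddCommGroup V] [Module ℂ V] where
  lattice : Submodule ℤ V
  form : V →ₗ[ℝ] V →ₗ[ℝ] ℝ
  form_I_smul : ∀ x y, form (Complex.I • x) (Complex.I • y) = form x y
  form_pos : ∀ x, x ≠ 0 → 0 < form (Complex.I • x) x
  exists_framing : ∃ (g : ℕ) (b : Module.Basis (Fin g ⊕ Fin g) ℝ V),
    Submodule.span ℤ (Set.range b) = lattice ∧
    (Matrix.of fun s t => form (b s) (b t)) = Matrix.fromBlocks 0 1 (-1) 0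

namespace PPAV

variable {V : Type} [AddCommGroup V] [Module ℂ V]

/-- `b` is a framing: a symplectic basis of `H₁ = lattice`. -/
def IsFraming (A : PPAV V) {g : ℕ} (b : Module.Basis (Fin g ⊕ Fin g) ℝ V) : Prop :=
  Submodule.span ℤ (Set.range b) = A.lattice ∧
    (Matrix.of fun s t => A.form (b s) (b t)) = Matrix.fromBlocks 0 1 (-1) 0

/-- `A` is isomorphic, as a polarized abelian variety, to the product of `A₁` and `A₂` with the
product polarization. -/
def IsProductOf (A : PPAV V) {V₁ V₂ : Type} [AddCommGroup V₁] [Module ℂ V₁] [AddCommGroup V₂]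
    [Module ℂ V₂] (A₁ : PPAV V₁) (A₂ : PPAV V₂) : Prop :=
  ∃ e : V ≃ₗ[ℂ] V₁ × V₂,
    (∀ x, x ∈ A.lattice ↔ (e x).1 ∈ A₁.lattice ∧ (e x).2 ∈ A₂.lattice) ∧
    ∀ x y, A.form x y = A₁.form (e x).1 (e y).1 + A₂.form (e x).2 (e y).2

/-- `A` is the product of two principally polarized abelian varieties of positive dimension. -/
def IsReducible (A : PPAV V) : Prop :=
  ∃ (V₁ V₂ : Type) (_ : AddCommGroup V₁) (_ : Module ℂ V₁) (_ : AddCommGroup V₂)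
    (_ : Module ℂ V₂) (A₁ : PPAV V₁) (A₂ : PPAV V₂),
    Nontrivial V₁ ∧ Nontrivial V₂ ∧ A.IsProductOf A₁ A₂

/-- `Ω` is the normalized period matrix of `A` with the framing `b`: in the coordinates of `V`
in which the last `g` basis vectors are the standard ones, the first `g` are the rows of `Ω`. -/
def IsPeriodMatrix (A : PPAV V) {g : ℕ} (b : Module.Basis (Fin g ⊕ Fin g) ℝ V)
    (Ω : Matrix (Fin g) (Fin g) ℂ) : Prop :=
  A.IsFraming b ∧ ∃ φ : V ≃ₗ[ℂ] (Fin g → ℂ),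
    (∀ j, φ (b (Sum.inl j)) = Ω j) ∧ ∀ j, φ (b (Sum.inr j)) = Pi.single j 1

end PPAV

/-! Siegel space and thetanulls. -/

/-- The space `ℂ^{g(g+1)/2}` of symmetric complex `g × g` matrices, in terms of their entries. -/
abbrev SymCoord (g : ℕ) : Type := Sym2 (Fin g) → ℂ

/-- The symmetric matrix with the given entries. -/
def SymCoord.toMatrix {g : ℕ} (ω : SymCoord g) : Matrix (Fin g) (Fin g) ℂ :=
  Matrix.of fun j k => ω s(j, k)

/-- Siegel space of rank `g`: symmetric matrices with positive definite imaginary part. -/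
def siegelSpace (g : ℕ) : Set (SymCoord g) := {ω | (ω.toMatrix.map Complex.im).PosDef}

/-- The locus of period matrices of reducible framed principally polarized abelian varieties. -/
def reducibleLocus (g : ℕ) : Set (SymCoord g) :=
  {ω | ω ∈ siegelSpace g ∧ ∃ (V : Type) (_ : AddCommGroup V) (_ : Module ℂ V) (A : PPAV V)
    (b : Module.Basis (Fin g ⊕ Fin g) ℝ V), A.IsPeriodMatrix b ω.toMatrix ∧ A.IsReducible}

/-- A theta characteristic `(δ', δ'')` in `(½ℤ/ℤ)^g ⊕ (½ℤ/ℤ)^g`; the entry `a : ZMod 2` stands for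
the class of `a / 2`. -/
structure ThetaChar (g : ℕ) where
  fst : Fin g → ZMod 2
  snd : Fin g → ZMod 2

/-- The characteristic is even. -/
def ThetaChar.IsEven {g : ℕ} (δ : ThetaChar g) : Prop := ∑ j, δ.fst j * δ.snd j = 0

/-- The representative `0` or `1/2` in `ℂ` of a class in `½ℤ/ℤ`. -/
def halfRep (a : ZMod 2) : ℂ := (a.val : ℂ) / 2

/-- The theta function of characteristic `δ`. -/
def thetaFun {g : ℕ} (δ : ThetaChar g) (Ω : Matrix (Fin g) (Fin g) ℂ) (z : Fin g → ℂ) : ℂ :=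
  ∑' m : Fin g → ℤ, Complex.exp (Real.pi * Complex.I *
    ((∑ j, ∑ k, (m j + halfRep (δ.fst j)) * Ω j k * (m k + halfRep (δ.fst k))) +
      2 * ∑ j, (m j + halfRep (δ.fst j)) * (z j + halfRep (δ.snd j))))

/-- The zero locus in Siegel space of the thetanull of characteristic `δ`. -/
def thetanullLocus {g : ℕ} (δ : ThetaChar g) : Set (SymCoord g) :=
  {ω | ω ∈ siegelSpace g ∧ thetaFun δ ω.toMatrix 0 = 0}

end

/-! Splitting an elliptic curve off a principally polarized abelian variety is the same as giving an
idempotent `P` of the period lattice that has trace 2, is self-adjoint for the symplectic form and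
commutes with the complex structure. A product decomposition of a threefold always has a factor of
dimension one, so the reducible locus is the union of the loci `projLocus P` over such `P`. This
union is locally finite, because a self-adjoint projection does not increase the Hermitian norm and
so has bounded integral entries near a given period matrix (`isLocallyFiniteIn_projLocus`).

The integral symplectic group moves each `projLocus P` to the linear slice of Siegel space given by
`ω₀₁ = ω₀₂ = 0`. Hence these loci are smooth and irreducible, and they are the components. If two
different ones meet, positivity of the polarization forces `P * Q = 0`
(`eq_or_orthogonal_of_mem_projLocus`); then `1 - P - Q` is a third projection, and the point can be
moved to a diagonal period matrix. So a reducible point lies on exactly one component, where the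
reducible locus is smooth, or on exactly three. Symplectic transformations permute even
characteristics compatibly with the thetanulls (`exists_transform_characteristic`), so only two
normal forms remain: a diagonal point, or a point on the first standard slice and on no other
elliptic locus.

At a split point the thetanull is a product of thetanulls of a one-dimensional and a two-dimensional
factor, whose characteristics have equal parity, and its derivatives in the off-diagonal entries are
products of first derivatives of the factors in `z`. At a diagonal point in the thetanull locus
exactly two of the three one-dimensional characteristics, say at `i` and `a`, are odd. Then the
slices of `i` and `a` lie in the thetanull locus, the derivative in `ω_{ia}` is nonzero, and the
derivative along `ω_{ia}` also shows that the slice of the third index `k` is not contained in it.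
With the thetanull as a coordinate in place of `ω_{ia}`, the reducible part is `ω_{ik} ω_{ak} = 0`.
At a point on a single slice the factors must be odd, and the same picture holds with one
coordinate.

What makes this work is that a theta function in one variable never vanishes to order two at the
origin, and one in two variables does so only if the surface decomposes
(`exists_latticeProj_of_order_two`). By the addition formula, vanishing to order two gives a linear
relation between `θ²` and the second derivatives of `log θ`, multiplied by `θ²`. In one variable
this makes `θ` zero-free, which is absurd. In two variables the quadratic form in the relation
factors, so `∂_v ∂_w log θ` is constant. If `v` and `w` are independent, the quasi-periodicity of
`θ` separates and the projection to `ℂ v` along `w` preserves the lattice. If they are proportional,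
`θ` has no zeros on some translates of `ℂ v` and vanishes identically on the others, which forces a
rank two sublattice of `ℂ v` on which the polarization vanishes, contradicting positivity. -/

noncomputable section

/-! ### Analytic subsets: locally finite unions, irreducibility, transport by biholomorphic maps. -/

section AnalyticSets

open Set Filter Topology

variable {E : Type} [NormedAddCommGroup E] [NormedSpace ℂ E]

theorem IsAnalyticSubset.of_fintype {U Z : Set E} (hZ : Z ⊆ U)
    (h : ∀ p ∈ U, ∃ V : Set E, IsOpen V ∧ p ∈ V ∧ V ⊆ U ∧
      ∃ (ι : Type) (_ : Fintype ι) (f : ι → E → ℂ), (∀ i, DifferentiableOn ℂ (f i) V) ∧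
        ∀ q ∈ V, (q ∈ Z ↔ ∀ i, f i q = 0)) : IsAnalyticSubset U Z := by
  refine ⟨hZ, fun p hp => ?_⟩
  obtain ⟨V, hV, hpV, hVU, ι, _, f, hf, hq⟩ := h p hp
  refine ⟨V, hV, hpV, hVU, Fintype.card ι, fun i => f ((Fintype.equivFin ι).symm i),
    fun i => hf _, fun q hqV => ?_⟩
  rw [hq q hqV]
  exact ⟨fun h i => h _, fun h i => by simpa using h (Fintype.equivFin ι i)⟩

theorem IsAnalyticSubset.empty {U : Set E} (hU : IsOpen U) : IsAnalyticSubset U ∅ :=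
  .of_fintype (empty_subset U) fun p hp => ⟨U, hU, hp, subset_rfl, Unit, inferInstance,
    fun _ _ => 1, fun _ => differentiableOn_const _, fun q _ => by simp⟩

theorem IsAnalyticSubset.union {U Z₁ Z₂ : Set E} (h₁ : IsAnalyticSubset U Z₁)
    (h₂ : IsAnalyticSubset U Z₂) : IsAnalyticSubset U (Z₁ ∪ Z₂) := by
  refine .of_fintype (union_subset h₁.1 h₂.1) fun p hp => ?_
  obtain ⟨V, hV, hpV, hVU, n, f, hf, hq⟩ := h₁.2 p hp
  obtain ⟨V', hV', hpV', hVU', n', f', hf', hq'⟩ := h₂.2 p hp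
  refine ⟨V ∩ V', hV.inter hV', ⟨hpV, hpV'⟩, inter_subset_left.trans hVU, Fin n × Fin n',
    inferInstance, fun i => f i.1 * f' i.2,
    fun i => ((hf i.1).mono inter_subset_left).mul ((hf' i.2).mono inter_subset_right), ?_⟩
  rintro q ⟨hqV, hqV'⟩
  rw [mem_union, hq q hqV, hq' q hqV']
  constructor
  · rintro (h | h) i
    · simp [h i.1]
    · simp [h i.2]
  · intro h
    by_contra! hc
    obtain ⟨⟨i, hi⟩, ⟨j, hj⟩⟩ := hc
    simpa [hi, hj] using h (i, j)

theorem IsAnalyticSubset.inter {U Z₁ Z₂ : Set E} (h₁ : IsAnalyticSubset U Z₁)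
    (h₂ : IsAnalyticSubset U Z₂) : IsAnalyticSubset U (Z₁ ∩ Z₂) := by
  refine .of_fintype (inter_subset_left.trans h₁.1) fun p hp => ?_
  obtain ⟨V, hV, hpV, hVU, n, f, hf, hq⟩ := h₁.2 p hp
  obtain ⟨V', hV', hpV', hVU', n', f', hf', hq'⟩ := h₂.2 p hp
  refine ⟨V ∩ V', hV.inter hV', ⟨hpV, hpV'⟩, inter_subset_left.trans hVU, Fin n ⊕ Fin n',
    inferInstance, Sum.elim f f', ?_, ?_⟩
  · rintro (i | i)
    · exact (hf i).mono inter_subset_left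
    · exact (hf' i).mono inter_subset_right
  rintro q ⟨hqV, hqV'⟩
  rw [mem_inter_iff, hq q hqV, hq' q hqV']
  simp

theorem IsAnalyticSubset.biUnion_finite {U : Set E} (hU : IsOpen U) {ι : Type*} {s : Set ι}
    (hs : s.Finite) {Z : ι → Set E} (hZ : ∀ i ∈ s, IsAnalyticSubset U (Z i)) :
    IsAnalyticSubset U (⋃ i ∈ s, Z i) := by
  induction s, hs using Set.Finite.induction_on with
  | empty => simpa using IsAnalyticSubset.empty hU
  | @insert a s _ _ ih =>
    rw [biUnion_insert]
    exact (hZ a (mem_insert _ _)).union (ih fun i hi => hZ i (mem_insert_of_mem _ hi))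

/-- Around each point of `U` only finitely many members of the family are met. -/
def IsLocallyFiniteIn (U : Set E) {ι : Type*} (Z : ι → Set E) : Prop :=
  ∀ p ∈ U, ∃ V : Set E, IsOpen V ∧ p ∈ V ∧ {i | (Z i ∩ V).Nonempty}.Finite

omit [NormedSpace ℂ E] in
theorem IsLocallyFiniteIn.finite_mem {U : Set E} {ι : Type*} {Z : ι → Set E}
    (h : IsLocallyFiniteIn U Z) {p : E} (hp : p ∈ U) : {i | p ∈ Z i}.Finite := by
  obtain ⟨V, _, hpV, hf⟩ := h p hp
  exact hf.subset fun i hi => ⟨p, hi, hpV⟩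

theorem IsLocallyFiniteIn.isAnalyticSubset_biUnion {U : Set E} (hU : IsOpen U) {ι : Type*}
    {Z : ι → Set E} (h : IsLocallyFiniteIn U Z) (s : Set ι)
    (hZ : ∀ i, IsAnalyticSubset U (Z i)) : IsAnalyticSubset U (⋃ i ∈ s, Z i) := by
  refine ⟨iUnion₂_subset fun i _ => (hZ i).1, fun p hp => ?_⟩
  obtain ⟨V, hV, hpV, hf⟩ := h p hp
  obtain ⟨W, hW, hpW, hWU, n, f, hd, hq⟩ :=
    (IsAnalyticSubset.biUnion_finite hU (hf.inter_of_right s) fun i _ => hZ i).2 p hp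
  refine ⟨V ∩ W, hV.inter hW, ⟨hpV, hpW⟩, inter_subset_right.trans hWU, n, f,
    fun i => (hd i).mono inter_subset_right, ?_⟩
  rintro q ⟨hqV, hqW⟩
  rw [← hq q hqW]
  simp only [mem_iUnion, exists_prop]
  constructor
  · rintro ⟨i, his, hi⟩
    exact ⟨i, ⟨his, q, hi, hqV⟩, hi⟩
  · rintro ⟨i, his, hi⟩
    exact ⟨i, his.1, hi⟩

/-- The members that avoid `p` have an analytic, hence relatively closed, union, so a neighbourhood
of `p` misses all of them at once. Local questions at `p` thereby only involve the members through
`p`. -/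
theorem IsLocallyFiniteIn.exists_open_forall {U : Set E} {ι : Type*} {Z : ι → Set E}
    (hU : IsOpen U) (h : IsLocallyFiniteIn U Z) (hZ : ∀ i, IsAnalyticSubset U (Z i)) {p : E}
    (hp : p ∈ U) :
    ∃ V, IsOpen V ∧ p ∈ V ∧ V ⊆ U ∧ ∀ i, (Z i ∩ V).Nonempty → p ∈ Z i := by
  obtain ⟨W, hW, hpW, hWU, n, f, hd, hq⟩ :=
    (h.isAnalyticSubset_biUnion hU {i | p ∉ Z i} hZ).2 p hp
  have hnot : ¬ ∀ i, f i p = 0 := by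
    rw [← hq p hpW]
    simp
  push Not at hnot
  obtain ⟨i, hi⟩ := hnot
  refine ⟨W ∩ f i ⁻¹' {0}ᶜ, (hd i).continuousOn.isOpen_inter_preimage hW isOpen_compl_singleton,
    ⟨hpW, hi⟩, inter_subset_left.trans hWU, ?_⟩
  rintro j ⟨q, hqj, hqW, hqi⟩
  by_contra hpj
  have : q ∈ ⋃ i ∈ {i | p ∉ Z i}, Z i := mem_biUnion (show j ∈ {i | p ∉ Z i} from hpj) hqj
  exact hqi ((hq q hqW).1 this i)

theorem IsIrreducibleAnalytic.subset_or_subset {U Z A B : Set E} (h : IsIrreducibleAnalytic U Z)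
    (hA : IsAnalyticSubset U A) (hB : IsAnalyticSubset U B) (hZ : Z ⊆ A ∪ B) : Z ⊆ A ∨ Z ⊆ B := by
  have := h.2.2 (Z ∩ A) (Z ∩ B) (h.1.inter hA) (h.1.inter hB)
    (by rw [← inter_union_distrib_left]; exact (inter_eq_left.2 hZ).symm)
  exact this.imp (fun h => inter_eq_left.1 h.symm) (fun h => inter_eq_left.1 h.symm)

/-- Fix a point `p` of `Z`. The finitely many members through `p` are split off one at a time by
irreducibility; the union of the others is analytic and cannot contain `Z`, because it misses `p`.
-/
theorem IsIrreducibleAnalytic.exists_subset {U Z : Set E} (hU : IsOpen U)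
    (h : IsIrreducibleAnalytic U Z) {ι : Type*}
    {X : ι → Set E} (hX : ∀ i, IsAnalyticSubset U (X i)) (hf : IsLocallyFiniteIn U X)
    {s : Set ι} (hZ : Z ⊆ ⋃ i ∈ s, X i) : ∃ i ∈ s, Z ⊆ X i := by
  obtain ⟨p, hp⟩ := h.2.1
  have key : ∀ t : Set ι, t.Finite → Z ⊆ (⋃ i ∈ t, X i) ∪ (⋃ i ∈ {i ∈ s | p ∉ X i}, X i) →
      ∃ i ∈ t, Z ⊆ X i := by
    intro t ht
    induction t, ht using Set.Finite.induction_on with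
    | empty =>
      intro hs
      have := hs hp
      simp at this
      obtain ⟨i, hi, hi'⟩ := this
      exact absurd hi' hi.2
    | @insert a t _ ht ih =>
      intro hs
      rw [biUnion_insert, union_assoc] at hs
      rcases h.subset_or_subset (hX a) ((IsAnalyticSubset.biUnion_finite hU ht
        fun i _ => hX i).union (hf.isAnalyticSubset_biUnion hU _ hX)) hs with h1 | h1
      · exact ⟨a, mem_insert _ _, h1⟩
      · obtain ⟨i, hi, h2⟩ := ih h1
        exact ⟨i, mem_insert_of_mem _ hi, h2⟩
  obtain ⟨i, hi, h1⟩ := key ({i | p ∈ X i} ∩ s) ((hf.finite_mem (h.1.1 hp)).inter_of_left s) (by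
    intro q hq
    obtain ⟨i, hi, hqi⟩ := mem_iUnion₂.1 (hZ hq)
    by_cases hpi : p ∈ X i
    · exact Or.inl (mem_biUnion (show i ∈ {i | p ∈ X i} ∩ s from ⟨hpi, hi⟩) hqi)
    · exact Or.inr (mem_biUnion (show i ∈ {i ∈ s | p ∉ X i} from ⟨hi, hpi⟩) hqi))
  exact ⟨i, hi.2, h1⟩

theorem IsAnalyticSubset.preimage {U Z : Set E} (hU : IsOpen U) (h : IsAnalyticSubset U Z)
    {m : E → E} (hm : DifferentiableOn ℂ m U) (hmU : MapsTo m U U) :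
    IsAnalyticSubset U (U ∩ m ⁻¹' Z) := by
  refine ⟨inter_subset_left, fun p hp => ?_⟩
  obtain ⟨V, hV, hpV, hVU, n, f, hf, hq⟩ := h.2 (m p) (hmU hp)
  refine ⟨U ∩ m ⁻¹' V, hm.continuousOn.isOpen_inter_preimage hU hV, ⟨hp, hpV⟩, inter_subset_left,
    n, fun i => f i ∘ m, fun i => (hf i).comp (hm.mono inter_subset_left) fun q hq => hq.2, ?_⟩
  rintro q ⟨hqU, hqV⟩
  simpa [hqU] using hq (m q) hqV

theorem IsIrreducibleAnalytic.preimage {U Z : Set E} (hU : IsOpen U)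
    (h : IsIrreducibleAnalytic U Z) {m m' : E → E} (hm : DifferentiableOn ℂ m U)
    (hmU : MapsTo m U U) (hm' : DifferentiableOn ℂ m' U) (hmU' : MapsTo m' U U)
    (hl : ∀ q ∈ U, m' (m q) = q) (hr : ∀ q ∈ U, m (m' q) = q) :
    IsIrreducibleAnalytic U (U ∩ m ⁻¹' Z) := by
  refine ⟨h.1.preimage hU hm hmU, ?_, fun Z₁ Z₂ h₁ h₂ hZ => ?_⟩
  · obtain ⟨p, hp⟩ := h.2.1
    exact ⟨m' p, hmU' (h.1.1 hp), by simpa [hr p (h.1.1 hp)] using hp⟩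
  · have aux : ∀ A, A ⊆ U → Z = U ∩ m' ⁻¹' A → U ∩ m ⁻¹' Z = A := by
      intro A hA hZA
      ext q
      constructor
      · rintro ⟨hq, hqZ⟩
        have : m q ∈ U ∩ m' ⁻¹' A := hZA ▸ hqZ
        simpa [hl q hq] using this.2
      · intro hq
        refine ⟨hA hq, ?_⟩
        rw [hZA]
        exact ⟨hmU (hA hq), by simpa [hl q (hA hq)] using hq⟩
    refine (h.2.2 _ _ (h₁.preimage hU hm' hmU') (h₂.preimage hU hm' hmU') ?_).imp
      (aux _ h₁.1) (aux _ h₂.1)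
    rw [← inter_union_distrib_left, ← preimage_union, ← hZ]
    ext q
    constructor
    · intro hq
      exact ⟨h.1.1 hq, hmU' (h.1.1 hq), by simpa [hr q (h.1.1 hq)] using hq⟩
    · rintro ⟨hq, -, hq'⟩
      simpa [hr q hq] using hq'

/-- Identity theorem along a holomorphic curve: the set of parameters near which the curve stays in
`Z` is open, and it is closed in `T` by uniqueness of analytic continuation for the local equations.
-/
theorem IsAnalyticSubset.isClosed_line {U Z : Set E} (h : IsAnalyticSubset U Z)
    {T : Set ℂ} (hT : IsPreconnected T) {l : ℂ → E} (hl : Differentiable ℂ l)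
    (hlU : ∀ t ∈ T, l t ∈ U) {t₀ : ℂ} (ht₀ : t₀ ∈ T) (hZ : ∀ᶠ t in 𝓝 t₀, l t ∈ Z) :
    ∀ t ∈ T, l t ∈ Z := by
  have hI : IsOpen {t | ∀ᶠ s in 𝓝 t, l s ∈ Z} := isOpen_setOfPred_eventually_nhds
  have := hT.subset_of_closure_inter_subset hI ⟨t₀, ht₀, hZ⟩ (by
    rintro t ⟨htc, htT⟩
    obtain ⟨V, hV, hpV, hVU, n, f, hf, hq⟩ := h.2 (l t) (hlU t htT)
    obtain ⟨r, hr, hball⟩ := Metric.isOpen_iff.1 (hV.preimage hl.continuous) t hpV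
    obtain ⟨s, hs, hsr⟩ := Metric.mem_closure_iff.1 htc r hr
    have hs' : s ∈ Metric.ball t r := by rwa [Metric.mem_ball, dist_comm]
    have hzero : ∀ i, EqOn (f i ∘ l) 0 (Metric.ball t r) := by
      intro i
      have hd : DifferentiableOn ℂ (f i ∘ l) (Metric.ball t r) :=
        (hf i).comp hl.differentiableOn hball
      refine (hd.analyticOnNhd Metric.isOpen_ball).eqOn_zero_of_preconnected_of_eventuallyEq_zero
        (convex_ball t r).isPreconnected hs' ?_
      filter_upwards [hs, Metric.isOpen_ball.mem_nhds hs'] with x hx hxb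
      exact (hq (l x) (hball hxb)).1 hx i
    filter_upwards [Metric.ball_mem_nhds t hr] with x hx
    exact (hq (l x) (hball hx)).2 fun i => hzero i hx)
  exact fun t ht => (this ht).self_of_nhds

/-- Join a point `p` outside `Z₁` to a point `q` outside `Z₂` by a complex line inside the
submodule. Near `p` the line avoids `Z₁`, hence lies in `Z₂`, and the identity theorem carries this
to `q`, a contradiction. -/
theorem isIrreducibleAnalytic_inter_submodule {U : Set E}
    (hline : ∀ p ∈ U, ∀ q ∈ U, IsPreconnected {t : ℂ | p + t • (q - p) ∈ U})
    (W : Submodule ℂ E) (han : IsAnalyticSubset U (U ∩ W)) (hne : (U ∩ W : Set E).Nonempty) :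
    IsIrreducibleAnalytic U (U ∩ W) := by
  refine ⟨han, hne, fun Z₁ Z₂ h₁ h₂ hZ => ?_⟩
  by_contra! hc
  have hp : ∃ p ∈ (U ∩ W : Set E), p ∉ Z₁ := by
    by_contra! h
    exact hc.1 (Subset.antisymm h (hZ ▸ subset_union_left))
  have hq : ∃ p ∈ (U ∩ W : Set E), p ∉ Z₂ := by
    by_contra! h
    exact hc.2 (Subset.antisymm h (hZ ▸ subset_union_right))
  obtain ⟨p, hp, hp1⟩ := hp
  obtain ⟨q, hq, hq2⟩ := hq
  have hl : Differentiable ℂ fun t : ℂ => p + t • (q - p) := by fun_prop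
  obtain ⟨V, hV, hpV, hVU, n, f, hf, hfq⟩ := h₁.2 p hp.1
  have h0 : ∃ i, f i p ≠ 0 := by
    by_contra! h
    exact hp1 ((hfq p hpV).2 h)
  obtain ⟨i, hi⟩ := h0
  have hopen : IsOpen (V ∩ f i ⁻¹' {0}ᶜ) :=
    (hf i).continuousOn.isOpen_inter_preimage hV isOpen_compl_singleton
  have hev : ∀ᶠ t : ℂ in 𝓝 0, p + t • (q - p) ∈ Z₂ := by
    have : ∀ᶠ t : ℂ in 𝓝 0, p + t • (q - p) ∈ V ∩ f i ⁻¹' {0}ᶜ :=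
      hl.continuous.continuousAt.eventually_mem (by simpa using hopen.mem_nhds ⟨hpV, hi⟩)
    filter_upwards [this] with t ht
    have hmem : p + t • (q - p) ∈ (U ∩ W : Set E) :=
      ⟨hVU ht.1, W.add_mem hp.2 (W.smul_mem _ (W.sub_mem hq.2 hp.2))⟩
    rw [hZ] at hmem
    exact hmem.resolve_left fun h => ht.2 ((hfq _ ht.1).1 h i)
  have := h₂.isClosed_line (hline p hp.1 q hq.1) hl (fun t ht => ht) (t₀ := 0)
    (by simpa using hp.1) hev 1 (by simpa using hq.1)
  simp at this
  exact hq2 this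

theorem IsHolomorphicChart.comp {n : ℕ} {e : OpenPartialHomeomorph E (Fin n → ℂ)}
    (he : IsHolomorphicChart e) {m : OpenPartialHomeomorph E E}
    (hm : DifferentiableOn ℂ m m.source) (hm' : DifferentiableOn ℂ m.symm m.target) :
    IsHolomorphicChart (m.trans e) := by
  constructor
  · rw [OpenPartialHomeomorph.trans_source, OpenPartialHomeomorph.coe_trans]
    exact he.1.comp (hm.mono inter_subset_left) fun x hx => hx.2
  · rw [OpenPartialHomeomorph.trans_target, OpenPartialHomeomorph.coe_trans_symm]
    exact hm'.comp (he.2.mono inter_subset_left) fun x hx => hx.2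

end AnalyticSets

/-! ### Charts in which one coordinate is replaced by a holomorphic function. -/

section CoordinateCharts

open Set Filter Topology

variable {κ : Type} [Fintype κ] [DecidableEq κ]

/-- The derivative of the map that replaces the coordinate `c` by a function with differential
`L`. -/
def replaceCoordDeriv (c : κ) (L : (κ → ℂ) →L[ℂ] ℂ) : (κ → ℂ) →L[ℂ] (κ → ℂ) :=
  ContinuousLinearMap.pi fun d => if d = c then L else ContinuousLinearMap.proj d

omit [Fintype κ] in
theorem replaceCoordDeriv_injective (c : κ) (L : (κ → ℂ) →L[ℂ] ℂ) (h : L (Pi.single c 1) ≠ 0) :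
    Function.Injective (replaceCoordDeriv c L) := by
  rw [injective_iff_map_eq_zero]
  intro x hx
  have hd : ∀ d, d ≠ c → x d = 0 := by
    intro d hd
    simpa [replaceCoordDeriv, hd] using congrFun hx d
  have hxc : x = x c • Pi.single c (1 : ℂ) := by
    ext d
    by_cases hdc : d = c
    · subst hdc; simp
    · simp [hd d hdc, hdc]
  have hc : L x = 0 := by simpa [replaceCoordDeriv] using congrFun hx c
  rw [hxc, map_smul, smul_eq_mul] at hc
  rw [hxc, (mul_eq_zero.1 hc).resolve_right h, zero_smul]

/-- If `G` has nonzero derivative along the coordinate `c`, then `G` and the other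
coordinates form a holomorphic chart. -/
theorem exists_chart_replaceCoord (c : κ) {G : (κ → ℂ) → ℂ} {G' : (κ → ℂ) → (κ → ℂ) →L[ℂ] ℂ}
    {U : Set (κ → ℂ)} (hU : IsOpen U) {p : κ → ℂ} (hp : p ∈ U)
    (hG : ∀ q ∈ U, HasFDerivAt G (G' q) q) (hG' : ContinuousOn G' U)
    (hne : G' p (Pi.single c 1) ≠ 0) (hGp : G p = 0) :
    ∃ ε > 0, Metric.ball p ε ⊆ U ∧
      ∃ e : OpenPartialHomeomorph (κ → ℂ) (Fin (Fintype.card κ) → ℂ),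
        IsHolomorphicChart e ∧ e.source = Metric.ball p ε ∧ e p = 0 ∧
        ∀ q d, e q (Fintype.equivFin κ d) = if d = c then G q else q d - p d := by
  set Φ : (κ → ℂ) → (κ → ℂ) := fun q d => if d = c then G q else q d - p d with hΦ
  have hd : ∀ q ∈ U, HasFDerivAt Φ (replaceCoordDeriv c (G' q)) q := by
    intro q hq
    refine hasFDerivAt_pi.2 fun d => ?_
    by_cases h : d = c
    · simpa [hΦ, h] using hG q hq
    · simp only [h, if_false]
      exact (hasFDerivAt_apply d q).sub_const _
  -- The differential is rewritten as a finite sum of compositions, whose continuity in the base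
  -- point can be read off term by term.
  have hcont : ContinuousOn (fun q => replaceCoordDeriv c (G' q)) U := by
    have : ContinuousOn (fun q => ∑ d, (ContinuousLinearMap.single ℂ (fun _ : κ => ℂ) d).comp
      (if d = c then G' q else ContinuousLinearMap.proj d)) U := by
      refine continuousOn_finsetSum _ fun d _ => ?_
      by_cases h : d = c
      · simp only [h, if_true]
        exact continuousOn_const.clm_comp hG'
      · simp only [h, if_false]
        exact continuousOn_const
    refine this.congr fun q _ => ?_
    ext x d
    simp only [replaceCoordDeriv, ContinuousLinearMap.coe_pi', FunLike.coe_sum,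
      Finset.sum_apply, ContinuousLinearMap.coe_comp, Function.comp_apply,
      ContinuousLinearMap.single_apply]
    rw [Finset.sum_eq_single d]
    · simp
    · intro b _ hb
      rw [Pi.single_eq_of_ne hb.symm]
    · simp
  let eqv : ∀ L : (κ → ℂ) →L[ℂ] ℂ, L (Pi.single c 1) ≠ 0 → (κ → ℂ) ≃L[ℂ] (κ → ℂ) := fun L h =>
    (LinearEquiv.ofInjectiveEndo (replaceCoordDeriv c L).toLinearMap
      (replaceCoordDeriv_injective c L h)).toContinuousLinearEquiv
  have heqv : ∀ L h, (eqv L h : (κ → ℂ) →L[ℂ] (κ → ℂ)) = replaceCoordDeriv c L := by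
    intro L h
    ext x : 1
    rfl
  have hstrict : HasStrictFDerivAt Φ (eqv (G' p) hne : (κ → ℂ) →L[ℂ] (κ → ℂ)) p := by
    rw [heqv _ hne]
    exact hasStrictFDerivAt_of_hasFDerivAt_of_continuousAt
      (by filter_upwards [hU.mem_nhds hp] with q hq using hd q hq)
      (hcont.continuousAt (hU.mem_nhds hp))
  set e₀ := hstrict.toOpenPartialHomeomorph Φ with he₀
  have hpe : p ∈ e₀.source := hstrict.mem_toOpenPartialHomeomorph_source
  -- The derivative along `c` must stay nonzero on the whole ball: invertibility of the differential
  -- at every point there, and not only at `p`, makes the inverse holomorphic.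
  have hopen : IsOpen (U ∩ (fun q => G' q (Pi.single c 1)) ⁻¹' {0}ᶜ) :=
    (hG'.clm_apply continuousOn_const).isOpen_inter_preimage hU isOpen_compl_singleton
  obtain ⟨ε, hε, hball⟩ := Metric.isOpen_iff.1 (hopen.inter e₀.open_source) p ⟨⟨hp, hne⟩, hpe⟩
  let re : (κ → ℂ) ≃L[ℂ] (Fin (Fintype.card κ) → ℂ) :=
    ContinuousLinearEquiv.piCongrLeft ℂ (fun _ => ℂ) (Fintype.equivFin κ)
  have hre : ∀ x d, re x (Fintype.equivFin κ d) = x d := fun x d =>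
    Equiv.piCongrLeft_apply_apply (fun _ => ℂ) (Fintype.equivFin κ) x d
  refine ⟨ε, hε, fun q hq => (hball hq).1.1,
    (e₀.restrOpen (Metric.ball p ε) Metric.isOpen_ball).transHomeomorph re.toHomeomorph, ⟨?_, ?_⟩, ?_, ?_, ?_⟩
  · intro q hq
    have hq' : q ∈ Metric.ball p ε := by
      have : q ∈ e₀.source ∩ Metric.ball p ε := hq
      exact this.2
    exact (re.differentiableAt.comp q
      (hd q (hball hq').1.1).differentiableAt).differentiableWithinAt
  · intro y hy
    have hy' : re.symm y ∈ (e₀.restrOpen (Metric.ball p ε) Metric.isOpen_ball).target := hy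
    have hx := (e₀.restrOpen (Metric.ball p ε) Metric.isOpen_ball).map_target hy'
    set x := (e₀.restrOpen (Metric.ball p ε) Metric.isOpen_ball).symm (re.symm y)
    have hx' : x ∈ Metric.ball p ε := by
      have : x ∈ e₀.source ∩ Metric.ball p ε := hx
      exact this.2
    have hxd : HasFDerivAt (e₀.restrOpen (Metric.ball p ε) Metric.isOpen_ball)
        (eqv (G' x) (show G' x (Pi.single c 1) ≠ 0 from (hball hx').1.2) : (κ → ℂ) →L[ℂ] (κ → ℂ)) x := by
      rw [heqv _ (show G' x (Pi.single c 1) ≠ 0 from (hball hx').1.2)]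
      exact hd x (hball hx').1.1
    have := (e₀.restrOpen (Metric.ball p ε) Metric.isOpen_ball).hasFDerivAt_symm hy' hxd
    exact (this.differentiableAt.comp y re.symm.differentiableAt).differentiableWithinAt
  · change e₀.source ∩ Metric.ball p ε = _
    exact inter_eq_right.2 fun q hq => (hball hq).2
  · change re (Φ p) = 0
    have : Φ p = 0 := by
      ext d
      by_cases h : d = c <;> simp [hΦ, h, hGp]
    rw [this, map_zero]
  · intro q d
    change re (Φ q) _ = _
    rw [hre]

end CoordinateCharts

/-! ### Siegel space is open and convex; uniform positivity of the imaginary part. -/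

section SiegelForm

variable {g : ℕ}

/-- The quadratic form of the imaginary part of a symmetric matrix. -/
def imForm (ω : SymCoord g) (v : Fin g → ℝ) : ℝ := ∑ j, ∑ k, v j * (ω s(j, k)).im * v k

theorem mem_siegelSpace_iff {ω : SymCoord g} :
    ω ∈ siegelSpace g ↔ ∀ v, v ≠ 0 → 0 < imForm ω v := by
  have hform : ∀ v : Fin g → ℝ, star v ⬝ᵥ ((ω.toMatrix.map Complex.im).mulVec v) = imForm ω v := by
    intro v
    simp only [dotProduct, Matrix.mulVec, Matrix.map_apply, SymCoord.toMatrix, Matrix.of_apply,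
      imForm, Finset.mul_sum, Pi.star_apply, star_trivial, mul_assoc]
  have hherm : (ω.toMatrix.map Complex.im).IsHermitian := by
    ext j k
    simp [SymCoord.toMatrix, Sym2.eq_swap]
  rw [siegelSpace, Set.mem_ofPred_eq, Matrix.posDef_iff_dotProduct_mulVec]
  simp only [hform]
  exact ⟨fun h v hv => h.2 hv, fun h => ⟨hherm, @fun v hv => h v hv⟩⟩

theorem imForm_smul (ω : SymCoord g) (t : ℝ) (v : Fin g → ℝ) :
    imForm ω (t • v) = t ^ 2 * imForm ω v := by
  simp only [imForm, Finset.mul_sum, Pi.smul_apply, smul_eq_mul]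
  exact Finset.sum_congr rfl fun j _ => Finset.sum_congr rfl fun k _ => by ring

theorem continuous_imForm (ω : SymCoord g) : Continuous (imForm ω) := by
  unfold imForm
  fun_prop

theorem imForm_sub_le (ω ω₀ : SymCoord g) (v : Fin g → ℝ) :
    |imForm ω v - imForm ω₀ v| ≤ (g : ℝ) ^ 2 * ‖ω - ω₀‖ * ‖v‖ ^ 2 := by
  have : imForm ω v - imForm ω₀ v = ∑ j, ∑ k, v j * ((ω - ω₀) s(j, k)).im * v k := by
    simp only [imForm, ← Finset.sum_sub_distrib, Pi.sub_apply, Complex.sub_im]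
    exact Finset.sum_congr rfl fun j _ => Finset.sum_congr rfl fun k _ => by ring
  rw [this]
  calc |∑ j, ∑ k, v j * ((ω - ω₀) s(j, k)).im * v k|
      ≤ ∑ j : Fin g, ∑ k : Fin g, ‖v‖ * ‖ω - ω₀‖ * ‖v‖ := by
        refine (Finset.abs_sum_le_sum_abs _ _).trans (Finset.sum_le_sum fun j _ => ?_)
        refine (Finset.abs_sum_le_sum_abs _ _).trans (Finset.sum_le_sum fun k _ => ?_)
        rw [abs_mul, abs_mul]
        gcongr
        · exact norm_le_pi_norm v j
        · exact (Complex.abs_im_le_norm _).trans (norm_le_pi_norm _ _)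
        · exact norm_le_pi_norm v k
    _ = _ := by simp; ring

/-- Compactness of the unit sphere gives the bound at `ω₀`, and a small perturbation costs at most
half of the constant. The uniformity in `ω` is what makes theta series converge locally uniformly
and the elliptic loci locally finite. -/
theorem exists_imForm_lower {ω₀ : SymCoord g} (h : ω₀ ∈ siegelSpace g) :
    ∃ c > 0, ∃ r > 0, ∀ ω ∈ Metric.ball ω₀ r, ∀ v, c * ‖v‖ ^ 2 ≤ imForm ω v := by
  have h1 : ∃ c > 0, ∀ v, c * ‖v‖ ^ 2 ≤ imForm ω₀ v := by
    -- The sphere is empty when `g = 0`; then the only vector is zero and any constant serves.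
    rcases (Metric.sphere (0 : Fin g → ℝ) 1).eq_empty_or_nonempty with he | hne
    · refine ⟨1, one_pos, fun v => ?_⟩
      have hv : v = 0 := by
        by_contra hv
        have : ‖v‖⁻¹ • v ∈ Metric.sphere (0 : Fin g → ℝ) 1 := by
          simp [norm_smul, norm_ne_zero_iff.2 hv]
        rw [he] at this
        exact this
      simp [hv, imForm]
    · obtain ⟨v₀, hv₀, hmin⟩ := (isCompact_sphere (0 : Fin g → ℝ) 1).exists_isMinOn hne
        (continuous_imForm ω₀).continuousOn
      refine ⟨imForm ω₀ v₀, mem_siegelSpace_iff.1 h v₀ ?_, fun v => ?_⟩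
      · rintro rfl
        simp at hv₀
      · rcases eq_or_ne v 0 with rfl | hv
        · simp [imForm]
        · have hn := norm_ne_zero_iff.2 hv
          have : ‖v‖⁻¹ • v ∈ Metric.sphere (0 : Fin g → ℝ) 1 := by
            simp [norm_smul, hn]
          have h2 := hmin this
          rw [Set.mem_ofPred_eq, imForm_smul] at h2
          calc imForm ω₀ v₀ * ‖v‖ ^ 2 ≤ (‖v‖⁻¹ ^ 2 * imForm ω₀ v) * ‖v‖ ^ 2 := by gcongr
            _ = imForm ω₀ v := by field_simp
  obtain ⟨c, hc, hcv⟩ := h1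
  -- The radius makes `g² ‖ω - ω₀‖ ≤ c / 2`; the added `1` keeps the denominator positive for `g =
  -- 0`.
  refine ⟨c / 2, by positivity, c / 2 / (g ^ 2 + 1), by positivity, fun ω hω v => ?_⟩
  have h2 := (abs_le.1 (imForm_sub_le ω ω₀ v)).1
  have h3 : (g : ℝ) ^ 2 * ‖ω - ω₀‖ ≤ c / 2 := by
    rw [Metric.mem_ball, dist_eq_norm, lt_div_iff₀ (by positivity)] at hω
    nlinarith [norm_nonneg (ω - ω₀)]
  have h4 := mul_le_mul_of_nonneg_right h3 (sq_nonneg ‖v‖)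
  have h5 := hcv v
  linarith

theorem isOpen_siegelSpace : IsOpen (siegelSpace g) := by
  rw [Metric.isOpen_iff]
  intro ω₀ h
  obtain ⟨c, hc, r, hr, hb⟩ := exists_imForm_lower h
  refine ⟨r, hr, fun ω hω => mem_siegelSpace_iff.2 fun v hv => lt_of_lt_of_le ?_ (hb ω hω v)⟩
  have := norm_pos_iff.2 hv
  positivity

theorem imForm_add_smul (ω η : SymCoord g) (s t : ℝ) (v : Fin g → ℝ) :
    imForm (s • ω + t • η) v = s * imForm ω v + t * imForm η v := by
  simp only [imForm, Finset.mul_sum, ← Finset.sum_add_distrib, Pi.add_apply, Pi.smul_apply,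
    Complex.add_im, Complex.smul_im, smul_eq_mul]
  exact Finset.sum_congr rfl fun j _ => Finset.sum_congr rfl fun k _ => by ring

theorem convex_siegelSpace : Convex ℝ (siegelSpace g) := by
  intro ω hω η hη s t hs ht hst
  rw [mem_siegelSpace_iff] at *
  intro v hv
  rw [imForm_add_smul]
  have h1 := hω v hv
  have h2 := hη v hv
  rcases hs.eq_or_lt with rfl | hs
  · have : t = 1 := by linarith
    subst this
    linarith
  · nlinarith [mul_pos hs h1, mul_nonneg ht h2.le]

theorem isPreconnected_siegelSpace_line (p q : SymCoord g) :
    IsPreconnected {t : ℂ | p + t • (q - p) ∈ siegelSpace g} := by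
  refine Convex.isPreconnected (s := {t : ℂ | p + t • (q - p) ∈ siegelSpace g}) ?_
  intro s hs t ht a b ha hb hab
  have := convex_siegelSpace hs ht ha hb hab
  rw [Set.mem_ofPred_eq]
  convert this using 1
  ext d
  simp only [Pi.add_apply, Pi.smul_apply, Pi.sub_apply, smul_eq_mul, Complex.real_smul]
  have : (b : ℂ) = 1 - a := by
    rw [eq_sub_iff_add_eq', ← Complex.ofReal_add, hab, Complex.ofReal_one]
  rw [this]
  ring

end SiegelForm

/-! ### Theta series with coefficients of polynomial growth: convergence and termwise
differentiation. -/

section ThetaSeries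

open Filter Topology

variable {g : ℕ}

/-- A point of the shifted lattice `ℤ^g + u`. -/
def latticeShift (u : Fin g → ℝ) (m : Fin g → ℤ) : Fin g → ℝ := fun j => m j + u j

/-- The exponent of the term of a theta series at the lattice point `v`, as a linear functional of
the period matrix and the argument. -/
def thetaExp (v : Fin g → ℝ) : (SymCoord g × (Fin g → ℂ)) →L[ℂ] ℂ :=
  (Real.pi * Complex.I : ℂ) •
    ((∑ j, ∑ k, ((v j : ℂ) * v k) • (ContinuousLinearMap.proj s(j, k)).comp
      (ContinuousLinearMap.fst ℂ (SymCoord g) (Fin g → ℂ))) +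
    (2 : ℂ) • ∑ j, (v j : ℂ) • (ContinuousLinearMap.proj j).comp
      (ContinuousLinearMap.snd ℂ (SymCoord g) (Fin g → ℂ)))

theorem thetaExp_apply (v : Fin g → ℝ) (x : SymCoord g × (Fin g → ℂ)) :
    thetaExp v x = Real.pi * Complex.I *
      ((∑ j, ∑ k, (v j : ℂ) * v k * x.1 s(j, k)) + 2 * ∑ j, (v j : ℂ) * x.2 j) := by
  simp [thetaExp, mul_add]

/-- The theta series over the lattice `ℤ^g + u` with coefficients `a`. -/
def thetaSeries (u : Fin g → ℝ) (a : (Fin g → ℤ) → ℂ) (x : SymCoord g × (Fin g → ℂ)) : ℂ :=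
  ∑' m, a m * Complex.exp (thetaExp (latticeShift u m) x)

/-- Coefficients of at most polynomial growth. -/
def PolyGrowth (a : (Fin g → ℤ) → ℂ) : Prop := ∃ (C : ℝ) (N : ℕ), ∀ m, ‖a m‖ ≤ C * (1 + ‖m‖) ^ N

theorem summable_prod_pi {f : ℤ → ℝ} (hf : Summable f) (h0 : ∀ n, 0 ≤ f n) (g : ℕ) :
    Summable fun m : Fin g → ℤ => ∏ j, f (m j) := by
  induction g with
  | zero => exact Summable.of_finite
  | succ g ih =>
    rw [← (Fin.consEquiv fun _ : Fin (g + 1) => ℤ).summable_iff]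
    refine (hf.mul_of_nonneg ih h0 fun m => Finset.prod_nonneg fun j _ => h0 _).congr ?_
    rintro ⟨n, m⟩
    simp [Fin.consEquiv, Fin.prod_univ_succ]

/-- A summable function on the lattice that dominates theta series. -/
def latticeMajorant (m : Fin g → ℤ) : ℝ := ∏ j, ((1 + |(m j : ℝ)|) ^ 2)⁻¹

theorem summable_latticeMajorant : Summable (latticeMajorant (g := g)) := by
  refine summable_prod_pi (f := fun n : ℤ => ((1 + |(n : ℝ)|) ^ 2)⁻¹) ?_ (fun n => by positivity) g
  have h : Summable fun n : ℕ => ((1 + |((n : ℤ) : ℝ)|) ^ 2)⁻¹ := by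
    have := (summable_nat_add_iff 1).2 (Real.summable_nat_pow_inv (p := 2).2 one_lt_two)
    refine this.congr fun n => ?_
    rw [abs_of_nonneg (by positivity)]
    push_cast
    rw [add_comm]
  refine Summable.of_nat_of_neg h ?_
  simpa using h

theorem latticeMajorant_nonneg (m : Fin g → ℤ) : 0 ≤ latticeMajorant m :=
  Finset.prod_nonneg fun _ _ => by positivity

/-- The factor `exp (-‖m‖)` beats any power: apply `x ^ n / n! ≤ exp x` with `x = 1 + ‖m‖` and `n =
N + 2 g`, where `2 g` of the powers pay for the product that defines the majorant. -/
theorem exists_pow_mul_exp_le (N : ℕ) :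
    ∃ C ≥ 0, ∀ m : Fin g → ℤ, (1 + ‖m‖) ^ N * Real.exp (-‖m‖) ≤ C * latticeMajorant m := by
  refine ⟨(N + 2 * g).factorial * Real.exp 1, by positivity, fun m => ?_⟩
  have hs : 0 ≤ 1 + ‖m‖ := by positivity
  have h1 := Real.pow_div_factorial_le_exp (1 + ‖m‖) hs (N + 2 * g)
  have h2 : ∏ j, (1 + |(m j : ℝ)|) ^ 2 ≤ (1 + ‖m‖) ^ (2 * g) := by
    have h4 : (1 + ‖m‖) ^ (2 * g) = ∏ _j : Fin g, (1 + ‖m‖) ^ 2 := by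
      rw [Finset.prod_const, Finset.card_univ, Fintype.card_fin, pow_mul]
    rw [h4]
    refine Finset.prod_le_prod (fun _ _ => by positivity) fun j _ => ?_
    gcongr
    have := norm_le_pi_norm m j
    rwa [Int.norm_eq_abs] at this
  have h3 : 0 < ∏ j, (1 + |(m j : ℝ)|) ^ 2 := Finset.prod_pos fun _ _ => by positivity
  rw [latticeMajorant, Finset.prod_inv_distrib, ← div_eq_mul_inv, le_div_iff₀ h3]
  rw [div_le_iff₀ (by positivity), Real.exp_add] at h1
  calc (1 + ‖m‖) ^ N * Real.exp (-‖m‖) * ∏ j, (1 + |(m j : ℝ)|) ^ 2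
      ≤ (1 + ‖m‖) ^ N * Real.exp (-‖m‖) * (1 + ‖m‖) ^ (2 * g) := by gcongr
    _ = (1 + ‖m‖) ^ (N + 2 * g) * Real.exp (-‖m‖) := by ring
    _ ≤ (Real.exp 1 * Real.exp ‖m‖ * (N + 2 * g).factorial) * Real.exp (-‖m‖) := by gcongr
    _ = (N + 2 * g).factorial * Real.exp 1 * (Real.exp ‖m‖ * Real.exp (-‖m‖)) := by ring
    _ = _ := by rw [← Real.exp_add, add_neg_cancel, Real.exp_zero, mul_one]

theorem thetaExp_re (v : Fin g → ℝ) (x : SymCoord g × (Fin g → ℂ)) :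
    (thetaExp v x).re = -Real.pi * (imForm x.1 v + 2 * ∑ j, v j * (x.2 j).im) := by
  have : ∀ w : ℂ, (Real.pi * Complex.I * w : ℂ).re = -Real.pi * w.im := by
    intro w
    simp [mul_assoc]
  rw [thetaExp_apply, this]
  congr 1
  rw [Complex.add_im, Complex.im_sum, imForm]
  congr 1
  · refine Finset.sum_congr rfl fun j _ => ?_
    rw [Complex.im_sum]
    refine Finset.sum_congr rfl fun k _ => ?_
    rw [← Complex.ofReal_mul, Complex.im_ofReal_mul]
    ring
  · rw [show (2 : ℂ) = ((2 : ℝ) : ℂ) by norm_num, Complex.im_ofReal_mul, Complex.im_sum]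
    simp

theorem norm_le_norm_latticeShift (u : Fin g → ℝ) (m : Fin g → ℤ) :
    ‖m‖ ≤ ‖latticeShift u m‖ + ‖u‖ := by
  refine (pi_norm_le_iff_of_nonneg (by positivity)).2 fun j => ?_
  have h1 := norm_le_pi_norm (latticeShift u m) j
  have h2 := norm_le_pi_norm u j
  have : (m j : ℝ) = latticeShift u m j - u j := by simp [latticeShift]
  rw [← Int.norm_cast_real, this]
  exact (norm_sub_le _ _).trans (add_le_add h1 h2)

theorem norm_latticeShift_le (u : Fin g → ℝ) (m : Fin g → ℤ) :
    ‖latticeShift u m‖ ≤ ‖m‖ + ‖u‖ := by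
  refine (pi_norm_le_iff_of_nonneg (by positivity)).2 fun j => ?_
  have h1 := norm_le_pi_norm m j
  have h2 := norm_le_pi_norm u j
  rw [← Int.norm_cast_real] at h1
  exact (norm_add_le _ _).trans (add_le_add h1 h2)

/-- The quadratic part of the exponent has real part at most `-π c ‖v‖²`, which dominates the linear
part uniformly near `x₀` and leaves an additional factor `exp (-‖m‖)`. -/
theorem exists_thetaExp_bound (u : Fin g → ℝ) {x₀ : SymCoord g × (Fin g → ℂ)}
    (h : x₀.1 ∈ siegelSpace g) (N : ℕ) :
    ∃ r > 0, ∃ C ≥ 0, ∀ x ∈ Metric.ball x₀ r, ∀ m,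
      (1 + ‖m‖) ^ N * ‖Complex.exp (thetaExp (latticeShift u m) x)‖ ≤ C * latticeMajorant m := by
  obtain ⟨c, hc, r, hr, hb⟩ := exists_imForm_lower h
  obtain ⟨C, hC, hCm⟩ := exists_pow_mul_exp_le (g := g) N
  set R : ℝ := ‖x₀.2‖ + r
  have hR : 0 ≤ R := by positivity
  -- This is the coefficient of `‖v‖` coming from the linear part, increased by `1` to save a factor
  -- `exp (-‖v‖)`.
  set b : ℝ := 2 * Real.pi * g * R + 1
  -- The first term is the maximum of `-π c t² + b t`; the second replaces `‖v‖` by `‖m‖`, which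
  -- differ by the shift `u`.
  set A : ℝ := b ^ 2 / (4 * Real.pi * c) + ‖u‖
  refine ⟨r, hr, C * Real.exp A, by positivity, fun x hx m => ?_⟩
  set v := latticeShift u m
  have hx1 : x.1 ∈ Metric.ball x₀.1 r := by
    rw [Metric.mem_ball] at hx ⊢
    exact (le_max_left _ _).trans_lt hx
  have hx2 : ‖x.2‖ ≤ R := by
    rw [Metric.mem_ball, dist_eq_norm] at hx
    have h1 : ‖x.2 - x₀.2‖ ≤ r := (le_max_right _ _).trans hx.le
    calc ‖x.2‖ = ‖x₀.2 + (x.2 - x₀.2)‖ := by rw [add_sub_cancel]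
      _ ≤ _ := (norm_add_le _ _).trans (add_le_add le_rfl h1)
  have hlin : -∑ j, v j * (x.2 j).im ≤ g * (‖v‖ * R) := by
    calc -∑ j, v j * (x.2 j).im ≤ |∑ j, v j * (x.2 j).im| := neg_le_abs _
      _ ≤ ∑ j : Fin g, ‖v‖ * R := by
        refine (Finset.abs_sum_le_sum_abs _ _).trans (Finset.sum_le_sum fun j _ => ?_)
        rw [abs_mul]
        gcongr
        · exact norm_le_pi_norm v j
        · exact ((Complex.abs_im_le_norm _).trans (norm_le_pi_norm _ j)).trans hx2
      _ = _ := by simp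
  have hre : (thetaExp v x).re ≤ A - ‖m‖ := by
    have hpi := Real.pi_pos
    have h1 := hb x.1 hx1 v
    have h2 := norm_le_norm_latticeShift u m
    have h3 : -Real.pi * c * ‖v‖ ^ 2 + b * ‖v‖ ≤ b ^ 2 / (4 * Real.pi * c) := by
      rw [le_div_iff₀ (by positivity)]
      nlinarith [sq_nonneg (2 * Real.pi * c * ‖v‖ - b)]
    rw [thetaExp_re]
    have h4 := mul_le_mul_of_nonneg_left h1 hpi.le
    have h5 := mul_le_mul_of_nonneg_left hlin (by positivity : 0 ≤ 2 * Real.pi)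
    have h6 : b * ‖v‖ = 2 * Real.pi * (g * (‖v‖ * R)) + ‖v‖ := by simp only [b]; ring
    simp only [A]
    linarith
  rw [Complex.norm_exp]
  calc (1 + ‖m‖) ^ N * Real.exp (thetaExp v x).re
      ≤ (1 + ‖m‖) ^ N * Real.exp (A - ‖m‖) := by gcongr
    _ = Real.exp A * ((1 + ‖m‖) ^ N * Real.exp (-‖m‖)) := by
        rw [sub_eq_add_neg, Real.exp_add]; ring
    _ ≤ Real.exp A * (C * latticeMajorant m) :=
        mul_le_mul_of_nonneg_left (hCm m) (Real.exp_pos A).le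
    _ = _ := by ring

theorem exists_norm_thetaExp_le (u : Fin g → ℝ) :
    ∃ C ≥ 0, ∀ m, ‖thetaExp (latticeShift u m)‖ ≤ C * (1 + ‖m‖) ^ 2 := by
  refine ⟨Real.pi * (g ^ 2 + 2 * g) * (1 + ‖u‖) ^ 2, by positivity, fun m => ?_⟩
  refine ContinuousLinearMap.opNorm_le_bound _ (by positivity) fun x => ?_
  set v := latticeShift u m
  have hv : ‖v‖ ≤ (1 + ‖u‖) * (1 + ‖m‖) := by
    nlinarith [norm_latticeShift_le u m, norm_nonneg u, norm_nonneg m]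
  set s := (1 + ‖u‖) * (1 + ‖m‖)
  have hs : 1 ≤ s := by nlinarith [norm_nonneg u, norm_nonneg m]
  have hx1 : ∀ d, ‖x.1 d‖ ≤ ‖x‖ := fun d => (norm_le_pi_norm x.1 d).trans (le_max_left _ _)
  have hx2 : ∀ d, ‖x.2 d‖ ≤ ‖x‖ := fun d => (norm_le_pi_norm x.2 d).trans (le_max_right _ _)
  have hvj : ∀ j, ‖(v j : ℂ)‖ ≤ s := fun j => by
    rw [Complex.norm_real]
    exact (norm_le_pi_norm v j).trans hv
  have h1 : ‖∑ j, ∑ k, (v j : ℂ) * v k * x.1 s(j, k)‖ ≤ ∑ j : Fin g, ∑ k : Fin g, s * s * ‖x‖ := by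
    refine (norm_sum_le _ _).trans (Finset.sum_le_sum fun j _ => ?_)
    refine (norm_sum_le _ _).trans (Finset.sum_le_sum fun k _ => ?_)
    rw [norm_mul, norm_mul]
    gcongr
    exacts [hvj j, hvj k, hx1 _]
  have h2 : ‖∑ j, (v j : ℂ) * x.2 j‖ ≤ ∑ j : Fin g, s * s * ‖x‖ := by
    refine (norm_sum_le _ _).trans (Finset.sum_le_sum fun j _ => ?_)
    rw [norm_mul]
    gcongr
    · exact (hvj j).trans (by nlinarith)
    · exact hx2 _
  rw [thetaExp_apply, norm_mul, norm_mul, Complex.norm_I, Complex.norm_real, mul_one,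
    Real.norm_of_nonneg Real.pi_pos.le]
  have h3 : ‖(∑ j, ∑ k, (v j : ℂ) * v k * x.1 s(j, k)) + 2 * ∑ j, (v j : ℂ) * x.2 j‖ ≤
      (g ^ 2 + 2 * g) * (s * s * ‖x‖) := by
    refine (norm_add_le _ _).trans ?_
    rw [norm_mul, Complex.norm_two]
    simp only [Finset.sum_const, Finset.card_univ, Fintype.card_fin, nsmul_eq_mul] at h1 h2
    linarith
  calc Real.pi * _ ≤ Real.pi * ((g ^ 2 + 2 * g) * (s * s * ‖x‖)) := by gcongr
    _ = _ := by simp only [s]; ring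

theorem PolyGrowth.const_mul {a : (Fin g → ℤ) → ℂ} (ha : PolyGrowth a) (c : ℂ) :
    PolyGrowth fun m => c * a m := by
  obtain ⟨C, N, h⟩ := ha
  refine ⟨‖c‖ * C, N, fun m => ?_⟩
  rw [norm_mul, mul_assoc]
  exact mul_le_mul_of_nonneg_left (h m) (norm_nonneg c)

theorem PolyGrowth.of_norm_le_one {a : (Fin g → ℤ) → ℂ} (ha : ∀ m, ‖a m‖ ≤ 1) : PolyGrowth a :=
  ⟨1, 0, fun m => by simpa using ha m⟩

/-- The coefficients of the derivative of a theta series along `h`. -/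
def derivCoeff (u : Fin g → ℝ) (h : SymCoord g × (Fin g → ℂ)) (a : (Fin g → ℤ) → ℂ) :
    (Fin g → ℤ) → ℂ := fun m => a m * thetaExp (latticeShift u m) h

theorem PolyGrowth.derivCoeff {a : (Fin g → ℤ) → ℂ} (ha : PolyGrowth a) (u : Fin g → ℝ)
    (h : SymCoord g × (Fin g → ℂ)) : PolyGrowth (derivCoeff u h a) := by
  obtain ⟨C, N, hC⟩ := ha
  obtain ⟨K, hK, hKm⟩ := exists_norm_thetaExp_le u
  refine ⟨C * K * ‖h‖, N + 2, fun m => ?_⟩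
  rw [_root_.derivCoeff, norm_mul]
  calc ‖a m‖ * ‖thetaExp (latticeShift u m) h‖
      ≤ (C * (1 + ‖m‖) ^ N) * ((K * (1 + ‖m‖) ^ 2) * ‖h‖) :=
        mul_le_mul (hC m) (((thetaExp _).le_opNorm h).trans
          (mul_le_mul_of_nonneg_right (hKm m) (norm_nonneg h))) (norm_nonneg _)
          ((norm_nonneg _).trans (hC m))
    _ = _ := by ring

theorem exists_thetaSeries_bound (u : Fin g → ℝ) {a : (Fin g → ℤ) → ℂ} (ha : PolyGrowth a)
    {x₀ : SymCoord g × (Fin g → ℂ)} (h : x₀.1 ∈ siegelSpace g) :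
    ∃ r > 0, ∃ C ≥ 0, ∀ x ∈ Metric.ball x₀ r, ∀ m,
      ‖a m * Complex.exp (thetaExp (latticeShift u m) x)‖ ≤ C * latticeMajorant m ∧
      ‖(a m * Complex.exp (thetaExp (latticeShift u m) x)) • thetaExp (latticeShift u m)‖ ≤
        C * latticeMajorant m := by
  obtain ⟨D, N, hD⟩ := ha
  obtain ⟨K, hK, hKm⟩ := exists_norm_thetaExp_le u
  -- The exponent `N` bounds the coefficients, and the extra `2` pays for the norm of the linear
  -- functional in the derivative.
  obtain ⟨r, hr, C, hC, hb⟩ := exists_thetaExp_bound u h (N + 2)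
  have hD0 : 0 ≤ D := by
    have := (norm_nonneg _).trans (hD 0)
    simpa using this
  refine ⟨r, hr, D * (K + 1) * C, by positivity, fun x hx m => ?_⟩
  have hb' := hb x hx m
  have hm : 1 ≤ 1 + ‖m‖ := by linarith [norm_nonneg m]
  constructor
  · rw [norm_mul]
    calc ‖a m‖ * ‖Complex.exp (thetaExp (latticeShift u m) x)‖
        ≤ (D * (1 + ‖m‖) ^ (N + 2)) * ‖Complex.exp (thetaExp (latticeShift u m) x)‖ := by
          gcongr
          exact (hD m).trans (by gcongr <;> omega)
      _ = D * 1 * ((1 + ‖m‖) ^ (N + 2) * ‖Complex.exp (thetaExp (latticeShift u m) x)‖) := by ring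
      _ ≤ D * (K + 1) * (C * latticeMajorant m) := by
          have := latticeMajorant_nonneg m
          gcongr
          linarith
      _ = _ := by ring
  · rw [norm_smul, norm_mul]
    calc ‖a m‖ * ‖Complex.exp (thetaExp (latticeShift u m) x)‖ * ‖thetaExp (latticeShift u m)‖
        ≤ (D * (1 + ‖m‖) ^ N) * ‖Complex.exp (thetaExp (latticeShift u m) x)‖ *
          (K * (1 + ‖m‖) ^ 2) := by
          gcongr
          exacts [hD m, hKm m]
      _ = D * K * ((1 + ‖m‖) ^ (N + 2) * ‖Complex.exp (thetaExp (latticeShift u m) x)‖) := by ring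
      _ ≤ D * (K + 1) * (C * latticeMajorant m) := by
          have := latticeMajorant_nonneg m
          gcongr
          linarith
      _ = _ := by ring

theorem summable_norm_thetaSeries (u : Fin g → ℝ) {a : (Fin g → ℤ) → ℂ} (ha : PolyGrowth a)
    {x : SymCoord g × (Fin g → ℂ)} (h : x.1 ∈ siegelSpace g) :
    Summable fun m => ‖a m * Complex.exp (thetaExp (latticeShift u m) x)‖ := by
  obtain ⟨r, hr, C, hC, hb⟩ := exists_thetaSeries_bound u ha h
  exact .of_nonneg_of_le (fun _ => norm_nonneg _)
    (fun m => (hb x (Metric.mem_ball_self hr) m).1) (summable_latticeMajorant.mul_left C)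

theorem summable_thetaSeries (u : Fin g → ℝ) {a : (Fin g → ℤ) → ℂ} (ha : PolyGrowth a)
    {x : SymCoord g × (Fin g → ℂ)} (h : x.1 ∈ siegelSpace g) :
    Summable fun m => a m * Complex.exp (thetaExp (latticeShift u m) x) :=
  (summable_norm_thetaSeries u ha h).of_norm

/-- The differential of a theta series. -/
def thetaDeriv (u : Fin g → ℝ) (a : (Fin g → ℤ) → ℂ) (x : SymCoord g × (Fin g → ℂ)) :
    (SymCoord g × (Fin g → ℂ)) →L[ℂ] ℂ :=
  ∑' m, (a m * Complex.exp (thetaExp (latticeShift u m) x)) • thetaExp (latticeShift u m)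

theorem thetaSeries_local (u : Fin g → ℝ) {a : (Fin g → ℤ) → ℂ} (ha : PolyGrowth a)
    {x₀ : SymCoord g × (Fin g → ℂ)} (h : x₀.1 ∈ siegelSpace g) :
    ∃ r > 0, (∀ x ∈ Metric.ball x₀ r, HasFDerivAt (thetaSeries u a) (thetaDeriv u a x) x) ∧
      ContinuousOn (thetaDeriv u a) (Metric.ball x₀ r) := by
  obtain ⟨r, hr, C, hC, hb⟩ := exists_thetaSeries_bound u ha h
  have hsum := (summable_latticeMajorant (g := g)).mul_left C
  refine ⟨r, hr, fun x hx => ?_, ?_⟩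
  · refine hasFDerivAt_tsum_of_isPreconnected hsum Metric.isOpen_ball
      (convex_ball x₀ r).isPreconnected (fun m y hy => ?_) (fun m y hy => (hb y hy m).2)
      (Metric.mem_ball_self hr) (summable_thetaSeries u ha h) hx
    have := ((thetaExp (latticeShift u m)).hasFDerivAt (x := y)).cexp.const_mul (a m)
    rwa [smul_smul] at this
  · refine continuousOn_tsum (fun m => ?_) hsum fun m y hy => (hb y hy m).2
    fun_prop

theorem hasFDerivAt_thetaSeries (u : Fin g → ℝ) {a : (Fin g → ℤ) → ℂ} (ha : PolyGrowth a)
    {x : SymCoord g × (Fin g → ℂ)} (h : x.1 ∈ siegelSpace g) :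
    HasFDerivAt (thetaSeries u a) (thetaDeriv u a x) x := by
  obtain ⟨r, hr, h1, -⟩ := thetaSeries_local u ha h
  exact h1 x (Metric.mem_ball_self hr)

theorem continuousAt_thetaDeriv (u : Fin g → ℝ) {a : (Fin g → ℤ) → ℂ} (ha : PolyGrowth a)
    {x : SymCoord g × (Fin g → ℂ)} (h : x.1 ∈ siegelSpace g) :
    ContinuousAt (thetaDeriv u a) x := by
  obtain ⟨r, hr, -, h1⟩ := thetaSeries_local u ha h
  exact h1.continuousAt (Metric.ball_mem_nhds x hr)

theorem thetaDeriv_apply (u : Fin g → ℝ) {a : (Fin g → ℤ) → ℂ} (ha : PolyGrowth a)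
    {x : SymCoord g × (Fin g → ℂ)} (hx : x.1 ∈ siegelSpace g) (h : SymCoord g × (Fin g → ℂ)) :
    thetaDeriv u a x h = thetaSeries u (derivCoeff u h a) x := by
  obtain ⟨r, hr, C, hC, hb⟩ := exists_thetaSeries_bound u ha hx
  have hs : Summable fun m =>
      (a m * Complex.exp (thetaExp (latticeShift u m) x)) • thetaExp (latticeShift u m) :=
    .of_norm_bounded (summable_latticeMajorant.mul_left C)
      fun m => (hb x (Metric.mem_ball_self hr) m).2
  rw [thetaDeriv, ← ContinuousLinearMap.apply_apply h, ContinuousLinearMap.map_tsum _ hs,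
    thetaSeries]
  refine tsum_congr fun m => ?_
  simp only [ContinuousLinearMap.apply_apply, FunLike.coe_smul, Pi.smul_apply, smul_eq_mul,
    derivCoeff]
  ring

theorem hasDerivAt_thetaSeries_line (u : Fin g → ℝ) {a : (Fin g → ℤ) → ℂ} (ha : PolyGrowth a)
    (x h : SymCoord g × (Fin g → ℂ)) {t : ℂ} (hx : (x + t • h).1 ∈ siegelSpace g) :
    HasDerivAt (fun t : ℂ => thetaSeries u a (x + t • h))
      (thetaSeries u (derivCoeff u h a) (x + t • h)) t := by
  rw [← thetaDeriv_apply u ha hx]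
  have h1 : HasDerivAt (fun t : ℂ => x + t • h) h t := by
    simpa using ((hasDerivAt_id t).smul_const h).const_add x
  exact (hasFDerivAt_thetaSeries u ha hx).comp_hasDerivAt t h1

end ThetaSeries

/-! ### Theta functions with real characteristics and their quasi-periodicity. -/

section RealCharacteristics

open Matrix

variable {g : ℕ}

/-- A real vector, regarded as a complex one. -/
def toComplexVec (v : Fin g → ℝ) : Fin g → ℂ := fun j => v j

/-- An integral vector, regarded as a complex one. -/
def intVec (n : Fin g → ℤ) : Fin g → ℂ := fun j => n j

theorem toComplexVec_latticeShift (u : Fin g → ℝ) (m : Fin g → ℤ) :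
    toComplexVec (latticeShift u m) = intVec m + toComplexVec u := by
  ext j
  simp [toComplexVec, latticeShift, intVec]

theorem SymCoord.toMatrix_transpose (ω : SymCoord g) : ω.toMatrixᵀ = ω.toMatrix := by
  ext j k
  simp [SymCoord.toMatrix, Sym2.eq_swap]

theorem SymCoord.dotProduct_mulVec_comm (ω : SymCoord g) (v w : Fin g → ℂ) :
    v ⬝ᵥ ω.toMatrix *ᵥ w = w ⬝ᵥ ω.toMatrix *ᵥ v := by
  rw [dotProduct_mulVec, ← mulVec_transpose, ω.toMatrix_transpose, dotProduct_comm]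

theorem thetaExp_eq_dotProduct (v : Fin g → ℝ) (ω : SymCoord g) (z : Fin g → ℂ) :
    thetaExp v (ω, z) = Real.pi * Complex.I * (toComplexVec v ⬝ᵥ ω.toMatrix *ᵥ toComplexVec v +
      2 * (toComplexVec v ⬝ᵥ z)) := by
  rw [thetaExp_apply]
  simp only [dotProduct, mulVec, toComplexVec, SymCoord.toMatrix, of_apply, Finset.mul_sum]
  congr 2
  exact Finset.sum_congr rfl fun j _ => Finset.sum_congr rfl fun k _ => by ring

/-- The coefficients of the theta function with real characteristic `(u, s)`. -/
def charCoeff (u s : Fin g → ℝ) (m : Fin g → ℤ) : ℂ :=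
  Complex.exp (2 * Real.pi * Complex.I * (toComplexVec (latticeShift u m) ⬝ᵥ toComplexVec s))

theorem norm_charCoeff (u s : Fin g → ℝ) (m : Fin g → ℤ) : ‖charCoeff u s m‖ = 1 := by
  have : toComplexVec (latticeShift u m) ⬝ᵥ toComplexVec s =
      ((latticeShift u m ⬝ᵥ s : ℝ) : ℂ) := by
    simp [dotProduct, toComplexVec]
  rw [charCoeff, this, Complex.norm_exp]
  simp

theorem polyGrowth_charCoeff (u s : Fin g → ℝ) : PolyGrowth (charCoeff u s) :=
  .of_norm_le_one fun m => (norm_charCoeff u s m).le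

/-- The theta function with real characteristic `(u, s)`. -/
def thetaC (u s : Fin g → ℝ) (ω : SymCoord g) (z : Fin g → ℂ) : ℂ :=
  thetaSeries u (charCoeff u s) (ω, z)

theorem thetaC_add_int (u s : Fin g → ℝ) (ω : SymCoord g) (z : Fin g → ℂ) (n : Fin g → ℤ) :
    thetaC u s ω (z + intVec n) =
      Complex.exp (2 * Real.pi * Complex.I * (toComplexVec u ⬝ᵥ intVec n)) * thetaC u s ω z := by
  rw [thetaC, thetaC, thetaSeries, thetaSeries, ← tsum_mul_left]
  refine tsum_congr fun m => ?_
  rw [thetaExp_eq_dotProduct, thetaExp_eq_dotProduct, mul_left_comm, ← Complex.exp_add]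
  congr 1
  have h1 : intVec m ⬝ᵥ intVec n = ((m ⬝ᵥ n : ℤ) : ℂ) := by simp [dotProduct, intVec]
  rw [Complex.exp_eq_exp_iff_exists_int]
  refine ⟨m ⬝ᵥ n, ?_⟩
  rw [← h1, dotProduct_add, toComplexVec_latticeShift]
  simp only [add_dotProduct]
  ring

/-- Reindexing the sum by `m ↦ m + n` completes the square; the symmetry of `ω` merges the two cross
terms. -/
theorem thetaC_add_period (u s : Fin g → ℝ) (ω : SymCoord g) (z : Fin g → ℂ) (n : Fin g → ℤ) :
    thetaC u s ω (z + ω.toMatrix *ᵥ intVec n) =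
      Complex.exp (-(2 * Real.pi * Complex.I * (intVec n ⬝ᵥ toComplexVec s)) -
        Real.pi * Complex.I * (intVec n ⬝ᵥ ω.toMatrix *ᵥ intVec n + 2 * (intVec n ⬝ᵥ z))) *
      thetaC u s ω z := by
  rw [thetaC, thetaC, thetaSeries, thetaSeries, ← tsum_mul_left, eq_comm]
  refine ((Equiv.addRight n).tsum_eq _).symm.trans (tsum_congr fun m => ?_)
  have hs : toComplexVec (latticeShift u (m + n)) =
      toComplexVec (latticeShift u m) + intVec n := by
    rw [toComplexVec_latticeShift, toComplexVec_latticeShift]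
    ext j
    simp [intVec]
    ring
  rw [Equiv.coe_addRight, charCoeff, charCoeff, thetaExp_eq_dotProduct, thetaExp_eq_dotProduct, hs,
    ← Complex.exp_add, ← Complex.exp_add, ← Complex.exp_add]
  congr 1
  generalize toComplexVec (latticeShift u m) = v
  simp only [add_dotProduct, dotProduct_add, mulVec_add]
  rw [ω.dotProduct_mulVec_comm (intVec n) v]
  ring

theorem contDiff_thetaC (u s : Fin g → ℝ) {ω : SymCoord g} (hω : ω ∈ siegelSpace g) :
    ContDiff ℂ 1 (thetaC u s ω) := by
  have hp := polyGrowth_charCoeff u s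
  refine contDiff_one_iff_hasFDerivAt.2 ⟨fun z => (thetaDeriv u (charCoeff u s) (ω, z)).comp
    (ContinuousLinearMap.inr ℂ _ _), ?_, fun z => ?_⟩
  · refine Continuous.clm_comp ?_ continuous_const
    rw [continuous_iff_continuousAt]
    intro z
    exact (continuousAt_thetaDeriv u hp (x := (ω, z)) hω).comp
      (f := fun z : Fin g → ℂ => (ω, z)) (by fun_prop)
  · exact (hasFDerivAt_thetaSeries u hp (x := (ω, z)) hω).comp z (hasFDerivAt_prodMk_right ω z)

end RealCharacteristics

/-! ### Fourier analysis on the torus: uniqueness and nonvanishing of theta functions. -/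

section FourierUniqueness

open MeasureTheory Matrix Filter Topology

variable {g : ℕ}

/-- The unit cube with corner `a`. -/
def unitCube (a : Fin g → ℝ) : Set (Fin g → ℝ) := {x | ∀ i, x i ∈ Set.Ioc (a i) (a i + 1)}

theorem periodic_intVec {h : (Fin g → ℂ) → ℂ}
    (hp : ∀ z j, h (z + Pi.single j 1) = h z) (n : Fin g → ℤ) (z : Fin g → ℂ) :
    h (z + intVec n) = h z := by
  let S : AddSubgroup (Fin g → ℤ) :=
    { carrier := {n | ∀ z, h (z + intVec n) = h z}
      zero_mem' := fun z => by
        have : intVec (0 : Fin g → ℤ) = 0 := by ext j; simp [intVec]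
        rw [this, add_zero]
      add_mem' := fun {a b} ha hb z => by
        have : intVec (a + b) = intVec a + intVec b := by ext j; simp [intVec]
        rw [this, ← add_assoc, hb, ha]
      neg_mem' := fun {a} ha z => by
        have : intVec (-a) = -intVec a := by ext j; simp [intVec]
        rw [this, ← ha, neg_add_cancel_right] }
  have hsingle : ∀ j (k : ℤ), (Pi.single j k : Fin g → ℤ) ∈ S := by
    intro j k
    have h1 : (Pi.single j 1 : Fin g → ℤ) ∈ S := fun z => by
      have : intVec (Pi.single j 1 : Fin g → ℤ) = Pi.single j 1 := by
        ext i
        by_cases hij : i = j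
        · subst hij; simp [intVec]
        · simp [intVec, hij]
      rw [this, hp]
    have h2 := S.zsmul_mem h1 k
    rwa [← Pi.single_smul, smul_eq_mul, mul_one] at h2
  have : n ∈ S := by
    rw [← Finset.univ_sum_single n]
    exact S.sum_mem fun j _ => hsingle j _
  exact this z

/-- The function on the torus defined by a continuous periodic function. -/
theorem exists_torus_lift {h : (Fin g → ℂ) → ℂ} (hc : Continuous h)
    (hp : ∀ z j, h (z + Pi.single j 1) = h z) (w : Fin g → ℂ) :
    ∃ F : C(UnitAddTorus (Fin g), ℂ), ∀ x : Fin g → ℝ,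
      F (fun i => (x i : UnitAddCircle)) = h (toComplexVec x + w) := by
  let π : (Fin g → ℝ) → UnitAddTorus (Fin g) := fun x i => (x i : UnitAddCircle)
  have hπ : IsOpenQuotientMap π :=
    IsOpenQuotientMap.piMap fun _ => QuotientAddGroup.isOpenQuotientMap_mk
  have hcx : Continuous fun x : Fin g → ℝ => h (toComplexVec x + w) := by
    unfold toComplexVec
    fun_prop
  let f : C(Fin g → ℝ, ℂ) := ⟨fun x => h (toComplexVec x + w), hcx⟩
  have hf : Function.FactorsThrough f π := by
    intro x y hxy
    have : ∀ i, ∃ n : ℤ, x i = y i + n := by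
      intro i
      have h1 : ((x i - y i : ℝ) : UnitAddCircle) = 0 := by
        rw [AddCircle.coe_sub, sub_eq_zero]
        exact congrFun hxy i
      obtain ⟨n, hn⟩ := (AddCircle.coe_eq_zero_iff (1 : ℝ)).1 h1
      refine ⟨n, ?_⟩
      rw [zsmul_one] at hn
      linarith
    choose n hn using this
    have : toComplexVec x + w = toComplexVec y + w + intVec n := by
      ext i
      simp [toComplexVec, intVec, hn i]
      ring
    change h _ = h _
    rw [this, periodic_intVec hp]
  have hπc : Continuous π := by fun_prop
  have hq : IsQuotientMap (⟨π, hπc⟩ : C(Fin g → ℝ, UnitAddTorus (Fin g))) := hπ.isQuotientMap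
  exact ⟨hq.lift f hf, fun x => DFunLike.congr_fun (hq.lift_comp f hf) x⟩

/-- Both integrals are the zeroth Fourier coefficient of the same function on the torus, so the
corner of the cube does not matter. -/
theorem integral_unitCube_eq {h : (Fin g → ℂ) → ℂ} (hc : Continuous h)
    (hp : ∀ z j, h (z + Pi.single j 1) = h z) (w : Fin g → ℂ) (a : Fin g → ℝ) :
    ∫ x in unitCube a, h (toComplexVec x + w) = ∫ x in unitCube 0, h (toComplexVec x + w) := by
  obtain ⟨F, hF⟩ := exists_torus_lift hc hp w
  have key : ∀ a, ∫ x in unitCube a, h (toComplexVec x + w) =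
      UnitAddTorus.mFourierCoeff F 0 := by
    intro a
    rw [UnitAddTorus.mFourierCoeff_eq_integral F 0 a]
    refine integral_congr_ae (ae_of_all _ fun x => ?_)
    simp [hF, UnitAddTorus.mFourier_zero]
  rw [key, key]

theorem integral_unitCube_add_real {h : (Fin g → ℂ) → ℂ} (hc : Continuous h)
    (hp : ∀ z j, h (z + Pi.single j 1) = h z) (w : Fin g → ℂ) (r : Fin g → ℝ) :
    ∫ x in unitCube 0, h (toComplexVec x + (toComplexVec r + w)) =
      ∫ x in unitCube 0, h (toComplexVec x + w) := by
  rw [← integral_unitCube_eq hc hp w r]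
  have hpre : (fun x : Fin g → ℝ => x + r) ⁻¹' unitCube r = unitCube 0 := by
    ext x
    simp only [unitCube, Set.mem_preimage, Set.mem_ofPred_eq, Set.mem_Ioc, Pi.add_apply,
      Pi.zero_apply]
    refine forall_congr' fun i => ?_
    constructor <;> rintro ⟨h1, h2⟩ <;> constructor <;> linarith
  have hmp := (measurePreserving_add_right volume r).setIntegral_preimage_emb
    (measurableEmbedding_addRight r) (fun x => h (toComplexVec x + w)) (unitCube r)
  rw [← hmp, hpre]
  refine integral_congr_ae (ae_of_all _ fun x => ?_)
  change h _ = h _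
  congr 1
  ext j
  simp [toComplexVec]
  ring

theorem integrableOn_unitCube {h : (Fin g → ℝ) → ℂ} (hc : Continuous h) :
    IntegrableOn h (unitCube 0) := by
  refine (hc.continuousOn.integrableOn_compact (K := Set.Icc 0 1) isCompact_Icc).mono_set ?_
  intro x hx
  refine ⟨fun i => (hx i).1.le, fun i => ?_⟩
  simpa using (hx i).2

theorem measurableSet_unitCube (a : Fin g → ℝ) : MeasurableSet (unitCube a) := by
  have : unitCube a = Set.pi Set.univ fun i => Set.Ioc (a i) (a i + 1) := by
    ext x; simp [unitCube]
  rw [this]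
  exact MeasurableSet.univ_pi fun i => measurableSet_Ioc

/-- Differentiation under the integral sign; the derivative of the integrand is bounded because the
cube and a closed disc of parameters lie in a compact set. -/
theorem differentiable_integral_unitCube {h : (Fin g → ℂ) → ℂ} (hc : ContDiff ℂ 1 h)
    (w e : Fin g → ℂ) :
    Differentiable ℂ fun ζ : ℂ => ∫ x in unitCube 0, h (toComplexVec x + (ζ • e + w)) := by
  intro ζ₀
  have hcont := hc.continuous
  have hderiv : Continuous fun z => fderiv ℂ h z := hc.continuous_fderiv one_ne_zero
  have hK : IsCompact ((Set.Icc (0 : Fin g → ℝ) 1) ×ˢ Metric.closedBall ζ₀ 1) :=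
    isCompact_Icc.prod (isCompact_closedBall _ _)
  have hD : Continuous fun y : (Fin g → ℝ) × ℂ =>
      fderiv ℂ h (toComplexVec y.1 + (y.2 • e + w)) e := by
    refine Continuous.clm_apply (hderiv.comp ?_) continuous_const
    unfold toComplexVec
    fun_prop
  obtain ⟨C, hC⟩ := hK.exists_bound_of_continuousOn hD.continuousOn
  have hcx : ∀ ζ : ℂ, Continuous fun x : Fin g → ℝ => h (toComplexVec x + (ζ • e + w)) := by
    intro ζ
    unfold toComplexVec
    fun_prop
  refine (hasDerivAt_integral_of_dominated_loc_of_deriv_le (μ := volume.restrict (unitCube 0))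
    (F := fun ζ x => h (toComplexVec x + (ζ • e + w)))
    (F' := fun ζ x => fderiv ℂ h (toComplexVec x + (ζ • e + w)) e)
    (bound := fun _ => C) (Metric.ball_mem_nhds ζ₀ one_pos)
    (Eventually.of_forall fun ζ => (hcx ζ).aestronglyMeasurable)
    (integrableOn_unitCube (hcx ζ₀)) ?_ ?_ ?_ ?_).2.differentiableAt
  · exact (hD.comp (by fun_prop : Continuous fun x : Fin g → ℝ => (x, ζ₀))).aestronglyMeasurable
  · refine (ae_restrict_iff' (measurableSet_unitCube 0)).2 (ae_of_all _ fun x hx ζ hζ => ?_)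
    refine hC (x, ζ) ⟨⟨fun i => (hx i).1.le, fun i => ?_⟩, Metric.ball_subset_closedBall hζ⟩
    simpa using (hx i).2
  · simpa using (integrableOn_unitCube (h := fun _ => (C : ℂ)) continuous_const).re
  · refine ae_of_all _ fun x ζ _ => ?_
    have h1 : HasDerivAt (fun ζ : ℂ => toComplexVec x + (ζ • e + w)) e ζ := by
      simpa using (((hasDerivAt_id ζ).smul_const e).add_const w).const_add (toComplexVec x)
    exact ((hc.differentiable one_ne_zero _).hasFDerivAt).comp_hasDerivAt ζ h1

/-- The complex derivative can be computed along the real direction, in which the function is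
constant. -/
theorem eq_of_differentiable_of_real_periodic {φ : ℂ → ℂ} (hφ : Differentiable ℂ φ)
    (hr : ∀ (ζ : ℂ) (r : ℝ), φ (ζ + r) = φ ζ) (ζ : ℂ) : φ ζ = φ 0 := by
  have hd : ∀ ζ, deriv φ ζ = 0 := by
    intro ζ
    have h1 : HasDerivAt (fun r : ℝ => φ (ζ + r)) (deriv φ ζ) 0 := by
      have h3 : HasDerivAt φ (deriv φ ζ) (ζ + ((0 : ℝ) : ℂ)) := by
        simpa using (hφ ζ).hasDerivAt
      exact (h3.comp_const_add ζ _).comp_ofReal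
    have h4 : (fun r : ℝ => φ (ζ + r)) = fun _ => φ ζ := funext fun r => hr ζ r
    rw [h4] at h1
    exact h1.unique (hasDerivAt_const _ _)
  exact is_const_of_deriv_eq_zero hφ hd ζ 0

/-- The mean over the real torus of an entire periodic function does not depend on the imaginary
part of the base point. -/
theorem integral_unitCube_const {h : (Fin g → ℂ) → ℂ} (hc : ContDiff ℂ 1 h)
    (hp : ∀ z j, h (z + Pi.single j 1) = h z) (w : Fin g → ℂ) :
    ∫ x in unitCube 0, h (toComplexVec x + w) = ∫ x in unitCube 0, h (toComplexVec x) := by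
  have hsplit : w = toComplexVec (fun j => (w j).re) +
      (Complex.I • toComplexVec (fun j => (w j).im) + 0) := by
    ext j
    simp only [Pi.add_apply, Pi.smul_apply, toComplexVec, smul_eq_mul, add_zero]
    rw [mul_comm, Complex.re_add_im]
  rw [hsplit, integral_unitCube_add_real hc.continuous hp]
  set e := toComplexVec fun j => (w j).im
  -- With a complex multiple `ζ` of the imaginary part as base point, the mean is entire in `ζ` and
  -- insensitive to real shifts, hence constant. The value `ζ = I` is the one needed.
  have h1 := eq_of_differentiable_of_real_periodic (differentiable_integral_unitCube hc 0 e)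
    (fun ζ r => by
      have : (ζ + (r : ℂ)) • e + 0 =
          toComplexVec (fun j => r * (w j).im) + (ζ • e + 0) := by
        ext j
        simp [e, toComplexVec]
        ring
      change ∫ x in unitCube 0, h (toComplexVec x + ((ζ + (r : ℂ)) • e + 0)) = _
      rw [this, integral_unitCube_add_real hc.continuous hp]) Complex.I
  simpa using h1

/-- The exponential with frequency `v`. -/
def expDot (v z : Fin g → ℂ) : ℂ := Complex.exp (-(2 * Real.pi * Complex.I * (v ⬝ᵥ z)))

theorem expDot_ne_zero (v z : Fin g → ℂ) : expDot v z ≠ 0 := Complex.exp_ne_zero _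

theorem expDot_add (v z w : Fin g → ℂ) : expDot v (z + w) = expDot v z * expDot v w := by
  rw [expDot, expDot, expDot, ← Complex.exp_add, dotProduct_add]
  ring_nf

theorem expDot_add_left (v w z : Fin g → ℂ) : expDot (v + w) z = expDot v z * expDot w z := by
  rw [expDot, expDot, expDot, ← Complex.exp_add, add_dotProduct]
  ring_nf

theorem contDiff_expDot (v : Fin g → ℂ) : ContDiff ℂ 1 (expDot v) := by
  unfold expDot dotProduct
  fun_prop

theorem expDot_intVec_single (m : Fin g → ℤ) (j : Fin g) :
    expDot (intVec m) (Pi.single j 1) = 1 := by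
  rw [expDot, dotProduct_single, mul_one, Complex.exp_eq_one_iff]
  exact ⟨-m j, by simp [intVec]; ring⟩

/-- The functional equations of the theta function with real characteristic `(u, s)`. -/
structure IsQuasiPeriodic (u s : Fin g → ℝ) (ω : SymCoord g) (f : (Fin g → ℂ) → ℂ) : Prop where
  contDiff : ContDiff ℂ 1 f
  add_single : ∀ z j, f (z + Pi.single j 1) = Complex.exp (2 * Real.pi * Complex.I * u j) * f z
  add_col : ∀ z j, f (z + ω.toMatrix *ᵥ Pi.single j 1) =
    Complex.exp (-(2 * Real.pi * Complex.I * s j) -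
      Real.pi * Complex.I * (ω s(j, j) + 2 * z j)) * f z

theorem isQuasiPeriodic_thetaC (u s : Fin g → ℝ) {ω : SymCoord g} (hω : ω ∈ siegelSpace g) :
    IsQuasiPeriodic u s ω (thetaC u s ω) := by
  have hsing : ∀ j, intVec (Pi.single j 1 : Fin g → ℤ) = Pi.single j 1 := by
    intro j
    ext i
    by_cases hij : i = j
    · subst hij; simp [intVec]
    · simp [intVec, hij]
  refine ⟨contDiff_thetaC u s hω, fun z j => ?_, fun z j => ?_⟩
  · have := thetaC_add_int u s ω z (Pi.single j 1)
    rwa [hsing, dotProduct_single, mul_one] at this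
  · have := thetaC_add_period u s ω z (Pi.single j 1)
    rw [hsing] at this
    simpa [SymCoord.toMatrix, toComplexVec] using this

/-- The Fourier coefficients of a quasi-periodic function. -/
def quasiCoeff (u : Fin g → ℝ) (f : (Fin g → ℂ) → ℂ) (m : Fin g → ℤ) : ℂ :=
  ∫ x in unitCube 0, f (toComplexVec x) * expDot (intVec m + toComplexVec u) (toComplexVec x)

namespace IsQuasiPeriodic

variable {u s : Fin g → ℝ} {ω : SymCoord g} {f : (Fin g → ℂ) → ℂ}

theorem periodic (hf : IsQuasiPeriodic u s ω f) (m : Fin g → ℤ) (z : Fin g → ℂ) (j : Fin g) :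
    f (z + Pi.single j 1) * expDot (intVec m + toComplexVec u) (z + Pi.single j 1) =
      f z * expDot (intVec m + toComplexVec u) z := by
  rw [hf.add_single, expDot_add, expDot_add_left _ _ (Pi.single j 1), expDot_intVec_single, one_mul]
  have : expDot (toComplexVec u) (Pi.single j 1) =
      Complex.exp (-(2 * Real.pi * Complex.I * u j)) := by
    rw [expDot, dotProduct_single, mul_one, toComplexVec]
  rw [this, Complex.exp_neg]
  field_simp

theorem contDiff_mul (hf : IsQuasiPeriodic u s ω f) (m : Fin g → ℤ) :
    ContDiff ℂ 1 fun z => f z * expDot (intVec m + toComplexVec u) z :=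
  hf.contDiff.mul (contDiff_expDot _)

/-- Moving the torus of integration by the `j`-th column of `ω` leaves the mean unchanged, while the
automorphy factor raises the frequency by the `j`-th unit vector. So one coefficient determines all
of them. -/
theorem quasiCoeff_recursion (hf : IsQuasiPeriodic u s ω f) (m : Fin g → ℤ) (j : Fin g) :
    ∃ K : ℂ, K ≠ 0 ∧ quasiCoeff u f m = K * quasiCoeff u f (m + Pi.single j 1) := by
  have h1 := integral_unitCube_const (hf.contDiff_mul m) (hf.periodic m)
    (ω.toMatrix *ᵥ Pi.single j 1)
  refine ⟨Complex.exp (-(2 * Real.pi * Complex.I * s j) - Real.pi * Complex.I * ω s(j, j)) *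
    expDot (intVec m + toComplexVec u) (ω.toMatrix *ᵥ Pi.single j 1),
    mul_ne_zero (Complex.exp_ne_zero _) (expDot_ne_zero _ _), ?_⟩
  rw [quasiCoeff, quasiCoeff, ← h1, ← integral_const_mul]
  refine integral_congr_ae (ae_of_all _ fun x => ?_)
  have hm : intVec (m + Pi.single j 1) + toComplexVec u =
      (intVec m + toComplexVec u) + Pi.single j 1 := by
    ext i
    by_cases hij : i = j
    · subst hij; simp [intVec]; ring
    · simp [intVec, hij]
  simp only [hf.add_col, expDot_add, hm, expDot_add_left _ (Pi.single j 1)]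
  have h2 : expDot (Pi.single j 1) (toComplexVec x) =
      Complex.exp (-(Real.pi * Complex.I * (2 * toComplexVec x j))) := by
    rw [expDot, single_dotProduct, one_mul]
    ring_nf
  have h3 : Complex.exp (-(2 * Real.pi * Complex.I * s j) -
      Real.pi * Complex.I * (ω s(j, j) + 2 * toComplexVec x j)) =
      Complex.exp (-(2 * Real.pi * Complex.I * s j) - Real.pi * Complex.I * ω s(j, j)) *
      Complex.exp (-(Real.pi * Complex.I * (2 * toComplexVec x j))) := by
    rw [← Complex.exp_add]
    ring_nf
  rw [h2, h3]
  ring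

theorem quasiCoeff_eq_zero (hf : IsQuasiPeriodic u s ω f) (h0 : quasiCoeff u f 0 = 0)
    (m : Fin g → ℤ) : quasiCoeff u f m = 0 := by
  have hiff : ∀ m j, quasiCoeff u f (m + Pi.single j 1) = 0 ↔ quasiCoeff u f m = 0 := by
    intro m j
    obtain ⟨K, hK, h⟩ := hf.quasiCoeff_recursion m j
    rw [h, mul_eq_zero, or_iff_right hK]
  let S : AddSubgroup (Fin g → ℤ) :=
    { carrier := {n | ∀ m, quasiCoeff u f (m + n) = 0 ↔ quasiCoeff u f m = 0}
      zero_mem' := fun m => by rw [add_zero]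
      add_mem' := fun {a b} ha hb m => by rw [← add_assoc, hb, ha]
      neg_mem' := fun {a} ha m => by rw [← ha (m + -a), neg_add_cancel_right] }
  have hsingle : ∀ j (k : ℤ), (Pi.single j k : Fin g → ℤ) ∈ S := by
    intro j k
    have h2 := S.zsmul_mem (show (Pi.single j 1 : Fin g → ℤ) ∈ S from fun m => hiff m j) k
    rwa [← Pi.single_smul, smul_eq_mul, mul_one] at h2
  have hm : m ∈ S := by
    rw [← Finset.univ_sum_single m]
    exact S.sum_mem fun j _ => hsingle j _
  have := (hm 0).2 h0
  rwa [zero_add] at this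

/-- On the real torus through any base point `w` the Fourier coefficients are nonzero multiples of
those on the torus through `0`, hence all vanish. The Fourier series is then trivially summable and
so represents the function pointwise. -/
theorem eq_zero (hf : IsQuasiPeriodic u s ω f) (h0 : quasiCoeff u f 0 = 0) : f = 0 := by
  funext w
  obtain ⟨F, hF⟩ := exists_torus_lift (hf.contDiff_mul 0).continuous (hf.periodic 0) w
  have hcoef : ∀ m, UnitAddTorus.mFourierCoeff F m = 0 := by
    intro m
    have h1 := integral_unitCube_const (hf.contDiff_mul m) (hf.periodic m) w
    rw [show (∫ x in unitCube 0, f (toComplexVec x) *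
      expDot (intVec m + toComplexVec u) (toComplexVec x)) = quasiCoeff u f m from rfl,
      hf.quasiCoeff_eq_zero h0] at h1
    have h2 : UnitAddTorus.mFourierCoeff F m * expDot (intVec m) w = 0 := by
      rw [UnitAddTorus.mFourierCoeff_eq_integral F m 0, ← integral_mul_const, ← h1]
      refine integral_congr_ae (ae_of_all _ fun x => ?_)
      have h3 : UnitAddTorus.mFourier (-m) (fun i => (x i : UnitAddCircle)) =
          expDot (intVec m) (toComplexVec x) := by
        simp only [UnitAddTorus.mFourier, ContinuousMap.coe_mk, fourier_coe_apply, expDot,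
          ← Complex.exp_sum, dotProduct, Finset.mul_sum, intVec, toComplexVec, Pi.neg_apply,
          ← Finset.sum_neg_distrib]
        refine congrArg _ (Finset.sum_congr rfl fun i _ => ?_)
        push_cast
        ring
      have h4 : intVec (0 : Fin g → ℤ) = 0 := by ext j; simp [intVec]
      simp only [hF, h3, smul_eq_mul, h4, zero_add, expDot_add_left, expDot_add (intVec m)]
      ring
    exact (mul_eq_zero.1 h2).resolve_right (expDot_ne_zero _ _)
  have hsum := UnitAddTorus.hasSum_mFourier_series_apply_of_summable (f := F)
    (by simpa only [funext hcoef] using summable_zero) (fun i => ((0 : ℝ) : UnitAddCircle))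
  simp only [hcoef, zero_smul] at hsum
  have h5 := hsum.unique hasSum_zero
  rw [hF fun _ => 0] at h5
  have h6 : toComplexVec (fun _ : Fin g => (0 : ℝ)) + w = w := by
    ext j; simp [toComplexVec]
  rw [h6] at h5
  exact (mul_eq_zero.1 h5).resolve_right (expDot_ne_zero _ _)

theorem sub_const_mul {f' : (Fin g → ℂ) → ℂ} (hf : IsQuasiPeriodic u s ω f)
    (hf' : IsQuasiPeriodic u s ω f') (c d : ℂ) :
    IsQuasiPeriodic u s ω fun z => c * f z - d * f' z := by
  refine ⟨(contDiff_const.mul hf.contDiff).sub (contDiff_const.mul hf'.contDiff),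
    fun z j => ?_, fun z j => ?_⟩
  · rw [hf.add_single, hf'.add_single]; ring
  · rw [hf.add_col, hf'.add_col]; ring

/-- The space of solutions of the functional equations is at most one-dimensional. -/
theorem exists_eq_const_mul {f' : (Fin g → ℂ) → ℂ} (hf : IsQuasiPeriodic u s ω f)
    (hf' : IsQuasiPeriodic u s ω f') (hne : f' ≠ 0) : ∃ c : ℂ, ∀ z, f z = c * f' z := by
  have hc : quasiCoeff u f' 0 ≠ 0 := fun h => hne (hf'.eq_zero h)
  have hI : ∀ {h}, IsQuasiPeriodic u s ω h → IntegrableOn (fun x : Fin g → ℝ =>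
      h (toComplexVec x) * expDot (intVec 0 + toComplexVec u) (toComplexVec x)) (unitCube 0) := by
    intro h hh
    refine integrableOn_unitCube ((hh.contDiff_mul 0).continuous.comp ?_)
    unfold toComplexVec
    fun_prop
  -- This is the linear combination whose zeroth coefficient cancels, so that it vanishes
  -- identically.
  have h := (hf.sub_const_mul hf' (quasiCoeff u f' 0) (quasiCoeff u f 0)).eq_zero (by
    rw [quasiCoeff]
    simp only [sub_mul, mul_assoc]
    rw [integral_sub ((hI hf).const_mul _) ((hI hf').const_mul _), integral_const_mul,
      integral_const_mul]
    change quasiCoeff u f' 0 * quasiCoeff u f 0 - quasiCoeff u f 0 * quasiCoeff u f' 0 = 0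
    ring)
  refine ⟨quasiCoeff u f 0 / quasiCoeff u f' 0, fun z => ?_⟩
  have := congrFun h z
  simp only [Pi.zero_apply] at this
  field_simp
  linear_combination this

end IsQuasiPeriodic

/-- The mean is unchanged when the base point moves by `I` in a direction `j` with `m j ≠ 0`, but
the integrand is multiplied by `exp (2 π m_j) ≠ 1`. -/
theorem integral_expDot_eq_zero {m : Fin g → ℤ} (hm : m ≠ 0) :
    ∫ x in unitCube 0, expDot (intVec m) (toComplexVec x) = 0 := by
  obtain ⟨j, hj⟩ := Function.ne_iff.1 hm
  have h1 := integral_unitCube_const (contDiff_expDot (intVec m))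
    (fun z j => by rw [expDot_add, expDot_intVec_single, mul_one]) (Pi.single j Complex.I)
  simp only [expDot_add] at h1
  rw [integral_mul_const] at h1
  have h2 : expDot (intVec m) (Pi.single j Complex.I) ≠ 1 := by
    have : expDot (intVec m) (Pi.single j Complex.I) =
        ((Real.exp (2 * Real.pi * m j) : ℝ) : ℂ) := by
      rw [expDot, dotProduct_single, Complex.ofReal_exp]
      congr 1
      simp only [intVec]
      push_cast
      linear_combination (-2 * Real.pi * m j : ℂ) * Complex.I_sq
    rw [this]
    norm_cast
    rw [Real.exp_eq_one_iff]
    have := Real.pi_ne_zero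
    have hj' : (m j : ℝ) ≠ 0 := by exact_mod_cast hj
    positivity
  by_contra hne
  exact h2 (mul_left_cancel₀ hne (h1.trans (mul_one _).symm))

/-- After the frequency `u` is removed, the theta series is a Fourier series on the real torus.
Integrating it term by term isolates the coefficient at `m = 0`, which is a product of exponentials.
-/
theorem thetaC_ne_zero (u s : Fin g → ℝ) {ω : SymCoord g} (hω : ω ∈ siegelSpace g) :
    thetaC u s ω ≠ 0 := by
  intro h0
  have hsum := summable_norm_thetaSeries u (polyGrowth_charCoeff u s) (x := (ω, 0)) hω
  set b : (Fin g → ℤ) → ℂ := fun m =>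
    charCoeff u s m * Complex.exp (thetaExp (latticeShift u m) (ω, 0)) with hb
  have hterm : ∀ (x : Fin g → ℝ) m, charCoeff u s m *
      Complex.exp (thetaExp (latticeShift u m) (ω, toComplexVec x)) * expDot (toComplexVec u)
        (toComplexVec x) = b m * expDot (intVec (-m)) (toComplexVec x) := by
    intro x m
    simp only [hb, thetaExp_eq_dotProduct, expDot, mul_assoc, ← Complex.exp_add]
    congr 2
    have : intVec (-m) = -intVec m := by ext j; simp [intVec]
    rw [this, toComplexVec_latticeShift, dotProduct_zero]
    simp only [add_dotProduct, neg_dotProduct]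
    ring
  have hnorm : ∀ (x : Fin g → ℝ) m, ‖expDot (intVec m) (toComplexVec x)‖ = 1 := by
    intro x m
    have : intVec m ⬝ᵥ toComplexVec x = (((fun j => (m j : ℝ)) ⬝ᵥ x : ℝ) : ℂ) := by
      simp [dotProduct, intVec, toComplexVec]
    rw [expDot, this, Complex.norm_exp]
    simp
  have hcont : ∀ m, Continuous fun x : Fin g → ℝ => b m * expDot (intVec (-m)) (toComplexVec x) := by
    intro m
    refine continuous_const.mul ((contDiff_expDot _).continuous.comp ?_)
    unfold toComplexVec
    fun_prop
  have hvol : (volume : Measure (Fin g → ℝ)).real (unitCube 0) = 1 := by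
    have : unitCube (0 : Fin g → ℝ) = Set.pi Set.univ fun i => Set.Ioc (0 : ℝ) 1 := by
      ext x; simp [unitCube]
    rw [this, Measure.real, Real.volume_pi_Ioc]
    simp
  have hfin : (volume : Measure (Fin g → ℝ)) (unitCube 0) ≠ ⊤ := by
    intro h
    rw [Measure.real, h] at hvol
    simp at hvol
  have hI := hasSum_integral_of_summable_integral_norm
    (μ := volume.restrict (unitCube (0 : Fin g → ℝ)))
    (F := fun m x => b m * expDot (intVec (-m)) (toComplexVec x))
    (fun m => integrableOn_unitCube (hcont m)) (by
      refine hsum.congr fun m => ?_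
      simp only [norm_mul, hnorm, mul_one]
      rw [setIntegral_const, hvol, one_smul]
      simp only [hb, norm_mul])
  have hz : ∀ x : Fin g → ℝ, ∑' m, b m * expDot (intVec (-m)) (toComplexVec x) = 0 := by
    intro x
    rw [← tsum_congr fun m => hterm x m, tsum_mul_right]
    have := congrFun h0 (toComplexVec x)
    rw [thetaC, thetaSeries] at this
    rw [this, Pi.zero_apply, zero_mul]
  simp only [hz, integral_zero] at hI
  have h1 : HasSum (fun m => ∫ x in unitCube (0 : Fin g → ℝ),
      b m * expDot (intVec (-m)) (toComplexVec x)) (b 0) := by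
    have hone : ∫ x in unitCube (0 : Fin g → ℝ),
        b 0 * expDot (intVec (-0)) (toComplexVec x) = b 0 := by
      have h4 : intVec (0 : Fin g → ℤ) = 0 := by ext j; simp [intVec]
      simp only [neg_zero, h4, expDot, zero_dotProduct, mul_zero, neg_zero, Complex.exp_zero, mul_one]
      rw [setIntegral_const, hvol, one_smul]
    conv => arg 2; rw [← hone]
    refine hasSum_single 0 fun m hm => ?_
    rw [integral_const_mul, integral_expDot_eq_zero (neg_ne_zero.2 hm), mul_zero]
  have h2 := hI.unique h1
  have h3 : b 0 ≠ 0 := mul_ne_zero (Complex.exp_ne_zero _) (Complex.exp_ne_zero _)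
  exact h3 h2.symm

end FourierUniqueness

/-! ### Entire functions: vanishing Wronskians and constant mixed logarithmic derivatives. -/

section OneVariable

open Filter Topology

theorem eq_zero_of_eventually_eq_zero {A : ℂ → ℂ} (hA : Differentiable ℂ A) {t₀ : ℂ}
    (h : ∀ᶠ t in 𝓝 t₀, A t = 0) (t : ℂ) : A t = 0 := by
  have h1 : AnalyticOnNhd ℂ A Set.univ := fun x _ => hA.analyticAt x
  exact h1.eqOn_zero_of_preconnected_of_eventuallyEq_zero isPreconnected_univ (Set.mem_univ t₀) h
    (Set.mem_univ t)

/-- Two entire functions with vanishing Wronskian are proportional. -/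
theorem mul_eq_mul_of_wronskian {A B A' B' : ℂ → ℂ} (hA : ∀ t, HasDerivAt A (A' t) t)
    (hB : ∀ t, HasDerivAt B (B' t) t) (h0 : B 0 ≠ 0)
    (hw : ∀ᶠ t in 𝓝 0, A' t * B t = A t * B' t) (t : ℂ) : A t * B 0 = A 0 * B t := by
  have hne : ∀ᶠ t in 𝓝 0, B t ≠ 0 := (hB 0).continuousAt.eventually_ne h0
  obtain ⟨r, hr, hball⟩ := Metric.eventually_nhds_iff_ball.1 (hw.and hne)
  have hconst : ∀ t ∈ Metric.ball (0 : ℂ) r, A t / B t = A 0 / B 0 := by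
    intro t ht
    refine IsOpen.is_const_of_deriv_eq_zero Metric.isOpen_ball
      (convex_ball (0 : ℂ) r).isPreconnected (f := fun t => A t / B t) (fun x hx => ?_)
      (fun x hx => ?_) ht (Metric.mem_ball_self hr)
    · exact ((hA x).div (hB x) (hball x hx).2).differentiableAt.differentiableWithinAt
    · rw [((hA x).fun_div (hB x) (hball x hx).2).deriv, (hball x hx).1, sub_self, zero_div]
      rfl
  have hd : Differentiable ℂ fun t => A t * B 0 - A 0 * B t := fun t =>
    (((hA t).mul_const _).sub ((hB t).const_mul _)).differentiableAt
  refine sub_eq_zero.1 (eq_zero_of_eventually_eq_zero hd (t₀ := 0) ?_ t)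
  filter_upwards [Metric.ball_mem_nhds (0 : ℂ) hr] with x hx
  have h1 := hconst x hx
  rw [div_eq_div_iff (hball x hx).2 h0] at h1
  rw [h1, sub_self]

/-- A function of two variables with `∂₁∂₂ log g = k` is a product up to the factor `exp (k s t)`. -/
theorem eq_mul_of_mixed_log_deriv {g g₁ g₂ g₁₂ : ℂ → ℂ → ℂ} {k : ℂ}
    (h₁ : ∀ s t, HasDerivAt (fun s => g s t) (g₁ s t) s)
    (h₂ : ∀ s t, HasDerivAt (fun t => g s t) (g₂ s t) t)
    (h₁₂ : ∀ s t, HasDerivAt (fun t => g₁ s t) (g₁₂ s t) t)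
    (heq : ∀ s t, g s t * g₁₂ s t - g₁ s t * g₂ s t = k * g s t ^ 2)
    (h0 : g 0 0 ≠ 0) (s t : ℂ) :
    g s t * g 0 0 = Complex.exp (k * s * t) * (g s 0 * g 0 t) := by
  -- Where `g s t` is nonzero too, this says `∂₁ log g (s, t) - ∂₁ log g (s, 0) = k t`. Clearing
  -- denominators keeps the statement meaningful at zeros of `g`, and the left side has vanishing
  -- Wronskian with `g s ·`.
  have hR : ∀ s, g s 0 ≠ 0 → ∀ t,
      g₁ s t * g s 0 - g₁ s 0 * g s t - k * t * g s t * g s 0 = 0 := by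
    intro s hs t
    have hA : ∀ t, HasDerivAt
        (fun t => g₁ s t * g s 0 - g₁ s 0 * g s t - k * t * g s t * g s 0)
        (g₁₂ s t * g s 0 - g₁ s 0 * g₂ s t - (k * g s t + k * t * g₂ s t) * g s 0) t := by
      intro t
      have h3 : HasDerivAt (fun t : ℂ => k * t) k t := by
        simpa using (hasDerivAt_id t).const_mul k
      exact (((h₁₂ s t).mul_const _).sub ((h₂ s t).const_mul _)).sub
        ((h3.mul (h₂ s t)).mul_const _)
    have := mul_eq_mul_of_wronskian hA (h₂ s) hs (Eventually.of_forall fun t => by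
      linear_combination (g s 0) * heq s t) t
    simp only [mul_zero, zero_mul, sub_zero] at this
    rw [show g₁ s 0 * g s 0 - g₁ s 0 * g s 0 = 0 by ring, zero_mul] at this
    exact (mul_eq_zero.1 this).resolve_right hs
  have hne : ∀ᶠ s in 𝓝 0, g s 0 ≠ 0 := (h₁ 0 0).continuousAt.eventually_ne h0
  have hB : ∀ s, HasDerivAt (fun s => Complex.exp (k * s * t) * g s 0)
      (Complex.exp (k * s * t) * (k * t) * g s 0 + Complex.exp (k * s * t) * g₁ s 0) s := by
    intro s
    have h3 : HasDerivAt (fun s : ℂ => k * s * t) (k * t) s := by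
      simpa using ((hasDerivAt_id s).const_mul k).mul_const t
    exact h3.cexp.mul (h₁ s 0)
  have := mul_eq_mul_of_wronskian (fun s => h₁ s t) hB (by simpa using h0) (by
    filter_upwards [hne] with s hs
    linear_combination Complex.exp (k * s * t) * hR s hs t) s
  simp only [mul_zero, zero_mul, Complex.exp_zero, one_mul] at this
  rw [this]
  ring

end OneVariable

/-! ### First and second derivatives of theta functions in the variable `z`. -/

section Partials

variable {g : ℕ}

/-- The derivative of `thetaC u s ω` along `v`. -/
def thetaP (u s : Fin g → ℝ) (ω : SymCoord g) (v z : Fin g → ℂ) : ℂ :=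
  thetaSeries u (derivCoeff u (0, v) (charCoeff u s)) (ω, z)

/-- The second derivative of `thetaC u s ω` along `v` and `w`. -/
def thetaPP (u s : Fin g → ℝ) (ω : SymCoord g) (v w z : Fin g → ℂ) : ℂ :=
  thetaSeries u (derivCoeff u (0, v) (derivCoeff u (0, w) (charCoeff u s))) (ω, z)

variable (u s : Fin g → ℝ) {ω : SymCoord g}

theorem hasDerivAt_thetaC (hω : ω ∈ siegelSpace g) (z v : Fin g → ℂ) (t : ℂ) :
    HasDerivAt (fun t : ℂ => thetaC u s ω (z + t • v)) (thetaP u s ω v (z + t • v)) t := by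
  have := hasDerivAt_thetaSeries_line u (polyGrowth_charCoeff u s) (ω, z) (0, v) (t := t)
    (by simpa using hω)
  simpa [thetaC, thetaP] using this

theorem hasDerivAt_thetaP (hω : ω ∈ siegelSpace g) (w z v : Fin g → ℂ) (t : ℂ) :
    HasDerivAt (fun t : ℂ => thetaP u s ω w (z + t • v)) (thetaPP u s ω v w (z + t • v)) t := by
  have := hasDerivAt_thetaSeries_line u ((polyGrowth_charCoeff u s).derivCoeff u (0, w))
    (ω, z) (0, v) (t := t) (by simpa using hω)
  simpa [thetaPP, thetaP] using this

theorem thetaPP_comm (v w z : Fin g → ℂ) : thetaPP u s ω v w z = thetaPP u s ω w v z := by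
  rw [thetaPP, thetaPP]
  congr 1
  funext m
  simp only [derivCoeff]
  ring

theorem thetaP_eq_thetaDeriv (hω : ω ∈ siegelSpace g) (v z : Fin g → ℂ) :
    thetaP u s ω v z = thetaDeriv u (charCoeff u s) (ω, z) (0, v) :=
  (thetaDeriv_apply u (polyGrowth_charCoeff u s) hω _).symm

theorem thetaPP_eq_thetaDeriv (hω : ω ∈ siegelSpace g) (v w z : Fin g → ℂ) :
    thetaPP u s ω v w z =
      thetaDeriv u (derivCoeff u (0, w) (charCoeff u s)) (ω, z) (0, v) :=
  (thetaDeriv_apply u ((polyGrowth_charCoeff u s).derivCoeff u _) hω _).symm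

theorem thetaP_lin (hω : ω ∈ siegelSpace g) (a b : ℂ) (v w z : Fin g → ℂ) :
    thetaP u s ω (a • v + b • w) z = a * thetaP u s ω v z + b * thetaP u s ω w z := by
  simp only [thetaP_eq_thetaDeriv u s hω]
  rw [← smul_eq_mul, ← smul_eq_mul, ← map_smul, ← map_smul, ← map_add]
  simp

theorem thetaPP_lin (hω : ω ∈ siegelSpace g) (a b : ℂ) (v w x z : Fin g → ℂ) :
    thetaPP u s ω (a • v + b • w) x z = a * thetaPP u s ω v x z + b * thetaPP u s ω w x z := by
  simp only [thetaPP_eq_thetaDeriv u s hω]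
  rw [← smul_eq_mul, ← smul_eq_mul, ← map_smul, ← map_smul, ← map_add]
  simp

/-- The second derivative of `log θ`, multiplied by `θ²`. -/
def thetaLogHess (u s : Fin g → ℝ) (ω : SymCoord g) (v w z : Fin g → ℂ) : ℂ :=
  thetaC u s ω z * thetaPP u s ω v w z - thetaP u s ω v z * thetaP u s ω w z

theorem thetaLogHess_comm (v w z : Fin g → ℂ) :
    thetaLogHess u s ω v w z = thetaLogHess u s ω w v z := by
  rw [thetaLogHess, thetaLogHess, thetaPP_comm]
  ring

theorem thetaLogHess_lin (hω : ω ∈ siegelSpace g) (a b : ℂ) (v w x z : Fin g → ℂ) :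
    thetaLogHess u s ω (a • v + b • w) x z =
      a * thetaLogHess u s ω v x z + b * thetaLogHess u s ω w x z := by
  rw [thetaLogHess, thetaLogHess, thetaLogHess, thetaPP_lin u s hω, thetaP_lin u s hω]
  ring

/-- The hypothesis says `∂_v ∂_w log θ = k`. Integrated over the plane spanned by `v` and `w`
through `x`, it makes `θ` a product of functions of `a` and of `b`, up to `exp (k a b)`. -/
theorem thetaC_mul_eq_of_logHess (hω : ω ∈ siegelSpace g) {v w : Fin g → ℂ} {k : ℂ}
    (h : ∀ z, thetaLogHess u s ω v w z = k * thetaC u s ω z ^ 2) {x : Fin g → ℂ}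
    (hx : thetaC u s ω x ≠ 0) (a b : ℂ) :
    thetaC u s ω (x + a • v + b • w) * thetaC u s ω x =
      Complex.exp (k * a * b) * (thetaC u s ω (x + a • v) * thetaC u s ω (x + b • w)) := by
  have := eq_mul_of_mixed_log_deriv (g := fun a b => thetaC u s ω (x + a • v + b • w))
    (g₁ := fun a b => thetaP u s ω v (x + a • v + b • w))
    (g₂ := fun a b => thetaP u s ω w (x + a • v + b • w))
    (g₁₂ := fun a b => thetaPP u s ω w v (x + a • v + b • w)) (k := k)
    (fun a b => by
      have := hasDerivAt_thetaC u s hω (x + b • w) v a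
      simpa only [add_right_comm] using this)
    (fun a b => hasDerivAt_thetaC u s hω (x + a • v) w b)
    (fun a b => hasDerivAt_thetaP u s hω v (x + a • v) w b)
    (fun a b => by
      rw [← h, thetaLogHess, thetaPP_comm])
    (by simpa using hx) a b
  simpa using this

end Partials

/-! ### The addition formula, and relations caused by a zero of order two. -/

section Addition

variable {g : ℕ}

/-- Half of a vector of binary digits. -/
def halfVec (σ : Fin g → Fin 2) : Fin g → ℝ := fun j => ((σ j : ℕ) : ℝ) / 2

/-- The bijection `(σ, r, t) ↦ (r + t + σ, r - t)`. -/
def parityEquiv (g : ℕ) : (Fin g → Fin 2) × (Fin g → ℤ) × (Fin g → ℤ) ≃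
    (Fin g → ℤ) × (Fin g → ℤ) :=
  Equiv.ofBijective (fun x => (fun j => x.2.1 j + x.2.2 j + ((x.1 j : ℕ) : ℤ),
    fun j => x.2.1 j - x.2.2 j)) (by
  constructor
  · rintro ⟨σ, r, t⟩ ⟨σ', r', t'⟩ h
    simp only [Prod.mk.injEq] at h
    have h1 := fun j => congrFun h.1 j
    have h2 := fun j => congrFun h.2 j
    have h3 : ∀ j, σ j = σ' j ∧ r j = r' j ∧ t j = t' j := by
      intro j
      have := h1 j
      have := h2 j
      have := (σ j).isLt
      have := (σ' j).isLt
      refine ⟨Fin.ext ?_, ?_, ?_⟩ <;> omega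
    simp only [Prod.mk.injEq]
    exact ⟨funext fun j => (h3 j).1, funext fun j => (h3 j).2.1, funext fun j => (h3 j).2.2⟩
  · rintro ⟨m, n⟩
    refine ⟨(fun j => ⟨((m j - n j) % 2).toNat, by omega⟩, fun j => n j + (m j - n j) / 2,
      fun j => (m j - n j) / 2), ?_⟩
    simp only [Prod.mk.injEq]
    refine ⟨funext fun j => ?_, funext fun j => ?_⟩ <;> omega)

theorem add_self_mem_siegelSpace {ω : SymCoord g} (hω : ω ∈ siegelSpace g) :
    ω + ω ∈ siegelSpace g := by
  rw [mem_siegelSpace_iff] at *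
  intro v hv
  have h1 := imForm_add_smul ω ω 1 1 v
  rw [one_smul] at h1
  rw [h1]
  linarith [hω v hv]

/-- With `P = r + u + σ/2` and `Q = t + σ/2`, the pair of lattice points in the double sum is `P +
Q` and `P - Q`. By the parallelogram identity the quadratic form splits into twice its values at `P`
and `Q`, so the sums over `r` and `t` separate and the period matrix is doubled. -/
theorem thetaC_mul_thetaC (u s : Fin g → ℝ) {ω : SymCoord g} (hω : ω ∈ siegelSpace g)
    (x y : Fin g → ℂ) :
    thetaC u s ω (x + y) * thetaC u s ω (x - y) = ∑ σ : Fin g → Fin 2,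
      thetaC (u + halfVec σ) (s + s) (ω + ω) (x + x) *
        thetaC (halfVec σ) 0 (ω + ω) (y + y) := by
  have hω2 := add_self_mem_siegelSpace hω
  have hS : ∀ (u s : Fin g → ℝ) {ω : SymCoord g} (z : Fin g → ℂ), ω ∈ siegelSpace g →
      Summable fun m => ‖charCoeff u s m * Complex.exp (thetaExp (latticeShift u m) (ω, z))‖ :=
    fun u s ω z h => summable_norm_thetaSeries u (polyGrowth_charCoeff u s) (x := (ω, z)) h
  have hterm : ∀ (σ : Fin g → Fin 2) (r t : Fin g → ℤ),
      charCoeff u s (parityEquiv g (σ, r, t)).1 *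
        Complex.exp (thetaExp (latticeShift u (parityEquiv g (σ, r, t)).1) (ω, x + y)) *
      (charCoeff u s (parityEquiv g (σ, r, t)).2 *
        Complex.exp (thetaExp (latticeShift u (parityEquiv g (σ, r, t)).2) (ω, x - y))) =
      charCoeff (u + halfVec σ) (s + s) r *
        Complex.exp (thetaExp (latticeShift (u + halfVec σ) r) (ω + ω, x + x)) *
      (charCoeff (halfVec σ) 0 t *
        Complex.exp (thetaExp (latticeShift (halfVec σ) t) (ω + ω, y + y))) := by
    intro σ r t
    have hpe : parityEquiv g (σ, r, t) = (fun j => r j + t j + ((σ j : ℕ) : ℤ),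
      fun j => r j - t j) := rfl
    have e1 : toComplexVec (latticeShift u (parityEquiv g (σ, r, t)).1) =
        toComplexVec (latticeShift (u + halfVec σ) r) +
          toComplexVec (latticeShift (halfVec σ) t) := by
      ext j
      rw [hpe]
      simp [toComplexVec, latticeShift, halfVec]
      ring
    have e2 : toComplexVec (latticeShift u (parityEquiv g (σ, r, t)).2) =
        toComplexVec (latticeShift (u + halfVec σ) r) -
          toComplexVec (latticeShift (halfVec σ) t) := by
      ext j
      rw [hpe]
      simp [toComplexVec, latticeShift, halfVec]
      ring
    have e3 : (ω + ω).toMatrix = ω.toMatrix + ω.toMatrix := rfl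
    have e4 : toComplexVec (s + s) = toComplexVec s + toComplexVec s := by
      ext j; simp [toComplexVec]
    have e5 : toComplexVec (0 : Fin g → ℝ) = 0 := by
      ext j; simp [toComplexVec]
    simp only [charCoeff, thetaExp_eq_dotProduct, ← Complex.exp_add, e1, e2, e3, e4, e5]
    congr 1
    generalize toComplexVec (latticeShift (u + halfVec σ) r) = P
    generalize toComplexVec (latticeShift (halfVec σ) t) = Q
    simp only [add_dotProduct, dotProduct_add, sub_dotProduct, dotProduct_sub, Matrix.mulVec_add,
      Matrix.mulVec_sub, Matrix.add_mulVec, dotProduct_zero]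
    ring
  rw [thetaC, thetaC, thetaSeries, thetaSeries,
    tsum_mul_tsum_of_summable_norm (hS u s (x + y) hω) (hS u s (x - y) hω),
    ← (parityEquiv g).tsum_eq]
  have hsum := ((parityEquiv g).summable_iff.2
    (summable_mul_of_summable_norm (hS u s (x + y) hω) (hS u s (x - y) hω)))
  refine (hsum.tsum_prod).trans ?_
  rw [tsum_fintype]
  refine Finset.sum_congr rfl fun σ _ => ?_
  rw [thetaC, thetaC, thetaSeries, thetaSeries,
    tsum_mul_tsum_of_summable_norm (hS _ _ (x + x) hω2) (hS _ _ (y + y) hω2)]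
  exact tsum_congr fun rt => hterm σ rt.1 rt.2

/-- Apply `∂_v ∂_w` in the variable `y` at `y = 0` to both sides of the addition formula. On the
product `θ (x + y) θ (x - y)` this produces twice the logarithmic Hessian. -/
theorem logHess_eq_sum (u s : Fin g → ℝ) {ω : SymCoord g} (hω : ω ∈ siegelSpace g)
    (v w x : Fin g → ℂ) :
    2 * thetaLogHess u s ω v w x = ∑ σ : Fin g → Fin 2,
      thetaC (u + halfVec σ) (s + s) (ω + ω) (x + x) *
        thetaPP (halfVec σ) 0 (ω + ω) (v + v) (w + w) 0 := by
  have hω2 := add_self_mem_siegelSpace hω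
  have h1 : ∀ a : ℂ, thetaP u s ω w (x + a • v) * thetaC u s ω (x + a • (-v)) -
      thetaC u s ω (x + a • v) * thetaP u s ω w (x + a • (-v)) = ∑ σ : Fin g → Fin 2,
      thetaC (u + halfVec σ) (s + s) (ω + ω) (x + x) *
        thetaP (halfVec σ) 0 (ω + ω) (w + w) (0 + a • (v + v)) := by
    intro a
    have hL : HasDerivAt (fun b : ℂ => thetaC u s ω (x + (a • v + b • w)) *
        thetaC u s ω (x - (a • v + b • w)))
        (thetaP u s ω w (x + a • v) * thetaC u s ω (x + a • (-v)) -
          thetaC u s ω (x + a • v) * thetaP u s ω w (x + a • (-v))) 0 := by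
      have e1 := hasDerivAt_thetaC u s hω (x + a • v) w 0
      have e2 := hasDerivAt_thetaC u s hω (x + a • (-v)) (-w) 0
      have e3 : thetaP u s ω (-w) (x + a • (-v)) = -thetaP u s ω w (x + a • (-v)) := by
        have := thetaP_lin u s hω (-1) 0 w 0 (x + a • (-v))
        simpa using this
      have e4 := e1.fun_mul e2
      simp only [zero_smul, add_zero, e3] at e4
      refine (e4.congr_of_eventuallyEq (Filter.Eventually.of_forall fun b => ?_)).congr_deriv ?_
      · dsimp only
        congr 2
        · module
        · module
      · ring
    have hR : HasDerivAt (fun b : ℂ => ∑ σ : Fin g → Fin 2,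
        thetaC (u + halfVec σ) (s + s) (ω + ω) (x + x) *
        thetaC (halfVec σ) 0 (ω + ω) ((a • v + b • w) + (a • v + b • w)))
        (∑ σ : Fin g → Fin 2, thetaC (u + halfVec σ) (s + s) (ω + ω) (x + x) *
        thetaP (halfVec σ) 0 (ω + ω) (w + w) (0 + a • (v + v))) 0 := by
      refine HasDerivAt.fun_sum fun σ _ => HasDerivAt.const_mul _ ?_
      have e1 := hasDerivAt_thetaC (halfVec σ) 0 hω2 (0 + a • (v + v)) (w + w) 0
      rw [zero_smul, add_zero] at e1
      refine e1.congr_of_eventuallyEq (Filter.Eventually.of_forall fun b => ?_)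
      dsimp only
      congr 1
      module
    refine hL.unique (hR.congr_of_eventuallyEq (Filter.Eventually.of_forall fun b => ?_))
    exact thetaC_mul_thetaC u s hω x _
  have hL : HasDerivAt (fun a : ℂ => thetaP u s ω w (x + a • v) * thetaC u s ω (x + a • (-v)) -
      thetaC u s ω (x + a • v) * thetaP u s ω w (x + a • (-v)))
      (2 * thetaLogHess u s ω v w x) 0 := by
    have e1 := hasDerivAt_thetaC u s hω x v 0
    have e2 := hasDerivAt_thetaC u s hω x (-v) 0
    have e3 := hasDerivAt_thetaP u s hω w x v 0
    have e4 := hasDerivAt_thetaP u s hω w x (-v) 0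
    have e5 : thetaP u s ω (-v) x = -thetaP u s ω v x := by
      have := thetaP_lin u s hω (-1) 0 v 0 x
      simpa using this
    have e6 : thetaPP u s ω (-v) w x = -thetaPP u s ω v w x := by
      have := thetaPP_lin u s hω (-1) 0 v 0 w x
      simpa using this
    have e7 := (e3.fun_mul e2).fun_sub (e1.fun_mul e4)
    simp only [zero_smul, add_zero, e5, e6] at e7
    refine e7.congr_deriv ?_
    rw [thetaLogHess]
    ring
  have hR : HasDerivAt (fun a : ℂ => ∑ σ : Fin g → Fin 2,
      thetaC (u + halfVec σ) (s + s) (ω + ω) (x + x) *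
        thetaP (halfVec σ) 0 (ω + ω) (w + w) (0 + a • (v + v)))
      (∑ σ : Fin g → Fin 2, thetaC (u + halfVec σ) (s + s) (ω + ω) (x + x) *
        thetaPP (halfVec σ) 0 (ω + ω) (v + v) (w + w) 0) 0 := by
    refine HasDerivAt.fun_sum fun σ _ => HasDerivAt.const_mul _ ?_
    have e1 := hasDerivAt_thetaP (halfVec σ) 0 hω2 (w + w) 0 (v + v) 0
    rwa [zero_smul, add_zero] at e1
  exact hL.unique (hR.congr_of_eventuallyEq (Filter.Eventually.of_forall h1))

/-- Restrict to the line through a point `y` with `θ y ≠ 0`. If the product vanished everywhere, `θ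
(-t y)` would vanish for `t` near `1`, hence for all `t`, in particular for `t = -1`. -/
theorem exists_thetaC_mul_neg_ne_zero (u s : Fin g → ℝ) {ω : SymCoord g}
    (hω : ω ∈ siegelSpace g) : ∃ y, thetaC u s ω y * thetaC u s ω (-y) ≠ 0 := by
  by_contra! h
  obtain ⟨y, hy⟩ := Function.ne_iff.1 (thetaC_ne_zero u s hω)
  have hd : ∀ v, Differentiable ℂ fun t : ℂ => thetaC u s ω (0 + t • v) := fun v t =>
    (hasDerivAt_thetaC u s hω 0 v t).differentiableAt
  have h1 : ∀ᶠ t : ℂ in nhds 1, thetaC u s ω (0 + t • y) ≠ 0 :=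
    (hd y).continuous.continuousAt.eventually_ne (by simpa using hy)
  have h2 := eq_zero_of_eventually_eq_zero (hd (-y)) (t₀ := 1) (by
    filter_upwards [h1] with t ht
    have := h (t • y)
    rw [zero_add] at ht ⊢
    rw [smul_neg]
    exact (mul_eq_zero.1 this).resolve_left ht) (-1)
  simp only [zero_add, smul_neg, neg_smul, neg_neg, one_smul] at h2
  exact hy h2

/-- If a theta function vanishes to second order at the origin, then its logarithm satisfies a
second order differential equation with constant coefficients, provided that enough second
derivatives are available. -/
theorem exists_logHess_relation (u s : Fin g → ℝ) {ω : SymCoord g} (hω : ω ∈ siegelSpace g)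
    {ι : Type} [Fintype ι] (hι : Fintype.card ι + 1 = 2 ^ g) (v w : ι → Fin g → ℂ)
    (h0 : thetaC u s ω 0 = 0) (h1 : ∀ x, thetaP u s ω x 0 = 0) :
    ∃ (c₀ : ℂ) (c : ι → ℂ), c ≠ 0 ∧
      ∀ x, c₀ * thetaC u s ω x ^ 2 + ∑ i, c i * thetaLogHess u s ω (v i) (w i) x = 0 := by
  set Φ : (Fin g → ℂ) → (Fin g → Fin 2) → ℂ := fun x σ =>
    thetaC (u + halfVec σ) (s + s) (ω + ω) (x + x) with hΦ
  set vec : Option ι → (Fin g → Fin 2) → ℂ := fun o => o.elim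
    (fun σ => thetaC (halfVec σ) 0 (ω + ω) 0)
    (fun i σ => thetaPP (halfVec σ) 0 (ω + ω) (v i + v i) (w i + w i) 0) with hvec
  have hnone : ∀ x, Φ x ⬝ᵥ vec none = thetaC u s ω x ^ 2 := by
    intro x
    have := thetaC_mul_thetaC u s hω x 0
    rw [add_zero, sub_zero, add_zero] at this
    rw [sq, this]
    rfl
  have hsome : ∀ x i, Φ x ⬝ᵥ vec (some i) = 2 * thetaLogHess u s ω (v i) (w i) x := by
    intro x i
    rw [logHess_eq_sum u s hω]
    rfl
  have hΦ0 : Φ 0 ≠ 0 := by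
    intro h
    obtain ⟨y, hy⟩ := exists_thetaC_mul_neg_ne_zero u s hω
    have := thetaC_mul_thetaC u s hω 0 y
    rw [zero_add, zero_sub] at this
    rw [this] at hy
    refine hy (Finset.sum_eq_zero fun σ _ => ?_)
    have := congrFun h σ
    simp only [hΦ, Pi.zero_apply] at this
    rw [this, zero_mul]
  have hzero : ∀ o, Φ 0 ⬝ᵥ vec o = 0 := by
    rintro (_ | i)
    · rw [hnone, h0]; simp
    · rw [hsome, thetaLogHess, h0, h1]; simp
  -- There are `2 ^ g` vectors in a space of that dimension, and all are annihilated by the nonzero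
  -- functional `Φ 0`. So they cannot be a basis.
  have hdep : ¬ LinearIndependent ℂ vec := by
    intro hli
    have hspan := hli.span_eq_top_of_card_eq_finrank (by simp [hι])
    let φ : ((Fin g → Fin 2) → ℂ) →ₗ[ℂ] ℂ := dotProductBilin ℂ ℂ (Φ 0)
    have hφ : φ = 0 := by
      refine LinearMap.ext_on hspan ?_
      rintro _ ⟨o, rfl⟩
      exact hzero o
    refine hΦ0 (funext fun σ => ?_)
    have := LinearMap.congr_fun hφ (Pi.single σ 1)
    simpa [φ] using this
  obtain ⟨c, hc, o, ho⟩ := Fintype.not_linearIndependent_iff.1 hdep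
  have hrel : ∀ x, c none * thetaC u s ω x ^ 2 +
      ∑ i, (2 * c (some i)) * thetaLogHess u s ω (v i) (w i) x = 0 := by
    intro x
    have := congrArg (fun y => Φ x ⬝ᵥ y) hc
    simp only [Fintype.sum_option, dotProduct_add, dotProduct_sum, dotProduct_smul, dotProduct_zero,
      hnone, hsome, smul_eq_mul] at this
    rw [← this]
    congr 1
    exact Finset.sum_congr rfl fun i _ => by ring
  -- The relation must involve some second derivative: otherwise it would read `θ² = 0`.
  refine ⟨c none, fun i => 2 * c (some i), fun h => ?_, hrel⟩
  have hc' : ∀ i, c (some i) = 0 := fun i => by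
    have := congrFun h i
    simpa using this
  have hcn : c none ≠ 0 := by
    rcases o with _ | i
    · exact ho
    · exact absurd (hc' i) ho
  refine thetaC_ne_zero u s hω (funext fun x => ?_)
  have := hrel x
  simp only [hc', mul_zero, zero_mul, Finset.sum_const_zero, add_zero] at this
  simpa [hcn] using this

/-- In one variable a single second derivative and `θ²` already give `2 ^ 1` vectors, so `(log θ)''`
is constant. The product formula at `a = -x`, `b = x` then equates `θ(x)²` with a multiple of `θ(0)
= 0`. -/
theorem thetaC_one_not_order_two (u s : Fin 1 → ℝ) {ω : SymCoord 1} (hω : ω ∈ siegelSpace 1)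
    (h0 : thetaC u s ω 0 = 0) (h1 : ∀ x, thetaP u s ω x 0 = 0) : False := by
  set e : Fin 1 → ℂ := fun _ => 1
  obtain ⟨c₀, c, hc, h⟩ := exists_logHess_relation u s hω (ι := Unit) (by simp) (fun _ => e)
    (fun _ => e) h0 h1
  have hc1 : c () ≠ 0 := fun h => hc (funext fun _ => h)
  have hk : ∀ z, thetaLogHess u s ω e e z = (-c₀ / c ()) * thetaC u s ω z ^ 2 := by
    intro z
    have := h z
    simp only [Finset.univ_unique, Finset.sum_singleton] at this
    field_simp
    linear_combination this
  obtain ⟨x, hx⟩ := Function.ne_iff.1 (thetaC_ne_zero u s hω)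
  have hxe : x = x 0 • e := by ext j; fin_cases j; simp [e]
  have := thetaC_mul_eq_of_logHess u s hω hk hx (-x 0) (x 0)
  rw [neg_smul, ← hxe, add_neg_cancel, zero_add, h0, zero_mul, mul_zero] at this
  exact (mul_self_ne_zero.2 hx) this

/-- Over `ℂ` the form `a X² + c X Y + b Y²` is the product of `p X + q Y` and `r X + t Y`, by a
square root of the discriminant. This turns a second order operator into `∂_v ∂_w`. -/
theorem exists_factor_binary_form (a b c : ℂ) (h : a ≠ 0 ∨ b ≠ 0 ∨ c ≠ 0) :
    ∃ p q r t : ℂ, (p ≠ 0 ∨ q ≠ 0) ∧ (r ≠ 0 ∨ t ≠ 0) ∧ p * r = a ∧ q * t = b ∧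
      p * t + q * r = c := by
  by_cases ha : a = 0
  · refine ⟨0, 1, c, b, by simp, ?_, by simp [ha], by simp, by simp⟩
    tauto
  · obtain ⟨d, hd⟩ := IsSquare.exists_sq (a := c ^ 2 - 4 * a * b)
      ((IsAlgClosed.exists_pow_nat_eq (c ^ 2 - 4 * a * b) two_pos).imp fun d hd => by
        rw [← hd, sq])
    refine ⟨a, (c + d) / 2, 1, (c - d) / (2 * a), Or.inl ha, Or.inl one_ne_zero, by ring, ?_, ?_⟩
    · field_simp
      linear_combination hd
    · field_simp
      ring

/-- In two variables the three second derivatives together with `θ²` make up exactly `2 ^ 2`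
vectors. The resulting quadratic form in `∂₀` and `∂₁` is nonzero and factors into two directions.
-/
theorem exists_logHess_eq_of_order_two (u s : Fin 2 → ℝ) {ω : SymCoord 2}
    (hω : ω ∈ siegelSpace 2) (h0 : thetaC u s ω 0 = 0) (h1 : ∀ x, thetaP u s ω x 0 = 0) :
    ∃ (v w : Fin 2 → ℂ) (k : ℂ), v ≠ 0 ∧ w ≠ 0 ∧
      ∀ z, thetaLogHess u s ω v w z = k * thetaC u s ω z ^ 2 := by
  set e : Fin 2 → Fin 2 → ℂ := fun i => Pi.single i 1
  obtain ⟨c₀, c, hc, h⟩ := exists_logHess_relation u s hω (ι := Fin 3) (by simp)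
    ![e 0, e 1, e 0] ![e 0, e 1, e 1] h0 h1
  obtain ⟨p, q, r, t, hpq, hrt, h00, h11, h01⟩ := exists_factor_binary_form (c 0) (c 1) (c 2) (by
    by_contra! hcon
    exact hc (funext fun i => by fin_cases i <;> simp [hcon]))
  have hne : ∀ a b : ℂ, (a ≠ 0 ∨ b ≠ 0) → a • e 0 + b • e 1 ≠ 0 := by
    intro a b hab heq
    have e0 := congrFun heq 0
    have e1 := congrFun heq 1
    simp [e] at e0 e1
    tauto
  refine ⟨p • e 0 + q • e 1, r • e 0 + t • e 1, -c₀, hne p q hpq, hne r t hrt, fun z => ?_⟩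
  have := h z
  rw [Fin.sum_univ_three] at this
  change c₀ * _ + (c 0 * thetaLogHess u s ω (e 0) (e 0) z + c 1 * thetaLogHess u s ω (e 1) (e 1) z +
    c 2 * thetaLogHess u s ω (e 0) (e 1) z) = 0 at this
  rw [thetaLogHess_lin u s hω, thetaLogHess_comm u s (e 0), thetaLogHess_comm u s (e 1),
    thetaLogHess_lin u s hω, thetaLogHess_lin u s hω, thetaLogHess_comm u s (e 1) (e 0)]
  linear_combination this + h00 * thetaLogHess u s ω (e 0) (e 0) z +
    h11 * thetaLogHess u s ω (e 1) (e 1) z + h01 * thetaLogHess u s ω (e 0) (e 1) z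

end Addition

/-! ### Real lattice coordinates on `ℂ^g` and the polarization as an alternating form. -/

section Periods

open Matrix

variable {g : ℕ}

/-- The imaginary part of the matrix of `ω`. -/
def imMatrix (ω : SymCoord g) : Matrix (Fin g) (Fin g) ℝ := ω.toMatrix.map Complex.im

theorem imMatrix_transpose (ω : SymCoord g) : (imMatrix ω)ᵀ = imMatrix ω := by
  rw [imMatrix, ← transpose_map, ω.toMatrix_transpose]

theorem imMatrix_comm (ω : SymCoord g) (v w : Fin g → ℝ) :
    v ⬝ᵥ imMatrix ω *ᵥ w = w ⬝ᵥ imMatrix ω *ᵥ v := by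
  rw [dotProduct_mulVec, ← mulVec_transpose, imMatrix_transpose, dotProduct_comm]

theorem imMatrix_pos {ω : SymCoord g} (hω : ω ∈ siegelSpace g) {v : Fin g → ℝ} (hv : v ≠ 0) :
    0 < v ⬝ᵥ imMatrix ω *ᵥ v := by
  have := mem_siegelSpace_iff.1 hω v hv
  simpa [imForm, imMatrix, dotProduct, mulVec, SymCoord.toMatrix, Finset.mul_sum, mul_assoc]
    using this

/-- The vector with real lattice coordinates `(a, b)`. -/
def periodMap (ω : SymCoord g) : ((Fin g → ℝ) × (Fin g → ℝ)) →ₗ[ℝ] (Fin g → ℂ) where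
  toFun x := ω.toMatrix *ᵥ toComplexVec x.1 + toComplexVec x.2
  map_add' x y := by
    have h : ∀ v w : Fin g → ℝ, toComplexVec (v + w) = toComplexVec v + toComplexVec w := by
      intro v w; ext j; simp [toComplexVec]
    simp only [Prod.fst_add, Prod.snd_add, h, mulVec_add]
    abel
  map_smul' c x := by
    have h : ∀ v : Fin g → ℝ, toComplexVec (c • v) = c • toComplexVec v := by
      intro v; ext j; simp [toComplexVec]
    simp only [Prod.smul_fst, Prod.smul_snd, h, mulVec_smul, smul_add, RingHom.id_apply]

theorem periodMap_im (ω : SymCoord g) (x : (Fin g → ℝ) × (Fin g → ℝ)) (j : Fin g) :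
    (periodMap ω x j).im = (imMatrix ω *ᵥ x.1) j := by
  simp [periodMap, mulVec, dotProduct, imMatrix, toComplexVec, Complex.im_sum]

theorem periodMap_injective {ω : SymCoord g} (hω : ω ∈ siegelSpace g) :
    Function.Injective (periodMap ω) := by
  rw [injective_iff_map_eq_zero]
  rintro ⟨a, b⟩ h
  have ha : a = 0 := by
    by_contra ha
    have h1 := imMatrix_pos hω ha
    have h2 : imMatrix ω *ᵥ a = 0 := by
      ext j
      rw [← periodMap_im ω (a, b), h]
      simp
    rw [h2, dotProduct_zero] at h1
    exact lt_irrefl _ h1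
  subst ha
  have hb : b = 0 := by
    ext j
    have := congrFun h j
    simpa [periodMap, toComplexVec, mulVec, dotProduct] using this
  rw [hb]
  rfl

/-- The real lattice coordinates identify `ℝ^g × ℝ^g` with `ℂ^g`. -/
def periodEquiv {ω : SymCoord g} (hω : ω ∈ siegelSpace g) :
    ((Fin g → ℝ) × (Fin g → ℝ)) ≃ₗ[ℝ] (Fin g → ℂ) :=
  LinearEquiv.ofInjectiveOfFinrankEq (periodMap ω) (periodMap_injective hω) (by
    rw [Module.finrank_prod, Module.finrank_pi, Module.finrank_pi_fintype]
    simp [Complex.finrank_real_complex]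
    ring)

theorem periodEquiv_apply {ω : SymCoord g} (hω : ω ∈ siegelSpace g)
    (x : (Fin g → ℝ) × (Fin g → ℝ)) :
    periodEquiv hω x = ω.toMatrix *ᵥ toComplexVec x.1 + toComplexVec x.2 := rfl

/-- The real basis of `ℂ^g` formed by the periods. -/
def periodBasis {ω : SymCoord g} (hω : ω ∈ siegelSpace g) :
    Module.Basis (Fin g ⊕ Fin g) ℝ (Fin g → ℂ) :=
  ((Pi.basisFun ℝ (Fin g)).prod (Pi.basisFun ℝ (Fin g))).map (periodEquiv hω)

theorem toComplexVec_single (j : Fin g) : toComplexVec (Pi.single j 1) = Pi.single j 1 := by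
  ext i
  by_cases h : i = j
  · subst h; simp [toComplexVec]
  · simp [toComplexVec, h]

theorem toComplexVec_zero : toComplexVec (0 : Fin g → ℝ) = 0 := by
  ext i; simp [toComplexVec]

theorem basisFun_prod_inl (j : Fin g) :
    ((Pi.basisFun ℝ (Fin g)).prod (Pi.basisFun ℝ (Fin g))) (Sum.inl j) = (Pi.single j 1, 0) := by
  simp [Module.Basis.prod_apply]

theorem basisFun_prod_inr (j : Fin g) :
    ((Pi.basisFun ℝ (Fin g)).prod (Pi.basisFun ℝ (Fin g))) (Sum.inr j) = (0, Pi.single j 1) := by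
  simp [Module.Basis.prod_apply]

theorem periodBasis_inl {ω : SymCoord g} (hω : ω ∈ siegelSpace g) (j : Fin g) :
    periodBasis hω (Sum.inl j) = ω.toMatrix j := by
  rw [periodBasis, Module.Basis.map_apply, basisFun_prod_inl, periodEquiv_apply]
  simp only [toComplexVec_single, toComplexVec_zero, add_zero]
  ext k
  simp [SymCoord.toMatrix, Sym2.eq_swap]

theorem periodBasis_inr {ω : SymCoord g} (hω : ω ∈ siegelSpace g) (j : Fin g) :
    periodBasis hω (Sum.inr j) = Pi.single j 1 := by
  rw [periodBasis, Module.Basis.map_apply, basisFun_prod_inr, periodEquiv_apply]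
  simp [toComplexVec_single, toComplexVec_zero]

/-- The first half of the real lattice coordinates. -/
def latFst {ω : SymCoord g} (hω : ω ∈ siegelSpace g) : (Fin g → ℂ) →ₗ[ℝ] (Fin g → ℝ) :=
  LinearMap.fst ℝ _ _ ∘ₗ (periodEquiv hω).symm.toLinearMap

/-- The second half of the real lattice coordinates. -/
def latSnd {ω : SymCoord g} (hω : ω ∈ siegelSpace g) : (Fin g → ℂ) →ₗ[ℝ] (Fin g → ℝ) :=
  LinearMap.snd ℝ _ _ ∘ₗ (periodEquiv hω).symm.toLinearMap

theorem latFst_latSnd {ω : SymCoord g} (hω : ω ∈ siegelSpace g) (z : Fin g → ℂ) :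
    ω.toMatrix *ᵥ toComplexVec (latFst hω z) + toComplexVec (latSnd hω z) = z :=
  (periodEquiv hω).apply_symm_apply z

theorem latFst_apply {ω : SymCoord g} (hω : ω ∈ siegelSpace g) (a b : Fin g → ℝ) :
    latFst hω (ω.toMatrix *ᵥ toComplexVec a + toComplexVec b) = a :=
  congrArg Prod.fst ((periodEquiv hω).symm_apply_apply (a, b))

theorem latSnd_apply {ω : SymCoord g} (hω : ω ∈ siegelSpace g) (a b : Fin g → ℝ) :
    latSnd hω (ω.toMatrix *ᵥ toComplexVec a + toComplexVec b) = b :=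
  congrArg Prod.snd ((periodEquiv hω).symm_apply_apply (a, b))

theorem imMatrix_mulVec_latFst {ω : SymCoord g} (hω : ω ∈ siegelSpace g) (z : Fin g → ℂ)
    (j : Fin g) : (imMatrix ω *ᵥ latFst hω z) j = (z j).im := by
  rw [← periodMap_im ω (latFst hω z, latSnd hω z)]
  exact congrArg (fun w : Fin g → ℂ => (w j).im) (latFst_latSnd hω z)

/-- The principal polarization, as an alternating form. -/
def polForm {ω : SymCoord g} (hω : ω ∈ siegelSpace g) :
    (Fin g → ℂ) →ₗ[ℝ] (Fin g → ℂ) →ₗ[ℝ] ℝ :=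
  LinearMap.mk₂ ℝ (fun z w => latFst hω z ⬝ᵥ latSnd hω w - latSnd hω z ⬝ᵥ latFst hω w)
    (fun _ _ _ => by simp only [map_add, add_dotProduct]; ring)
    (fun _ _ _ => by simp only [map_smul, smul_dotProduct, smul_eq_mul]; ring)
    (fun _ _ _ => by simp only [map_add, dotProduct_add]; ring)
    (fun _ _ _ => by simp only [map_smul, dotProduct_smul, smul_eq_mul]; ring)

theorem polForm_apply {ω : SymCoord g} (hω : ω ∈ siegelSpace g) (z w : Fin g → ℂ) :
    polForm hω z w = latFst hω z ⬝ᵥ latSnd hω w - latSnd hω z ⬝ᵥ latFst hω w := rfl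

theorem polForm_self {ω : SymCoord g} (hω : ω ∈ siegelSpace g) (z : Fin g → ℂ) :
    polForm hω z z = 0 := by
  rw [polForm_apply, dotProduct_comm, sub_self]

theorem polForm_swap {ω : SymCoord g} (hω : ω ∈ siegelSpace g) (z w : Fin g → ℂ) :
    polForm hω z w = -polForm hω w z := by
  rw [polForm_apply, polForm_apply, dotProduct_comm (latFst hω z), dotProduct_comm (latSnd hω z)]
  ring

theorem toComplexVec_dotProduct (v w : Fin g → ℝ) :
    toComplexVec v ⬝ᵥ toComplexVec w = ((v ⬝ᵥ w : ℝ) : ℂ) := by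
  simp [dotProduct, toComplexVec]

/-- By the symmetry of `ω` the terms quadratic in the first lattice coordinates cancel. In this
shape the polarization can be compared with the exponents in the quasi-periodicity of theta
functions. -/
theorem ofReal_polForm {ω : SymCoord g} (hω : ω ∈ siegelSpace g) (z w : Fin g → ℂ) :
    (polForm hω z w : ℂ) =
      toComplexVec (latFst hω z) ⬝ᵥ w - toComplexVec (latFst hω w) ⬝ᵥ z := by
  conv_rhs =>
    arg 1; arg 2; rw [← latFst_latSnd hω w]
  conv_rhs =>
    arg 2; arg 2; rw [← latFst_latSnd hω z]
  rw [polForm_apply, dotProduct_add, dotProduct_add, toComplexVec_dotProduct,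
    toComplexVec_dotProduct, ω.dotProduct_mulVec_comm, dotProduct_comm (latFst hω w)]
  push_cast
  ring

theorem polForm_eq_re {ω : SymCoord g} (hω : ω ∈ siegelSpace g) (z w : Fin g → ℂ) :
    polForm hω z w = latFst hω z ⬝ᵥ (fun j => (w j).re) - latFst hω w ⬝ᵥ (fun j => (z j).re) := by
  have := congrArg Complex.re (ofReal_polForm hω z w)
  rw [Complex.ofReal_re] at this
  rw [this]
  simp [dotProduct, toComplexVec, Complex.re_sum]

theorem latFst_dotProduct_im {ω : SymCoord g} (hω : ω ∈ siegelSpace g) (z w : Fin g → ℂ) :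
    latFst hω z ⬝ᵥ (fun j => (w j).im) = latFst hω w ⬝ᵥ (fun j => (z j).im) := by
  have h : ∀ z : Fin g → ℂ, (fun j => (z j).im) = imMatrix ω *ᵥ latFst hω z :=
    fun z => funext fun j => (imMatrix_mulVec_latFst hω z j).symm
  rw [h, h, imMatrix_comm]

theorem polForm_I_smul_left {ω : SymCoord g} (hω : ω ∈ siegelSpace g) (z w : Fin g → ℂ) :
    polForm hω (Complex.I • z) w = latFst hω (Complex.I • z) ⬝ᵥ (fun j => (w j).re) +
      latFst hω w ⬝ᵥ (fun j => (z j).im) := by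
  rw [polForm_eq_re]
  have : (fun j => ((Complex.I • z) j).re) = -fun j => (z j).im := by ext j; simp
  rw [this, dotProduct_neg, sub_neg_eq_add]

theorem polForm_I_smul {ω : SymCoord g} (hω : ω ∈ siegelSpace g) (z w : Fin g → ℂ) :
    polForm hω (Complex.I • z) (Complex.I • w) = polForm hω z w := by
  have h1 : ∀ w : Fin g → ℂ, (fun j => ((Complex.I • w) j).re) = -fun j => (w j).im :=
    fun w => by ext j; simp
  have h2 : ∀ w : Fin g → ℂ, (fun j => ((Complex.I • w) j).im) = fun j => (w j).re :=
    fun w => by ext j; simp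
  have h3 := latFst_dotProduct_im hω (Complex.I • z) w
  have h4 := latFst_dotProduct_im hω z (Complex.I • w)
  rw [h2] at h3 h4
  rw [polForm_eq_re, polForm_eq_re, h1, h1, dotProduct_neg, dotProduct_neg, h3, ← h4]
  ring

/-- The imaginary part of `ω` maps the first lattice coordinates of `I • z` and of `z` to the real
and imaginary parts of `z`. So the value is the sum of two values of a positive definite form, not
both zero. -/
theorem polForm_pos {ω : SymCoord g} (hω : ω ∈ siegelSpace g) {z : Fin g → ℂ} (hz : z ≠ 0) :
    0 < polForm hω (Complex.I • z) z := by
  have hre : (fun j => (z j).re) = imMatrix ω *ᵥ latFst hω (Complex.I • z) :=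
    funext fun j => by rw [imMatrix_mulVec_latFst]; simp
  have him : (fun j => (z j).im) = imMatrix ω *ᵥ latFst hω z :=
    funext fun j => by rw [imMatrix_mulVec_latFst]
  have hnn : ∀ v : Fin g → ℝ, 0 ≤ v ⬝ᵥ imMatrix ω *ᵥ v := by
    intro v
    rcases eq_or_ne v 0 with rfl | hv
    · simp
    · exact (imMatrix_pos hω hv).le
  rw [polForm_I_smul_left, hre, him]
  by_cases h : latFst hω z = 0
  · refine add_pos_of_pos_of_nonneg (imMatrix_pos hω fun h' => hz ?_) (hnn _)
    rw [h, mulVec_zero] at him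
    rw [h', mulVec_zero] at hre
    ext j
    exact Complex.ext (congrFun hre j) (congrFun him j)
  · exact add_pos_of_nonneg_of_pos (hnn _) (imMatrix_pos hω h)

theorem polForm_periodBasis {ω : SymCoord g} (hω : ω ∈ siegelSpace g) :
    (Matrix.of fun s t => polForm hω (periodBasis hω s) (periodBasis hω t)) =
      Matrix.fromBlocks 0 1 (-1) 0 := by
  have hl : ∀ j, latFst hω (periodBasis hω (Sum.inl j)) = Pi.single j 1 ∧
      latSnd hω (periodBasis hω (Sum.inl j)) = 0 := by
    intro j
    have : periodBasis hω (Sum.inl j) =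
        ω.toMatrix *ᵥ toComplexVec (Pi.single j 1) + toComplexVec 0 := by
      rw [periodBasis, Module.Basis.map_apply, basisFun_prod_inl, periodEquiv_apply]
    rw [this, latFst_apply, latSnd_apply]
    exact ⟨rfl, rfl⟩
  have hr : ∀ j, latFst hω (periodBasis hω (Sum.inr j)) = 0 ∧
      latSnd hω (periodBasis hω (Sum.inr j)) = Pi.single j 1 := by
    intro j
    have : periodBasis hω (Sum.inr j) =
        ω.toMatrix *ᵥ toComplexVec 0 + toComplexVec (Pi.single j 1) := by
      rw [periodBasis, Module.Basis.map_apply, basisFun_prod_inr, periodEquiv_apply]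
    rw [this, latFst_apply, latSnd_apply]
    exact ⟨rfl, rfl⟩
  ext (i | i) (j | j) <;>
    simp [polForm_apply, hl, hr, Matrix.one_apply, Pi.single_apply, eq_comm]

theorem polForm_smul_smul {ω : SymCoord g} (hω : ω ∈ siegelSpace g) (α β : ℂ) (z : Fin g → ℂ) :
    polForm hω (α • z) (β • z) =
      (α.im * β.re - α.re * β.im) * polForm hω (Complex.I • z) z := by
  have h : ∀ γ : ℂ, γ • z = γ.re • z + γ.im • (Complex.I • z) := by
    intro γ
    ext j
    simp only [Pi.smul_apply, Pi.add_apply, smul_eq_mul, Complex.real_smul]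
    conv_lhs => rw [← Complex.re_add_im γ]
    ring
  rw [h α, h β]
  simp only [map_add, map_smul, LinearMap.add_apply, LinearMap.smul_apply, smul_eq_mul,
    polForm_self, polForm_swap hω z (Complex.I • z)]
  ring

end Periods

/-! ### Endomorphisms of the torus as integral matrices acting on the lattice of periods. -/

section LatticeEndomorphisms

open Matrix

variable {g : ℕ}

/-- The complex matrix with given integral entries. -/
def intMatrix {m n : Type*} (P : Matrix m n ℤ) : Matrix m n ℂ := P.map (Int.castRingHom ℂ)

@[simp] theorem intMatrix_apply {m n : Type*} (P : Matrix m n ℤ) (i : m) (j : n) :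
    intMatrix P i j = (P i j : ℂ) := rfl

theorem intMatrix_mul {l m n : Type*} [Fintype m] (P : Matrix l m ℤ) (Q : Matrix m n ℤ) :
    intMatrix (P * Q) = intMatrix P * intMatrix Q := Matrix.map_mul

theorem intMatrix_one {m : Type*} [DecidableEq m] : intMatrix (1 : Matrix m m ℤ) = 1 :=
  Matrix.map_one _ (map_zero _) (map_one _)

theorem intMatrix_sub {m n : Type*} (P Q : Matrix m n ℤ) :
    intMatrix (P - Q) = intMatrix P - intMatrix Q := by ext i j; simp

theorem intMatrix_transpose {m n : Type*} (P : Matrix m n ℤ) : intMatrix Pᵀ = (intMatrix P)ᵀ :=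
  transpose_map

theorem trace_intMatrix {m : Type*} [Fintype m] (P : Matrix m m ℤ) :
    (intMatrix P).trace = (P.trace : ℂ) := by simp [trace]

/-- The `2g × g` matrix of periods. -/
def periodMatrix (ω : SymCoord g) : Matrix (Fin g ⊕ Fin g) (Fin g) ℂ := fromRows ω.toMatrix 1

theorem periodMatrix_apply {ω : SymCoord g} (hω : ω ∈ siegelSpace g) (s : Fin g ⊕ Fin g) :
    periodMatrix ω s = periodBasis hω s := by
  rcases s with j | j
  · rw [periodBasis_inl]; rfl
  · rw [periodBasis_inr]
    ext k
    simp [periodMatrix, Matrix.one_apply, Pi.single_apply, eq_comm]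

theorem vecMul_periodMatrix {ω : SymCoord g} (hω : ω ∈ siegelSpace g) (x : Fin g ⊕ Fin g → ℝ) :
    (fun s => (x s : ℂ)) ᵥ* periodMatrix ω = ∑ s, x s • periodBasis hω s := by
  ext k
  simp [vecMul, dotProduct, ← periodMatrix_apply]

theorem vecMul_intMatrix_periodMatrix {ω : SymCoord g} (hω : ω ∈ siegelSpace g)
    (P : Matrix (Fin g ⊕ Fin g) (Fin g ⊕ Fin g) ℤ) (s : Fin g ⊕ Fin g) :
    (intMatrix P * periodMatrix ω) s = ∑ t, (P s t : ℝ) • periodBasis hω t := by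
  rw [← vecMul_periodMatrix]
  rfl

theorem eq_zero_of_intMatrix_mul_periodMatrix {ω : SymCoord g} (hω : ω ∈ siegelSpace g)
    {P : Matrix (Fin g ⊕ Fin g) (Fin g ⊕ Fin g) ℤ} (h : intMatrix P * periodMatrix ω = 0) :
    P = 0 := by
  ext s t
  have h1 := vecMul_intMatrix_periodMatrix hω P s
  rw [h] at h1
  have := Fintype.linearIndependent_iff.1 (periodBasis hω).linearIndependent _ h1.symm t
  simpa using this

theorem intMatrix_mul_periodMatrix_injective {ω : SymCoord g} (hω : ω ∈ siegelSpace g)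
    {P Q : Matrix (Fin g ⊕ Fin g) (Fin g ⊕ Fin g) ℤ}
    (h : intMatrix P * periodMatrix ω = intMatrix Q * periodMatrix ω) : P = Q :=
  sub_eq_zero.1 (eq_zero_of_intMatrix_mul_periodMatrix hω (by
    rw [intMatrix_sub, Matrix.sub_mul, h, sub_self]))

/-- The lower block of `P * periodMatrix ω`. -/
def lowerPeriods (P : Matrix (Fin g ⊕ Fin g) (Fin g ⊕ Fin g) ℤ) (ω : SymCoord g) :
    Matrix (Fin g) (Fin g) ℂ := (intMatrix P * periodMatrix ω).toRows₂

theorem toRows₂_periodMatrix_mul (ω : SymCoord g) (K : Matrix (Fin g) (Fin g) ℂ) :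
    (periodMatrix ω * K).toRows₂ = K := by
  rw [periodMatrix, fromRows_mul, toRows₂_fromRows, one_mul]

/-- `P` is the action on the lattice of periods of the endomorphism `K`. -/
def IsPeriodAction (P : Matrix (Fin g ⊕ Fin g) (Fin g ⊕ Fin g) ℤ) (ω : SymCoord g)
    (K : Matrix (Fin g) (Fin g) ℂ) : Prop :=
  intMatrix P * periodMatrix ω = periodMatrix ω * K

theorem IsPeriodAction.eq_lowerPeriods {P : Matrix (Fin g ⊕ Fin g) (Fin g ⊕ Fin g) ℤ}
    {ω : SymCoord g} {K : Matrix (Fin g) (Fin g) ℂ} (h : IsPeriodAction P ω K) :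
    K = lowerPeriods P ω := by
  rw [lowerPeriods, h, toRows₂_periodMatrix_mul]

theorem IsPeriodAction.mul {P Q : Matrix (Fin g ⊕ Fin g) (Fin g ⊕ Fin g) ℤ}
    {ω : SymCoord g} {K L : Matrix (Fin g) (Fin g) ℂ} (h : IsPeriodAction P ω K)
    (h' : IsPeriodAction Q ω L) : IsPeriodAction (P * Q) ω (K * L) := by
  rw [IsPeriodAction] at *
  rw [intMatrix_mul, Matrix.mul_assoc, h', ← Matrix.mul_assoc, h, Matrix.mul_assoc]

theorem IsPeriodAction.injective {P Q : Matrix (Fin g ⊕ Fin g) (Fin g ⊕ Fin g) ℤ}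
    {ω : SymCoord g} (hω : ω ∈ siegelSpace g) {K : Matrix (Fin g) (Fin g) ℂ}
    (h : IsPeriodAction P ω K) (h' : IsPeriodAction Q ω K) : P = Q :=
  intMatrix_mul_periodMatrix_injective hω (h.trans h'.symm)

theorem det_imMatrix_ne_zero {ω : SymCoord g} (hω : ω ∈ siegelSpace g) :
    (imMatrix ω).det ≠ 0 := (Matrix.PosDef.det_pos hω).ne'

/-- Over `ℂ` the action on the lattice is conjugate to `K ⊕ K̄`. The conjugating matrix consists of
the periods and their complex conjugates, and its determinant is that of `ω - ω̄ = 2 I • Im ω`. -/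
theorem trace_eq_of_isPeriodAction {P : Matrix (Fin g ⊕ Fin g) (Fin g ⊕ Fin g) ℤ}
    {ω : SymCoord g} (hω : ω ∈ siegelSpace g) {K : Matrix (Fin g) (Fin g) ℂ}
    (h : IsPeriodAction P ω K) : (P.trace : ℝ) = 2 * K.trace.re := by
  set c : ℂ →+* ℂ := starRingEnd ℂ
  set M : Matrix (Fin g ⊕ Fin g) (Fin g ⊕ Fin g) ℂ :=
    fromCols (periodMatrix ω) ((periodMatrix ω).map c) with hM
  have h' : intMatrix P * (periodMatrix ω).map c = (periodMatrix ω).map c * K.map c := by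
    have h1 : (intMatrix P).map c = intMatrix P := by ext i j; simp [c]
    rw [← Matrix.map_mul, ← (show _ = _ from h), Matrix.map_mul, h1]
  have hMd : M.det ≠ 0 := by
    have h1 : M = fromBlocks ω.toMatrix (ω.toMatrix.map c) 1 1 := by
      ext (i | i) (j | j) <;> simp [hM, periodMatrix, Matrix.one_apply, apply_ite c]
    have h2 : ω.toMatrix - ω.toMatrix.map c * 1 = ((2 * Complex.I : ℂ)) •
        (imMatrix ω).map Complex.ofRealHom := by
      ext i j
      simp only [mul_one, Matrix.sub_apply, map_apply, Matrix.smul_apply, imMatrix, smul_eq_mul, c,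
        Complex.ofRealHom_eq_coe]
      rw [Complex.sub_conj]
      push_cast
      ring
    rw [h1, det_fromBlocks_one₂₂, h2, det_smul, ← RingHom.mapMatrix_apply, ← RingHom.map_det]
    simp [det_imMatrix_ne_zero hω]
  have hMK : intMatrix P * M = M * fromBlocks K 0 0 (K.map c) := by
    rw [hM, mul_fromCols, fromCols_mul_fromBlocks, h', (show _ = _ from h)]
    simp
  have hconj : intMatrix P = M * fromBlocks K 0 0 (K.map c) * M⁻¹ := by
    rw [← hMK, Matrix.mul_assoc, Matrix.mul_nonsing_inv _ hMd.isUnit, mul_one]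
  have ht := congrArg trace hconj
  rw [trace_intMatrix, trace_mul_comm, ← Matrix.mul_assoc, Matrix.nonsing_inv_mul _ hMd.isUnit,
    one_mul] at ht
  have h2 : (fromBlocks K 0 0 (K.map c)).trace = K.trace + c K.trace := by
    simp [trace, map_sum]
  rw [h2, Complex.add_conj] at ht
  exact_mod_cast ht

/-- The symmetric idempotents of the symplectic lattice. -/
structure IsLatticeProj (P : Matrix (Fin g ⊕ Fin g) (Fin g ⊕ Fin g) ℤ) : Prop where
  mul_self : P * P = P
  mul_J : P * J (Fin g) ℤ = J (Fin g) ℤ * Pᵀ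

theorem polForm_periodMatrix {ω : SymCoord g} (hω : ω ∈ siegelSpace g) (s t : Fin g ⊕ Fin g) :
    polForm hω (periodBasis hω s) (periodBasis hω t) = -(J (Fin g) ℤ s t : ℝ) := by
  have := congrFun (congrFun (polForm_periodBasis hω) s) t
  rw [of_apply] at this
  rw [this]
  rcases s with s | s <;> rcases t with t | t <;> simp [J, Matrix.one_apply]

/-- An endomorphism is determined by its action on lattice vectors, so idempotence and
self-adjointness pass to the integral matrix. Periods are rows here, hence the transpose of the
matrix of `κ`. -/
theorem exists_latticeProj {ω : SymCoord g} (hω : ω ∈ siegelSpace g)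
    (κ : (Fin g → ℂ) →ₗ[ℂ] (Fin g → ℂ)) (hκ : ∀ z, κ (κ z) = κ z)
    (hL : ∀ s, ∃ x : Fin g ⊕ Fin g → ℤ, κ (periodBasis hω s) = ∑ t, (x t : ℝ) • periodBasis hω t)
    (hE : ∀ z w, polForm hω (κ z) w = polForm hω z (κ w)) :
    ∃ P, IsLatticeProj P ∧ IsPeriodAction P ω (LinearMap.toMatrix' κ)ᵀ ∧
      (∀ s, κ (periodBasis hω s) = ∑ t, (P s t : ℝ) • periodBasis hω t) := by
  choose x hx using hL
  have hK : IsPeriodAction (of x) ω (LinearMap.toMatrix' κ)ᵀ := by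
    rw [IsPeriodAction]
    funext s
    rw [vecMul_intMatrix_periodMatrix hω]
    change _ = periodMatrix ω s ᵥ* (LinearMap.toMatrix' κ)ᵀ
    rw [vecMul_transpose, ← toLin'_apply, toLin'_toMatrix', periodMatrix_apply hω, hx]
    rfl
  refine ⟨of x, ⟨?_, ?_⟩, hK, hx⟩
  · refine IsPeriodAction.injective hω (hK.mul hK) ?_
    rw [← transpose_mul, ← LinearMap.toMatrix'_comp]
    have : κ ∘ₗ κ = κ := LinearMap.ext hκ
    rwa [this]
  · ext s t
    have := hE (periodBasis hω s) (periodBasis hω t)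
    simp only [hx, map_sum, map_smul, LinearMap.sum_apply, LinearMap.smul_apply, smul_eq_mul,
      polForm_periodMatrix] at this
    simp only [mul_apply, transpose_apply, of_apply]
    have h2 : ∑ u, (x s u : ℝ) * (J (Fin g) ℤ u t : ℝ) = ∑ u, (J (Fin g) ℤ s u : ℝ) * x t u := by
      simp only [mul_neg, Finset.sum_neg_distrib, neg_inj] at this
      rw [this]
      exact Finset.sum_congr rfl fun _ _ => mul_comm _ _
    exact_mod_cast h2

end LatticeEndomorphisms

/-! ### Constant mixed logarithmic derivative along independent directions splits the lattice. -/

section OrderTwo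

open Matrix

variable {g : ℕ}

/-- The lattice vector with given integral coordinates. -/
def latticeVec {ω : SymCoord g} (hω : ω ∈ siegelSpace g) :
    (Fin g ⊕ Fin g → ℤ) →ₗ[ℤ] (Fin g → ℂ) where
  toFun x := ∑ t, (x t : ℝ) • periodBasis hω t
  map_add' x y := by
    simp only [Pi.add_apply, Int.cast_add, add_smul, Finset.sum_add_distrib]
  map_smul' c x := by
    simp only [Pi.smul_apply, smul_eq_mul, Int.cast_mul, mul_smul, Finset.smul_sum,
      RingHom.id_apply, Int.cast_smul_eq_zsmul]

theorem latticeVec_apply {ω : SymCoord g} (hω : ω ∈ siegelSpace g) (x : Fin g ⊕ Fin g → ℤ) :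
    latticeVec hω x = ∑ t, (x t : ℝ) • periodBasis hω t := rfl

theorem latticeVec_eq {ω : SymCoord g} (hω : ω ∈ siegelSpace g) (x : Fin g ⊕ Fin g → ℤ) :
    latticeVec hω x = ω.toMatrix *ᵥ intVec (x ∘ Sum.inl) + intVec (x ∘ Sum.inr) := by
  rw [latticeVec_apply, Fintype.sum_sum_type]
  congr 1
  · ext k
    simp only [periodBasis_inl, Finset.sum_apply, Pi.smul_apply, mulVec, dotProduct, intVec,
      Function.comp, SymCoord.toMatrix, of_apply]
    refine Finset.sum_congr rfl fun j _ => ?_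
    rw [Sym2.eq_swap, mul_comm]
    simp
  · ext k
    simp [periodBasis_inr, intVec, Pi.single_apply]

theorem toComplexVec_intCast (n : Fin g → ℤ) : toComplexVec (fun j => (n j : ℝ)) = intVec n := by
  ext j; simp [toComplexVec, intVec]

theorem latFst_latticeVec {ω : SymCoord g} (hω : ω ∈ siegelSpace g) (x : Fin g ⊕ Fin g → ℤ) :
    latFst hω (latticeVec hω x) = fun j => (x (Sum.inl j) : ℝ) := by
  rw [latticeVec_eq, ← toComplexVec_intCast, ← toComplexVec_intCast, latFst_apply]
  rfl

theorem latSnd_latticeVec {ω : SymCoord g} (hω : ω ∈ siegelSpace g) (x : Fin g ⊕ Fin g → ℤ) :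
    latSnd hω (latticeVec hω x) = fun j => (x (Sum.inr j) : ℝ) := by
  rw [latticeVec_eq, ← toComplexVec_intCast, ← toComplexVec_intCast, latSnd_apply]
  rfl

theorem latticeVec_single {ω : SymCoord g} (hω : ω ∈ siegelSpace g) (s : Fin g ⊕ Fin g) :
    latticeVec hω (Pi.single s 1) = periodBasis hω s := by
  rw [latticeVec_apply, Finset.sum_eq_single s]
  · simp
  · intro t _ h; simp [h]
  · simp

/-- The polarization is unimodular. -/
theorem exists_latticeVec_eq {ω : SymCoord g} (hω : ω ∈ siegelSpace g) {z : Fin g → ℂ}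
    (h : ∀ s, ∃ n : ℤ, polForm hω z (periodBasis hω s) = n) : ∃ x, z = latticeVec hω x := by
  choose n hn using h
  refine ⟨Sum.elim (fun j => n (Sum.inr j)) (fun j => -n (Sum.inl j)), ?_⟩
  have h1 : latFst hω z = fun j => (n (Sum.inr j) : ℝ) := by
    ext j
    rw [← hn, polForm_apply, ← latticeVec_single, latFst_latticeVec, latSnd_latticeVec]
    simp [dotProduct, Pi.single_apply]
  have h2 : latSnd hω z = fun j => ((-n (Sum.inl j) : ℤ) : ℝ) := by
    ext j
    rw [Int.cast_neg, ← hn, polForm_apply, ← latticeVec_single, latFst_latticeVec,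
      latSnd_latticeVec]
    simp [dotProduct, Pi.single_apply]
  rw [latticeVec_eq, ← latFst_latSnd hω z, h1, h2, toComplexVec_intCast, toComplexVec_intCast]
  rfl

/-- Only the linear part of the exponent in `z` matters in what follows; everything constant is
collected in `C`. -/
theorem exists_thetaC_add_latticeVec (u s : Fin g → ℝ) {ω : SymCoord g} (hω : ω ∈ siegelSpace g)
    (x : Fin g ⊕ Fin g → ℤ) : ∃ C : ℂ, C ≠ 0 ∧ ∀ z, thetaC u s ω (z + latticeVec hω x) =
      C * Complex.exp (-(2 * Real.pi * Complex.I *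
        (toComplexVec (latFst hω (latticeVec hω x)) ⬝ᵥ z))) * thetaC u s ω z := by
  refine ⟨Complex.exp (2 * Real.pi * Complex.I * (toComplexVec u ⬝ᵥ intVec (x ∘ Sum.inr))) *
    Complex.exp (-(2 * Real.pi * Complex.I * (intVec (x ∘ Sum.inl) ⬝ᵥ toComplexVec s)) -
        Real.pi * Complex.I * (intVec (x ∘ Sum.inl) ⬝ᵥ ω.toMatrix *ᵥ intVec (x ∘ Sum.inl))),
    mul_ne_zero (Complex.exp_ne_zero _) (Complex.exp_ne_zero _), fun z => ?_⟩
  rw [latFst_latticeVec, toComplexVec_intCast, latticeVec_eq, ← add_assoc, thetaC_add_int,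
    thetaC_add_period, ← mul_assoc, ← Complex.exp_add, ← Complex.exp_add, ← Complex.exp_add]
  congr 2
  change _ = _ + -(2 * (Real.pi : ℂ) * Complex.I * (intVec (x ∘ Sum.inl) ⬝ᵥ z))
  ring

theorem exp_mul_eq_const {p A : ℂ} (h : ∀ t : ℂ, Complex.exp (p * t) = A) : p = 0 := by
  have h1 : HasDerivAt (fun t : ℂ => Complex.exp (p * t)) (Complex.exp (p * 0) * (p * 1)) 0 :=
    ((hasDerivAt_id (0 : ℂ)).const_mul p).cexp
  have h2 : (fun t : ℂ => Complex.exp (p * t)) = fun _ => A := funext h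
  rw [h2] at h1
  simpa using h1.unique (hasDerivAt_const 0 A)

/-! ### Multipliers of the theta function restricted to lines in the direction `v`. -/

section Multiplier

variable (u s : Fin g → ℝ) {ω : SymCoord g} (hω : ω ∈ siegelSpace g)

/-- The exponent of the multiplier along `v` of a lattice vector `z`, where `b` is the component of
`z` along `w`. -/
def multExp (v : Fin g → ℂ) (k : ℂ) (b : (Fin g → ℂ) →ₗ[ℂ] ℂ) : (Fin g → ℂ) →ₗ[ℝ] ℂ where
  toFun z := -(2 * Real.pi * Complex.I * (toComplexVec (latFst hω z) ⬝ᵥ v)) - k * b z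
  map_add' z z' := by
    have h : toComplexVec (latFst hω (z + z')) =
        toComplexVec (latFst hω z) + toComplexVec (latFst hω z') := by
      ext j; simp [toComplexVec]
    rw [h, add_dotProduct, map_add]
    ring
  map_smul' c z := by
    have h : toComplexVec (latFst hω (c • z)) = (c : ℂ) • toComplexVec (latFst hω z) := by
      ext j; simp [toComplexVec]
    have h' : b (c • z) = c * b z := by
      rw [← Complex.coe_smul, map_smul, smul_eq_mul]
    rw [h, smul_dotProduct, h', RingHom.id_apply, Complex.real_smul]
    simp only [smul_eq_mul]
    ring

theorem multExp_apply (v : Fin g → ℂ) (k : ℂ) (b : (Fin g → ℂ) →ₗ[ℂ] ℂ) (z : Fin g → ℂ) :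
    multExp hω v k b z =
      -(2 * Real.pi * Complex.I * (toComplexVec (latFst hω z) ⬝ᵥ v)) - k * b z := rfl

variable {v w : Fin g → ℂ} {k : ℂ} {a b : (Fin g → ℂ) →ₗ[ℂ] ℂ}

/-- For a lattice vector `l = a v + b w` the product formula peels off the part `b w`, so the
quasi-periodicity of `θ` under `l` becomes one of its restriction to `x₀ + ℂ v` under `t ↦ t + a`.
The factor `exp (k (t + a) b)` accounts for the term `-k b` in `multExp`. -/
theorem exists_multiplier
    (h : ∀ z, thetaLogHess u s ω v w z = k * thetaC u s ω z ^ 2)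
    {x₀ : Fin g → ℂ} (hx : thetaC u s ω x₀ ≠ 0) (n : Fin g ⊕ Fin g → ℤ)
    (hab : latticeVec hω n = a (latticeVec hω n) • v + b (latticeVec hω n) • w) :
    ∃ A : ℂ, A ≠ 0 ∧ ∀ t, thetaC u s ω (x₀ + (t + a (latticeVec hω n)) • v) =
      A * Complex.exp (multExp hω v k b (latticeVec hω n) * t) * thetaC u s ω (x₀ + t • v) := by
  obtain ⟨C, hC, hq⟩ := exists_thetaC_add_latticeVec u s hω n
  set l := latticeVec hω n
  have key : ∀ t, thetaC u s ω (x₀ + (t + a l) • v) * thetaC u s ω (x₀ + b l • w) *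
      Complex.exp (k * (t + a l) * b l) =
      C * Complex.exp (-(2 * Real.pi * Complex.I * (toComplexVec (latFst hω l) ⬝ᵥ (x₀ + t • v)))) *
        thetaC u s ω (x₀ + t • v) * thetaC u s ω x₀ := by
    intro t
    have h1 := thetaC_mul_eq_of_logHess u s hω h hx (t + a l) (b l)
    have h2 : x₀ + (t + a l) • v + b l • w = x₀ + t • v + l := by
      conv_rhs => rw [hab]
      rw [add_smul]; abel
    rw [h2, hq] at h1
    linear_combination -h1
  have hB : thetaC u s ω (x₀ + b l • w) ≠ 0 := by
    intro h0
    have := key 0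
    rw [h0] at this
    simp [hC, hx] at this
  refine ⟨C * Complex.exp (-(2 * Real.pi * Complex.I * (toComplexVec (latFst hω l) ⬝ᵥ x₀))) *
    thetaC u s ω x₀ * (thetaC u s ω (x₀ + b l • w))⁻¹ * Complex.exp (-(k * a l * b l)), ?_, ?_⟩
  · simp [hC, hx, hB]
  intro t
  have h3 : Complex.exp (-(2 * Real.pi * Complex.I * (toComplexVec (latFst hω l) ⬝ᵥ (x₀ + t • v))))
      = Complex.exp (-(2 * Real.pi * Complex.I * (toComplexVec (latFst hω l) ⬝ᵥ x₀))) *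
        Complex.exp (-(k * a l * b l)) * Complex.exp (multExp hω v k b l * t) *
        Complex.exp (k * (t + a l) * b l) := by
    rw [← Complex.exp_add, ← Complex.exp_add, ← Complex.exp_add, multExp_apply, dotProduct_add,
      dotProduct_smul, smul_eq_mul]
    congr 1
    ring
  have h4 := key t
  rw [h3] at h4
  refine mul_right_cancel₀ (mul_ne_zero hB (Complex.exp_ne_zero (k * (t + a l) * b l))) ?_
  have hi := inv_mul_cancel₀ hB
  linear_combination h4 -
    (C * Complex.exp (-(2 * Real.pi * Complex.I * (toComplexVec (latFst hω l) ⬝ᵥ x₀))) *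
      thetaC u s ω x₀ * Complex.exp (-(k * a l * b l)) * Complex.exp (multExp hω v k b l * t) *
      thetaC u s ω (x₀ + t • v) * Complex.exp (k * (t + a l) * b l)) * hi

/-- Shifting the parameter by the `v`-components of two lattice vectors in either order gives the
same value. Hence the two exponentials agree, and their exponents differ by a multiple of `2 π I`.
-/
theorem exists_int_multExp
    (h : ∀ z, thetaLogHess u s ω v w z = k * thetaC u s ω z ^ 2)
    (hab : ∀ z, z = a z • v + b z • w) (n m : Fin g ⊕ Fin g → ℤ) :
    ∃ r : ℤ, multExp hω v k b (latticeVec hω m) * a (latticeVec hω n) -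
      multExp hω v k b (latticeVec hω n) * a (latticeVec hω m) =
        2 * Real.pi * Complex.I * r := by
  obtain ⟨x₀, hx⟩ := Function.ne_iff.1 (thetaC_ne_zero u s hω)
  obtain ⟨A, hA, hA'⟩ := exists_multiplier u s hω h hx n (hab _)
  obtain ⟨B, hB, hB'⟩ := exists_multiplier u s hω h hx m (hab _)
  set l := latticeVec hω n
  set l' := latticeVec hω m
  have h1 := hA' (a l')
  have h2 := hB' (a l)
  have h3 := hA' 0
  have h4 := hB' 0
  rw [zero_add, mul_zero, Complex.exp_zero, mul_one, zero_smul, add_zero] at h3 h4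
  rw [h4, add_comm (a l')] at h1
  rw [h3, h1] at h2
  have hAB : A * B * thetaC u s ω x₀ ≠ 0 := mul_ne_zero (mul_ne_zero hA hB) hx
  have h5 : Complex.exp (multExp hω v k b l' * a l) = Complex.exp (multExp hω v k b l * a l') :=
    mul_left_cancel₀ hAB (by linear_combination -h2)
  obtain ⟨r, hr⟩ := Complex.exp_eq_exp_iff_exists_int.1 h5
  exact ⟨r, by linear_combination hr⟩

/-- The expression is real bilinear in `z` and `z'`, and on the lattice basis it is an integral
multiple of `2 π I`. -/
theorem multExp_symp_real
    (h : ∀ z, thetaLogHess u s ω v w z = k * thetaC u s ω z ^ 2)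
    (hab : ∀ z, z = a z • v + b z • w) (z z' : Fin g → ℂ) :
    ∃ r : ℝ, multExp hω v k b z' * a z - multExp hω v k b z * a z' =
        2 * Real.pi * Complex.I * r := by
  choose r hr using fun i j : Fin g ⊕ Fin g =>
    exists_int_multExp u s hω h hab (Pi.single i 1) (Pi.single j 1)
  simp only [latticeVec_single] at hr
  set B := periodBasis hω
  refine ⟨∑ i, ∑ j, B.repr z i * B.repr z' j * r i j, ?_⟩
  have ha : ∀ z, a z = ∑ i, (B.repr z i : ℂ) * a (B i) := by
    intro z
    conv_lhs => rw [← B.sum_repr z]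
    rw [map_sum]
    refine Finset.sum_congr rfl fun i _ => ?_
    rw [← Complex.coe_smul, map_smul, smul_eq_mul]
  have hp : ∀ z, multExp hω v k b z = ∑ i, (B.repr z i : ℂ) * multExp hω v k b (B i) := by
    intro z
    conv_lhs => rw [← B.sum_repr z]
    rw [map_sum]
    refine Finset.sum_congr rfl fun i _ => ?_
    rw [map_smul, Complex.real_smul]
  rw [ha z, ha z', hp z, hp z', mul_comm, Finset.sum_mul_sum, Finset.sum_mul_sum,
    ← Finset.sum_sub_distrib]
  push_cast
  rw [Finset.mul_sum]
  refine Finset.sum_congr rfl fun i _ => ?_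
  rw [Finset.mul_sum, ← Finset.sum_sub_distrib]
  refine Finset.sum_congr rfl fun j _ => ?_
  linear_combination (B.repr z i : ℂ) * B.repr z' j * hr i j

/-- Pairing `z` with `c • v` shows that `c` times the exponent lies in `2 π I ℝ` for every complex
`c`. The values `c = 1` and `c = I` leave only zero. -/
theorem multExp_eq_zero
    (h : ∀ z, thetaLogHess u s ω v w z = k * thetaC u s ω z ^ 2)
    (hab : ∀ z, z = a z • v + b z • w) (hav : a v = 1) {z : Fin g → ℂ} (hz : a z = 0) :
    multExp hω v k b z = 0 := by
  have key : ∀ c : ℂ, ∃ r : ℝ, multExp hω v k b z * c = 2 * Real.pi * Complex.I * r := by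
    intro c
    obtain ⟨r, hr⟩ := multExp_symp_real u s hω h hab z (c • v)
    rw [hz, map_smul a, hav, smul_eq_mul, mul_one, mul_zero, zero_sub] at hr
    exact ⟨-r, by push_cast; linear_combination -hr⟩
  obtain ⟨r, hr⟩ := key 1
  obtain ⟨r', hr'⟩ := key Complex.I
  rw [mul_one] at hr
  have h1 : 2 * Real.pi * Complex.I * (r * Complex.I - r') = 0 := by
    rw [hr] at hr'; linear_combination hr'
  have h2 : (r : ℂ) * Complex.I - r' = 0 := by
    simpa [Real.pi_ne_zero] using h1
  have h3 : r = 0 := by simpa using congrArg Complex.im h2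
  rw [hr, h3]
  simp

/-- Since `multExp_eq_zero` applies to both directions, the directions `v` and `w` are orthogonal
for the polarization, and what remains on `ℂ v` is the pairing of multipliers. In particular it is
integral on lattice vectors. -/
theorem polForm_component
    (h : ∀ z, thetaLogHess u s ω v w z = k * thetaC u s ω z ^ 2)
    (hab : ∀ z, z = a z • v + b z • w) (hav : a v = 1) (hbv : b v = 0) (haw : a w = 0)
    (hbw : b w = 1) (z z' : Fin g → ℂ) :
    (polForm hω (a z • v) z' : ℂ) * (2 * Real.pi * Complex.I) =
      multExp hω v k b z' * a z - multExp hω v k b z * a z' := by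
  have h' : ∀ z, thetaLogHess u s ω w v z = k * thetaC u s ω z ^ 2 := fun z => by
    rw [thetaLogHess_comm, h]
  have hba : ∀ z, z = b z • w + a z • v := fun z => by rw [add_comm]; exact hab z
  have hsplit : ∀ z, multExp hω v k b z = multExp hω v k b (a z • v) := by
    intro z
    conv_lhs => rw [hab z]
    rw [map_add, multExp_eq_zero u s hω h hab hav (z := b z • w) (by simp [haw]), add_zero]
  have e1 : multExp hω v k b (b z' • w) = 0 :=
    multExp_eq_zero u s hω h hab hav (by simp [haw])
  have e2 : multExp hω w k a (a z • v) = 0 :=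
    multExp_eq_zero u s hω h' hba hbw (by simp [hbv])
  have e3 : (polForm hω (a z • v) z' : ℂ) = polForm hω (a z • v) (a z' • v) +
      polForm hω (a z • v) (b z' • w) := by
    conv_lhs => rw [hab z']
    rw [map_add, Complex.ofReal_add]
  rw [multExp_apply, map_smul b, hbw, smul_eq_mul, mul_one] at e1
  rw [multExp_apply, map_smul a, hav, smul_eq_mul, mul_one] at e2
  rw [e3, ofReal_polForm, ofReal_polForm, hsplit z, hsplit z', multExp_apply, multExp_apply]
  simp only [dotProduct_smul, smul_eq_mul, map_smul b, hbv, mul_zero, sub_zero]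
  linear_combination a z * e1 - b z' * e2

end Multiplier

/-- The projection `z ↦ a z • v` maps a lattice vector to a vector with integral pairing against the
lattice, so by unimodularity to a lattice vector. Its complex trace is `a v = 1`, so the trace on
the lattice is `2`. -/
theorem exists_latticeProj_of_logHess (u s : Fin g → ℝ) {ω : SymCoord g} (hω : ω ∈ siegelSpace g)
    {v w : Fin g → ℂ} {k : ℂ} {a b : (Fin g → ℂ) →ₗ[ℂ] ℂ}
    (h : ∀ z, thetaLogHess u s ω v w z = k * thetaC u s ω z ^ 2)
    (hab : ∀ z, z = a z • v + b z • w) (hav : a v = 1) (hbv : b v = 0) (haw : a w = 0)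
    (hbw : b w = 1) :
    ∃ (P : _) (K : _), IsLatticeProj P ∧ IsPeriodAction P ω K ∧ P.trace = 2 := by
  have hpi : (2 * Real.pi * Complex.I : ℂ) ≠ 0 := by simp [Real.pi_ne_zero]
  have hc := polForm_component u s hω h hab hav hbv haw hbw
  have hL : ∀ i, ∃ x : Fin g ⊕ Fin g → ℤ, a.smulRight v (periodBasis hω i) =
      ∑ t, (x t : ℝ) • periodBasis hω t := by
    intro i
    refine exists_latticeVec_eq hω fun j => ?_
    obtain ⟨r, hr⟩ := exists_int_multExp u s hω h hab (Pi.single i 1) (Pi.single j 1)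
    simp only [latticeVec_single] at hr
    refine ⟨r, ?_⟩
    have := hc (periodBasis hω i) (periodBasis hω j)
    rw [hr, mul_comm] at this
    exact_mod_cast mul_left_cancel₀ hpi this
  have hE : ∀ z z', polForm hω (a.smulRight v z) z' = polForm hω z (a.smulRight v z') := by
    intro z z'
    have h1 := hc z z'
    have h2 := hc z' z
    rw [← neg_sub, ← h1] at h2
    rw [polForm_swap hω z]
    have : (polForm hω (a z • v) z' : ℂ) = -polForm hω (a z' • v) z :=
      mul_right_cancel₀ hpi (by linear_combination h2)
    exact_mod_cast this
  obtain ⟨P, hP, hPK, -⟩ := exists_latticeProj hω (a.smulRight v) (fun z => by simp [hav]) hL hE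
  refine ⟨P, _, hP, hPK, ?_⟩
  have ht := trace_eq_of_isPeriodAction hω hPK
  have h1 : (LinearMap.toMatrix' (a.smulRight v)).trace = a v := by
    conv_rhs => rw [pi_eq_sum_univ' v]
    simp only [trace, diag_apply, LinearMap.toMatrix'_apply, LinearMap.smulRight_apply,
      map_sum, map_smul, smul_eq_mul, Pi.smul_apply]
    refine Finset.sum_congr rfl fun i _ => ?_
    rw [mul_comm]
  rw [trace_transpose, h1, hav] at ht
  simp at ht
  exact_mod_cast ht

end OrderTwo

/-! ### The degenerate case of proportional directions in dimension two. -/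

section OrderTwoDegenerate

open Matrix

/-- The linear form on `ℂ²` with kernel spanned by `v`. -/
def crossForm (v : Fin 2 → ℂ) : (Fin 2 → ℂ) →ₗ[ℂ] ℂ where
  toFun z := v 0 * z 1 - v 1 * z 0
  map_add' z z' := by simp only [Pi.add_apply]; ring
  map_smul' c z := by simp only [Pi.smul_apply, smul_eq_mul, RingHom.id_apply]; ring

theorem crossForm_apply (v z : Fin 2 → ℂ) : crossForm v z = v 0 * z 1 - v 1 * z 0 := rfl

theorem exists_eq_smul_of_crossForm {v z : Fin 2 → ℂ} (hv : v ≠ 0) (h : crossForm v z = 0) :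
    ∃ c : ℂ, z = c • v := by
  rw [crossForm_apply, sub_eq_zero] at h
  by_cases h0 : v 0 = 0
  · have h1 : v 1 ≠ 0 := fun h1 => hv (funext fun i => by fin_cases i <;> simpa)
    refine ⟨z 1 / v 1, funext fun i => ?_⟩
    rw [h0, zero_mul, eq_comm, mul_eq_zero, or_iff_right h1] at h
    fin_cases i
    · simp [h, h0]
    · simp [h1]
  · refine ⟨z 0 / v 0, funext fun i => ?_⟩
    fin_cases i
    · simp [h0]
    · simp only [Fin.mk_one, Pi.smul_apply, smul_eq_mul]
      field_simp
      linear_combination h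

theorem exists_crossForm_eq_one {v : Fin 2 → ℂ} (hv : v ≠ 0) : ∃ e, crossForm v e = 1 := by
  by_cases h0 : v 0 = 0
  · have h1 : v 1 ≠ 0 := fun h1 => hv (funext fun i => by fin_cases i <;> simpa)
    exact ⟨![-(v 1)⁻¹, 0], by simp [crossForm_apply, h1]⟩
  · exact ⟨![0, (v 0)⁻¹], by simp [crossForm_apply, h0]⟩

theorem discreteTopology_of_isolated (M : Submodule ℤ ℂ) {ε : ℝ} (hε : 0 < ε)
    (h : ∀ z ∈ M, ‖z‖ < ε → z = 0) : DiscreteTopology M := by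
  rw [discreteTopology_iff_isOpen_singleton_zero, isOpen_induced_iff]
  refine ⟨Metric.ball 0 ε, Metric.isOpen_ball, Set.ext fun z => ?_⟩
  simp only [Set.mem_preimage, mem_ball_zero_iff, Set.mem_singleton_iff]
  exact ⟨fun hz => Subtype.ext (h z z.2 hz), fun hz => by simpa [hz] using hε⟩

/-- A discrete subgroup of `ℂ` has the rank of its real span, hence rank at most two. -/
theorem finrank_ker_of_discrete_range {M : Type*} [AddCommGroup M] [Module.Finite ℤ M]
    (f : M →ₗ[ℤ] ℂ) (h : DiscreteTopology (LinearMap.range f)) :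
    Module.finrank ℤ M ≤ Module.finrank ℤ (LinearMap.ker f) + 2 := by
  have h1 := Submodule.finrank_quotient_add_finrank (LinearMap.ker f)
  rw [LinearEquiv.finrank_eq f.quotKerEquivRange] at h1
  have h2 : DiscreteTopology (Submodule.span ℤ (LinearMap.range f : Set ℂ)) := by
    rwa [Submodule.span_eq]
  have h3 := Real.finrank_eq_int_finrank_of_discrete h2
  rw [Set.finrank, Set.finrank, Submodule.span_eq] at h3
  have h4 := Submodule.finrank_le (Submodule.span ℝ (LinearMap.range f : Set ℂ))
  rw [Complex.finrank_real_complex] at h4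
  omega

variable (u s : Fin 2 → ℝ) {ω : SymCoord 2} (hω : ω ∈ siegelSpace 2) {v : Fin 2 → ℂ} {k : ℂ}
include hω

/-- The product formula with the shifts `a v` and `-a v` expresses `θ(x)²` as a multiple of `θ(x + a
v)`. So the zero set of `θ` is a union of lines parallel to `v`. -/
theorem thetaC_add_smul_ne_zero
    (h : ∀ z, thetaLogHess u s ω v v z = k * thetaC u s ω z ^ 2) {x : Fin 2 → ℂ}
    (hx : thetaC u s ω x ≠ 0) (a : ℂ) : thetaC u s ω (x + a • v) ≠ 0 := by
  intro h0
  have := thetaC_mul_eq_of_logHess u s hω h hx a (-a)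
  rw [h0, neg_smul, add_neg_cancel_right, zero_mul, mul_zero] at this
  exact mul_self_ne_zero.2 hx this

/-- Since the zero set is invariant under `ℂ v`, it comes from the zeros of a nonzero entire
function on the quotient by `ℂ v`, which are isolated. All lattice points are zeros because the
origin is one. -/
theorem exists_isolated_of_logHess (hv : v ≠ 0)
    (h : ∀ z, thetaLogHess u s ω v v z = k * thetaC u s ω z ^ 2) (h0 : thetaC u s ω 0 = 0) :
    ∃ ε > 0, ∀ x, ‖crossForm v (latticeVec hω x)‖ < ε → crossForm v (latticeVec hω x) = 0 := by
  obtain ⟨e, he⟩ := exists_crossForm_eq_one hv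
  have hdec : ∀ z, ∃ c : ℂ, z = crossForm v z • e + c • v := by
    intro z
    obtain ⟨c, hc⟩ := exists_eq_smul_of_crossForm hv (z := z - crossForm v z • e) (by
      rw [map_sub, map_smul, he, smul_eq_mul, mul_one, sub_self])
    exact ⟨c, by rw [← hc]; abel⟩
  set f : ℂ → ℂ := fun t => thetaC u s ω (t • e)
  have hf : Differentiable ℂ f := fun t => by
    have := hasDerivAt_thetaC u s hω 0 e t
    simp only [zero_add] at this
    exact this.differentiableAt
  have hzero : ∀ x, f (crossForm v (latticeVec hω x)) = 0 := by
    intro x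
    obtain ⟨c, hc⟩ := hdec (latticeVec hω x)
    by_contra hne
    have := thetaC_add_smul_ne_zero u s hω h hne c
    rw [← hc] at this
    obtain ⟨C, -, hq⟩ := exists_thetaC_add_latticeVec u s hω x
    have h1 := hq 0
    rw [zero_add, h0, mul_zero] at h1
    exact this h1
  rcases (hf.analyticAt 0).eventually_eq_zero_or_eventually_ne_zero with h1 | h1
  · have h2 := eq_zero_of_eventually_eq_zero hf h1
    exfalso
    refine thetaC_ne_zero u s hω (funext fun z => ?_)
    obtain ⟨c, hc⟩ := hdec z
    by_contra hne
    have := thetaC_add_smul_ne_zero u s hω h hne (-c)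
    rw [hc, neg_smul, add_neg_cancel_right] at this
    exact this (h2 _)
  · rw [eventually_nhdsWithin_iff, Metric.eventually_nhds_iff] at h1
    obtain ⟨ε, hε, h2⟩ := h1
    refine ⟨ε, hε, fun x hx => ?_⟩
    by_contra hne
    exact h2 (by simpa using hx) hne (hzero x)

/-- A lattice vector on `ℂ v` translates `θ` both by quasi-periodicity and by the product formula.
Comparison of the two exponentials in the position along `v` gives the relation. -/
theorem latticeVec_multiplier
    (h : ∀ z, thetaLogHess u s ω v v z = k * thetaC u s ω z ^ 2) (x : Fin 2 ⊕ Fin 2 → ℤ) (a : ℂ)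
    (hx : latticeVec hω x = a • v) :
    k * a = -(2 * Real.pi * Complex.I * (toComplexVec (latFst hω (a • v)) ⬝ᵥ v)) := by
  obtain ⟨x₀, hx₀⟩ := Function.ne_iff.1 (thetaC_ne_zero u s hω)
  obtain ⟨C, hC, hq⟩ := exists_thetaC_add_latticeVec u s hω x
  rw [hx] at hq
  set q := 2 * Real.pi * Complex.I * (toComplexVec (latFst hω (a • v)) ⬝ᵥ v) with hqdef
  have key : ∀ t : ℂ, C * Complex.exp (-(2 * Real.pi * Complex.I *
      (toComplexVec (latFst hω (a • v)) ⬝ᵥ x₀))) * thetaC u s ω x₀ * Complex.exp (-q * t) =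
        Complex.exp (k * a * t) * thetaC u s ω (x₀ + a • v) := by
    intro t
    have h1 := thetaC_mul_eq_of_logHess u s hω h hx₀ t a
    rw [hq, dotProduct_add, dotProduct_smul, smul_eq_mul] at h1
    have h2 := thetaC_add_smul_ne_zero u s hω h hx₀ t
    refine mul_right_cancel₀ h2 ?_
    have h3 : Complex.exp (-(2 * Real.pi * Complex.I * (toComplexVec (latFst hω (a • v)) ⬝ᵥ x₀ +
        t * (toComplexVec (latFst hω (a • v)) ⬝ᵥ v)))) =
        Complex.exp (-(2 * Real.pi * Complex.I * (toComplexVec (latFst hω (a • v)) ⬝ᵥ x₀))) *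
          Complex.exp (-q * t) := by
      rw [← Complex.exp_add]; congr 1; rw [hqdef]; ring
    rw [h3, show k * t * a = k * a * t by ring] at h1
    linear_combination h1
  have hne : thetaC u s ω (x₀ + a • v) ≠ 0 := thetaC_add_smul_ne_zero u s hω h hx₀ a
  have h5 := exp_mul_eq_const (p := k * a + q) (A := Complex.exp 0) (fun t => by
    have h0 := key 0
    rw [mul_zero, mul_zero, Complex.exp_zero, mul_one, one_mul] at h0
    have h1 := key t
    rw [h0] at h1
    have h6 : Complex.exp (-q * t) = Complex.exp (k * a * t) :=
      mul_left_cancel₀ hne (by linear_combination h1)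
    rw [add_mul, Complex.exp_add, ← h6, ← Complex.exp_add]
    congr 1
    ring)
  linear_combination h5

/-- The lattice of rank four has discrete image in the quotient by `ℂ v`, so two independent lattice
vectors lie on `ℂ v`. By `latticeVec_multiplier` the polarization vanishes on this pair, which
positivity allows only for vectors proportional over `ℝ`. -/
theorem not_logHess_degenerate (hv : v ≠ 0)
    (h : ∀ z, thetaLogHess u s ω v v z = k * thetaC u s ω z ^ 2) (h0 : thetaC u s ω 0 = 0) :
    False := by
  obtain ⟨ε, hε, hiso⟩ := exists_isolated_of_logHess u s hω hv h h0
  set f : (Fin 2 ⊕ Fin 2 → ℤ) →ₗ[ℤ] ℂ :=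
    ((crossForm v).restrictScalars ℤ) ∘ₗ latticeVec hω with hf
  have hdisc : DiscreteTopology (LinearMap.range f) := by
    refine discreteTopology_of_isolated _ hε fun z hz hzε => ?_
    obtain ⟨x, rfl⟩ := hz
    exact hiso x hzε
  have hrank := finrank_ker_of_discrete_range f hdisc
  have h4 : Module.finrank ℤ (Fin 2 ⊕ Fin 2 → ℤ) = 4 := by simp
  have h1 : 1 < Module.finrank ℤ (LinearMap.ker f) := by omega
  have : Nontrivial (LinearMap.ker f) := Module.nontrivial_of_finrank_pos (R := ℤ) (by omega)
  obtain ⟨x, hx⟩ := exists_ne (0 : LinearMap.ker f)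
  obtain ⟨y, hxy⟩ := exists_linearIndependent_pair_of_one_lt_finrank h1 hx
  obtain ⟨a, ha⟩ := exists_eq_smul_of_crossForm hv (z := latticeVec hω x) x.2
  obtain ⟨b, hb⟩ := exists_eq_smul_of_crossForm hv (z := latticeVec hω y) y.2
  have ka := latticeVec_multiplier u s hω h x a ha
  have kb := latticeVec_multiplier u s hω h y b hb
  have hpi : (2 * Real.pi * Complex.I : ℂ) ≠ 0 := by simp [Real.pi_ne_zero]
  have hE : polForm hω (a • v) (b • v) = 0 := by
    have := ofReal_polForm hω (a • v) (b • v)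
    rw [dotProduct_smul, dotProduct_smul, smul_eq_mul, smul_eq_mul] at this
    have h2 : (polForm hω (a • v) (b • v) : ℂ) * (2 * Real.pi * Complex.I) = 0 := by
      rw [this]; linear_combination b * ka - a * kb
    have h3 := (mul_eq_zero.1 h2).resolve_right hpi
    exact_mod_cast h3
  rw [polForm_smul_smul, mul_eq_zero, or_iff_left (polForm_pos hω hv).ne'] at hE
  -- Vanishing of the form on `a v` and `b v` makes `a` and `b` proportional over `ℝ`; uniqueness of
  -- real lattice coordinates transfers this to the integral coordinates.
  have hrel : ∀ i j, (x.1 i : ℝ) * y.1 j = x.1 j * y.1 i := by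
    obtain ⟨r, t, hrt, hr⟩ : ∃ r t : ℝ, (r ≠ 0 ∨ t ≠ 0) ∧ (r : ℂ) * a = t * b := by
      by_cases ha0 : a = 0
      · exact ⟨1, 0, by simp, by simp [ha0]⟩
      · by_cases har : a.re = 0
        · refine ⟨b.im, a.im, Or.inr fun hi => ha0 (Complex.ext har hi), ?_⟩
          apply Complex.ext <;> simp <;> linarith
        · refine ⟨b.re, a.re, Or.inr har, ?_⟩
          apply Complex.ext <;> simp <;> linarith
    have hlin : ∑ i, (r * x.1 i - t * y.1 i) • periodBasis hω i = 0 := by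
      simp only [sub_smul, mul_smul, Finset.sum_sub_distrib, ← Finset.smul_sum,
        ← latticeVec_apply]
      rw [ha, hb, ← Complex.coe_smul, ← Complex.coe_smul, smul_smul, smul_smul, hr, sub_self]
    have hz := Fintype.linearIndependent_iff.1 (periodBasis hω).linearIndependent _ hlin
    intro i j
    have hi := hz i
    have hj := hz j
    rcases hrt with h | h
    · refine mul_left_cancel₀ h ?_
      linear_combination (y.1 j : ℝ) * hi - y.1 i * hj
    · refine mul_left_cancel₀ h ?_
      linear_combination (x.1 j : ℝ) * hi - x.1 i * hj
  have hx0 : (x : Fin 2 ⊕ Fin 2 → ℤ) ≠ 0 := fun h => hx (Subtype.ext h)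
  obtain ⟨i, hi⟩ := Function.ne_iff.1 hx0
  rw [LinearIndependent.pair_iff] at hxy
  obtain ⟨-, h2⟩ := hxy (y.1 i) (-x.1 i) (by
    ext j
    have := hrel i j
    simp only [Submodule.coe_add, Submodule.coe_smul, Pi.add_apply, Pi.smul_apply, smul_eq_mul,
      Submodule.coe_zero, Pi.zero_apply]
    have h3 : x.1 i * y.1 j = x.1 j * y.1 i := by exact_mod_cast this
    linear_combination -h3)
  exact hi (by simpa using h2)

omit hω in
/-- A theta function in two variables vanishing to order two at the origin comes from a
decomposable abelian surface. -/
theorem exists_latticeProj_of_order_two (hω : ω ∈ siegelSpace 2) (h0 : thetaC u s ω 0 = 0)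
    (h1 : ∀ x, thetaP u s ω x 0 = 0) :
    ∃ (P : _) (K : _), IsLatticeProj P ∧ IsPeriodAction P ω K ∧ P.trace = 2 := by
  obtain ⟨v, w, k, hv, hw, h⟩ := exists_logHess_eq_of_order_two u s hω h0 h1
  by_cases hd : crossForm v w = 0
  · obtain ⟨c, rfl⟩ := exists_eq_smul_of_crossForm hv hd
    have hc : c ≠ 0 := by rintro rfl; simp at hw
    refine (not_logHess_degenerate u s hω (k := k / c) hv (fun z => ?_) h0).elim
    have h2 := thetaLogHess_lin u s hω c 0 v v v z
    rw [zero_smul, add_zero, zero_mul, add_zero, thetaLogHess_comm, h z] at h2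
    field_simp
    linear_combination -h2
  -- By Cramer's rule these are the coordinates with respect to the basis `v`, `w`.
  · refine exists_latticeProj_of_logHess u s hω (a := -(crossForm v w)⁻¹ • crossForm w)
      (b := (crossForm v w)⁻¹ • crossForm v) h (fun z => ?_) ?_ ?_ ?_ ?_
    · have h2 : crossForm v w ≠ 0 := hd
      rw [crossForm_apply] at h2
      ext i
      fin_cases i <;>
      · simp only [Fin.zero_eta, Fin.mk_one, LinearMap.smul_apply, crossForm_apply, smul_eq_mul,
          Pi.add_apply, Pi.smul_apply]
        field_simp
        ring
    · have : crossForm w v = -crossForm v w := by rw [crossForm_apply, crossForm_apply]; ring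
      simp [this, hd]
    · simp [crossForm_apply, mul_comm]
    · simp [crossForm_apply, mul_comm]
    · simp [hd]

end OrderTwoDegenerate

/-! ### Self-adjoint idempotents of the symplectic lattice and hyperbolic planes. -/

section SymplecticLattice

open Matrix

variable {g : ℕ}

/-- The standard symplectic form on the lattice. -/
def sympForm (x y : Fin g ⊕ Fin g → ℤ) : ℤ := x ⬝ᵥ J (Fin g) ℤ *ᵥ y

theorem sympForm_eq (x y : Fin g ⊕ Fin g → ℤ) :
    sympForm x y = ∑ j, (x (Sum.inr j) * y (Sum.inl j) - x (Sum.inl j) * y (Sum.inr j)) := by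
  rw [sympForm, J, fromBlocks_mulVec, dotProduct, Fintype.sum_sum_type, Finset.sum_sub_distrib]
  simp [neg_mulVec]
  ring

theorem sympForm_swap (x y : Fin g ⊕ Fin g → ℤ) : sympForm x y = -sympForm y x := by
  rw [sympForm_eq, sympForm_eq, ← Finset.sum_neg_distrib]
  exact Finset.sum_congr rfl fun _ _ => by ring

theorem sympForm_self (x : Fin g ⊕ Fin g → ℤ) : sympForm x x = 0 := by
  rw [sympForm_eq]
  exact Finset.sum_eq_zero fun _ _ => by ring

theorem sympForm_add_left (x x' y : Fin g ⊕ Fin g → ℤ) :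
    sympForm (x + x') y = sympForm x y + sympForm x' y := add_dotProduct _ _ _

theorem sympForm_smul_left (c : ℤ) (x y : Fin g ⊕ Fin g → ℤ) :
    sympForm (c • x) y = c * sympForm x y := smul_dotProduct _ _ _

theorem sympForm_add_right (x y y' : Fin g ⊕ Fin g → ℤ) :
    sympForm x (y + y') = sympForm x y + sympForm x y' := by
  rw [sympForm, mulVec_add, dotProduct_add]; rfl

theorem sympForm_smul_right (c : ℤ) (x y : Fin g ⊕ Fin g → ℤ) :
    sympForm x (c • y) = c * sympForm x y := by
  rw [sympForm, mulVec_smul, dotProduct_smul]; rfl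

/-- Bézout coefficients of the entries of `x`, rearranged according to the signs in the form. -/
theorem exists_sympForm_eq_one {x : Fin g ⊕ Fin g → ℤ}
    (h : Finset.univ.gcd x = 1) : ∃ y, sympForm x y = 1 := by
  obtain ⟨f, hf⟩ := Finset.gcd_eq_sum_mul Finset.univ x
  rw [h, Fintype.sum_sum_type] at hf
  refine ⟨Sum.elim (fun j => f (Sum.inr j)) (fun j => -f (Sum.inl j)), ?_⟩
  rw [sympForm_eq, hf, ← Finset.sum_add_distrib]
  exact Finset.sum_congr rfl fun j _ => by simp; ring

theorem IsLatticeProj.sympForm_vecMul {P : Matrix (Fin g ⊕ Fin g) (Fin g ⊕ Fin g) ℤ}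
    (hP : IsLatticeProj P) (x y : Fin g ⊕ Fin g → ℤ) :
    sympForm (x ᵥ* P) y = sympForm x (y ᵥ* P) := by
  rw [sympForm, sympForm, ← mulVec_transpose, dotProduct_comm, ← dotProduct_comm,
    mulVec_transpose, ← dotProduct_mulVec, mulVec_mulVec, hP.mul_J, ← mulVec_mulVec,
    mulVec_transpose]

theorem IsLatticeProj.vecMul_vecMul {P : Matrix (Fin g ⊕ Fin g) (Fin g ⊕ Fin g) ℤ}
    (hP : IsLatticeProj P) (x : Fin g ⊕ Fin g → ℤ) : x ᵥ* P ᵥ* P = x ᵥ* P := by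
  rw [Matrix.vecMul_vecMul, hP.mul_self]

theorem matrix_eq_of_vecMul_eq {P Q : Matrix (Fin g ⊕ Fin g) (Fin g ⊕ Fin g) ℤ}
    (h : ∀ x, x ᵥ* P = x ᵥ* Q) : P = Q := by
  ext s t
  simpa using congrFun (h (Pi.single s 1)) t

/-- The trace of an idempotent of a free module is its rank. This lets traces decide equality of
projections below. -/
theorem IsLatticeProj.eq_zero_of_trace {P : Matrix (Fin g ⊕ Fin g) (Fin g ⊕ Fin g) ℤ}
    (hP : P * P = P) (h : P.trace = 0) : P = 0 := by
  have h1 : IsIdempotentElem (toLin' P) := by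
    rw [IsIdempotentElem, Module.End.mul_eq_comp, ← toLin'_mul, hP]
  have h2 := (LinearMap.IsIdempotentElem.trace_eq_zero_iff h1).1 (by rw [trace_toLin'_eq, h])
  exact (LinearEquiv.map_eq_zero_iff _).1 h2

/-- A nonzero projection contains a hyperbolic pair in its image. -/
theorem IsLatticeProj.exists_pair {P : Matrix (Fin g ⊕ Fin g) (Fin g ⊕ Fin g) ℤ}
    (hP : IsLatticeProj P) (h : P ≠ 0) :
    ∃ e f, e ᵥ* P = e ∧ f ᵥ* P = f ∧ sympForm e f = -1 := by
  obtain ⟨s, hs⟩ := Function.ne_iff.1 h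
  obtain ⟨t, ht⟩ := Function.ne_iff.1 hs
  -- A row of `P` is fixed by `P`; dividing it by the greatest common divisor of its entries gives a
  -- primitive vector that is still fixed, as the lattice is torsion-free.
  obtain ⟨e, he, he1⟩ := Finset.extract_gcd (s := Finset.univ) (P s) ⟨s, Finset.mem_univ _⟩
  have hd : Finset.univ.gcd (P s) ≠ 0 := fun h => ht (Finset.gcd_eq_zero_iff.1 h t (Finset.mem_univ _))
  have hPs : P s = Finset.univ.gcd (P s) • e := funext fun b => he b (Finset.mem_univ _)
  have hePe : e ᵥ* P = e := by
    have h1 : P s ᵥ* P = P s := by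
      have := congrFun hP.mul_self s
      exact this
    rw [hPs, smul_vecMul] at h1
    exact smul_right_injective _ hd h1
  obtain ⟨y, hy⟩ := exists_sympForm_eq_one he1
  -- Projecting `-y` into the image does not change its pairing with `e`, by self-adjointness. The
  -- value `-1` is the sign convention of `J`.
  refine ⟨e, (-y) ᵥ* P, hePe, hP.vecMul_vecMul _, ?_⟩
  rw [← hP.sympForm_vecMul, hePe, ← neg_one_smul ℤ, sympForm_smul_right, hy, mul_one]

/-- The projection to the hyperbolic plane spanned by `e` and `f`. -/
def pairProj (e f : Fin g ⊕ Fin g → ℤ) : Matrix (Fin g ⊕ Fin g) (Fin g ⊕ Fin g) ℤ :=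
  of fun s => sympForm f (Pi.single s 1) • e + sympForm (Pi.single s 1) e • f

theorem sympForm_sum_left (c : Fin g ⊕ Fin g → ℤ) (y : Fin g ⊕ Fin g → ℤ) :
    sympForm c y = ∑ s, c s * sympForm (Pi.single s 1) y := by
  simp only [sympForm, single_one_dotProduct]
  rfl

theorem vecMul_pairProj (e f x : Fin g ⊕ Fin g → ℤ) :
    x ᵥ* pairProj e f = sympForm f x • e + sympForm x e • f := by
  rw [sympForm_swap f x, sympForm_sum_left x f, sympForm_sum_left x e]
  ext t
  simp only [vecMul, dotProduct, pairProj, of_apply, Pi.add_apply, Pi.smul_apply, smul_eq_mul,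
    sympForm_swap f, ← Finset.sum_neg_distrib, Finset.sum_mul, ← Finset.sum_add_distrib]
  exact Finset.sum_congr rfl fun _ _ => by ring

theorem isLatticeProj_of_sympForm {P : Matrix (Fin g ⊕ Fin g) (Fin g ⊕ Fin g) ℤ}
    (h1 : ∀ x, x ᵥ* P ᵥ* P = x ᵥ* P) (h2 : ∀ x y, sympForm (x ᵥ* P) y = sympForm x (y ᵥ* P)) :
    IsLatticeProj P := by
  refine ⟨matrix_eq_of_vecMul_eq fun x => by rw [← Matrix.vecMul_vecMul, h1], ?_⟩
  ext s t
  have := h2 (Pi.single s 1) (Pi.single t 1)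
  rw [sympForm, sympForm, ← dotProduct_mulVec, ← mulVec_transpose, mulVec_mulVec, mulVec_mulVec]
    at this
  simpa using this

theorem isLatticeProj_pairProj {e f : Fin g ⊕ Fin g → ℤ} (h : sympForm e f = -1) :
    IsLatticeProj (pairProj e f) := by
  have h' : sympForm f e = 1 := by rw [sympForm_swap, h]; rfl
  refine isLatticeProj_of_sympForm (fun x => ?_) fun x y => ?_
  · simp only [vecMul_pairProj, sympForm_add_left, sympForm_add_right, sympForm_smul_left,
      sympForm_smul_right, sympForm_self, h']
    simp
  · simp only [vecMul_pairProj, sympForm_add_left, sympForm_add_right, sympForm_smul_left,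
      sympForm_smul_right, sympForm_swap f x, sympForm_swap y e]
    ring

theorem trace_pairProj {e f : Fin g ⊕ Fin g → ℤ} (h : sympForm e f = -1) :
    (pairProj e f).trace = 2 := by
  have h' : sympForm f e = 1 := by rw [sympForm_swap, h]; rfl
  have h1 := sympForm_sum_left e f
  have h2 := sympForm_sum_left f e
  have : (pairProj e f).trace = -sympForm e f + sympForm f e := by
    rw [h1, h2, trace, ← Finset.sum_neg_distrib, ← Finset.sum_add_distrib]
    refine Finset.sum_congr rfl fun s _ => ?_
    simp only [diag_apply, pairProj, of_apply, Pi.add_apply, Pi.smul_apply, smul_eq_mul,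
      sympForm_swap f]
    ring
  rw [this, h, h']
  rfl

theorem IsLatticeProj.mul_mul_J {P Q : Matrix (Fin g ⊕ Fin g) (Fin g ⊕ Fin g) ℤ}
    (hP : IsLatticeProj P) (hQ : IsLatticeProj Q) :
    P * Q * J (Fin g) ℤ = J (Fin g) ℤ * (Q * P)ᵀ := by
  rw [Matrix.mul_assoc, hQ.mul_J, ← Matrix.mul_assoc, hP.mul_J, transpose_mul, Matrix.mul_assoc]

theorem eq_of_mul_J_eq {P Q : Matrix (Fin g ⊕ Fin g) (Fin g ⊕ Fin g) ℤ}
    (h : P * J (Fin g) ℤ = Q * J (Fin g) ℤ) : P = Q := by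
  have := congrArg (· * J (Fin g) ℤ) h
  simpa [Matrix.mul_assoc, J_squared] using this

theorem IsLatticeProj.mul_eq_self {P Q : Matrix (Fin g ⊕ Fin g) (Fin g ⊕ Fin g) ℤ}
    (hP : IsLatticeProj P) (hQ : IsLatticeProj Q) (h : Q * P = Q) : P * Q = Q :=
  eq_of_mul_J_eq (by rw [hP.mul_mul_J hQ, h, hQ.mul_J])

theorem IsLatticeProj.mul_eq_zero {P Q : Matrix (Fin g ⊕ Fin g) (Fin g ⊕ Fin g) ℤ}
    (hP : IsLatticeProj P) (hQ : IsLatticeProj Q) (h : Q * P = 0) : P * Q = 0 :=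
  eq_of_mul_J_eq (by rw [hP.mul_mul_J hQ, h]; simp)

/-- Under the inclusion of images the difference `P - Q` is again idempotent, and it has trace zero.
-/
theorem eq_of_latticeProj_of_le {P Q : Matrix (Fin g ⊕ Fin g) (Fin g ⊕ Fin g) ℤ}
    (hP : IsLatticeProj P) (hQ : IsLatticeProj Q) (hQP : Q * P = Q)
    (ht : P.trace = Q.trace) : P = Q := by
  have := IsLatticeProj.eq_zero_of_trace (P := P - Q) (by
    rw [Matrix.sub_mul, Matrix.mul_sub, Matrix.mul_sub, hP.mul_self, hQ.mul_self, hQP,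
      hP.mul_eq_self hQ hQP]
    abel) (by rw [trace_sub, ht, sub_self])
  exact sub_eq_zero.1 this

theorem IsLatticeProj.eq_pairProj {P : Matrix (Fin g ⊕ Fin g) (Fin g ⊕ Fin g) ℤ}
    (hP : IsLatticeProj P) (ht : P.trace = 2) {e f : Fin g ⊕ Fin g → ℤ}
    (he : e ᵥ* P = e) (hf : f ᵥ* P = f) (h : sympForm e f = -1) : P = pairProj e f := by
  refine eq_of_latticeProj_of_le hP (isLatticeProj_pairProj h) ?_ (by rw [ht, trace_pairProj h])
  refine matrix_eq_of_vecMul_eq fun x => ?_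
  rw [← Matrix.vecMul_vecMul, vecMul_pairProj, add_vecMul, smul_vecMul, smul_vecMul, he, hf]

theorem IsLatticeProj.one_sub {P : Matrix (Fin g ⊕ Fin g) (Fin g ⊕ Fin g) ℤ}
    (hP : IsLatticeProj P) : IsLatticeProj (1 - P) := by
  refine ⟨?_, ?_⟩
  · rw [Matrix.sub_mul, Matrix.mul_sub, Matrix.one_mul, Matrix.mul_sub, Matrix.one_mul,
      Matrix.mul_one, hP.mul_self]
    abel
  · rw [Matrix.sub_mul, transpose_sub, Matrix.mul_sub, hP.mul_J, transpose_one, one_mul, mul_one]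

theorem IsLatticeProj.one_sub_sub {P Q : Matrix (Fin g ⊕ Fin g) (Fin g ⊕ Fin g) ℤ}
    (hP : IsLatticeProj P) (hQ : IsLatticeProj Q) (h : P * Q = 0) :
    IsLatticeProj (1 - P - Q) := by
  refine ⟨?_, ?_⟩
  · simp only [Matrix.sub_mul, Matrix.mul_sub, one_mul, mul_one, hP.mul_self, hQ.mul_self, h,
      hQ.mul_eq_zero hP h]
    abel
  · simp only [Matrix.sub_mul, transpose_sub, Matrix.mul_sub, hP.mul_J, hQ.mul_J, transpose_one,
      one_mul, mul_one]

/-- The projection to the `i`-th standard hyperbolic plane. -/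
def stdProj (i : Fin g) : Matrix (Fin g ⊕ Fin g) (Fin g ⊕ Fin g) ℤ :=
  diagonal (Sum.elim (Pi.single i 1) (Pi.single i 1))

theorem vecMul_eq_zero_of_mul_eq_zero {P Q : Matrix (Fin g ⊕ Fin g) (Fin g ⊕ Fin g) ℤ}
    (h : P * Q = 0) {x : Fin g ⊕ Fin g → ℤ} (hx : x ᵥ* P = x) : x ᵥ* Q = 0 := by
  rw [← hx, Matrix.vecMul_vecMul, h, vecMul_zero]

/-- The images are mutually orthogonal and each contains a hyperbolic pair. The `g` pairs are the
rows of a symplectic matrix, and each row is fixed by one of the projections and killed by the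
others. -/
theorem exists_symplectic_of_orthogonal {P : Fin g → Matrix (Fin g ⊕ Fin g) (Fin g ⊕ Fin g) ℤ}
    (hP : ∀ i, IsLatticeProj (P i)) (h0 : ∀ i, P i ≠ 0) (ho : ∀ i j, i ≠ j → P i * P j = 0) :
    ∃ N ∈ symplecticGroup (Fin g) ℤ, ∀ i, N * P i = stdProj i * N := by
  choose e f he hf hef using fun i => (hP i).exists_pair (h0 i)
  have horth : ∀ i j, i ≠ j → ∀ x y, x ᵥ* P i = x → y ᵥ* P j = y → sympForm x y = 0 := by
    intro i j hij x y hx hy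
    rw [← hy, ← (hP j).sympForm_vecMul, vecMul_eq_zero_of_mul_eq_zero (ho i j hij) hx]
    exact zero_dotProduct _
  refine ⟨of (Sum.elim e f), ?_, fun i => ?_⟩
  · rw [SymplecticGroup.mem_iff]
    have h1 : ∀ s t, (of (Sum.elim e f) * J (Fin g) ℤ * (of (Sum.elim e f))ᵀ) s t =
        sympForm (Sum.elim e f s) (Sum.elim e f t) := by
      intro s t
      rw [Matrix.mul_assoc, sympForm]
      rfl
    have h2 : ∀ i j, sympForm (e i) (f j) = if i = j then -1 else 0 := by
      intro i j
      split_ifs with hij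
      · rw [← hij, hef]
      · exact horth i j hij _ _ (he i) (hf j)
    have h3 : ∀ i j, sympForm (e i) (e j) = 0 := by
      intro i j
      rcases eq_or_ne i j with rfl | hij
      · exact sympForm_self _
      · exact horth i j hij _ _ (he i) (he j)
    have h4 : ∀ i j, sympForm (f i) (f j) = 0 := by
      intro i j
      rcases eq_or_ne i j with rfl | hij
      · exact sympForm_self _
      · exact horth i j hij _ _ (hf i) (hf j)
    ext (s | s) (t | t) <;> rw [h1]
    · simp [h3, J]
    · simp [h2, J, Matrix.one_apply, apply_ite]
    · rw [Sum.elim_inr, Sum.elim_inl, sympForm_swap, h2]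
      simp [J, Matrix.one_apply, eq_comm]
      split_ifs <;> simp
    · simp [h4, J]
  · funext s
    have h1 : ∀ x j, x ᵥ* P j = x → x ᵥ* P i = (Pi.single i (1 : ℤ) : Fin g → ℤ) j • x := by
      intro x j hx
      rcases eq_or_ne j i with rfl | hij
      · simp [hx]
      · simp [hij, vecMul_eq_zero_of_mul_eq_zero (ho j i hij) hx]
    ext t
    rw [stdProj, diagonal_mul]
    change (Sum.elim e f s ᵥ* P i) t = _
    rcases s with j | j
    · rw [Sum.elim_inl, h1 _ _ (he j)]; rfl
    · rw [Sum.elim_inr, h1 _ _ (hf j)]; rfl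

section Three

variable {P Q : Matrix (Fin 3 ⊕ Fin 3) (Fin 3 ⊕ Fin 3) ℤ}

theorem trace_one_three : (1 : Matrix (Fin 3 ⊕ Fin 3) (Fin 3 ⊕ Fin 3) ℤ).trace = 6 := by
  simp

/-- In rank six, `1 - P - Q` is a third self-adjoint idempotent of trace two, so the three planes
can be straightened simultaneously. -/
theorem exists_symplectic_pair (hP : IsLatticeProj P) (hPt : P.trace = 2)
    (hQ : IsLatticeProj Q) (hQt : Q.trace = 2) (h : P * Q = 0) :
    ∃ N ∈ symplecticGroup (Fin 3) ℤ, N * P = stdProj 0 * N ∧ N * Q = stdProj 1 * N ∧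
      N * (1 - P - Q) = stdProj 2 * N := by
  have hQP := hQ.mul_eq_zero hP h
  have hR := hP.one_sub_sub hQ h
  have hRt : (1 - P - Q).trace = 2 := by
    rw [trace_sub, trace_sub, hPt, hQt, trace_one_three]; rfl
  have h0 : ∀ M : Matrix (Fin 3 ⊕ Fin 3) (Fin 3 ⊕ Fin 3) ℤ, M.trace = 2 → M ≠ 0 := by
    rintro M hM rfl
    simp at hM
  obtain ⟨N, hN, hN'⟩ := exists_symplectic_of_orthogonal (P := ![P, Q, 1 - P - Q])
    (fun i => by fin_cases i <;> assumption)
    (fun i => by fin_cases i <;> exact h0 _ (by assumption))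
    (fun i j hij => by
      fin_cases i <;> fin_cases j <;> first | exact absurd rfl hij | skip
      all_goals
        simp [Matrix.sub_mul, Matrix.mul_sub, hP.mul_self, hQ.mul_self, h, hQP])
  exact ⟨N, hN, hN' 0, hN' 1, hN' 2⟩

/-- The complementary projection `1 - P` is nonzero by its trace, so its image contains a hyperbolic
pair, which spans a plane orthogonal to the image of `P`. -/
theorem exists_orthogonal_latticeProj (hP : IsLatticeProj P) (hPt : P.trace = 2) :
    ∃ Q, IsLatticeProj Q ∧ Q.trace = 2 ∧ P * Q = 0 := by
  have h1 : 1 - P ≠ 0 := by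
    intro h
    have := congrArg trace h
    rw [trace_sub, trace_one_three, hPt] at this
    simp at this
  obtain ⟨e, f, he, hf, hef⟩ := hP.one_sub.exists_pair h1
  have hQ := isLatticeProj_pairProj hef
  refine ⟨pairProj e f, hQ, trace_pairProj hef, hP.mul_eq_zero hQ ?_⟩
  have h2 : ∀ x : Fin 3 ⊕ Fin 3 → ℤ, x ᵥ* (1 - P) = x → x ᵥ* P = 0 := by
    intro x hx
    rw [vecMul_sub, vecMul_one] at hx
    exact sub_eq_self.1 hx
  refine matrix_eq_of_vecMul_eq fun x => ?_
  rw [← Matrix.vecMul_vecMul, vecMul_pairProj, add_vecMul, smul_vecMul, smul_vecMul, h2 e he,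
    h2 f hf]
  simp

end Three

end SymplecticLattice

/-! ### The integral symplectic group acts on Siegel space by biholomorphic maps. -/

section SymplecticAction

open Matrix

variable {g : ℕ}

/-- The coordinates of a symmetric matrix. -/
def SymCoord.ofMatrix (M : Matrix (Fin g) (Fin g) ℂ) : SymCoord g := fun p => M p.out.1 p.out.2

theorem SymCoord.ofMatrix_apply {M : Matrix (Fin g) (Fin g) ℂ} (hM : Mᵀ = M) (j k : Fin g) :
    SymCoord.ofMatrix M s(j, k) = M j k := by
  have h : s((s(j, k) : Sym2 (Fin g)).out.1, (s(j, k) : Sym2 (Fin g)).out.2) = s(j, k) := by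
    exact Quot.out_eq (s(j, k) : Sym2 (Fin g))
  rcases Sym2.eq_iff.1 h with ⟨h1, h2⟩ | ⟨h1, h2⟩
  · rw [SymCoord.ofMatrix, h1, h2]
  · rw [SymCoord.ofMatrix, h1, h2]
    exact congrFun (congrFun hM j) k

theorem SymCoord.toMatrix_ofMatrix {M : Matrix (Fin g) (Fin g) ℂ} (hM : Mᵀ = M) :
    (SymCoord.ofMatrix M).toMatrix = M := by
  ext j k
  exact SymCoord.ofMatrix_apply hM j k

theorem SymCoord.toMatrix_injective :
    Function.Injective (SymCoord.toMatrix : SymCoord g → Matrix (Fin g) (Fin g) ℂ) := by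
  intro ω ω' h
  ext p
  induction p using Sym2.ind with
  | _ j k => exact congrFun (congrFun h j) k

theorem dotProduct_imPart (ω : SymCoord g) (v : Fin g → ℂ) :
    star v ⬝ᵥ (ω.toMatrix - ω.toMatrixᴴ) *ᵥ v =
      2 * Complex.I * ((imForm ω (fun j => (v j).re) + imForm ω (fun j => (v j).im) : ℝ) : ℂ) := by
  have h1 : ω.toMatrix - ω.toMatrixᴴ = of fun j k => 2 * Complex.I * ((ω s(j, k)).im : ℂ) := by
    ext j k
    simp only [SymCoord.toMatrix, Matrix.sub_apply, conjTranspose_apply, of_apply,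
      Sym2.eq_swap (a := k)]
    rw [Complex.star_def, Complex.sub_conj]
    push_cast
    ring
  have h2 : ∀ x y : Fin g → ℝ, ∑ j, ∑ k, x j * (ω s(j, k)).im * y k =
      ∑ j, ∑ k, y j * (ω s(j, k)).im * x k := by
    intro x y
    rw [Finset.sum_comm]
    refine Finset.sum_congr rfl fun j _ => Finset.sum_congr rfl fun k _ => ?_
    rw [Sym2.eq_swap]
    ring
  have h3 := h2 (fun j => (v j).re) (fun j => (v j).im)
  have h4 : star v ⬝ᵥ (ω.toMatrix - ω.toMatrixᴴ) *ᵥ v = 2 * Complex.I *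
      ∑ j, ∑ k, star (v j) * ((ω s(j, k)).im : ℂ) * v k := by
    rw [h1]
    simp only [dotProduct, mulVec, of_apply, Pi.star_apply, Finset.mul_sum]
    exact Finset.sum_congr rfl fun j _ => Finset.sum_congr rfl fun k _ => by ring
  rw [h4]
  congr 1
  apply Complex.ext
  · simp only [Complex.re_sum, Complex.ofReal_re, imForm, ← Finset.sum_add_distrib]
    refine Finset.sum_congr rfl fun j _ => Finset.sum_congr rfl fun k _ => ?_
    simp
  · rw [Complex.ofReal_im, ← sub_eq_zero.2 h3, ← Finset.sum_sub_distrib, Complex.im_sum]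
    refine Finset.sum_congr rfl fun j _ => ?_
    rw [← Finset.sum_sub_distrib, Complex.im_sum]
    refine Finset.sum_congr rfl fun k _ => ?_
    simp
    ring

theorem imForm_nonneg {ω : SymCoord g} (hω : ω ∈ siegelSpace g) (v : Fin g → ℝ) :
    0 ≤ imForm ω v := by
  rcases eq_or_ne v 0 with rfl | hv
  · simp [imForm]
  · exact (mem_siegelSpace_iff.1 hω v hv).le

theorem imForm_re_add_im_pos {ω : SymCoord g} (hω : ω ∈ siegelSpace g) {v : Fin g → ℂ}
    (hv : v ≠ 0) : 0 < imForm ω (fun j => (v j).re) + imForm ω (fun j => (v j).im) := by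
  by_cases h : (fun j => (v j).re) = 0
  · have h' : (fun j => (v j).im) ≠ 0 := fun h' =>
      hv (funext fun j => Complex.ext (congrFun h j) (congrFun h' j))
    exact add_pos_of_nonneg_of_pos (imForm_nonneg hω _) (mem_siegelSpace_iff.1 hω _ h')
  · exact add_pos_of_pos_of_nonneg (mem_siegelSpace_iff.1 hω _ h) (imForm_nonneg hω _)

/-- The upper block of `N * periodMatrix ω`. -/
def upperPeriods (N : Matrix (Fin g ⊕ Fin g) (Fin g ⊕ Fin g) ℤ) (ω : SymCoord g) :
    Matrix (Fin g) (Fin g) ℂ := (intMatrix N * periodMatrix ω).toRows₁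

theorem intMatrix_mul_periodMatrix (N : Matrix (Fin g ⊕ Fin g) (Fin g ⊕ Fin g) ℤ)
    (ω : SymCoord g) :
    intMatrix N * periodMatrix ω = fromRows (upperPeriods N ω) (lowerPeriods N ω) :=
  (fromRows_toRows _).symm

theorem J_mul_fromRows (U W : Matrix (Fin g) (Fin g) ℂ) :
    J (Fin g) ℂ * fromRows U W = fromRows (-W) U := by
  rw [J, fromBlocks_mul_fromRows]
  simp

theorem transpose_mul_J_mul (U W : Matrix (Fin g) (Fin g) ℂ) :
    (fromRows U W)ᵀ * (J (Fin g) ℂ * fromRows U W) = Wᵀ * U - Uᵀ * W := by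
  rw [J_mul_fromRows, transpose_fromRows, fromCols_mul_fromRows, Matrix.mul_neg]
  abel

theorem conjTranspose_mul_J_mul (U W : Matrix (Fin g) (Fin g) ℂ) :
    (fromRows U W)ᴴ * (J (Fin g) ℂ * fromRows U W) = Wᴴ * U - Uᴴ * W := by
  rw [J_mul_fromRows, conjTranspose_fromRows_eq_fromCols_conjTranspose, fromCols_mul_fromRows,
    Matrix.mul_neg]
  abel

theorem intMatrix_conjTranspose {m n : Type*} (P : Matrix m n ℤ) :
    (intMatrix P)ᴴ = intMatrix Pᵀ := by ext i j; simp

variable {N : Matrix (Fin g ⊕ Fin g) (Fin g ⊕ Fin g) ℤ}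

theorem intMatrix_J : intMatrix (J (Fin g) ℤ) = J (Fin g) ℂ := map_J _ _

theorem intMatrix_transpose_mul_J (hN : N ∈ symplecticGroup (Fin g) ℤ)
    (R : Matrix (Fin g ⊕ Fin g) (Fin g) ℂ) :
    intMatrix Nᵀ * (J (Fin g) ℂ * (intMatrix N * R)) = J (Fin g) ℂ * R := by
  have := SymplecticGroup.mem_iff'.1 hN
  rw [← intMatrix_J, ← Matrix.mul_assoc, ← Matrix.mul_assoc, ← intMatrix_mul, ← intMatrix_mul,
    this]

/-- A symplectic matrix preserves the first Riemann relation, that the columns of the period matrix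
span an isotropic space. It makes the transformed matrix symmetric; the Hermitian analogue below
gives positivity. -/
theorem lower_transpose_mul_upper (hN : N ∈ symplecticGroup (Fin g) ℤ) (ω : SymCoord g) :
    (lowerPeriods N ω)ᵀ * upperPeriods N ω = (upperPeriods N ω)ᵀ * lowerPeriods N ω := by
  rw [← sub_eq_zero, ← transpose_mul_J_mul, ← intMatrix_mul_periodMatrix, transpose_mul,
    ← intMatrix_transpose, Matrix.mul_assoc, intMatrix_transpose_mul_J hN, periodMatrix,
    transpose_mul_J_mul, ω.toMatrix_transpose]
  simp

theorem lower_conjTranspose_mul_upper (hN : N ∈ symplecticGroup (Fin g) ℤ) (ω : SymCoord g) :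
    (lowerPeriods N ω)ᴴ * upperPeriods N ω - (upperPeriods N ω)ᴴ * lowerPeriods N ω =
      ω.toMatrix - ω.toMatrixᴴ := by
  rw [← conjTranspose_mul_J_mul, ← intMatrix_mul_periodMatrix, conjTranspose_mul,
    intMatrix_conjTranspose, Matrix.mul_assoc, intMatrix_transpose_mul_J hN, periodMatrix,
    conjTranspose_mul_J_mul]
  simp

/-- A vector in the kernel would have value zero under the Hermitian form of `ω - ω*`, because both
products in `lower_conjTranspose_mul_upper` involve the lower block. Positivity of the imaginary
part excludes this. -/
theorem lowerPeriods_det_ne_zero (hN : N ∈ symplecticGroup (Fin g) ℤ) {ω : SymCoord g}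
    (hω : ω ∈ siegelSpace g) : (lowerPeriods N ω).det ≠ 0 := by
  intro h
  obtain ⟨v, hv, hv0⟩ := exists_mulVec_eq_zero_iff.2 h
  have h1 := dotProduct_imPart ω v
  rw [← lower_conjTranspose_mul_upper hN, sub_mulVec, dotProduct_sub, ← mulVec_mulVec,
    ← mulVec_mulVec, hv0, mulVec_zero, dotProduct_zero, dotProduct_mulVec, ← star_mulVec, hv0,
    star_zero, zero_dotProduct, sub_zero] at h1
  have h2 := imForm_re_add_im_pos hω hv
  have h3 : ((imForm ω (fun j => (v j).re) + imForm ω (fun j => (v j).im) : ℝ) : ℂ) = 0 := by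
    simpa using h1.symm
  exact h2.ne' (by exact_mod_cast h3)

/-- The action of the symplectic group on Siegel space. -/
def spAction (N : Matrix (Fin g ⊕ Fin g) (Fin g ⊕ Fin g) ℤ) (ω : SymCoord g) : SymCoord g :=
  SymCoord.ofMatrix (upperPeriods N ω * (lowerPeriods N ω)⁻¹)

theorem toMatrix_spAction (hN : N ∈ symplecticGroup (Fin g) ℤ) {ω : SymCoord g}
    (hω : ω ∈ siegelSpace g) :
    (spAction N ω).toMatrix = upperPeriods N ω * (lowerPeriods N ω)⁻¹ := by
  refine SymCoord.toMatrix_ofMatrix ?_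
  have hd := (lowerPeriods_det_ne_zero hN hω).isUnit
  have hdt : IsUnit ((lowerPeriods N ω)ᵀ).det := by rwa [det_transpose]
  have h := lower_transpose_mul_upper hN ω
  rw [transpose_mul, transpose_nonsing_inv]
  calc _ = ((lowerPeriods N ω)ᵀ)⁻¹ * ((upperPeriods N ω)ᵀ * lowerPeriods N ω) *
        (lowerPeriods N ω)⁻¹ := by
        rw [Matrix.mul_assoc, mul_nonsing_inv_cancel_right _ _ hd]
    _ = _ := by rw [← h, nonsing_inv_mul_cancel_left _ _ hdt]

theorem toMatrix_spAction_mul (hN : N ∈ symplecticGroup (Fin g) ℤ) {ω : SymCoord g}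
    (hω : ω ∈ siegelSpace g) :
    (spAction N ω).toMatrix * lowerPeriods N ω = upperPeriods N ω := by
  rw [toMatrix_spAction hN hω, nonsing_inv_mul_cancel_right _ _
    (lowerPeriods_det_ne_zero hN hω).isUnit]

theorem intMatrix_mul_periodMatrix_eq (hN : N ∈ symplecticGroup (Fin g) ℤ) {ω : SymCoord g}
    (hω : ω ∈ siegelSpace g) :
    intMatrix N * periodMatrix ω = periodMatrix (spAction N ω) * lowerPeriods N ω := by
  rw [intMatrix_mul_periodMatrix, periodMatrix, fromRows_mul, toMatrix_spAction_mul hN hω, one_mul]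

/-- With the substitution `x = W⁻¹ v` the imaginary form of the new matrix at `v` becomes the
Hermitian form of the old one at `x`. The vector `x` is complex even though `v` is real, so both
parts of `x` contribute. -/
theorem spAction_mem (hN : N ∈ symplecticGroup (Fin g) ℤ) {ω : SymCoord g}
    (hω : ω ∈ siegelSpace g) : spAction N ω ∈ siegelSpace g := by
  refine mem_siegelSpace_iff.2 fun v hv => ?_
  set W := lowerPeriods N ω
  have hd := (lowerPeriods_det_ne_zero hN hω).isUnit
  set x := W⁻¹ *ᵥ toComplexVec v
  have hx : W *ᵥ x = toComplexVec v := by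
    rw [mulVec_mulVec, mul_nonsing_inv _ hd, one_mulVec]
  have hv0 : toComplexVec v ≠ 0 := by
    intro h
    refine hv (funext fun j => ?_)
    simpa [toComplexVec] using congrFun h j
  have hx0 : x ≠ 0 := by
    intro h
    rw [h, mulVec_zero] at hx
    exact hv0 hx.symm
  have h1 := dotProduct_imPart (spAction N ω) (toComplexVec v)
  have h2 := dotProduct_imPart ω x
  have h3 : star (toComplexVec v) ⬝ᵥ
      ((spAction N ω).toMatrix - (spAction N ω).toMatrixᴴ) *ᵥ toComplexVec v =
      star x ⬝ᵥ (ω.toMatrix - ω.toMatrixᴴ) *ᵥ x := by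
    rw [← lower_conjTranspose_mul_upper hN ω, ← toMatrix_spAction_mul hN hω, ← hx, star_mulVec,
      mulVec_mulVec, dotProduct_mulVec, vecMul_vecMul, ← dotProduct_mulVec, conjTranspose_mul]
    congr 2
    rw [Matrix.sub_mul, Matrix.mul_sub, Matrix.mul_assoc]
  rw [h1, h2] at h3
  have h4 : imForm (spAction N ω) (fun j => (toComplexVec v j).re) = imForm (spAction N ω) v := rfl
  have h5 : imForm (spAction N ω) (fun j => (toComplexVec v j).im) = 0 := by
    simp [imForm, toComplexVec]
  rw [h4, h5, add_zero] at h3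
  have h6 := imForm_re_add_im_pos hω hx0
  have h7 := mul_left_cancel₀ (by simp : (2 * Complex.I : ℂ) ≠ 0) h3
  have h8 : imForm (spAction N ω) v =
      imForm ω (fun j => (x j).re) + imForm ω (fun j => (x j).im) := by exact_mod_cast h7
  rw [h8]
  exact h6

theorem spAction_eq_of {ω ω' : SymCoord g} (hN : N ∈ symplecticGroup (Fin g) ℤ)
    (hω : ω ∈ siegelSpace g) {W : Matrix (Fin g) (Fin g) ℂ}
    (h : intMatrix N * periodMatrix ω = periodMatrix ω' * W) : spAction N ω = ω' := by
  have hW : lowerPeriods N ω = W := by rw [lowerPeriods, h, toRows₂_periodMatrix_mul]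
  have hd := (lowerPeriods_det_ne_zero hN hω).isUnit
  have hU : upperPeriods N ω = ω'.toMatrix * W := by
    rw [upperPeriods, h, periodMatrix, fromRows_mul, toRows₁_fromRows]
  apply SymCoord.toMatrix_injective
  rw [toMatrix_spAction hN hω, hU, hW]
  exact mul_nonsing_inv_cancel_right _ _ (hW ▸ hd)

/-- The inverse of a symplectic matrix. -/
def spInv (N : Matrix (Fin g ⊕ Fin g) (Fin g ⊕ Fin g) ℤ) :
    Matrix (Fin g ⊕ Fin g) (Fin g ⊕ Fin g) ℤ := -J (Fin g) ℤ * Nᵀ * J (Fin g) ℤ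

theorem spInv_mem (hN : N ∈ symplecticGroup (Fin g) ℤ) : spInv N ∈ symplecticGroup (Fin g) ℤ :=
  (⟨N, hN⟩ : symplecticGroup (Fin g) ℤ)⁻¹.2

theorem spInv_mul (hN : N ∈ symplecticGroup (Fin g) ℤ) : spInv N * N = 1 :=
  congrArg Subtype.val (inv_mul_cancel (⟨N, hN⟩ : symplecticGroup (Fin g) ℤ))

theorem mul_spInv (hN : N ∈ symplecticGroup (Fin g) ℤ) : N * spInv N = 1 :=
  congrArg Subtype.val (mul_inv_cancel (⟨N, hN⟩ : symplecticGroup (Fin g) ℤ))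

theorem spAction_spInv (hN : N ∈ symplecticGroup (Fin g) ℤ) {ω : SymCoord g}
    (hω : ω ∈ siegelSpace g) : spAction (spInv N) (spAction N ω) = ω := by
  have hd := (lowerPeriods_det_ne_zero hN hω).isUnit
  refine spAction_eq_of (spInv_mem hN) (spAction_mem hN hω) (W := (lowerPeriods N ω)⁻¹) ?_
  have h1 := intMatrix_mul_periodMatrix_eq hN hω
  have h2 : periodMatrix (spAction N ω) =
      intMatrix N * periodMatrix ω * (lowerPeriods N ω)⁻¹ := by
    rw [h1, mul_nonsing_inv_cancel_right _ _ hd]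
  rw [h2, ← Matrix.mul_assoc, ← Matrix.mul_assoc, ← intMatrix_mul, spInv_mul hN, intMatrix_one,
    Matrix.one_mul]

theorem spInv_spInv (hN : N ∈ symplecticGroup (Fin g) ℤ) : spInv (spInv N) = N :=
  congrArg Subtype.val (inv_inv (⟨N, hN⟩ : symplecticGroup (Fin g) ℤ))

theorem spAction_spInv' (hN : N ∈ symplecticGroup (Fin g) ℤ) {ω : SymCoord g}
    (hω : ω ∈ siegelSpace g) : spAction N (spAction (spInv N) ω) = ω := by
  have := spAction_spInv (spInv_mem hN) hω
  rwa [spInv_spInv hN] at this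

theorem differentiable_mul_entry {E : Type} [NormedAddCommGroup E] [NormedSpace ℂ E] {U : Set E}
    {l m n : Type*} [Fintype m] {A : E → Matrix l m ℂ} {B : E → Matrix m n ℂ}
    (hA : ∀ i j, DifferentiableOn ℂ (fun x => A x i j) U)
    (hB : ∀ i j, DifferentiableOn ℂ (fun x => B x i j) U) (i : l) (j : n) :
    DifferentiableOn ℂ (fun x => (A x * B x) i j) U := by
  simp only [mul_apply]
  exact DifferentiableOn.fun_sum fun k _ => (hA i k).mul (hB k j)

theorem differentiable_det {E : Type} [NormedAddCommGroup E] [NormedSpace ℂ E] {U : Set E}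
    {n : Type*} [Fintype n] [DecidableEq n] {A : E → Matrix n n ℂ}
    (hA : ∀ i j, DifferentiableOn ℂ (fun x => A x i j) U) :
    DifferentiableOn ℂ (fun x => (A x).det) U := by
  simp only [det_apply]
  refine DifferentiableOn.fun_sum fun σ _ => ?_
  have : ∀ s : Finset n, DifferentiableOn ℂ (fun x => ∏ i ∈ s, A x (σ i) i) U := by
    intro s
    induction s using Finset.induction_on with
    | empty => simpa using differentiableOn_const 1
    | insert i s hi ih =>
      simp only [Finset.prod_insert hi]
      exact (hA _ _).mul ih
  replace this := this Finset.univ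
  rcases Int.units_eq_one_or (Equiv.Perm.sign σ) with h | h <;> rw [h]
  · simpa using this
  · simpa using this.neg

theorem differentiable_inv_entry {E : Type} [NormedAddCommGroup E] [NormedSpace ℂ E] {U : Set E}
    {n : Type*} [Fintype n] [DecidableEq n] {A : E → Matrix n n ℂ}
    (hA : ∀ i j, DifferentiableOn ℂ (fun x => A x i j) U) (hd : ∀ x ∈ U, (A x).det ≠ 0) (i j : n) :
    DifferentiableOn ℂ (fun x => (A x)⁻¹ i j) U := by
  simp only [inv_def, Matrix.smul_apply, smul_eq_mul, Ring.inverse_eq_inv']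
  refine ((differentiable_det hA).inv hd).mul ?_
  simp only [adjugate_apply]
  refine differentiable_det fun k l => ?_
  simp only [updateRow_apply]
  split_ifs
  · exact differentiableOn_const _
  · exact hA k l

theorem differentiable_periodMatrix (U : Set (SymCoord g)) (s : Fin g ⊕ Fin g) (j : Fin g) :
    DifferentiableOn ℂ (fun ω : SymCoord g => periodMatrix ω s j) U := by
  rcases s with i | i
  · change DifferentiableOn ℂ (fun ω : SymCoord g => ω s(i, j)) U
    fun_prop
  · change DifferentiableOn ℂ (fun ω : SymCoord g => (1 : Matrix (Fin g) (Fin g) ℂ) i j) U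
    exact differentiableOn_const _

theorem differentiable_lattice_mul (U : Set (SymCoord g))
    (N : Matrix (Fin g ⊕ Fin g) (Fin g ⊕ Fin g) ℤ) (s : Fin g ⊕ Fin g) (j : Fin g) :
    DifferentiableOn ℂ (fun ω : SymCoord g => (intMatrix N * periodMatrix ω) s j) U :=
  differentiable_mul_entry (A := fun _ : SymCoord g => intMatrix N)
    (B := fun ω : SymCoord g => periodMatrix ω) (fun _ _ => differentiableOn_const _)
    (fun s j => differentiable_periodMatrix U s j) s j

theorem differentiableOn_spAction (hN : N ∈ symplecticGroup (Fin g) ℤ) :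
    DifferentiableOn ℂ (spAction N) (siegelSpace g) := by
  refine differentiableOn_pi.2 fun p => ?_
  exact differentiable_mul_entry (fun i j => differentiable_lattice_mul _ N (Sum.inl i) j)
    (differentiable_inv_entry (fun i j => differentiable_lattice_mul _ N (Sum.inr i) j)
      fun ω hω => lowerPeriods_det_ne_zero hN hω) _ _

/-- The period matrices with an endomorphism acting as `P` on the lattice. -/
def projLocus (P : Matrix (Fin g ⊕ Fin g) (Fin g ⊕ Fin g) ℤ) : Set (SymCoord g) :=
  {ω | ω ∈ siegelSpace g ∧ ∃ K, IsPeriodAction P ω K}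

theorem spAction_mem_projLocus (hN : N ∈ symplecticGroup (Fin g) ℤ)
    {P Q : Matrix (Fin g ⊕ Fin g) (Fin g ⊕ Fin g) ℤ} (h : N * P = Q * N) {ω : SymCoord g}
    (hω : ω ∈ projLocus P) : spAction N ω ∈ projLocus Q := by
  obtain ⟨hω, K, hK⟩ := hω
  refine ⟨spAction_mem hN hω, lowerPeriods N ω * K * (lowerPeriods N ω)⁻¹, ?_⟩
  have hd := (lowerPeriods_det_ne_zero hN hω).isUnit
  have h1 := intMatrix_mul_periodMatrix_eq hN hω
  have h2 : periodMatrix (spAction N ω) =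
      intMatrix N * periodMatrix ω * (lowerPeriods N ω)⁻¹ := by
    rw [h1, mul_nonsing_inv_cancel_right _ _ hd]
  rw [IsPeriodAction] at *
  calc intMatrix Q * periodMatrix (spAction N ω)
      = intMatrix N * (intMatrix P * periodMatrix ω) * (lowerPeriods N ω)⁻¹ := by
        rw [h2, ← Matrix.mul_assoc, ← Matrix.mul_assoc, ← intMatrix_mul, ← h, intMatrix_mul,
          Matrix.mul_assoc (intMatrix N)]
    _ = _ := by
        rw [hK, ← Matrix.mul_assoc, h1]
        simp only [Matrix.mul_assoc]

theorem mem_projLocus_iff_spAction (hN : N ∈ symplecticGroup (Fin g) ℤ)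
    {P Q : Matrix (Fin g ⊕ Fin g) (Fin g ⊕ Fin g) ℤ} (h : N * P = Q * N) {ω : SymCoord g}
    (hω : ω ∈ siegelSpace g) : spAction N ω ∈ projLocus Q ↔ ω ∈ projLocus P := by
  refine ⟨fun h' => ?_, spAction_mem_projLocus hN h⟩
  rw [← spAction_spInv hN hω]
  refine spAction_mem_projLocus (spInv_mem hN) ?_ h'
  calc spInv N * Q = spInv N * (Q * N) * spInv N := by
        rw [Matrix.mul_assoc, Matrix.mul_assoc, mul_spInv hN, Matrix.mul_one]
    _ = P * spInv N := by rw [← h, ← Matrix.mul_assoc, spInv_mul hN, Matrix.one_mul]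

end SymplecticAction

/-! ### Elliptic loci: orthogonality and local finiteness. -/

section ProjectionLoci

open Matrix

variable {g : ℕ} {P Q : Matrix (Fin g ⊕ Fin g) (Fin g ⊕ Fin g) ℤ} {ω : SymCoord g}

theorem isPeriodAction_iff {K : Matrix (Fin g) (Fin g) ℂ} :
    IsPeriodAction P ω K ↔ upperPeriods P ω = ω.toMatrix * K ∧ lowerPeriods P ω = K := by
  rw [IsPeriodAction, intMatrix_mul_periodMatrix, periodMatrix, fromRows_mul, fromRows_inj.eq_iff,
    Matrix.one_mul]

theorem mem_projLocus_iff : ω ∈ projLocus P ↔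
    ω ∈ siegelSpace g ∧ upperPeriods P ω = ω.toMatrix * lowerPeriods P ω := by
  refine and_congr_right fun _ => ⟨?_, fun h => ⟨_, isPeriodAction_iff.2 ⟨h, rfl⟩⟩⟩
  rintro ⟨K, hK⟩
  obtain ⟨h1, rfl⟩ := isPeriodAction_iff.1 hK
  exact h1

theorem isAnalyticSubset_projLocus (P : Matrix (Fin g ⊕ Fin g) (Fin g ⊕ Fin g) ℤ) :
    IsAnalyticSubset (siegelSpace g) (projLocus P) := by
  refine .of_fintype (fun ω hω => hω.1) fun p hp => ⟨siegelSpace g, isOpen_siegelSpace, hp,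
    subset_rfl, Fin g × Fin g, inferInstance, fun i ω => upperPeriods P ω i.1 i.2 -
      (ω.toMatrix * lowerPeriods P ω) i.1 i.2, fun i => ?_, fun q hq => ?_⟩
  · exact (differentiable_lattice_mul _ P (Sum.inl i.1) i.2).sub
      (differentiable_mul_entry (A := fun ω : SymCoord g => ω.toMatrix)
        (fun j k => differentiable_periodMatrix _ (Sum.inl j) k)
        (fun j k => differentiable_lattice_mul _ P (Sum.inr j) k) i.1 i.2)
  · rw [mem_projLocus_iff]
    constructor
    · rintro ⟨-, h⟩ i
      change upperPeriods P q i.1 i.2 - (q.toMatrix * lowerPeriods P q) i.1 i.2 = 0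
      rw [h, sub_self]
    · intro h
      exact ⟨hq, Matrix.ext fun j k => sub_eq_zero.1 (h (j, k))⟩

theorem IsPeriodAction.latticeVec_vecMul {K : Matrix (Fin g) (Fin g) ℂ} (hK : IsPeriodAction P ω K)
    (hω : ω ∈ siegelSpace g) (x : Fin g ⊕ Fin g → ℤ) :
    latticeVec hω (x ᵥ* P) = latticeVec hω x ᵥ* K := by
  have h : ∀ x : Fin g ⊕ Fin g → ℤ, latticeVec hω x = (fun s => (x s : ℂ)) ᵥ* periodMatrix ω := by
    intro x
    rw [latticeVec_apply, ← vecMul_periodMatrix]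
    simp
  rw [h, h, Matrix.vecMul_vecMul, ← (show _ = _ from hK), ← Matrix.vecMul_vecMul]
  congr 1
  ext t
  simp [vecMul, dotProduct]

theorem polForm_latticeVec (hω : ω ∈ siegelSpace g) (x y : Fin g ⊕ Fin g → ℤ) :
    polForm hω (latticeVec hω x) (latticeVec hω y) = -(sympForm x y : ℝ) := by
  rw [polForm_apply, latFst_latticeVec, latFst_latticeVec, latSnd_latticeVec, latSnd_latticeVec,
    sympForm_eq, dotProduct, dotProduct, ← Finset.sum_sub_distrib]
  push_cast
  rw [← Finset.sum_neg_distrib]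
  exact Finset.sum_congr rfl fun _ _ => by ring

theorem latticeVec_injective (hω : ω ∈ siegelSpace g) : Function.Injective (latticeVec hω) := by
  rw [injective_iff_map_eq_zero]
  intro x hx
  rw [latticeVec_apply] at hx
  ext s
  simpa using Fintype.linearIndependent_iff.1 (periodBasis hω).linearIndependent _ hx s

theorem IsPeriodAction.polForm_vecMul {K : Matrix (Fin g) (Fin g) ℂ} (hK : IsPeriodAction P ω K)
    (hP : IsLatticeProj P) (hω : ω ∈ siegelSpace g) (z w : Fin g → ℂ) :
    polForm hω (z ᵥ* K) w = polForm hω z (w ᵥ* K) := by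
  set R : (Fin g → ℂ) →ₗ[ℝ] (Fin g → ℂ) := (vecMulLinear K).restrictScalars ℝ with hR
  have h : (polForm hω).compl₁₂ R LinearMap.id = (polForm hω).compl₁₂ LinearMap.id R := by
    refine LinearMap.ext_basis (periodBasis hω) (periodBasis hω) fun s t => ?_
    have h1 : ∀ s, R (periodBasis hω s) = latticeVec hω (Pi.single s 1 ᵥ* P) := by
      intro s
      rw [hK.latticeVec_vecMul hω, latticeVec_single]
      rfl
    simp only [LinearMap.compl₁₂_apply, h1, LinearMap.id_apply]
    rw [← latticeVec_single, ← latticeVec_single, polForm_latticeVec, polForm_latticeVec,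
      hP.sympForm_vecMul]
  exact LinearMap.congr_fun (LinearMap.congr_fun h z) w

theorem IsPeriodAction.mul_self {K : Matrix (Fin g) (Fin g) ℂ} (hK : IsPeriodAction P ω K)
    (hP : IsLatticeProj P) : K * K = K := by
  have := hK.mul hK
  rw [hP.mul_self] at this
  rw [this.eq_lowerPeriods, ← hK.eq_lowerPeriods]

/-- The Hermitian norm belonging to the polarization. -/
def polNorm (hω : ω ∈ siegelSpace g) (z : Fin g → ℂ) : ℝ := polForm hω (Complex.I • z) z

theorem polNorm_nonneg (hω : ω ∈ siegelSpace g) (z : Fin g → ℂ) : 0 ≤ polNorm hω z := by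
  rcases eq_or_ne z 0 with rfl | hz
  · simp [polNorm]
  · exact (polForm_pos hω hz).le

theorem eq_zero_of_polNorm (hω : ω ∈ siegelSpace g) {z : Fin g → ℂ} (h : polNorm hω z = 0) :
    z = 0 := by
  by_contra hz
  exact (polForm_pos hω hz).ne' h

/-- Pythagoras: the image and the kernel of a self-adjoint idempotent are orthogonal for the
Hermitian form. -/
theorem IsPeriodAction.polNorm_eq {K : Matrix (Fin g) (Fin g) ℂ} (hK : IsPeriodAction P ω K)
    (hP : IsLatticeProj P) (hω : ω ∈ siegelSpace g) (z : Fin g → ℂ) :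
    polNorm hω z = polNorm hω (z ᵥ* K) + polNorm hω (z - z ᵥ* K) := by
  have hE := hK.polForm_vecMul hP hω
  have h0 : (z - z ᵥ* K) ᵥ* K = 0 := by
    rw [sub_vecMul, Matrix.vecMul_vecMul, hK.mul_self hP, sub_self]
  have h1 : polForm hω (Complex.I • (z ᵥ* K)) (z - z ᵥ* K) = 0 := by
    rw [← smul_vecMul, hE, h0, map_zero]
  have h2 : polForm hω (Complex.I • (z - z ᵥ* K)) (z ᵥ* K) = 0 := by
    rw [← hE, smul_vecMul, h0, smul_zero, map_zero, LinearMap.zero_apply]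
  have h3 : z = z ᵥ* K + (z - z ᵥ* K) := by abel
  conv_lhs => rw [h3]
  simp only [polNorm, smul_add, map_add, LinearMap.add_apply, h1, h2]
  ring

/-- Two decompositions off an elliptic curve are equal or orthogonal. -/
theorem eq_or_orthogonal_of_mem_projLocus (hP : IsLatticeProj P) (hPt : P.trace = 2)
    (hQ : IsLatticeProj Q) (hQt : Q.trace = 2) (h : ω ∈ projLocus P) (h' : ω ∈ projLocus Q) :
    P = Q ∨ P * Q = 0 := by
  obtain ⟨hω, K, hK⟩ := h
  obtain ⟨-, L, hL⟩ := h'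
  obtain ⟨e, f, he, hf, hef⟩ := hQ.exists_pair (by rintro rfl; simp at hQt)
  have hQef := hQ.eq_pairProj hQt he hf hef
  -- The compression of `P` to the hyperbolic plane of `Q` is multiplication by this integer: by
  -- self-adjointness `x ᵥ* P` pairs to zero with `x`, so no off-diagonal terms occur.
  set c := sympForm f (e ᵥ* P) with hc
  have hself : ∀ x, sympForm (x ᵥ* P) x = 0 := by
    intro x
    rw [← hP.vecMul_vecMul, hP.sympForm_vecMul, sympForm_self]
  have he' : e ᵥ* P ᵥ* Q = c • e := by
    rw [hQef, vecMul_pairProj, hself, zero_smul, add_zero]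
  have hf' : f ᵥ* P ᵥ* Q = c • f := by
    rw [hQef, vecMul_pairProj, sympForm_swap f (f ᵥ* P), hself, hP.sympForm_vecMul, ← hc]
    simp
  have key : ∀ x, x ᵥ* Q = x → x ᵥ* P ᵥ* Q = c • x →
      polNorm hω (latticeVec hω x ᵥ* K) = c * polNorm hω (latticeVec hω x) := by
    intro x hx hx'
    have h1 : latticeVec hω x ᵥ* L = latticeVec hω x := by rw [← hL.latticeVec_vecMul hω, hx]
    have h2 : latticeVec hω x ᵥ* K ᵥ* L = (c : ℝ) • latticeVec hω x := by
      rw [← hK.latticeVec_vecMul hω, ← hL.latticeVec_vecMul hω, hx', map_smul,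
        Int.cast_smul_eq_zsmul]
    have h3 : latticeVec hω x ᵥ* K ᵥ* K = latticeVec hω x ᵥ* K := by
      rw [Matrix.vecMul_vecMul, hK.mul_self hP]
    calc polNorm hω (latticeVec hω x ᵥ* K)
        = polForm hω (Complex.I • (latticeVec hω x ᵥ* K)) (latticeVec hω x ᵥ* L) := by
          rw [polNorm, ← hK.polForm_vecMul hP, smul_vecMul, h3, h1]
      _ = c * polNorm hω (latticeVec hω x) := by
          rw [← hL.polForm_vecMul hQ, smul_vecMul, h2, smul_comm, map_smul, LinearMap.smul_apply,
            smul_eq_mul, polNorm]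
  have hpos : 0 < polNorm hω (latticeVec hω e) := by
    refine polForm_pos hω fun h => ?_
    have : e = 0 := latticeVec_injective hω (by rw [h, map_zero])
    rw [this, sympForm] at hef
    simp at hef
  have ke := key e he he'
  have kf := key f hf hf'
  have he2 := hK.polNorm_eq hP hω (latticeVec hω e)
  have hf2 := hK.polNorm_eq hP hω (latticeVec hω f)
  have hc0 : 0 ≤ c := by
    have h1 := polNorm_nonneg hω (latticeVec hω e ᵥ* K)
    rw [ke] at h1
    exact_mod_cast nonneg_of_mul_nonneg_left h1 hpos
  have hc1 : c ≤ 1 := by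
    have h1 := polNorm_nonneg hω (latticeVec hω e - latticeVec hω e ᵥ* K)
    have h2 : (c : ℝ) * polNorm hω (latticeVec hω e) ≤ 1 * polNorm hω (latticeVec hω e) := by
      rw [← ke]; linarith
    exact_mod_cast le_of_mul_le_mul_right h2 hpos
  -- An orthogonal projection scales the squared norm of `e` by a factor between `0` and `1`, and
  -- this factor is the integer `c`. The extreme cases mean that `P` kills the plane of `Q` or fixes
  -- it.
  have hc01 : c = 0 ∨ c = 1 := by omega
  rcases hc01 with h0 | h1
  · right
    have hz : ∀ x, polNorm hω (latticeVec hω x ᵥ* K) = c * polNorm hω (latticeVec hω x) →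
        x ᵥ* P = 0 := by
      intro x hx
      rw [h0, Int.cast_zero, zero_mul] at hx
      have := eq_zero_of_polNorm hω hx
      rw [← hK.latticeVec_vecMul hω] at this
      exact latticeVec_injective hω (by rw [this, map_zero])
    refine hP.mul_eq_zero hQ (matrix_eq_of_vecMul_eq fun x => ?_)
    rw [← Matrix.vecMul_vecMul, hQef, vecMul_pairProj, add_vecMul, smul_vecMul, smul_vecMul,
      hz e ke, hz f kf]
    simp
  · left
    have hz : ∀ x, polNorm hω (latticeVec hω x ᵥ* K) = c * polNorm hω (latticeVec hω x) →
        polNorm hω (latticeVec hω x) = polNorm hω (latticeVec hω x ᵥ* K) +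
          polNorm hω (latticeVec hω x - latticeVec hω x ᵥ* K) → x ᵥ* P = x := by
      intro x hx hx'
      rw [h1, Int.cast_one, one_mul] at hx
      have := eq_zero_of_polNorm hω (z := latticeVec hω x - latticeVec hω x ᵥ* K) (by linarith)
      rw [← hK.latticeVec_vecMul hω, sub_eq_zero] at this
      exact (latticeVec_injective hω this).symm
    refine eq_of_latticeProj_of_le hP hQ (matrix_eq_of_vecMul_eq fun x => ?_) (hPt.trans hQt.symm)
    rw [← Matrix.vecMul_vecMul, hQef, vecMul_pairProj, add_vecMul, smul_vecMul, smul_vecMul,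
      hz e ke he2, hz f kf hf2]

/-! ### Bounds for lattice projections near a given period matrix. -/

section LocalFiniteness

theorem abs_dotProduct_le (x y : Fin g → ℝ) : |x ⬝ᵥ y| ≤ g * ‖x‖ * ‖y‖ := by
  calc |x ⬝ᵥ y| ≤ ∑ j, |x j * y j| := Finset.abs_sum_le_sum_abs _ _
    _ ≤ ∑ _j : Fin g, ‖x‖ * ‖y‖ := Finset.sum_le_sum fun j _ => by
        rw [abs_mul]
        exact mul_le_mul (norm_le_pi_norm x j) (norm_le_pi_norm y j) (abs_nonneg _) (norm_nonneg _)
    _ = g * ‖x‖ * ‖y‖ := by simp [mul_assoc]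

theorem imForm_eq_dotProduct (ω : SymCoord g) (v : Fin g → ℝ) :
    imForm ω v = v ⬝ᵥ imMatrix ω *ᵥ v := by
  simp [imForm, imMatrix, dotProduct, mulVec, SymCoord.toMatrix, Finset.mul_sum, mul_assoc]

/-- The lower bound also controls `‖t‖` by the image of `t` under the imaginary part of `ω`. This
bounds the polarization norm from above without inverting that matrix. -/
theorem mul_imForm_le {c : ℝ} (hc : 0 < c) (h : ∀ v, c * ‖v‖ ^ 2 ≤ imForm ω v)
    (t : Fin g → ℝ) : c * imForm ω t ≤ g ^ 2 * ‖imMatrix ω *ᵥ t‖ ^ 2 := by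
  have h1 : imForm ω t ≤ g * ‖t‖ * ‖imMatrix ω *ᵥ t‖ := by
    rw [imForm_eq_dotProduct]
    exact (le_abs_self _).trans (abs_dotProduct_le _ _)
  have h2 : c * ‖t‖ ≤ g * ‖imMatrix ω *ᵥ t‖ := by
    rcases (norm_nonneg t).eq_or_lt with h0 | h0
    · rw [← h0]; simp; positivity
    · refine le_of_mul_le_mul_right ?_ h0
      nlinarith [h t]
  calc c * imForm ω t ≤ c * (g * ‖t‖ * ‖imMatrix ω *ᵥ t‖) := by gcongr
    _ = g * ‖imMatrix ω *ᵥ t‖ * (c * ‖t‖) := by ring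
    _ ≤ g * ‖imMatrix ω *ᵥ t‖ * (g * ‖imMatrix ω *ᵥ t‖) := by gcongr
    _ = _ := by ring

theorem norm_imMatrix_mulVec_le (ω : SymCoord g) (t : Fin g → ℝ) :
    ‖imMatrix ω *ᵥ t‖ ≤ g * ‖ω‖ * ‖t‖ := by
  refine (pi_norm_le_iff_of_nonneg (by positivity)).2 fun j => ?_
  refine (abs_dotProduct_le _ _).trans ?_
  gcongr
  refine (pi_norm_le_iff_of_nonneg (norm_nonneg _)).2 fun k => ?_
  exact (Complex.abs_im_le_norm _).trans (norm_le_pi_norm ω s(j, k))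

theorem polNorm_eq_imForm (hω : ω ∈ siegelSpace g) (z : Fin g → ℂ) :
    polNorm hω z = imForm ω (latFst hω (Complex.I • z)) + imForm ω (latFst hω z) := by
  rw [polNorm, polForm_I_smul_left, imForm_eq_dotProduct, imForm_eq_dotProduct]
  congr 2
  · ext j; rw [imMatrix_mulVec_latFst]; simp
  · ext j; rw [imMatrix_mulVec_latFst]

theorem norm_imMatrix_latFst_le (hω : ω ∈ siegelSpace g) (z : Fin g → ℂ) :
    ‖imMatrix ω *ᵥ latFst hω z‖ ≤ ‖z‖ := by
  refine (pi_norm_le_iff_of_nonneg (norm_nonneg _)).2 fun j => ?_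
  rw [imMatrix_mulVec_latFst]
  exact (Complex.abs_im_le_norm _).trans (norm_le_pi_norm z j)

theorem mul_polNorm_le (hω : ω ∈ siegelSpace g) {c : ℝ} (hc : 0 < c)
    (h : ∀ v, c * ‖v‖ ^ 2 ≤ imForm ω v) (z : Fin g → ℂ) :
    c * polNorm hω z ≤ 2 * (g ^ 2 * ‖z‖ ^ 2) := by
  have h1 := mul_imForm_le hc h (latFst hω (Complex.I • z))
  have h2 := mul_imForm_le hc h (latFst hω z)
  have h3 := norm_imMatrix_latFst_le hω (Complex.I • z)
  rw [norm_smul, Complex.norm_I, one_mul] at h3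
  have h4 := norm_imMatrix_latFst_le hω z
  have h5 : (g : ℝ) ^ 2 * ‖imMatrix ω *ᵥ latFst hω (Complex.I • z)‖ ^ 2 ≤ g ^ 2 * ‖z‖ ^ 2 := by
    gcongr
  have h6 : (g : ℝ) ^ 2 * ‖imMatrix ω *ᵥ latFst hω z‖ ^ 2 ≤ g ^ 2 * ‖z‖ ^ 2 := by gcongr
  rw [polNorm_eq_imForm, mul_add]
  linarith

theorem norm_latticeCoord_le (hω : ω ∈ siegelSpace g) {c R M : ℝ} (hc : 0 < c)
    (h : ∀ v, c * ‖v‖ ^ 2 ≤ imForm ω v) (hR : ‖ω‖ ≤ R) {z : Fin g → ℂ}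
    (hM : polNorm hω z ≤ c * M ^ 2) (hM0 : 0 ≤ M) :
    ‖latFst hω z‖ ≤ M ∧ ‖latSnd hω z‖ ≤ 3 * (g * R * M) := by
  have hR0 := (norm_nonneg _).trans hR
  rw [polNorm_eq_imForm] at hM
  have bound : ∀ t, imForm ω t ≤ c * M ^ 2 → ‖t‖ ≤ M := by
    intro t ht
    have h1 := (h t).trans ht
    exact abs_le_of_sq_le_sq' (le_of_mul_le_mul_left h1 hc) hM0 |>.2
  have b1 := bound (latFst hω (Complex.I • z)) (by linarith [imForm_nonneg hω (latFst hω z)])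
  have b2 := bound (latFst hω z) (by linarith [imForm_nonneg hω (latFst hω (Complex.I • z))])
  refine ⟨b2, ?_⟩
  have n1 : ‖imMatrix ω *ᵥ latFst hω (Complex.I • z)‖ ≤ g * R * M :=
    (norm_imMatrix_mulVec_le _ _).trans (by gcongr)
  refine (pi_norm_le_iff_of_nonneg (by positivity)).2 fun j => ?_
  have h2 := congrArg Complex.re (congrFun (latFst_latSnd hω z) j)
  have h3 : (latSnd hω z) j = (z j).re - (fun k => (ω s(j, k)).re) ⬝ᵥ latFst hω z := by
    rw [← h2]
    simp [mulVec, dotProduct, toComplexVec, SymCoord.toMatrix, Complex.re_sum]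
  have h4 : |(z j).re| ≤ g * R * M := by
    have h5 := norm_le_pi_norm (imMatrix ω *ᵥ latFst hω (Complex.I • z)) j
    rw [imMatrix_mulVec_latFst] at h5
    simp only [Pi.smul_apply, smul_eq_mul, Complex.I_mul_im, Real.norm_eq_abs] at h5
    exact h5.trans n1
  have h6 : |(fun k => (ω s(j, k)).re) ⬝ᵥ latFst hω z| ≤ g * R * M := by
    refine (abs_dotProduct_le _ _).trans ?_
    gcongr
    refine (pi_norm_le_iff_of_nonneg hR0).2 fun k => ?_
    exact (Complex.abs_re_le_norm _).trans ((norm_le_pi_norm ω s(j, k)).trans hR)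
  rw [Real.norm_eq_abs, h3]
  calc _ ≤ |(z j).re| + |(fun k => (ω s(j, k)).re) ⬝ᵥ latFst hω z| := abs_sub _ _
    _ ≤ _ := by
      have : 0 ≤ g * R * M := by positivity
      linarith

theorem finite_bounded_matrices (B : ℝ) :
    {P : Matrix (Fin g ⊕ Fin g) (Fin g ⊕ Fin g) ℤ | ∀ s t, |(P s t : ℝ)| ≤ B}.Finite := by
  have h1 : {n : ℤ | |(n : ℝ)| ≤ B}.Finite := by
    refine (Set.finite_Icc (-⌈B⌉) ⌈B⌉).subset fun n hn => ?_
    have h2 := abs_le.1 (Set.mem_ofPred_eq ▸ hn)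
    have h3 := Int.le_ceil B
    constructor
    · have : -(⌈B⌉ : ℝ) ≤ n := by linarith
      exact_mod_cast this
    · have : (n : ℝ) ≤ ⌈B⌉ := by linarith
      exact_mod_cast this
  exact Set.Finite.pi' fun s => Set.Finite.pi' fun t => h1

/-- The symmetric idempotents of rank two of the symplectic lattice. -/
abbrev EllipticProj (g : ℕ) : Type :=
  {P : Matrix (Fin g ⊕ Fin g) (Fin g ⊕ Fin g) ℤ // IsLatticeProj P ∧ P.trace = 2}

/-- The projection does not increase the Hermitian norm, so it maps the basis of periods to lattice
vectors of bounded norm. Near `ω₀` the norm controls lattice coordinates uniformly, so the integral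
entries of `P` are bounded. -/
theorem isLocallyFiniteIn_projLocus :
    IsLocallyFiniteIn (siegelSpace g) (fun P : EllipticProj g => projLocus P.1) := by
  intro ω₀ h₀
  obtain ⟨c, hc, r, hr, hlow⟩ := exists_imForm_lower h₀
  refine ⟨Metric.ball ω₀ r, Metric.isOpen_ball, Metric.mem_ball_self hr, ?_⟩
  set R := ‖ω₀‖ + r + 1 with hRdef
  have hR1 : 1 ≤ R := by have := norm_nonneg ω₀; rw [hRdef]; linarith
  -- The choice gives `c * (c * M ^ 2) = 4 g² R²`, which exceeds the bound on the norms of the basis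
  -- vectors.
  set M := 2 * (g * R) / c with hMdef
  have hM0 : 0 ≤ M := by positivity
  set B := max M (3 * (g * R * M))
  refine Set.Finite.of_finite_image (f := Subtype.val) ((finite_bounded_matrices (g := g) B).subset
    ?_) Subtype.val_injective.injOn
  rintro _ ⟨⟨P, hP, hPt⟩, ⟨ω, ⟨hω, K, hK⟩, hωr⟩, rfl⟩
  have hlow' := hlow ω hωr
  have hωR : ‖ω‖ ≤ R := by
    have h1 := norm_sub_norm_le ω ω₀
    rw [mem_ball_iff_norm] at hωr
    rw [hRdef]; linarith
  intro s
  have hs : ‖periodBasis hω s‖ ≤ R := by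
    rw [← periodMatrix_apply]
    refine (pi_norm_le_iff_of_nonneg (by linarith)).2 fun j => ?_
    rcases s with i | i
    · exact (norm_le_pi_norm ω s(i, j)).trans hωR
    · change ‖(1 : Matrix (Fin g) (Fin g) ℂ) i j‖ ≤ R
      rw [Matrix.one_apply]
      split_ifs <;> simp <;> linarith
  set z := latticeVec hω (Pi.single s 1 ᵥ* P)
  have hz : z = periodBasis hω s ᵥ* K := by
    rw [← latticeVec_single hω s, ← hK.latticeVec_vecMul hω]
  have h1 : polNorm hω z ≤ polNorm hω (periodBasis hω s) := by
    rw [hK.polNorm_eq hP hω (periodBasis hω s), ← hz]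
    linarith [polNorm_nonneg hω (periodBasis hω s - z)]
  have h2 := mul_polNorm_le hω hc hlow' (periodBasis hω s)
  have h3 : c * polNorm hω z ≤ c * (c * M ^ 2) := by
    calc c * polNorm hω z ≤ c * polNorm hω (periodBasis hω s) := by gcongr
      _ ≤ 2 * (g ^ 2 * ‖periodBasis hω s‖ ^ 2) := h2
      _ ≤ 2 * (g ^ 2 * R ^ 2) := by gcongr
      _ ≤ 4 * (g ^ 2 * R ^ 2) := by
        have : 0 ≤ (g : ℝ) ^ 2 * R ^ 2 := by positivity
        linarith
      _ = c * (c * M ^ 2) := by rw [hMdef]; field_simp; ring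
  obtain ⟨b1, b2⟩ := norm_latticeCoord_le hω hc hlow' hωR (le_of_mul_le_mul_left h3 hc) hM0
  intro t
  have hrow : Pi.single s 1 ᵥ* P = P s := single_one_vecMul s P
  rcases t with j | j
  · have h4 := (norm_le_pi_norm (latFst hω z) j).trans b1
    rw [latFst_latticeVec, hrow, Real.norm_eq_abs] at h4
    exact h4.trans (le_max_left _ _)
  · have h4 := (norm_le_pi_norm (latSnd hω z) j).trans b2
    rw [latSnd_latticeVec, hrow, Real.norm_eq_abs] at h4
    exact h4.trans (le_max_right _ _)

end LocalFiniteness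

end ProjectionLoci

/-! ### The standard elliptic loci are linear slices of Siegel space. -/

section StandardLoci

open Matrix

variable {g : ℕ}

theorem mul_periodMatrix_stdProj (i : Fin g) (ω : SymCoord g) (s : Fin g ⊕ Fin g) (k : Fin g) :
    (intMatrix (stdProj i) * periodMatrix ω) s k =
      (Sum.elim (Pi.single i 1) (Pi.single i 1) s : ℂ) * periodMatrix ω s k := by
  have : intMatrix (stdProj i) = diagonal (Sum.elim (Pi.single i (1 : ℂ)) (Pi.single i 1)) := by
    rw [intMatrix, stdProj, diagonal_map (map_zero _)]
    congr 1
    ext (s | s) <;> by_cases h : s = i <;> simp [h]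
  rw [this, diagonal_mul]

theorem mem_projLocus_stdProj {i : Fin g} {ω : SymCoord g} :
    ω ∈ projLocus (stdProj i) ↔ ω ∈ siegelSpace g ∧ ∀ j, j ≠ i → ω s(i, j) = 0 := by
  rw [mem_projLocus_iff]
  refine and_congr_right fun _ => ?_
  have hU : ∀ j k, upperPeriods (stdProj i) ω j k = (Pi.single i (1 : ℂ) : Fin g → ℂ) j * ω s(j, k) :=
    fun j k => mul_periodMatrix_stdProj i ω (Sum.inl j) k
  have hL : lowerPeriods (stdProj i) ω = diagonal (Pi.single i 1) := by
    ext j k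
    refine (mul_periodMatrix_stdProj i ω (Sum.inr j) k).trans ?_
    change (Pi.single i (1 : ℂ) : Fin g → ℂ) j * (1 : Matrix (Fin g) (Fin g) ℂ) j k = _
    rw [diagonal_apply, Matrix.one_apply]
    split_ifs <;> simp
  constructor
  · intro h j hj
    have h1 := congrFun (congrFun h i) j
    rw [hU, hL, mul_diagonal] at h1
    simpa [hj] using h1
  · intro h
    ext j k
    rw [hU, hL, mul_diagonal]
    change _ = ω s(j, k) * _
    by_cases hj : j = i
    · subst hj
      by_cases hk : k = j
      · subst hk; simp
      · simp [hk, h k hk]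
    · by_cases hk : k = i
      · subst hk; simp [hj, Sym2.eq_swap (a := j), h j hj]
      · simp [hj, hk]

/-- The space of symmetric matrices in which the `i`-th coordinate splits off. -/
def splitSubmodule (i : Fin g) : Submodule ℂ (SymCoord g) where
  carrier := {ω | ∀ j, j ≠ i → ω s(i, j) = 0}
  add_mem' h h' j hj := by rw [Pi.add_apply, h j hj, h' j hj, add_zero]
  zero_mem' _ _ := rfl
  smul_mem' c ω h j hj := by rw [Pi.smul_apply, h j hj, smul_zero]

theorem projLocus_stdProj (i : Fin g) :
    projLocus (stdProj i) = siegelSpace g ∩ splitSubmodule i := by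
  ext ω
  exact mem_projLocus_stdProj

/-- The diagonal matrix `√-1`, modified in the entry `p`. -/
def basePoint (c : Sym2 (Fin g) → ℝ) : SymCoord g := fun p => (if p.IsDiag then Complex.I else 0) + c p

theorem basePoint_mem (c : Sym2 (Fin g) → ℝ) : basePoint c ∈ siegelSpace g := by
  refine mem_siegelSpace_iff.2 fun v hv => ?_
  have h : imForm (basePoint c) v = ∑ j, v j ^ 2 := by
    rw [imForm]
    refine Finset.sum_congr rfl fun j _ => ?_
    rw [Finset.sum_eq_single j]
    · simp [basePoint]; ring
    · intro k _ hk
      simp [basePoint, hk.symm]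
    · simp
  rw [h]
  obtain ⟨j, hj⟩ := Function.ne_iff.1 hv
  exact Finset.sum_pos' (fun _ _ => sq_nonneg _) ⟨j, Finset.mem_univ _, by
    have : v j ≠ 0 := hj
    positivity⟩

theorem isIrreducibleAnalytic_projLocus_stdProj (i : Fin g) :
    IsIrreducibleAnalytic (siegelSpace g) (projLocus (stdProj i)) := by
  have han := isAnalyticSubset_projLocus (stdProj i)
  rw [projLocus_stdProj] at *
  refine isIrreducibleAnalytic_inter_submodule (fun p _ q _ => isPreconnected_siegelSpace_line p q)
    _ han ⟨basePoint 0, basePoint_mem _, fun j hj => ?_⟩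
  simp [basePoint, hj.symm]

end StandardLoci

/-! ### All elliptic loci in genus three are irreducible and determine their projections. -/

section EllipticLoci

open Matrix

variable {P Q : Matrix (Fin 3 ⊕ Fin 3) (Fin 3 ⊕ Fin 3) ℤ}

theorem projLocus_eq_preimage {g : ℕ} {N P Q : Matrix (Fin g ⊕ Fin g) (Fin g ⊕ Fin g) ℤ}
    (hN : N ∈ symplecticGroup (Fin g) ℤ) (h : N * P = Q * N) :
    projLocus P = siegelSpace g ∩ spAction N ⁻¹' projLocus Q := by
  ext ω
  constructor
  · exact fun hω => ⟨hω.1, (mem_projLocus_iff_spAction hN h hω.1).2 hω⟩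
  · exact fun hω => (mem_projLocus_iff_spAction hN h hω.1).1 hω.2

theorem exists_symplectic_one (hP : IsLatticeProj P) (hPt : P.trace = 2) :
    ∃ N ∈ symplecticGroup (Fin 3) ℤ, N * P = stdProj 0 * N := by
  obtain ⟨Q, hQ, hQt, h⟩ := exists_orthogonal_latticeProj hP hPt
  obtain ⟨N, hN, h1, -⟩ := exists_symplectic_pair hP hPt hQ hQt h
  exact ⟨N, hN, h1⟩

theorem isIrreducibleAnalytic_projLocus (hP : IsLatticeProj P) (hPt : P.trace = 2) :
    IsIrreducibleAnalytic (siegelSpace 3) (projLocus P) := by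
  obtain ⟨N, hN, h⟩ := exists_symplectic_one hP hPt
  rw [projLocus_eq_preimage hN h]
  exact (isIrreducibleAnalytic_projLocus_stdProj 0).preimage isOpen_siegelSpace
    (differentiableOn_spAction hN) (fun _ => spAction_mem hN)
    (differentiableOn_spAction (spInv_mem hN)) (fun _ => spAction_mem (spInv_mem hN))
    (fun _ => spAction_spInv hN) (fun _ => spAction_spInv' hN)

/-- At a common point different projections would be orthogonal. After both are moved to standard
position, the standard loci are visibly not contained in each other. -/
theorem eq_of_projLocus_subset (hP : IsLatticeProj P) (hPt : P.trace = 2) (hQ : IsLatticeProj Q)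
    (hQt : Q.trace = 2) (h : projLocus P ⊆ projLocus Q) : P = Q := by
  obtain ⟨ω, hω⟩ := (isIrreducibleAnalytic_projLocus hP hPt).2.1
  refine (eq_or_orthogonal_of_mem_projLocus hP hPt hQ hQt hω (h hω)).resolve_right fun h0 => ?_
  obtain ⟨N, hN, hNP, hNQ, -⟩ := exists_symplectic_pair hP hPt hQ hQt h0
  -- This matrix couples the last two coordinates, so the first one splits off and the second one
  -- does not.
  set ω' : SymCoord 3 := basePoint (Pi.single s(1, 2) 1)
  have hω' : ω' ∈ siegelSpace 3 := basePoint_mem _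
  have h1 : ω' ∈ projLocus (stdProj 0) := by
    refine mem_projLocus_stdProj.2 ⟨hω', fun j hj => ?_⟩
    fin_cases j
    · exact absurd rfl hj
    · simp [ω', basePoint]
    · simp [ω', basePoint]
  have h2 : ω' ∉ projLocus (stdProj 1) := by
    intro h
    have := (mem_projLocus_stdProj.1 h).2 2 (by decide)
    simp [ω', basePoint] at this
  have hm := spAction_mem (spInv_mem hN) hω'
  rw [← spAction_spInv' hN hω'] at h1 h2
  exact h2 ((mem_projLocus_iff_spAction hN hNQ hm).2 (h ((mem_projLocus_iff_spAction hN hNP hm).1 h1)))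

end EllipticLoci

/-! ### The reducible locus in genus three is the union of the elliptic loci. -/

section ReducibleLocus

open Matrix

variable {g : ℕ} {ω : SymCoord g}

theorem mem_span_periodBasis_iff (hω : ω ∈ siegelSpace g) (z : Fin g → ℂ) :
    z ∈ Submodule.span ℤ (Set.range (periodBasis hω)) ↔ ∃ x, z = latticeVec hω x := by
  rw [Submodule.mem_span_range_iff_exists_fun]
  simp only [latticeVec_apply, Int.cast_smul_eq_zsmul, eq_comm]

theorem mem_lattice_iff_coords (hω : ω ∈ siegelSpace g) (z : Fin g → ℂ) :
    z ∈ Submodule.span ℤ (Set.range (periodBasis hω)) ↔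
      (∀ j, ∃ n : ℤ, latFst hω z j = n) ∧ ∀ j, ∃ n : ℤ, latSnd hω z j = n := by
  rw [mem_span_periodBasis_iff]
  constructor
  · rintro ⟨x, rfl⟩
    rw [latFst_latticeVec, latSnd_latticeVec]
    exact ⟨fun j => ⟨_, rfl⟩, fun j => ⟨_, rfl⟩⟩
  · rintro ⟨h1, h2⟩
    choose n hn using h1
    choose m hm using h2
    refine ⟨Sum.elim n m, ?_⟩
    rw [latticeVec_eq, ← latFst_latSnd hω z, ← toComplexVec_intCast, ← toComplexVec_intCast]
    congr 3
    · ext j; exact hn j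
    · ext j; exact hm j

/-- The principally polarized abelian variety with period matrix `ω`. -/
def siegelPPAV (hω : ω ∈ siegelSpace g) : PPAV (Fin g → ℂ) where
  lattice := Submodule.span ℤ (Set.range (periodBasis hω))
  form := polForm hω
  form_I_smul := polForm_I_smul hω
  form_pos _ hx := polForm_pos hω hx
  exists_framing := ⟨g, periodBasis hω, rfl, polForm_periodBasis hω⟩

theorem siegelPPAV_isPeriodMatrix (hω : ω ∈ siegelSpace g) :
    (siegelPPAV hω).IsPeriodMatrix (periodBasis hω) ω.toMatrix :=
  ⟨⟨rfl, polForm_periodBasis hω⟩, LinearEquiv.refl ℂ _, periodBasis_inl hω, periodBasis_inr hω⟩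

/-- The principal submatrix of `ω` given by an injection of the index set. -/
def SymCoord.pullback {m : ℕ} (f : Fin m → Fin g) (ω : SymCoord g) : SymCoord m :=
  fun p => ω (p.map f)

theorem SymCoord.pullback_mem {m : ℕ} {f : Fin m → Fin g} (hf : Function.Injective f)
    (hω : ω ∈ siegelSpace g) : ω.pullback f ∈ siegelSpace m := by
  refine mem_siegelSpace_iff.2 fun v hv => ?_
  have h : imForm (ω.pullback f) v = imForm ω (Function.extend f v 0) := by
    have key : ∀ F : Fin g → ℝ, (∀ j, j ∉ Set.range f → F j = 0) → ∑ j, F j = ∑ j, F (f j) := by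
      intro F hF
      exact (Finset.sum_of_injOn f hf.injOn (by simp) (fun j _ hj => hF j (by simpa using hj))
        (fun _ _ => rfl)).symm
    rw [imForm, imForm, key _ fun j hj => ?_]
    · refine Finset.sum_congr rfl fun j _ => ?_
      rw [key _ fun k hk => ?_]
      · refine Finset.sum_congr rfl fun k _ => ?_
        rw [hf.extend_apply, hf.extend_apply]
        rfl
      · rw [Function.extend_apply' _ _ _ hk, Pi.zero_apply, mul_zero]
    · refine Finset.sum_eq_zero fun k _ => ?_
      rw [Function.extend_apply' _ _ _ hj, Pi.zero_apply, zero_mul, zero_mul]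
  rw [h]
  refine mem_siegelSpace_iff.1 hω _ fun h0 => hv (funext fun j => ?_)
  rw [← hf.extend_apply v 0 j, h0]
  rfl

theorem latticeVec_vecMul_symplectic {N : Matrix (Fin g ⊕ Fin g) (Fin g ⊕ Fin g) ℤ}
    (hN : N ∈ symplecticGroup (Fin g) ℤ) (hω : ω ∈ siegelSpace g) (x : Fin g ⊕ Fin g → ℤ) :
    latticeVec hω (x ᵥ* N) = latticeVec (spAction_mem hN hω) x ᵥ* lowerPeriods N ω := by
  have h : ∀ {ω : SymCoord g} (hω : ω ∈ siegelSpace g) (x : Fin g ⊕ Fin g → ℤ),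
      latticeVec hω x = (fun s => (x s : ℂ)) ᵥ* periodMatrix ω := by
    intro ω hω x
    rw [latticeVec_apply, ← vecMul_periodMatrix]
    simp
  rw [h, h, Matrix.vecMul_vecMul, ← intMatrix_mul_periodMatrix_eq hN hω, ← Matrix.vecMul_vecMul]
  congr 1
  ext t
  simp [vecMul, dotProduct]

theorem polForm_symplectic {N : Matrix (Fin g ⊕ Fin g) (Fin g ⊕ Fin g) ℤ}
    (hN : N ∈ symplecticGroup (Fin g) ℤ) (hω : ω ∈ siegelSpace g) (z w : Fin g → ℂ) :
    polForm hω (z ᵥ* lowerPeriods N ω) (w ᵥ* lowerPeriods N ω) =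
      polForm (spAction_mem hN hω) z w := by
  set R : (Fin g → ℂ) →ₗ[ℝ] (Fin g → ℂ) := (vecMulLinear (lowerPeriods N ω)).restrictScalars ℝ
  have h : (polForm hω).compl₁₂ R R = polForm (spAction_mem hN hω) := by
    refine LinearMap.ext_basis (periodBasis (spAction_mem hN hω))
      (periodBasis (spAction_mem hN hω)) fun s t => ?_
    have h1 : ∀ s, R (periodBasis (spAction_mem hN hω) s) =
        latticeVec hω (Pi.single s 1 ᵥ* N) := by
      intro s
      rw [latticeVec_vecMul_symplectic hN hω, latticeVec_single]
      rfl
    rw [LinearMap.compl₁₂_apply, h1, h1, polForm_latticeVec, ← latticeVec_single,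
      ← latticeVec_single, polForm_latticeVec]
    congr 2
    rw [sympForm, sympForm, ← dotProduct_mulVec, ← mulVec_transpose, mulVec_mulVec, mulVec_mulVec,
      SymplecticGroup.mem_iff.1 hN]
  exact LinearMap.congr_fun (LinearMap.congr_fun h z) w

theorem mem_lattice_symplectic {N : Matrix (Fin g ⊕ Fin g) (Fin g ⊕ Fin g) ℤ}
    (hN : N ∈ symplecticGroup (Fin g) ℤ) (hω : ω ∈ siegelSpace g) (z : Fin g → ℂ) :
    z ᵥ* lowerPeriods N ω ∈ Submodule.span ℤ (Set.range (periodBasis hω)) ↔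
      z ∈ Submodule.span ℤ (Set.range (periodBasis (spAction_mem hN hω))) := by
  rw [mem_span_periodBasis_iff, mem_span_periodBasis_iff]
  constructor
  · rintro ⟨x, hx⟩
    refine ⟨x ᵥ* spInv N, ?_⟩
    have h1 := latticeVec_vecMul_symplectic hN hω (x ᵥ* spInv N)
    rw [Matrix.vecMul_vecMul, spInv_mul hN, vecMul_one, ← hx] at h1
    exact vecMul_injective_of_isUnit ((isUnit_iff_isUnit_det _).2
      (lowerPeriods_det_ne_zero hN hω).isUnit) h1
  · rintro ⟨x, rfl⟩
    exact ⟨_, (latticeVec_vecMul_symplectic hN hω x).symm⟩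

/-- Splitting off the first coordinate. -/
def splitFirst (n : ℕ) : (Fin (n + 1) → ℂ) ≃ₗ[ℂ] (Fin 1 → ℂ) × (Fin n → ℂ) where
  toFun z := (fun _ => z 0, fun j => z j.succ)
  map_add' _ _ := rfl
  map_smul' _ _ := rfl
  invFun x := Fin.cons (x.1 0) x.2
  left_inv z := by ext j; refine Fin.cases ?_ (fun j => ?_) j <;> simp
  right_inv x := by
    refine Prod.ext (funext fun j => ?_) (funext fun j => ?_)
    · simp [Subsingleton.elim j 0]
    · simp

section Split

variable {n : ℕ} {ω : SymCoord (n + 1)}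

theorem pullback_zero_mem (hω : ω ∈ siegelSpace (n + 1)) : ω.pullback (fun _ : Fin 1 => 0) ∈ siegelSpace 1 :=
  SymCoord.pullback_mem (Function.injective_of_subsingleton _) hω

theorem pullback_succ_mem (hω : ω ∈ siegelSpace (n + 1)) : ω.pullback Fin.succ ∈ siegelSpace n :=
  SymCoord.pullback_mem (Fin.succ_injective n) hω

theorem splitFirst_fst (z : Fin (n + 1) → ℂ) : (splitFirst n z).1 = fun _ => z 0 := rfl

theorem splitFirst_snd (z : Fin (n + 1) → ℂ) : (splitFirst n z).2 = fun j => z j.succ := rfl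

variable (hω : ω ∈ siegelSpace (n + 1)) (h : ∀ j, j ≠ 0 → ω s(0, j) = 0)
include h

theorem lat_zero (z : Fin (n + 1) → ℂ) :
    latFst (pullback_zero_mem hω) (fun _ => z 0) = (fun _ => latFst hω z 0) ∧
      latSnd (pullback_zero_mem hω) (fun _ => z 0) = (fun _ => latSnd hω z 0) := by
  have h1 : (fun _ : Fin 1 => z 0) = (ω.pullback (fun _ : Fin 1 => 0)).toMatrix *ᵥ
      toComplexVec (fun _ => latFst hω z 0) + toComplexVec (fun _ => latSnd hω z 0) := by
    ext j
    rw [← congrFun (latFst_latSnd hω z) 0]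
    simp only [Pi.add_apply, mulVec, dotProduct, SymCoord.toMatrix, of_apply, toComplexVec,
      Fin.sum_univ_succ, SymCoord.pullback, Sym2.map_mk, h _ (Fin.succ_ne_zero _)]
    simp
  constructor
  · conv_lhs => rw [h1]
    rw [latFst_apply]
  · conv_lhs => rw [h1]
    rw [latSnd_apply]

theorem lat_succ (z : Fin (n + 1) → ℂ) :
    latFst (pullback_succ_mem hω) (fun j => z j.succ) = (fun j => latFst hω z j.succ) ∧
      latSnd (pullback_succ_mem hω) (fun j => z j.succ) = (fun j => latSnd hω z j.succ) := by
  have h1 : (fun j : Fin n => z j.succ) = (ω.pullback Fin.succ).toMatrix *ᵥ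
      toComplexVec (fun j => latFst hω z j.succ) + toComplexVec (fun j => latSnd hω z j.succ) := by
    ext j
    rw [← congrFun (latFst_latSnd hω z) j.succ]
    simp only [Pi.add_apply, mulVec, dotProduct, SymCoord.toMatrix, of_apply, toComplexVec,
      Fin.sum_univ_succ, SymCoord.pullback, Sym2.map_mk, Sym2.eq_swap (a := j.succ) (b := 0),
      h _ (Fin.succ_ne_zero _)]
    simp
  constructor
  · conv_lhs => rw [h1]
    rw [latFst_apply]
  · conv_lhs => rw [h1]
    rw [latSnd_apply]

theorem polForm_split (z w : Fin (n + 1) → ℂ) : polForm hω z w =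
    polForm (pullback_zero_mem hω) (splitFirst n z).1 (splitFirst n w).1 +
      polForm (pullback_succ_mem hω) (splitFirst n z).2 (splitFirst n w).2 := by
  simp only [splitFirst_fst, splitFirst_snd, polForm_apply, lat_zero hω h, lat_succ hω h, dotProduct, Fin.sum_univ_succ]
  simp
  ring

theorem mem_lattice_split (z : Fin (n + 1) → ℂ) :
    z ∈ Submodule.span ℤ (Set.range (periodBasis hω)) ↔
      (splitFirst n z).1 ∈ Submodule.span ℤ (Set.range (periodBasis (pullback_zero_mem hω))) ∧
      (splitFirst n z).2 ∈ Submodule.span ℤ (Set.range (periodBasis (pullback_succ_mem hω))) := by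
  simp only [splitFirst_fst, splitFirst_snd, mem_lattice_iff_coords, lat_zero hω h, lat_succ hω h, Fin.forall_fin_succ]
  simp
  tauto

end Split

/-- In standard position the period matrix is block diagonal and the torus is visibly a product. The
decomposition is pulled back by the lower block, the isomorphism of tori belonging to the symplectic
change of basis. -/
theorem projLocus_subset_reducibleLocus {P : Matrix (Fin 3 ⊕ Fin 3) (Fin 3 ⊕ Fin 3) ℤ}
    (hP : IsLatticeProj P) (hPt : P.trace = 2) : projLocus P ⊆ reducibleLocus 3 := by
  intro ω h
  obtain ⟨N, hN, hNP⟩ := exists_symplectic_one hP hPt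
  have hω := h.1
  have hω' := spAction_mem hN hω
  have h0 := (mem_projLocus_stdProj.1 (spAction_mem_projLocus hN hNP h)).2
  refine ⟨hω, _, _, _, siegelPPAV hω, periodBasis hω, siegelPPAV_isPeriodMatrix hω, _, _, _, _, _,
    _, siegelPPAV (pullback_zero_mem hω'), siegelPPAV (pullback_succ_mem hω'), inferInstance,
    inferInstance, ?_⟩
  have hd := (lowerPeriods_det_ne_zero hN hω).isUnit
  set W := lowerPeriods N ω
  have hW1 : ∀ z : Fin 3 → ℂ, z ᵥ* W⁻¹ ᵥ* W = z := fun z => by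
    rw [Matrix.vecMul_vecMul, nonsing_inv_mul _ hd, vecMul_one]
  have hW2 : ∀ z : Fin 3 → ℂ, z ᵥ* W ᵥ* W⁻¹ = z := fun z => by
    rw [Matrix.vecMul_vecMul, mul_nonsing_inv _ hd, vecMul_one]
  let e : (Fin 3 → ℂ) ≃ₗ[ℂ] (Fin 3 → ℂ) :=
    { vecMulLinear W⁻¹ with
      invFun := fun z => z ᵥ* W
      left_inv := hW1
      right_inv := hW2 }
  have he : ∀ z, e z ᵥ* W = z := hW1
  refine ⟨e.trans (splitFirst 2), fun x => ?_, fun x y => ?_⟩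
  · have h1 := mem_lattice_symplectic hN hω (e x)
    rw [he] at h1
    exact h1.trans (mem_lattice_split hω' h0 (e x))
  · have h1 := polForm_symplectic hN hω (e x) (e y)
    rw [he, he] at h1
    exact h1.trans (polForm_split hω' h0 (e x) (e y))

theorem IsPeriodAction.one_sub {P : Matrix (Fin g ⊕ Fin g) (Fin g ⊕ Fin g) ℤ}
    {K : Matrix (Fin g) (Fin g) ℂ} (hK : IsPeriodAction P ω K) :
    IsPeriodAction (1 - P) ω (1 - K) := by
  rw [IsPeriodAction] at *
  rw [intMatrix_sub, intMatrix_one, Matrix.sub_mul, hK, Matrix.mul_sub, Matrix.one_mul,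
    Matrix.mul_one]

/-- A product decomposition yields the projection to one factor, a self-adjoint idempotent of the
lattice. In dimension three one of the two factors is an elliptic curve, so either this projection
or its complement has trace two. -/
theorem reducibleLocus_subset {ω : SymCoord 3} (h : ω ∈ reducibleLocus 3) :
    ∃ P : EllipticProj 3, ω ∈ projLocus P.1 := by
  obtain ⟨hω, V, _, _, A, b, ⟨⟨hb, hbJ⟩, φ, hφl, hφr⟩, V₁, V₂, _, _, _, _, A₁, A₂, hV₁, hV₂, e,
    heL, heE⟩ := h
  have hφb : ∀ s, φ (b s) = periodBasis hω s := by
    rintro (j | j)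
    · rw [hφl, periodBasis_inl]
    · rw [hφr, periodBasis_inr]
  have hform : ∀ x y, A.form x y = polForm hω (φ x) (φ y) := by
    set R : V →ₗ[ℝ] (Fin 3 → ℂ) := φ.toLinearMap.restrictScalars ℝ
    have h1 : A.form = (polForm hω).compl₁₂ R R := by
      refine LinearMap.ext_basis b b fun s t => ?_
      have h2 : ∀ s, R (b s) = periodBasis hω s := hφb
      rw [LinearMap.compl₁₂_apply, h2, h2]
      exact congrFun (congrFun (hbJ.trans (polForm_periodBasis hω).symm) s) t
    intro x y
    rw [h1]
    rfl
  have hlat : ∀ x, x ∈ A.lattice ↔ ∃ n, φ x = latticeVec hω n := by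
    intro x
    rw [← hb, Submodule.mem_span_range_iff_exists_fun]
    refine exists_congr fun c => ?_
    rw [← φ.injective.eq_iff, map_sum, latticeVec_apply, eq_comm]
    have h2 : ∀ t, φ (c t • b t) = (c t : ℝ) • periodBasis hω t := by
      intro t
      rw [map_zsmul, hφb, Int.cast_smul_eq_zsmul]
    simp only [h2]
  set κ₀ : V →ₗ[ℂ] V := e.symm.toLinearMap ∘ₗ LinearMap.inl ℂ V₁ V₂ ∘ₗ LinearMap.fst ℂ V₁ V₂ ∘ₗ
    e.toLinearMap with hκ₀
  have hκe : ∀ x, e (κ₀ x) = ((e x).1, 0) := fun x => by simp [hκ₀]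
  set κ : (Fin 3 → ℂ) →ₗ[ℂ] (Fin 3 → ℂ) := φ.toLinearMap ∘ₗ κ₀ ∘ₗ φ.symm.toLinearMap with hκ
  have hκφ : ∀ x, κ (φ x) = φ (κ₀ x) := fun x => by simp [hκ]
  have hidem : ∀ z, κ (κ z) = κ z := by
    intro z
    obtain ⟨x, rfl⟩ := φ.surjective z
    rw [hκφ, hκφ]
    congr 1
    apply e.injective
    rw [hκe, hκe]
  obtain ⟨P, hP, hPK, hPb⟩ := exists_latticeProj hω κ hidem (fun s => by
      rw [← hφb, hκφ]
      refine (hlat _).1 ((heL _).2 ?_)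
      have h1 := (heL (b s)).1 (hb ▸ Submodule.subset_span ⟨s, rfl⟩)
      rw [hκe]
      exact ⟨h1.1, Submodule.zero_mem _⟩) (fun z w => by
      obtain ⟨x, rfl⟩ := φ.surjective z
      obtain ⟨y, rfl⟩ := φ.surjective w
      rw [hκφ, hκφ, ← hform, ← hform, heE, heE, hκe, hκe]
      simp)
  have hidem' : IsIdempotentElem κ := LinearMap.ext hidem
  have htr := trace_eq_of_isPeriodAction hω hPK
  have htr2 : (LinearMap.toMatrix' κ)ᵀ.trace = Module.finrank ℂ (LinearMap.range κ) := by
    rw [trace_transpose, ← LinearMap.IsProj.trace (LinearMap.IsIdempotentElem.isProj_range _ hidem'),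
      LinearMap.trace_eq_matrix_trace ℂ (Pi.basisFun ℂ (Fin 3)) κ]
    rfl
  have hle : Module.finrank ℂ (LinearMap.range κ) ≤ 3 := by
    simpa using Submodule.finrank_le (LinearMap.range κ)
  set n := Module.finrank ℂ (LinearMap.range κ)
  rw [htr2, Complex.natCast_re] at htr
  have htrP : P.trace = 2 * n := by exact_mod_cast htr
  -- Triviality of the projection or of its complement would make a factor zero-dimensional.
  have hP0 : P ≠ 0 := by
    rintro rfl
    obtain ⟨v, hv⟩ := exists_ne (0 : V₁)
    have hk0 : κ₀ = 0 := by
      have h1 : κ.restrictScalars ℝ = 0 := (periodBasis hω).ext fun s => by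
        rw [LinearMap.restrictScalars_apply, hPb]
        simp
      ext x
      apply φ.injective
      rw [← hκφ]
      simpa using LinearMap.congr_fun h1 (φ x)
    have h2 := hκe (e.symm (v, 0))
    rw [hk0, e.apply_symm_apply] at h2
    simp at h2
    exact hv (Prod.ext_iff.1 h2.symm).1
  have hP1 : 1 - P ≠ 0 := by
    intro h
    have hP1 : P = 1 := (sub_eq_zero.1 h).symm
    obtain ⟨v, hv⟩ := exists_ne (0 : V₂)
    have hk0 : κ₀ = LinearMap.id := by
      have h1 : κ.restrictScalars ℝ = LinearMap.id := (periodBasis hω).ext fun s => by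
        rw [LinearMap.restrictScalars_apply, hPb, hP1]
        simp [Matrix.one_apply]
      ext x
      apply φ.injective
      rw [← hκφ]
      simpa using LinearMap.congr_fun h1 (φ x)
    have h2 := hκe (e.symm (0, v))
    rw [hk0, LinearMap.id_apply, e.apply_symm_apply] at h2
    simp at h2
    exact hv h2
  have hn0 : n ≠ 0 := fun h => hP0 (IsLatticeProj.eq_zero_of_trace hP.mul_self (by simp [htrP, h]))
  have hn3 : n ≠ 3 := fun h => hP1 (IsLatticeProj.eq_zero_of_trace hP.one_sub.mul_self (by
    rw [trace_sub, trace_one_three, htrP, h]; rfl))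
  -- If the first factor is a surface, the complementary projection is the one onto an elliptic
  -- curve.
  have hn : n = 1 ∨ n = 2 := by omega
  rcases hn with h1 | h2
  · exact ⟨⟨P, hP, by rw [htrP, h1]; rfl⟩, hω, _, hPK⟩
  · exact ⟨⟨1 - P, hP.one_sub, by rw [trace_sub, trace_one_three, htrP, h2]; rfl⟩, hω, _,
      hPK.one_sub⟩

theorem reducibleLocus_three : reducibleLocus 3 = ⋃ P : EllipticProj 3, projLocus P.1 := by
  ext ω
  rw [Set.mem_iUnion]
  exact ⟨reducibleLocus_subset, fun ⟨P, hP⟩ => projLocus_subset_reducibleLocus P.2.1 P.2.2 hP⟩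

end ReducibleLocus

/-! ### Half-integral characteristics and the parity of theta functions. -/

section HalfCharacteristics

open Matrix

variable {g : ℕ}

/-- The real vector of representatives `0` or `1/2` of a half-period. -/
def charHalf (a : Fin g → ZMod 2) : Fin g → ℝ := fun j => ((a j).val : ℝ) / 2

/-- The theta function of characteristic `δ` on Siegel space. -/
def thetaChar (δ : ThetaChar g) : SymCoord g → (Fin g → ℂ) → ℂ :=
  thetaC (charHalf δ.fst) (charHalf δ.snd)

theorem thetaFun_toMatrix (δ : ThetaChar g) (ω : SymCoord g) (z : Fin g → ℂ) :
    thetaFun δ ω.toMatrix z = thetaChar δ ω z := by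
  rw [thetaFun, thetaChar, thetaC, thetaSeries]
  refine tsum_congr fun m => ?_
  rw [charCoeff, thetaExp_eq_dotProduct, ← Complex.exp_add]
  congr 1
  have h : ∀ j, (m j : ℂ) + halfRep (δ.fst j) =
      toComplexVec (latticeShift (charHalf δ.fst) m) j := by
    intro j
    simp only [toComplexVec, latticeShift, halfRep, charHalf]
    push_cast
    rfl
  have h' : ∀ j, halfRep (δ.snd j) = toComplexVec (charHalf δ.snd) j := by
    intro j
    simp only [toComplexVec, halfRep, charHalf]
    push_cast
    rfl
  simp only [h, h']
  generalize toComplexVec (latticeShift (charHalf δ.fst) m) = v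
  generalize toComplexVec (charHalf δ.snd) = s
  simp only [dotProduct, mulVec, mul_add, Finset.sum_add_distrib, Finset.mul_sum]
  rw [← sub_eq_zero]
  have h1 : ∀ x y w t : ℂ, x + (y + w) - (t + (x + y)) = w - t := fun x y w t => by ring
  simp only [mul_assoc]
  rw [h1, sub_eq_zero]
  exact Finset.sum_congr rfl fun _ _ => by ring

theorem mem_thetanullLocus_iff {δ : ThetaChar g} {ω : SymCoord g} :
    ω ∈ thetanullLocus δ ↔ ω ∈ siegelSpace g ∧ thetaChar δ ω 0 = 0 := by
  rw [thetanullLocus, Set.mem_ofPred_eq, thetaFun_toMatrix]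

/-- The sign of a characteristic. -/
def ThetaChar.sign (δ : ThetaChar g) : ℂ := (-1) ^ ∑ j, (δ.fst j).val * (δ.snd j).val

theorem ThetaChar.sign_eq (δ : ThetaChar g) :
    δ.IsEven ∧ δ.sign = 1 ∨ ¬ δ.IsEven ∧ δ.sign = -1 := by
  have h : δ.IsEven ↔ Even (∑ j, (δ.fst j).val * (δ.snd j).val) := by
    rw [ThetaChar.IsEven, ← ZMod.natCast_eq_zero_iff_even]
    push_cast
    simp
  rw [h, ThetaChar.sign]
  rcases Nat.even_or_odd (∑ j, (δ.fst j).val * (δ.snd j).val) with h1 | h1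
  · exact Or.inl ⟨h1, h1.neg_one_pow⟩
  · exact Or.inr ⟨Nat.not_even_iff_odd.2 h1, h1.neg_one_pow⟩

theorem exp_pi_int (n : ℤ) : Complex.exp (Real.pi * Complex.I * n) = (-1) ^ n := by
  rw [mul_comm, Complex.exp_int_mul, Complex.exp_pi_mul_I]

theorem thetaChar_neg (δ : ThetaChar g) (ω : SymCoord g) (z : Fin g → ℂ) :
    thetaChar δ ω (-z) = δ.sign * thetaChar δ ω z := by
  rw [thetaChar, thetaC, thetaSeries, thetaC, thetaSeries, ← tsum_mul_left]
  set a : Fin g → ℤ := fun j => (δ.fst j).val with ha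
  set b : Fin g → ℤ := fun j => (δ.snd j).val with hb
  -- Here `a` is twice the first half of the characteristic, so this involution of the index set
  -- sends the shifted lattice point to its negative.
  let σ : (Fin g → ℤ) ≃ (Fin g → ℤ) := ⟨fun m => -m - a, fun m => -m - a,
    fun m => by simp, fun m => by simp⟩
  rw [← σ.tsum_eq]
  refine tsum_congr fun m => ?_
  have hv : toComplexVec (latticeShift (charHalf δ.fst) (σ m)) =
      -toComplexVec (latticeShift (charHalf δ.fst) m) := by
    ext j
    simp [toComplexVec, latticeShift, charHalf, σ, ha]
    ring
  rw [charCoeff, charCoeff, thetaExp_eq_dotProduct, thetaExp_eq_dotProduct, hv]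
  have hs : δ.sign = Complex.exp (Real.pi * Complex.I * (a ⬝ᵥ b : ℤ)) := by
    rw [exp_pi_int, ThetaChar.sign, ← zpow_natCast]
    congr 1
    simp [dotProduct, ha, hb]
  have h2 : 2 * (toComplexVec (latticeShift (charHalf δ.fst) m) ⬝ᵥ toComplexVec (charHalf δ.snd)) =
      ((m ⬝ᵥ b : ℤ) : ℂ) + ((a ⬝ᵥ b : ℤ) : ℂ) / 2 := by
    simp only [dotProduct, toComplexVec, latticeShift, charHalf, Finset.mul_sum, ha, hb]
    push_cast
    rw [Finset.sum_div, ← Finset.sum_add_distrib]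
    exact Finset.sum_congr rfl fun j _ => by simp; ring
  rw [hs, ← mul_assoc, ← Complex.exp_add, ← Complex.exp_add, ← Complex.exp_add,
    Complex.exp_eq_exp_iff_exists_int]
  refine ⟨-(m ⬝ᵥ b) - a ⬝ᵥ b, ?_⟩
  simp only [neg_dotProduct, dotProduct_neg, mulVec_neg]
  push_cast at h2 ⊢
  linear_combination (-2 * Real.pi * Complex.I) * h2

theorem thetaChar_ne_zero (δ : ThetaChar g) {ω : SymCoord g} (hω : ω ∈ siegelSpace g) :
    thetaChar δ ω ≠ 0 := thetaC_ne_zero _ _ hω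

theorem thetaChar_zero_of_odd {δ : ThetaChar g} (hδ : ¬ δ.IsEven) (ω : SymCoord g) :
    thetaChar δ ω 0 = 0 := by
  have h := thetaChar_neg δ ω 0
  rw [(δ.sign_eq.resolve_left fun h => hδ h.1).2, neg_zero] at h
  linear_combination h / 2

theorem thetaP_zero_of_even {δ : ThetaChar g} (hδ : δ.IsEven) {ω : SymCoord g}
    (hω : ω ∈ siegelSpace g) (v : Fin g → ℂ) :
    thetaP (charHalf δ.fst) (charHalf δ.snd) ω v 0 = 0 := by
  have hs := (δ.sign_eq.resolve_right fun h => h.1 hδ).2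
  have h1 := hasDerivAt_thetaC (charHalf δ.fst) (charHalf δ.snd) hω 0 v 0
  have h2 := hasDerivAt_thetaC (charHalf δ.fst) (charHalf δ.snd) hω 0 (-v) 0
  have h3 : (fun t : ℂ => thetaC (charHalf δ.fst) (charHalf δ.snd) ω (0 + t • -v)) =
      fun t : ℂ => thetaC (charHalf δ.fst) (charHalf δ.snd) ω (0 + t • v) := by
    funext t
    have := thetaChar_neg δ ω (t • v)
    rw [hs, one_mul, thetaChar] at this
    rw [zero_add, zero_add, smul_neg, this]
  rw [h3] at h2
  have h4 := h1.unique h2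
  simp only [zero_smul, add_zero] at h4
  have h5 := thetaP_lin (charHalf δ.fst) (charHalf δ.snd) hω (-1) 0 v v 0
  simp only [zero_smul, add_zero, neg_smul, one_smul, zero_mul] at h5
  rw [h5] at h4
  linear_combination h4 / 2

end HalfCharacteristics

/-! ### The transformation formula under the symplectic group, up to a constant. -/

section Transformation

open Matrix

variable {g : ℕ}

/-- Reducing a characteristic modulo two does not change the multiplier, as `exp (π I n)` only
depends on the parity of `n`. -/
theorem exp_two_pi_charHalf (n : ℤ) :
    Complex.exp (2 * Real.pi * Complex.I * (((n : ZMod 2).val : ℝ) / 2 : ℝ)) =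
      Complex.exp (Real.pi * Complex.I * n) := by
  have h : (2 * Real.pi * Complex.I * (((n : ZMod 2).val : ℝ) / 2 : ℝ) : ℂ) =
      Real.pi * Complex.I * (((n : ZMod 2).val : ℤ) : ℂ) := by push_cast; ring
  rw [h, exp_pi_int, exp_pi_int]
  have h1 : ((n : ZMod 2).val : ℤ) = n % 2 := ZMod.val_intCast n
  rw [h1]
  conv_rhs => rw [← Int.emod_add_mul_ediv n 2]
  rw [zpow_add₀ (by norm_num), _root_.zpow_mul]
  norm_num

theorem exp_neg_two_pi_charHalf (n : ℤ) :
    Complex.exp (-(2 * Real.pi * Complex.I * (((n : ZMod 2).val : ℝ) / 2 : ℝ))) =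
      Complex.exp (Real.pi * Complex.I * n) := by
  rw [Complex.exp_neg, exp_two_pi_charHalf, exp_pi_int]
  rcases Int.even_or_odd n with h | h
  · simp [h.neg_one_zpow]
  · simp [h.neg_one_zpow]

variable {A B C D : Matrix (Fin g) (Fin g) ℤ}

theorem lowerPeriods_fromBlocks (ω : SymCoord g) :
    lowerPeriods (fromBlocks A B C D) ω = intMatrix C * ω.toMatrix + intMatrix D := by
  have : intMatrix (fromBlocks A B C D) =
      fromBlocks (intMatrix A) (intMatrix B) (intMatrix C) (intMatrix D) := fromBlocks_map _ _ _ _ _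
  rw [lowerPeriods, this, periodMatrix, fromBlocks_mul_fromRows, toRows₂_fromRows, Matrix.mul_one]

theorem upperPeriods_fromBlocks (ω : SymCoord g) :
    upperPeriods (fromBlocks A B C D) ω = intMatrix A * ω.toMatrix + intMatrix B := by
  have : intMatrix (fromBlocks A B C D) =
      fromBlocks (intMatrix A) (intMatrix B) (intMatrix C) (intMatrix D) := fromBlocks_map _ _ _ _ _
  rw [upperPeriods, this, periodMatrix, fromBlocks_mul_fromRows, toRows₁_fromRows, Matrix.mul_one]

theorem symplectic_block_relations (hN : fromBlocks A B C D ∈ symplecticGroup (Fin g) ℤ) :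
    C * Dᵀ = D * Cᵀ ∧ A * Dᵀ - B * Cᵀ = 1 := by
  have h := SymplecticGroup.transpose_mem hN
  rw [fromBlocks_transpose, SymplecticGroup.fromBlocks_mem_iff] at h
  simp only [transpose_transpose] at h
  exact ⟨h.2.1, h.2.2⟩

/-- The characteristic to which `δ` is transformed by a symplectic matrix with given blocks. -/
def ThetaChar.transform (δ : ThetaChar g) (A B C D : Matrix (Fin g) (Fin g) ℤ) : ThetaChar g where
  fst j := ((C j ⬝ᵥ D j + (fun k => ((δ.fst k).val : ℤ)) ⬝ᵥ D j -
    C j ⬝ᵥ (fun k => ((δ.snd k).val : ℤ)) : ℤ) : ZMod 2)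
  snd j := ((A j ⬝ᵥ B j + (fun k => ((δ.fst k).val : ℤ)) ⬝ᵥ B j -
    A j ⬝ᵥ (fun k => ((δ.snd k).val : ℤ)) : ℤ) : ZMod 2)

theorem intVec_dotProduct (m n : Fin g → ℤ) : intVec m ⬝ᵥ intVec n = ((m ⬝ᵥ n : ℤ) : ℂ) := by
  simp [dotProduct, intVec]

theorem toComplexVec_charHalf (a : Fin g → ZMod 2) :
    toComplexVec (charHalf a) = (1 / 2 : ℂ) • intVec (fun k => ((a k).val : ℤ)) := by
  ext j
  simp only [toComplexVec, charHalf, intVec, Pi.smul_apply, smul_eq_mul]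
  push_cast
  ring

theorem intMatrix_mul_add_row (ω : SymCoord g) (A B : Matrix (Fin g) (Fin g) ℤ) (j : Fin g) :
    (intMatrix A * ω.toMatrix + intMatrix B) j = ω.toMatrix *ᵥ intVec (A j) + intVec (B j) := by
  rw [← vecMul_transpose, ω.toMatrix_transpose]
  rfl

theorem thetaChar_add_lattice (δ : ThetaChar g) (ω : SymCoord g) (z : Fin g → ℂ)
    (m n : Fin g → ℤ) :
    thetaChar δ ω (z + (ω.toMatrix *ᵥ intVec m + intVec n)) =
      Complex.exp (Real.pi * Complex.I * (((fun k => ((δ.fst k).val : ℤ)) ⬝ᵥ n -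
        m ⬝ᵥ (fun k => ((δ.snd k).val : ℤ)) : ℤ) -
        (intVec m ⬝ᵥ ω.toMatrix *ᵥ intVec m + 2 * (intVec m ⬝ᵥ z)))) * thetaChar δ ω z := by
  rw [thetaChar, ← add_assoc, thetaC_add_int, thetaC_add_period, ← mul_assoc, ← Complex.exp_add,
    toComplexVec_charHalf, toComplexVec_charHalf, smul_dotProduct, dotProduct_smul,
    intVec_dotProduct, intVec_dotProduct]
  congr 2
  push_cast
  simp only [smul_eq_mul]
  ring

/-- The transform of a theta function by a symplectic matrix. -/
def thetaTransform (δ : ThetaChar g) (ω : SymCoord g) (C : Matrix (Fin g) (Fin g) ℤ)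
    (W : Matrix (Fin g) (Fin g) ℂ) (z : Fin g → ℂ) : ℂ :=
  Complex.exp (Real.pi * Complex.I * (z ⬝ᵥ intMatrix C *ᵥ (z ᵥ* W))) * thetaChar δ ω (z ᵥ* W)

/-- The map `z ↦ z ᵥ* W` carries unit vectors and columns of the new period matrix to lattice
vectors of the old one, with coordinates given by the rows of `(C, D)` and `(A, B)`. The Gaussian
factor absorbs the quadratic part of the multipliers, and the constants left over are those of the
transformed characteristic. -/
theorem isQuasiPeriodic_thetaTransform (δ : ThetaChar g)
    (hN : fromBlocks A B C D ∈ symplecticGroup (Fin g) ℤ) {ω : SymCoord g}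
    (hω : ω ∈ siegelSpace g) :
    IsQuasiPeriodic (charHalf (δ.transform A B C D).fst) (charHalf (δ.transform A B C D).snd)
      (spAction (fromBlocks A B C D) ω)
      (thetaTransform δ ω C (lowerPeriods (fromBlocks A B C D) ω)) := by
  set ω' := spAction (fromBlocks A B C D) ω
  set W := lowerPeriods (fromBlocks A B C D) ω with hW
  have hWeq := lowerPeriods_fromBlocks (A := A) (B := B) (C := C) (D := D) ω
  rw [← hW] at hWeq
  have hUW := toMatrix_spAction_mul hN hω
  rw [upperPeriods_fromBlocks, ← hW] at hUW
  obtain ⟨hCD, hAD⟩ := symplectic_block_relations hN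
  have hCD' : intMatrix C * (intMatrix D)ᵀ = intMatrix D * (intMatrix C)ᵀ := by
    rw [← intMatrix_transpose, ← intMatrix_transpose, ← intMatrix_mul, ← intMatrix_mul, hCD]
  have hAD' : intMatrix A * (intMatrix D)ᵀ - intMatrix B * (intMatrix C)ᵀ = 1 := by
    rw [← intMatrix_transpose, ← intMatrix_transpose, ← intMatrix_mul, ← intMatrix_mul,
      ← intMatrix_sub, hAD, intMatrix_one]
  -- The exponent of the Gaussian factor is thus a symmetric bilinear form, so shifting its argument
  -- produces a doubled cross term.
  have hsymm : (intMatrix C * Wᵀ)ᵀ = intMatrix C * Wᵀ := by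
    rw [hWeq]
    simp only [transpose_add, transpose_mul, transpose_transpose, ω.toMatrix_transpose,
      Matrix.mul_add, Matrix.mul_assoc, hCD']
  have hUC : (intMatrix A * ω.toMatrix + intMatrix B) * (intMatrix C)ᵀ = intMatrix A * Wᵀ - 1 := by
    rw [hWeq, transpose_add, transpose_mul, ω.toMatrix_transpose, Matrix.add_mul, Matrix.mul_add,
      ← hAD', Matrix.mul_assoc]
    abel
  set S := intMatrix C * Wᵀ with hS
  have hSz : ∀ z : Fin g → ℂ, intMatrix C *ᵥ (z ᵥ* W) = S *ᵥ z := fun z => by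
    rw [hS, ← mulVec_mulVec, mulVec_transpose]
  have hScomm : ∀ z w : Fin g → ℂ, z ⬝ᵥ S *ᵥ w = w ⬝ᵥ S *ᵥ z := fun z w => by
    rw [dotProduct_mulVec, ← mulVec_transpose, hsymm, dotProduct_comm]
  have hadd : ∀ z w : Fin g → ℂ, (z + w) ⬝ᵥ intMatrix C *ᵥ ((z + w) ᵥ* W) =
      z ⬝ᵥ intMatrix C *ᵥ (z ᵥ* W) + 2 * (z ⬝ᵥ intMatrix C *ᵥ (w ᵥ* W)) +
        w ⬝ᵥ intMatrix C *ᵥ (w ᵥ* W) := by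
    intro z w
    rw [hSz, hSz, hSz, mulVec_add, add_dotProduct, dotProduct_add, dotProduct_add, hScomm w z]
    ring
  refine ⟨?_, fun z j => ?_, fun z j => ?_⟩
  · have h1 : ContDiff ℂ 1 (fun z : Fin g → ℂ => z ᵥ* W) := by
      have : (fun z : Fin g → ℂ => z ᵥ* W) = (vecMulLinear W).toContinuousLinearMap := rfl
      rw [this]
      exact ContinuousLinearMap.contDiff _
    refine ContDiff.mul ?_ ((contDiff_thetaC _ _ hω).comp h1)
    refine ContDiff.cexp (contDiff_const.mul ?_)
    simp only [dotProduct, mulVec, vecMul]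
    fun_prop
  · have hrow : Pi.single j 1 ᵥ* W = ω.toMatrix *ᵥ intVec (C j) + intVec (D j) := by
      rw [single_one_vecMul, ← intMatrix_mul_add_row, ← hWeq]; rfl
    have e1 : z ⬝ᵥ intMatrix C *ᵥ (Pi.single j 1 ᵥ* W) = intVec (C j) ⬝ᵥ (z ᵥ* W) := by
      rw [hSz, hScomm, ← hSz, single_one_dotProduct]; rfl
    have e2 : Pi.single j 1 ⬝ᵥ intMatrix C *ᵥ (Pi.single j 1 ᵥ* W) =
        intVec (C j) ⬝ᵥ ω.toMatrix *ᵥ intVec (C j) + ((C j ⬝ᵥ D j : ℤ) : ℂ) := by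
      rw [single_one_dotProduct, ← intVec_dotProduct, ← dotProduct_add, ← hrow]; rfl
    rw [thetaTransform, thetaTransform, hadd, add_vecMul, hrow, thetaChar_add_lattice, ← hrow, e1,
      e2, charHalf, ThetaChar.transform, exp_two_pi_charHalf, ← mul_assoc, ← mul_assoc,
      ← Complex.exp_add, ← Complex.exp_add]
    congr 2
    push_cast
    ring
  · set p := ω'.toMatrix *ᵥ Pi.single j 1
    have hp : p = ω'.toMatrix j := by
      have h : ω'.toMatrix *ᵥ Pi.single j 1 = ω'.toMatrix j := by
        rw [← vecMul_transpose, ω'.toMatrix_transpose, single_one_vecMul]; rfl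
      exact h
    have hrow : p ᵥ* W = ω.toMatrix *ᵥ intVec (A j) + intVec (B j) := by
      rw [← intMatrix_mul_add_row, ← hUW, hp]; rfl
    have hCU : intMatrix C *ᵥ (p ᵥ* W) = W *ᵥ intVec (A j) - Pi.single j 1 := by
      have h1 := congrFun hUC j
      have h2 : ((intMatrix A * ω.toMatrix + intMatrix B) * (intMatrix C)ᵀ) j =
          intMatrix C *ᵥ (p ᵥ* W) := by
        rw [hrow, ← intMatrix_mul_add_row, ← vecMul_transpose]; rfl
      have h3 : (intMatrix A * Wᵀ - 1) j = W *ᵥ intVec (A j) - Pi.single j 1 := by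
        rw [← vecMul_transpose]
        ext k
        simp [Matrix.one_apply, Pi.single_apply, eq_comm, intVec, vecMul, mul_apply, dotProduct]
      rw [← h2, h1, h3]
    have e1 : z ⬝ᵥ intMatrix C *ᵥ (p ᵥ* W) = intVec (A j) ⬝ᵥ (z ᵥ* W) - z j := by
      rw [hCU, dotProduct_sub, dotProduct_single_one, dotProduct_mulVec, dotProduct_comm]
    have e2 : p ⬝ᵥ intMatrix C *ᵥ (p ᵥ* W) =
        intVec (A j) ⬝ᵥ ω.toMatrix *ᵥ intVec (A j) + ((A j ⬝ᵥ B j : ℤ) : ℂ) - ω' s(j, j) := by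
      rw [hCU, dotProduct_sub, dotProduct_single_one, dotProduct_mulVec, dotProduct_comm, hrow,
        dotProduct_add, intVec_dotProduct, hp]
      rfl
    have h6 := exp_neg_two_pi_charHalf (A j ⬝ᵥ B j + (fun k => ((δ.fst k).val : ℤ)) ⬝ᵥ B j -
      A j ⬝ᵥ (fun k => ((δ.snd k).val : ℤ)))
    rw [thetaTransform, thetaTransform, hadd, add_vecMul, hrow, thetaChar_add_lattice, ← hrow, e1,
      e2, charHalf, ThetaChar.transform, Complex.exp_sub, h6, ← Complex.exp_sub, ← mul_assoc,
      ← mul_assoc, ← Complex.exp_add, ← Complex.exp_add]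
    congr 2
    push_cast
    ring

/-- The functional equations have a space of solutions of dimension at most one, spanned by the
theta function. The constant is nonzero because the transform of a nonzero function is nonzero. -/
theorem exists_thetaTransform_eq (δ : ThetaChar g)
    (hN : fromBlocks A B C D ∈ symplecticGroup (Fin g) ℤ) {ω : SymCoord g}
    (hω : ω ∈ siegelSpace g) : ∃ c : ℂ, c ≠ 0 ∧ ∀ z,
      thetaTransform δ ω C (lowerPeriods (fromBlocks A B C D) ω) z =
        c * thetaChar (δ.transform A B C D) (spAction (fromBlocks A B C D) ω) z := by
  have hω' := spAction_mem hN hω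
  obtain ⟨c, hc⟩ := (isQuasiPeriodic_thetaTransform δ hN hω).exists_eq_const_mul
    (isQuasiPeriodic_thetaC _ _ hω') (thetaC_ne_zero _ _ hω')
  refine ⟨c, ?_, hc⟩
  rintro rfl
  obtain ⟨x, hx⟩ := Function.ne_iff.1 (thetaChar_ne_zero δ hω)
  set W := lowerPeriods (fromBlocks A B C D) ω
  have hd := (lowerPeriods_det_ne_zero hN hω).isUnit
  have h := hc (x ᵥ* W⁻¹)
  rw [thetaTransform, Matrix.vecMul_vecMul, nonsing_inv_mul _ hd, vecMul_one, zero_mul,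
    mul_eq_zero, or_iff_right (Complex.exp_ne_zero _)] at h
  exact hx h

/-- Symplectic transformations permute the even characteristics and their thetanulls. -/
theorem exists_transform_characteristic {δ : ThetaChar g} (hδ : δ.IsEven)
    {N : Matrix (Fin g ⊕ Fin g) (Fin g ⊕ Fin g) ℤ} (hN : N ∈ symplecticGroup (Fin g) ℤ) :
    ∃ δ' : ThetaChar g, δ'.IsEven ∧ ∀ ω ∈ siegelSpace g,
      (spAction N ω ∈ thetanullLocus δ' ↔ ω ∈ thetanullLocus δ) := by
  obtain ⟨A, B, C, D, rfl⟩ : ∃ A B C D, N = fromBlocks A B C D :=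
    ⟨_, _, _, _, (fromBlocks_toBlocks N).symm⟩
  refine ⟨δ.transform A B C D, ?_, fun ω hω => ?_⟩
  · have hω : basePoint 0 ∈ siegelSpace g := basePoint_mem 0
    obtain ⟨c, hc, h⟩ := exists_thetaTransform_eq δ hN hω
    -- Parity is tested at a single period matrix: the transform of an even theta function is even
    -- in `z`, hence no nonzero multiple of an odd function that is not identically zero.
    by_contra hodd
    obtain ⟨x, hx⟩ := Function.ne_iff.1 (thetaChar_ne_zero (δ.transform A B C D)
      (spAction_mem hN hω))
    have h1 := h x
    have h2 := h (-x)
    rw [thetaChar_neg, ((δ.transform A B C D).sign_eq.resolve_left fun h => hodd h.1).2,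
      thetaTransform, neg_vecMul, mulVec_neg, neg_dotProduct_neg, thetaChar_neg,
      (δ.sign_eq.resolve_right fun h => h.1 hδ).2, one_mul, ← thetaTransform, h1] at h2
    have h3 : c * thetaChar (δ.transform A B C D)
      (spAction (fromBlocks A B C D) (basePoint 0)) x = 0 := by linear_combination h2 / 2
    exact (mul_ne_zero hc hx) h3
  · obtain ⟨c, hc, h⟩ := exists_thetaTransform_eq δ hN hω
    have h0 := h 0
    rw [thetaTransform, zero_vecMul, zero_dotProduct, mul_zero, Complex.exp_zero, one_mul] at h0
    rw [mem_thetanullLocus_iff, mem_thetanullLocus_iff, h0]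
    simp [hω, spAction_mem hN hω, hc]

end Transformation

/-! ### Theta functions and their derivatives at split period matrices. -/

section SplitTheta

variable {n : ℕ} {i : Fin (n + 1)} {ω : SymCoord (n + 1)}

theorem thetaExp_split (h : ∀ j, j ≠ i → ω s(i, j) = 0) (v : Fin (n + 1) → ℝ)
    (z : Fin (n + 1) → ℂ) :
    thetaExp v (ω, z) =
      thetaExp (fun _ => v i) (ω.pullback fun _ : Fin 1 => i, fun _ => z i) +
        thetaExp (fun j => v (i.succAbove j))
          (ω.pullback i.succAbove, fun j => z (i.succAbove j)) := by
  simp only [thetaExp_apply, Fin.sum_univ_succAbove _ i, SymCoord.pullback, Sym2.map_mk,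
    Finset.univ_unique, Finset.sum_singleton, h _ (Fin.succAbove_ne i _),
    Sym2.eq_swap (a := i.succAbove _) (b := i), mul_zero, Finset.sum_const_zero, zero_add,
    add_zero]
  ring

theorem charCoeff_eq_exp_thetaExp {g : ℕ} (u s : Fin g → ℝ) (m : Fin g → ℤ) :
    charCoeff u s m = Complex.exp (thetaExp (latticeShift u m) (0, toComplexVec s)) := by
  rw [charCoeff, thetaExp_eq_dotProduct]
  have : (0 : SymCoord g).toMatrix = 0 := rfl
  rw [this, Matrix.zero_mulVec, dotProduct_zero]
  congr 1
  ring

theorem charCoeff_split (i : Fin (n + 1)) (u s : Fin (n + 1) → ℝ) (m : Fin (n + 1) → ℤ) :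
    charCoeff u s m = charCoeff (fun _ : Fin 1 => u i) (fun _ => s i) (fun _ => m i) *
      charCoeff (fun j => u (i.succAbove j)) (fun j => s (i.succAbove j))
        (fun j => m (i.succAbove j)) := by
  simp only [charCoeff_eq_exp_thetaExp, ← Complex.exp_add]
  rw [thetaExp_split (i := i) (fun _ _ => rfl)]
  rfl

/-- A theta series at a split period matrix with coefficients of product form is a product. -/
theorem thetaSeries_split (hω : ω ∈ siegelSpace (n + 1)) (h : ∀ j, j ≠ i → ω s(i, j) = 0)
    (u : Fin (n + 1) → ℝ) {a : (Fin (n + 1) → ℤ) → ℂ} {b : (Fin 1 → ℤ) → ℂ}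
    {c : (Fin n → ℤ) → ℂ} (hb : PolyGrowth b) (hc : PolyGrowth c)
    (ha : ∀ m, a m = b (fun _ => m i) * c (fun j => m (i.succAbove j))) :
    thetaSeries u a (ω, 0) =
      thetaSeries (fun _ => u i) b (ω.pullback fun _ : Fin 1 => i, 0) *
        thetaSeries (fun j => u (i.succAbove j)) c (ω.pullback i.succAbove, 0) := by
  have hω₁ : ω.pullback (fun _ : Fin 1 => i) ∈ siegelSpace 1 :=
    SymCoord.pullback_mem (Function.injective_of_subsingleton _) hω
  have hω₂ : ω.pullback i.succAbove ∈ siegelSpace n :=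
    SymCoord.pullback_mem Fin.succAbove_right_injective hω
  rw [thetaSeries, thetaSeries, thetaSeries,
    tsum_mul_tsum_of_summable_norm (summable_norm_thetaSeries _ hb hω₁)
      (summable_norm_thetaSeries _ hc hω₂),
    ← ((Equiv.funUnique (Fin 1) ℤ).symm.prodCongr (Equiv.refl _)).tsum_eq,
    ← (Fin.insertNthEquiv (fun _ => ℤ) i).tsum_eq]
  refine tsum_congr fun x => ?_
  have h1 : (Fin.insertNthEquiv (fun _ => ℤ) i) x i = x.1 := by simp [Fin.insertNthEquiv]
  have h2 : ∀ j, (Fin.insertNthEquiv (fun _ => ℤ) i) x (i.succAbove j) = x.2 j := by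
    simp [Fin.insertNthEquiv]
  rw [ha, thetaExp_split h, Complex.exp_add]
  simp only [latticeShift, h1, h2]
  exact mul_mul_mul_comm _ _ _ _

/-- The restriction of a characteristic to a set of coordinates. -/
def ThetaChar.pull {m g : ℕ} (f : Fin m → Fin g) (δ : ThetaChar g) : ThetaChar m :=
  ⟨fun j => δ.fst (f j), fun j => δ.snd (f j)⟩

theorem ThetaChar.isEven_split (i : Fin (n + 1)) (δ : ThetaChar (n + 1)) :
    δ.IsEven ↔ ((δ.pull fun _ : Fin 1 => i).IsEven ↔ (δ.pull i.succAbove).IsEven) := by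
  have key : ∀ x y : ZMod 2, x + y = 0 ↔ (x = 0 ↔ y = 0) := by decide
  rw [ThetaChar.IsEven, ThetaChar.IsEven, ThetaChar.IsEven, Fin.sum_univ_succAbove _ i, key]
  simp [ThetaChar.pull]

/-- The derivative of a thetanull along `h`. -/
def thetaNullDeriv {g : ℕ} (δ : ThetaChar g) (ω h : SymCoord g) : ℂ :=
  thetaSeries (charHalf δ.fst) (derivCoeff (charHalf δ.fst) (h, 0)
    (charCoeff (charHalf δ.fst) (charHalf δ.snd))) (ω, 0)

/-- The derivative of a theta function at `0` with respect to a coordinate. -/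
def thetaCoordDeriv {g : ℕ} (δ : ThetaChar g) (ω : SymCoord g) (j : Fin g) : ℂ :=
  thetaP (charHalf δ.fst) (charHalf δ.snd) ω (Pi.single j 1) 0

theorem thetaChar_split (hω : ω ∈ siegelSpace (n + 1)) (h : ∀ j, j ≠ i → ω s(i, j) = 0)
    (δ : ThetaChar (n + 1)) :
    thetaChar δ ω 0 = thetaChar (δ.pull fun _ : Fin 1 => i) (ω.pullback fun _ : Fin 1 => i) 0 *
      thetaChar (δ.pull i.succAbove) (ω.pullback i.succAbove) 0 :=
  thetaSeries_split hω h _ (polyGrowth_charCoeff _ _) (polyGrowth_charCoeff _ _)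
    fun m => charCoeff_split i _ _ m

theorem thetaExp_zero_single {g : ℕ} (v : Fin g → ℝ) (j : Fin g) :
    thetaExp v (0, Pi.single j 1) = 2 * Real.pi * Complex.I * v j := by
  have : (0 : SymCoord g).toMatrix = 0 := rfl
  rw [thetaExp_eq_dotProduct, this, Matrix.zero_mulVec, dotProduct_zero, dotProduct_single, mul_one,
    toComplexVec]
  ring

theorem thetaExp_single_zero {g : ℕ} (v : Fin g → ℝ) {j k : Fin g} (hjk : j ≠ k) :
    thetaExp v (Pi.single s(j, k) 1, 0) = 2 * Real.pi * Complex.I * (v j * v k) := by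
  rw [thetaExp_apply]
  have h1 : ∀ a b : Fin g, (v a : ℂ) * v b * (Pi.single s(j, k) 1 : SymCoord g) s(a, b) =
      (if a = j then if b = k then (v j * v k : ℂ) else 0 else 0) +
        (if a = k then if b = j then (v j * v k : ℂ) else 0 else 0) := by
    intro a b
    simp only [Pi.single_apply, Sym2.eq_iff]
    by_cases h1 : a = j
    · subst h1
      by_cases h2 : b = k <;> simp [h2, hjk]
    · by_cases h2 : a = k
      · subst h2
        by_cases h3 : b = j <;> simp [h1, h3, mul_comm]
      · simp [h1, h2]
  simp only [h1, Finset.sum_add_distrib]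
  simp
  ring

theorem thetaCoordDeriv_split_fst (hω : ω ∈ siegelSpace (n + 1))
    (h : ∀ j, j ≠ i → ω s(i, j) = 0) (δ : ThetaChar (n + 1)) :
    thetaCoordDeriv δ ω i =
      thetaCoordDeriv (δ.pull fun _ : Fin 1 => i) (ω.pullback fun _ : Fin 1 => i) 0 *
        thetaChar (δ.pull i.succAbove) (ω.pullback i.succAbove) 0 := by
  refine thetaSeries_split hω h _ ((polyGrowth_charCoeff _ _).derivCoeff _ _)
    (polyGrowth_charCoeff _ _) fun m => ?_
  rw [derivCoeff, derivCoeff, charCoeff_split i, thetaExp_zero_single, thetaExp_zero_single]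
  exact mul_right_comm _ _ _

/-- An off-diagonal entry occurs twice in the symmetric matrix and so brings down `2 π I v_i v_k`,
which is the product of the factors brought down by `∂/∂z_i` and `∂/∂z_k`, divided by `2 π I`. This
is the heat equation at a point where the series factors. -/
theorem thetaNullDeriv_split (hω : ω ∈ siegelSpace (n + 1))
    (h : ∀ j, j ≠ i → ω s(i, j) = 0) (δ : ThetaChar (n + 1)) (j : Fin n) :
    thetaNullDeriv δ ω (Pi.single s(i, i.succAbove j) 1) =
      thetaCoordDeriv (δ.pull fun _ : Fin 1 => i) (ω.pullback fun _ : Fin 1 => i) 0 *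
        ((2 * Real.pi * Complex.I)⁻¹ *
          thetaCoordDeriv (δ.pull i.succAbove) (ω.pullback i.succAbove) j) := by
  have hpi : (2 * Real.pi * Complex.I : ℂ) ≠ 0 := Complex.two_pi_I_ne_zero
  have hc : ∀ {g : ℕ} (u : Fin g → ℝ) (a : (Fin g → ℤ) → ℂ) (x : SymCoord g × (Fin g → ℂ)) (c : ℂ),
      c * thetaSeries u a x = thetaSeries u (fun m => c * a m) x := by
    intro g u a x c
    rw [thetaSeries, thetaSeries, ← tsum_mul_left]
    exact tsum_congr fun m => (mul_assoc _ _ _).symm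
  rw [thetaCoordDeriv, thetaCoordDeriv, thetaP, thetaP, hc]
  refine thetaSeries_split hω h _ ((polyGrowth_charCoeff _ _).derivCoeff _ _)
    (((polyGrowth_charCoeff _ _).derivCoeff _ _).const_mul _) fun m => ?_
  rw [derivCoeff, derivCoeff, derivCoeff, charCoeff_split i, thetaExp_zero_single,
    thetaExp_zero_single, thetaExp_single_zero _ (Fin.succAbove_ne i j).symm]
  have key : ∀ x y p a b : ℂ, p ≠ 0 → a * b * (p * (x * y)) = a * (p * x) * (p⁻¹ * (b * (p * y))) :=
    fun x y p a b hp => by field_simp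
  exact key _ _ _ _ _ hpi

/-- The one-variable thetanull of even characteristic does not vanish. -/
theorem thetaChar_one_ne_zero {δ : ThetaChar 1} (hδ : δ.IsEven) {τ : SymCoord 1}
    (hτ : τ ∈ siegelSpace 1) : thetaChar δ τ 0 ≠ 0 := fun h =>
  thetaC_one_not_order_two _ _ hτ h fun v => thetaP_zero_of_even hδ hτ v

theorem thetaP_eq_zero_of_coord {g : ℕ} {δ : ThetaChar g} {ω : SymCoord g}
    (hω : ω ∈ siegelSpace g) (h : ∀ j, thetaCoordDeriv δ ω j = 0) (v : Fin g → ℂ) :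
    thetaP (charHalf δ.fst) (charHalf δ.snd) ω v 0 = 0 := by
  have h1 : ∀ v, thetaP (charHalf δ.fst) (charHalf δ.snd) ω v 0 =
      (thetaDeriv (charHalf δ.fst) (charCoeff (charHalf δ.fst) (charHalf δ.snd)) (ω, 0)).comp
        (ContinuousLinearMap.inr ℂ (SymCoord g) (Fin g → ℂ)) v := fun v =>
    thetaP_eq_thetaDeriv _ _ hω v 0
  rw [h1, ← Finset.univ_sum_single v, map_sum]
  refine Finset.sum_eq_zero fun j _ => ?_
  have h2 : (Pi.single j (v j) : Fin g → ℂ) = v j • Pi.single j 1 := by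
    rw [← Pi.single_smul', smul_eq_mul, mul_one]
  rw [h2, map_smul, ← h1]
  exact (congrArg _ (h j)).trans (smul_zero _)

/-- The one-variable theta function of odd characteristic has a simple zero. -/
theorem thetaCoordDeriv_one_ne_zero {δ : ThetaChar 1} (hδ : ¬ δ.IsEven) {τ : SymCoord 1}
    (hτ : τ ∈ siegelSpace 1) : thetaCoordDeriv δ τ 0 ≠ 0 := fun h =>
  thetaC_one_not_order_two _ _ hτ (thetaChar_zero_of_odd hδ τ)
    (thetaP_eq_zero_of_coord hτ fun j => by rwa [Subsingleton.elim j 0])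

/-- The derivative of a thetanull, as a linear functional. -/
def thetaNullFDeriv {g : ℕ} (δ : ThetaChar g) (ω : SymCoord g) : SymCoord g →L[ℂ] ℂ :=
  (thetaDeriv (charHalf δ.fst) (charCoeff (charHalf δ.fst) (charHalf δ.snd)) (ω, 0)).comp
    (ContinuousLinearMap.inl ℂ (SymCoord g) (Fin g → ℂ))

variable {g : ℕ} (δ : ThetaChar g) {ω : SymCoord g} (hω : ω ∈ siegelSpace g)
include hω

theorem thetaNullFDeriv_apply (h : SymCoord g) :
    thetaNullFDeriv δ ω h = thetaNullDeriv δ ω h :=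
  thetaDeriv_apply _ (polyGrowth_charCoeff _ _) hω _

theorem hasFDerivAt_thetaNull :
    HasFDerivAt (fun ω => thetaChar δ ω 0) (thetaNullFDeriv δ ω) ω :=
  (hasFDerivAt_thetaSeries _ (polyGrowth_charCoeff _ _) hω).comp ω
    ((hasFDerivAt_id ω).prodMk (hasFDerivAt_const (0 : Fin g → ℂ) ω))

theorem continuousAt_thetaNullFDeriv : ContinuousAt (thetaNullFDeriv δ) ω := by
  have h1 : ContinuousAt (fun ω : SymCoord g => ((ω, 0) : SymCoord g × (Fin g → ℂ))) ω := by
    fun_prop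
  have h2 : ContinuousAt (thetaDeriv (charHalf δ.fst)
    (charCoeff (charHalf δ.fst) (charHalf δ.snd))) (ω, 0) :=
    continuousAt_thetaDeriv _ (polyGrowth_charCoeff _ _) hω
  exact (h2.comp (f := fun ω : SymCoord g => ((ω, 0) : SymCoord g × (Fin g → ℂ))) h1).clm_comp
    continuousAt_const

end SplitTheta

/-! ### Transport of local structure and the local model of normal crossings. -/

section Charts

variable {g : ℕ}

/-- The local condition in the definition of a simple normal crossings divisor `D` in `X`. -/
def HasNormalCrossingsAt (X D : Set (SymCoord g)) (p : SymCoord g) : Prop :=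
  ∃ (n : ℕ) (e : OpenPartialHomeomorph (SymCoord g) (Fin n → ℂ)) (S T : Finset (Fin n)),
    IsHolomorphicChart e ∧ p ∈ e.source ∧ e p = 0 ∧ Disjoint S T ∧
    (∀ q ∈ e.source, (q ∈ X ↔ ∀ i ∈ S, e q i = 0)) ∧
    (∀ q ∈ e.source, (q ∈ D ↔ q ∈ X ∧ ∏ i ∈ T, e q i = 0))

variable {N : Matrix (Fin g ⊕ Fin g) (Fin g ⊕ Fin g) ℤ}

/-- The action of a symplectic matrix on Siegel space as an open partial homeomorphism. -/
def spHomeomorph (hN : N ∈ Matrix.symplecticGroup (Fin g) ℤ) :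
    OpenPartialHomeomorph (SymCoord g) (SymCoord g) where
  toFun := spAction N
  invFun := spAction (spInv N)
  source := siegelSpace g
  target := siegelSpace g
  map_source' _ := spAction_mem hN
  map_target' _ := spAction_mem (spInv_mem hN)
  left_inv' _ := spAction_spInv hN
  right_inv' _ := spAction_spInv' hN
  open_source := isOpen_siegelSpace
  open_target := isOpen_siegelSpace
  continuousOn_toFun := (differentiableOn_spAction hN).continuousOn
  continuousOn_invFun := (differentiableOn_spAction (spInv_mem hN)).continuousOn

theorem IsHolomorphicChart.comp_spAction (hN : N ∈ Matrix.symplecticGroup (Fin g) ℤ) {n : ℕ}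
    {e : OpenPartialHomeomorph (SymCoord g) (Fin n → ℂ)} (he : IsHolomorphicChart e) :
    IsHolomorphicChart ((spHomeomorph hN).trans e) :=
  he.comp (differentiableOn_spAction hN) (differentiableOn_spAction (spInv_mem hN))

theorem HasNormalCrossingsAt.of_spAction (hN : N ∈ Matrix.symplecticGroup (Fin g) ℤ)
    {X D X' D' : Set (SymCoord g)} {p : SymCoord g} (hp : p ∈ siegelSpace g)
    (h : HasNormalCrossingsAt X' D' (spAction N p))
    (hX : ∀ q ∈ siegelSpace g, (spAction N q ∈ X' ↔ q ∈ X))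
    (hD : ∀ q ∈ siegelSpace g, (spAction N q ∈ D' ↔ q ∈ D)) : HasNormalCrossingsAt X D p := by
  obtain ⟨n, e, S, T, he, hpe, hp0, hST, hXe, hDe⟩ := h
  refine ⟨n, (spHomeomorph hN).trans e, S, T, he.comp_spAction hN, ?_, hp0, hST, ?_, ?_⟩
  · rw [OpenPartialHomeomorph.trans_source]
    exact ⟨hp, hpe⟩
  · rw [OpenPartialHomeomorph.trans_source]
    exact fun q hq => (hX q hq.1).symm.trans (hXe _ hq.2)
  · rw [OpenPartialHomeomorph.trans_source]
    intro q hq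
    rw [← hX q hq.1, ← hD q hq.1]
    exact hDe _ hq.2

theorem IsRegularPoint.of_spAction (hN : N ∈ Matrix.symplecticGroup (Fin g) ℤ)
    {Z Z' : Set (SymCoord g)} {p : SymCoord g} (hp : p ∈ siegelSpace g)
    (h : IsRegularPoint Z' (spAction N p))
    (hZ : ∀ q ∈ siegelSpace g, (spAction N q ∈ Z' ↔ q ∈ Z)) : IsRegularPoint Z p := by
  obtain ⟨hpZ, n, e, S, he, hpe, hZe⟩ := h
  refine ⟨(hZ p hp).1 hpZ, n, (spHomeomorph hN).trans e, S, he.comp_spAction hN, ?_, ?_⟩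
  · rw [OpenPartialHomeomorph.trans_source]
    exact ⟨hp, hpe⟩
  · rw [OpenPartialHomeomorph.trans_source]
    exact fun q hq => (hZ q hq.1).symm.trans (hZe _ hq.2)

theorem IsRegularPoint.congr {E : Type} [NormedAddCommGroup E] [NormedSpace ℂ E] {Z Z' : Set E}
    {p : E} (h : IsRegularPoint Z p) {V : Set E} (hV : IsOpen V) (hp : p ∈ V)
    (hZ : ∀ q ∈ V, (q ∈ Z ↔ q ∈ Z')) : IsRegularPoint Z' p := by
  obtain ⟨hpZ, n, e, S, he, hpe, hZe⟩ := h
  refine ⟨(hZ p hp).1 hpZ, n, e.restrOpen V hV, S, ⟨?_, ?_⟩, ?_, ?_⟩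
  · rw [OpenPartialHomeomorph.restrOpen_source]
    exact he.1.mono Set.inter_subset_left
  · exact he.2.mono Set.inter_subset_left
  · rw [OpenPartialHomeomorph.restrOpen_source]
    exact ⟨hpe, hp⟩
  · rw [OpenPartialHomeomorph.restrOpen_source]
    exact fun q hq => (hZ q hq.2).symm.trans (hZe q hq.1)

theorem isRegularPoint_projLocus_stdProj {i c : Fin g} (hc : c ≠ i) {p : SymCoord g}
    (hp : p ∈ projLocus (stdProj i)) : IsRegularPoint (projLocus (stdProj i)) p := by
  obtain ⟨hpU, hp0⟩ := mem_projLocus_stdProj.1 hp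
  -- A coordinate that vanishes at `p` is replaced by itself, so the chart consists of the
  -- translated coordinates.
  obtain ⟨ε, hε, hball, e, he, hes, -, hee⟩ := exists_chart_replaceCoord (s(i, c) : Sym2 (Fin g))
    (G := fun q => q s(i, c)) (G' := fun _ => ContinuousLinearMap.proj s(i, c))
    isOpen_siegelSpace hpU (fun q _ => hasFDerivAt_apply _ q) continuousOn_const (by simp)
    (hp0 c hc)
  refine ⟨hp, _, e, (Finset.univ.filter (· ≠ i)).image
    (fun j => Fintype.equivFin (Sym2 (Fin g)) s(i, j)), he, ?_, fun q hq => ?_⟩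
  · rw [hes]
    exact Metric.mem_ball_self hε
  · rw [hes] at hq
    rw [mem_projLocus_stdProj, and_iff_right (hball hq), Finset.forall_mem_image]
    simp only [Finset.mem_filter, Finset.mem_univ, true_and, hee]
    refine forall₂_congr fun j hj => ?_
    split_ifs with h
    · rw [h]
    · rw [hp0 j hj, sub_zero]

/-- A local model: if `∂θ/∂ω_c ≠ 0` at `p` and, near `p`, `D ∩ R` contains the points with
`ω_c = ∏_{d ∈ T} ω_d = 0`, and is contained in `∏_{d ∈ T} ω_d = 0`, then `D ∩ R` has normal
crossings in the zero locus `D` of the thetanull. -/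
theorem hasNormalCrossingsAt_of_coord {δ : ThetaChar g} {R : Set (SymCoord g)} {p : SymCoord g}
    (hp : p ∈ thetanullLocus δ) {c : Sym2 (Fin g)} {T : Finset (Sym2 (Fin g))} (hcT : c ∉ T)
    (hne : thetaNullDeriv δ p (Pi.single c 1) ≠ 0) (hpc : p c = 0) (hpT : ∀ d ∈ T, p d = 0)
    (h1 : ∀ q ∈ siegelSpace g, q c = 0 → ∀ d ∈ T, q d = 0 → q ∈ thetanullLocus δ ∩ R)
    {V : Set (SymCoord g)} (hV : IsOpen V) (hpV : p ∈ V)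
    (h2 : ∀ q ∈ V, q ∈ thetanullLocus δ ∩ R → ∃ d ∈ T, q d = 0) :
    HasNormalCrossingsAt (thetanullLocus δ) (thetanullLocus δ ∩ R) p := by
  obtain ⟨hpU, hp0⟩ := mem_thetanullLocus_iff.1 hp
  obtain ⟨ε, hε, hball, e, he, hes, he0, hee⟩ := exists_chart_replaceCoord c
    (G := fun q => thetaChar δ q 0) (G' := thetaNullFDeriv δ) (isOpen_siegelSpace.inter hV)
    ⟨hpU, hpV⟩ (fun q hq => hasFDerivAt_thetaNull δ hq.1)
    (fun q hq => (continuousAt_thetaNullFDeriv δ hq.1).continuousWithinAt)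
    (by rwa [thetaNullFDeriv_apply δ hpU]) hp0
  set φ := Fintype.equivFin (Sym2 (Fin g))
  have hX : ∀ q ∈ e.source, (q ∈ thetanullLocus δ ↔ e q (φ c) = 0) := by
    intro q hq
    rw [hes] at hq
    rw [mem_thetanullLocus_iff, and_iff_right (hball hq).1, hee, if_pos rfl]
  have hT : ∀ q, ∀ d ∈ T, e q (φ d) = q d := by
    intro q d hd
    rw [hee, if_neg (fun h : d = c => hcT (h ▸ hd)), hpT d hd, sub_zero]
  refine ⟨_, e, {φ c}, T.map φ.toEmbedding, he, ?_, he0, ?_, ?_, fun q hq => ?_⟩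
  · rw [hes]
    exact Metric.mem_ball_self hε
  · rw [Finset.disjoint_singleton_left, Finset.mem_map]
    rintro ⟨d, hd, h⟩
    exact hcT (φ.injective h ▸ hd)
  · intro q hq
    rw [hX q hq]
    simp
  · rw [Finset.prod_map, Finset.prod_eq_zero_iff]
    constructor
    · intro h
      rw [hes] at hq
      obtain ⟨d, hd, hqd⟩ := h2 q (hball hq).2 h
      exact ⟨h.1, d, hd, (hT q d hd).trans hqd⟩
    · rintro ⟨hqD, d, hd, hqd⟩
      rw [Equiv.coe_toEmbedding, hT q d hd] at hqd
      -- Setting the entry `c` to zero gives a point of `D ∩ R`, by `h1`. In the chart the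
      -- coordinate at `c` is the thetanull, which vanishes at `q` and at `q'`, and the others
      -- agree; so `q = q'`.
      set q' := Function.update q c 0 with hq'
      have hqs := hq
      rw [hes] at hqs
      have hqs' : q' ∈ e.source := by
        -- Since `p c = 0`, changing the entry `c` to zero does not leave the ball for the supremum
        -- norm.
        rw [hes, Metric.mem_ball, dist_pi_lt_iff hε] at *
        intro b
        by_cases hb : b = c
        · rw [hb, hq', Function.update_self, hpc, dist_self]
          exact hε
        · rw [hq', Function.update_of_ne hb]
          exact hqs b
      have hq'U : q' ∈ siegelSpace g := (hball (hes ▸ hqs')).1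
      have hdc : d ≠ c := fun h => hcT (h ▸ hd)
      have hq'D := h1 q' hq'U (Function.update_self _ _ _) d hd
        (by rw [hq', Function.update_of_ne hdc, hqd])
      have hqq : q = q' := by
        refine e.injOn hq hqs' ?_
        ext b
        obtain ⟨b, rfl⟩ := φ.surjective b
        by_cases hb : b = c
        · rw [hb, (hX q hq).1 hqD, (hX q' hqs').1 hq'D.1]
        · rw [hee, hee, if_neg hb, if_neg hb, hq', Function.update_of_ne hb]
      rw [hqq]
      exact hq'D

end Charts

/-! ### Extending a lattice projection from a two-dimensional factor. -/

section Embedding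

open Matrix

variable {n : ℕ}

/-- The inclusion of the lattice coordinates different from the `i`-th ones. -/
def latticeIncl (i : Fin (n + 1)) : Fin n ⊕ Fin n → Fin (n + 1) ⊕ Fin (n + 1) :=
  Sum.map i.succAbove i.succAbove

theorem latticeIncl_injective (i : Fin (n + 1)) : Function.Injective (latticeIncl i) :=
  Sum.map_injective.2 ⟨Fin.succAbove_right_injective, Fin.succAbove_right_injective⟩

/-- The projection from the lattice to the coordinates different from the `i`-th ones. -/
def latticeRestrict (i : Fin (n + 1)) : Matrix (Fin n ⊕ Fin n) (Fin (n + 1) ⊕ Fin (n + 1)) ℤ :=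
  (1 : Matrix _ _ ℤ).submatrix (latticeIncl i) id

/-- The extension of a matrix by zero in the `i`-th lattice coordinates. -/
def latticeExtend (i : Fin (n + 1)) (P : Matrix (Fin n ⊕ Fin n) (Fin n ⊕ Fin n) ℤ) :
    Matrix (Fin (n + 1) ⊕ Fin (n + 1)) (Fin (n + 1) ⊕ Fin (n + 1)) ℤ :=
  (latticeRestrict i)ᵀ * P * latticeRestrict i

theorem latticeRestrict_mul {m : Type*} (i : Fin (n + 1))
    (A : Matrix (Fin (n + 1) ⊕ Fin (n + 1)) m ℤ) :
    latticeRestrict i * A = A.submatrix (latticeIncl i) id := by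
  ext s t
  simp [latticeRestrict, Matrix.mul_apply, Matrix.one_apply]

theorem latticeRestrict_mul_transpose (i : Fin (n + 1)) :
    latticeRestrict i * (latticeRestrict i)ᵀ = 1 := by
  rw [latticeRestrict_mul, latticeRestrict, transpose_submatrix, submatrix_submatrix, transpose_one]
  exact submatrix_one _ (latticeIncl_injective i)

theorem latticeRestrict_mul_J (i : Fin (n + 1)) :
    latticeRestrict i * J (Fin (n + 1)) ℤ = J (Fin n) ℤ * latticeRestrict i := by
  rw [latticeRestrict_mul]
  ext (s | s) (t | t) <;> rcases Fin.eq_self_or_eq_succAbove i t with rfl | ⟨t, rfl⟩ <;>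
  simp [Fin.succAbove_ne, J, latticeRestrict, latticeIncl, Matrix.mul_apply, Matrix.one_apply]

theorem latticeExtend_apply_inl (i : Fin (n + 1)) (P : Matrix (Fin n ⊕ Fin n) (Fin n ⊕ Fin n) ℤ) :
    latticeExtend i P (Sum.inl i) (Sum.inl i) = 0 := by
  rw [latticeExtend, Matrix.mul_apply]
  refine Finset.sum_eq_zero fun s _ => ?_
  have : latticeRestrict i s (Sum.inl i) = 0 := by
    rcases s with s | s <;> simp [latticeRestrict, latticeIncl, Matrix.one_apply, Fin.succAbove_ne]
  rw [this, mul_zero]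

theorem trace_latticeExtend (i : Fin (n + 1)) (P : Matrix (Fin n ⊕ Fin n) (Fin n ⊕ Fin n) ℤ) :
    (latticeExtend i P).trace = P.trace := by
  rw [latticeExtend, Matrix.trace_mul_cycle, latticeRestrict_mul_transpose, Matrix.one_mul]

theorem IsLatticeProj.latticeExtend {P : Matrix (Fin n ⊕ Fin n) (Fin n ⊕ Fin n) ℤ}
    (hP : IsLatticeProj P) (i : Fin (n + 1)) : IsLatticeProj (latticeExtend i P) := by
  have hJt : J (Fin (n + 1)) ℤ * (latticeRestrict i)ᵀ = (latticeRestrict i)ᵀ * J (Fin n) ℤ := by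
    have := congrArg transpose (latticeRestrict_mul_J i)
    rw [transpose_mul, transpose_mul, J_transpose, J_transpose, Matrix.neg_mul,
      Matrix.mul_neg] at this
    exact neg_injective this
  constructor
  · calc _ = (latticeRestrict i)ᵀ * (P * ((latticeRestrict i) * (latticeRestrict i)ᵀ) * P) *
        latticeRestrict i := by simp only [_root_.latticeExtend, Matrix.mul_assoc]
      _ = _ := by rw [latticeRestrict_mul_transpose, Matrix.mul_one, hP.mul_self]; rfl
  · rw [_root_.latticeExtend, Matrix.mul_assoc, latticeRestrict_mul_J, transpose_mul, transpose_mul,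
      transpose_transpose, ← Matrix.mul_assoc, ← Matrix.mul_assoc, hJt, Matrix.mul_assoc _ P,
      hP.mul_J]
    simp only [Matrix.mul_assoc]

/-- At a split period matrix the projection and inclusion of the complementary lattice coordinates
are both complex linear, so the endomorphism of the factor extends by zero. -/
theorem IsPeriodAction.latticeExtend {i : Fin (n + 1)} {ω : SymCoord (n + 1)}
    (h : ∀ j, j ≠ i → ω s(i, j) = 0) {P : Matrix (Fin n ⊕ Fin n) (Fin n ⊕ Fin n) ℤ}
    {K : Matrix (Fin n) (Fin n) ℂ} (hK : IsPeriodAction P (ω.pullback i.succAbove) K) :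
    ∃ K', IsPeriodAction (latticeExtend i P) ω K' := by
  set R : Matrix (Fin n) (Fin (n + 1)) ℂ := (1 : Matrix _ _ ℂ).submatrix i.succAbove id with hR
  have h1 : intMatrix (latticeRestrict i) * periodMatrix ω =
      periodMatrix (ω.pullback i.succAbove) * R := by
    have : intMatrix (latticeRestrict i) * periodMatrix ω =
        (periodMatrix ω).submatrix (latticeIncl i) id := by
      ext s t
      simp [latticeRestrict, Matrix.mul_apply, Matrix.one_apply]
    rw [this]
    ext (s | s) t
    · rcases Fin.eq_self_or_eq_succAbove i t with rfl | ⟨t, rfl⟩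
      · simp [hR, latticeIncl, periodMatrix, Matrix.mul_apply, SymCoord.toMatrix,
          Sym2.eq_swap (a := t.succAbove s), h _ (Fin.succAbove_ne t s), Fin.succAbove_ne]
      · simp [hR, latticeIncl, periodMatrix, Matrix.mul_apply, Matrix.one_apply, SymCoord.toMatrix,
          SymCoord.pullback]
    · simp [hR, latticeIncl, periodMatrix]
      rfl
  have h2 : intMatrix (latticeRestrict i)ᵀ * periodMatrix (ω.pullback i.succAbove) =
      periodMatrix ω * Rᵀ := by
    ext (s | s) t
    · rcases Fin.eq_self_or_eq_succAbove i s with rfl | ⟨s, rfl⟩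
      · simp [hR, latticeIncl, latticeRestrict, periodMatrix, Matrix.mul_apply, Matrix.one_apply,
          SymCoord.toMatrix, h _ (Fin.succAbove_ne s t)]
      · simp [hR, latticeIncl, latticeRestrict, periodMatrix, Matrix.mul_apply, Matrix.one_apply,
          SymCoord.toMatrix, SymCoord.pullback]
    · rcases Fin.eq_self_or_eq_succAbove i s with rfl | ⟨s, rfl⟩ <;>
      simp [hR, latticeIncl, latticeRestrict, periodMatrix, Matrix.mul_apply, Matrix.one_apply,
        Fin.ne_succAbove]
  refine ⟨Rᵀ * (K * R), ?_⟩
  rw [IsPeriodAction] at hK ⊢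
  rw [_root_.latticeExtend, intMatrix_mul, intMatrix_mul, Matrix.mul_assoc, h1, Matrix.mul_assoc,
    ← Matrix.mul_assoc _ _ R, hK, ← Matrix.mul_assoc, ← Matrix.mul_assoc, h2]
  simp only [Matrix.mul_assoc]

/-- If a theta function of a two-dimensional factor vanishes to order two, the period matrix lies on
an elliptic locus other than the given one. -/
theorem exists_projLocus_of_order_two {i : Fin 3} {ω : SymCoord 3}
    (hω : ω ∈ projLocus (stdProj i)) {β : ThetaChar 2}
    (h0 : thetaChar β (ω.pullback i.succAbove) 0 = 0)
    (h1 : ∀ j, thetaCoordDeriv β (ω.pullback i.succAbove) j = 0) :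
    ∃ Q : EllipticProj 3, ω ∈ projLocus Q.1 ∧ Q.1 ≠ stdProj i := by
  obtain ⟨hωU, hs⟩ := mem_projLocus_stdProj.1 hω
  have hΩ : ω.pullback i.succAbove ∈ siegelSpace 2 :=
    SymCoord.pullback_mem Fin.succAbove_right_injective hωU
  obtain ⟨P, K, hP, hK, ht⟩ := exists_latticeProj_of_order_two _ _ hΩ h0
    (thetaP_eq_zero_of_coord hΩ h1)
  refine ⟨⟨latticeExtend i P, hP.latticeExtend i, by rw [trace_latticeExtend, ht]⟩,
    ⟨hωU, hK.latticeExtend hs⟩, fun h => ?_⟩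
  -- The two projections differ already in this diagonal entry, which is `0` for the extension and
  -- `1` for the standard projection.
  have : latticeExtend i P (Sum.inl i) (Sum.inl i) = stdProj i (Sum.inl i) (Sum.inl i) :=
    congrFun (congrFun h (Sum.inl i)) (Sum.inl i)
  rw [latticeExtend_apply_inl] at this
  simp [stdProj] at this

end Embedding

/-! ### Normal forms of reducible period matrices and the components of the reducible locus. -/

section EllipticConjugation

open Matrix

variable {g : ℕ} {N : Matrix (Fin g ⊕ Fin g) (Fin g ⊕ Fin g) ℤ}

/-- The standard elliptic projections. -/
def stdElliptic (i : Fin g) : EllipticProj g :=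
  ⟨stdProj i, ⟨by
    rw [stdProj, diagonal_mul_diagonal]
    congr 1
    ext (s | s) <;> by_cases h : s = i <;> simp [h], by
    ext (s | s) (t | t) <;> simp [stdProj, J, Matrix.one_apply] <;> aesop⟩, by
    simp [stdProj, trace_diagonal]⟩

theorem EllipticProj.exists_conj (hN : N ∈ symplecticGroup (Fin g) ℤ) (Q : EllipticProj g) :
    ∃ P : EllipticProj g, N * P.1 = Q.1 * N := by
  have hMN := spInv_mul hN
  have hNM := mul_spInv hN
  have hNJ : N * J (Fin g) ℤ = J (Fin g) ℤ * (spInv N)ᵀ := by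
    have h := congrArg (· * (spInv N)ᵀ) (SymplecticGroup.mem_iff.1 hN)
    simpa only [Matrix.mul_assoc, ← transpose_mul, hMN, transpose_one, Matrix.mul_one] using h
  have hMJ : spInv N * J (Fin g) ℤ = J (Fin g) ℤ * Nᵀ := by
    have h := congrArg (· * Nᵀ) (SymplecticGroup.mem_iff.1 (spInv_mem hN))
    simpa only [Matrix.mul_assoc, ← transpose_mul, hNM, transpose_one, Matrix.mul_one] using h
  refine ⟨⟨spInv N * (Q.1 * N), ⟨?_, ?_⟩, ?_⟩, ?_⟩
  · calc spInv N * (Q.1 * N) * (spInv N * (Q.1 * N))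
        = spInv N * (Q.1 * (N * spInv N) * Q.1 * N) := by simp only [Matrix.mul_assoc]
      _ = _ := by rw [hNM, Matrix.mul_one, Q.2.1.mul_self]
  · rw [Matrix.mul_assoc, Matrix.mul_assoc, hNJ, ← Matrix.mul_assoc Q.1, Q.2.1.mul_J,
      Matrix.mul_assoc, ← Matrix.mul_assoc, hMJ]
    simp only [transpose_mul, Matrix.mul_assoc]
  · rw [Matrix.trace_mul_comm, Matrix.mul_assoc, hNM, Matrix.mul_one, Q.2.2]
  · rw [← Matrix.mul_assoc, hNM, Matrix.one_mul]

theorem EllipticProj.exists_conj' (hN : N ∈ symplecticGroup (Fin g) ℤ) (P : EllipticProj g) :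
    ∃ Q : EllipticProj g, N * P.1 = Q.1 * N := by
  obtain ⟨Q, hQ⟩ := EllipticProj.exists_conj (spInv_mem hN) P
  refine ⟨Q, ?_⟩
  have h := congrArg (fun A => N * A * N) hQ
  simp only [← Matrix.mul_assoc, mul_spInv hN, Matrix.one_mul] at h
  rw [h, Matrix.mul_assoc, spInv_mul hN, Matrix.mul_one]

theorem eq_of_conj_left (hN : N ∈ symplecticGroup (Fin g) ℤ)
    {A B : Matrix (Fin g ⊕ Fin g) (Fin g ⊕ Fin g) ℤ} (h : A * N = B * N) : A = B := by
  have := congrArg (· * spInv N) h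
  simpa only [Matrix.mul_assoc, mul_spInv hN, Matrix.mul_one] using this

theorem eq_of_conj_right (hN : N ∈ symplecticGroup (Fin g) ℤ)
    {A B : Matrix (Fin g ⊕ Fin g) (Fin g ⊕ Fin g) ℤ} (h : N * A = N * B) : A = B := by
  have := congrArg (spInv N * ·) h
  simpa only [← Matrix.mul_assoc, spInv_mul hN, Matrix.one_mul] using this

theorem stdProj_injective : Function.Injective (stdProj : Fin g → _) := by
  intro i j h
  by_contra hij
  have := congrFun (congrFun h (Sum.inl i)) (Sum.inl i)
  simp [stdProj, hij] at this

theorem mem_reducibleLocus_three {ω : SymCoord 3} :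
    ω ∈ reducibleLocus 3 ↔ ∃ P : EllipticProj 3, ω ∈ projLocus P.1 := by
  rw [reducibleLocus_three, Set.mem_iUnion]

theorem spAction_mem_reducibleLocus_iff {N : Matrix (Fin 3 ⊕ Fin 3) (Fin 3 ⊕ Fin 3) ℤ}
    (hN : N ∈ symplecticGroup (Fin 3) ℤ) {ω : SymCoord 3} (hω : ω ∈ siegelSpace 3) :
    spAction N ω ∈ reducibleLocus 3 ↔ ω ∈ reducibleLocus 3 := by
  rw [mem_reducibleLocus_three, mem_reducibleLocus_three]
  constructor
  · rintro ⟨Q, hQ⟩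
    obtain ⟨P, hP⟩ := Q.exists_conj hN
    exact ⟨P, (mem_projLocus_iff_spAction hN hP hω).1 hQ⟩
  · rintro ⟨P, hP⟩
    obtain ⟨Q, hQ⟩ := P.exists_conj' hN
    exact ⟨Q, (mem_projLocus_iff_spAction hN hQ hω).2 hP⟩

theorem projLocus_stdProj_subset_reducibleLocus (i : Fin 3) :
    projLocus (stdProj i) ⊆ reducibleLocus 3 := fun _ h =>
  mem_reducibleLocus_three.2 ⟨stdElliptic i, h⟩

/-- The elliptic loci through a point of all three standard ones. -/
theorem exists_eq_stdElliptic {p : SymCoord 3} (hp : ∀ i, p ∈ projLocus (stdProj i))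
    {Q : EllipticProj 3} (hQ : p ∈ projLocus Q.1) : ∃ i, Q = stdElliptic i := by
  by_contra! h
  have h1 : ∀ i, Q.1 * stdProj i = 0 := fun i =>
    (eq_or_orthogonal_of_mem_projLocus Q.2.1 Q.2.2 (stdElliptic i).2.1 (stdElliptic i).2.2 hQ
      (hp i)).resolve_left fun h' => h i (Subtype.ext h')
  -- The standard projections add up to the identity, so one orthogonal to all three of them would
  -- be zero.
  have h2 : stdProj 0 + stdProj 1 + stdProj (2 : Fin 3) = 1 := by decide
  have h3 : Q.1 = 0 := by
    rw [← Matrix.mul_one Q.1, ← h2, Matrix.mul_add, Matrix.mul_add, h1, h1, h1]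
    simp
  have := Q.2.2
  rw [h3] at this
  simp at this

/-- Up to symplectic transformations, a reducible period matrix is diagonal, or it lies on the
first standard elliptic locus and on no other one. -/
theorem exists_normal_form {p : SymCoord 3} (hp : p ∈ reducibleLocus 3) :
    ∃ N ∈ symplecticGroup (Fin 3) ℤ, spAction N p ∈ projLocus (stdProj 0) ∧
      ((∀ i, spAction N p ∈ projLocus (stdProj i)) ∨
        ∀ Q : EllipticProj 3, spAction N p ∈ projLocus Q.1 → Q = stdElliptic 0) := by
  obtain ⟨P, hP⟩ := mem_reducibleLocus_three.1 hp
  have hpU := hP.1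
  -- A second elliptic locus through `p` belongs to an orthogonal projection, so both can be moved
  -- to standard position together. The vanishing of all off-diagonal entries then puts the point on
  -- the third standard locus as well.
  by_cases h : ∃ Q : EllipticProj 3, p ∈ projLocus Q.1 ∧ P ≠ Q
  · obtain ⟨Q, hQ, hPQ⟩ := h
    have h0 := (eq_or_orthogonal_of_mem_projLocus P.2.1 P.2.2 Q.2.1 Q.2.2 hP hQ).resolve_left
      fun h => hPQ (Subtype.ext h)
    obtain ⟨N, hN, hNP, hNQ, -⟩ := exists_symplectic_pair P.2.1 P.2.2 Q.2.1 Q.2.2 h0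
    have e0 := (mem_projLocus_iff_spAction hN hNP hpU).2 hP
    have e1 := (mem_projLocus_iff_spAction hN hNQ hpU).2 hQ
    refine ⟨N, hN, e0, Or.inl fun i => ?_⟩
    fin_cases i
    · exact e0
    · exact e1
    · refine mem_projLocus_stdProj.2 ⟨e0.1, fun j hj => ?_⟩
      fin_cases j
      · rw [Sym2.eq_swap]
        exact (mem_projLocus_stdProj.1 e0).2 2 (by decide)
      · rw [Sym2.eq_swap]
        exact (mem_projLocus_stdProj.1 e1).2 2 (by decide)
      · exact absurd rfl hj
  · push Not at h
    obtain ⟨N, hN, hNP⟩ := exists_symplectic_one P.2.1 P.2.2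
    refine ⟨N, hN, (mem_projLocus_iff_spAction hN hNP hpU).2 hP, Or.inr fun Q hQ => ?_⟩
    obtain ⟨P', hP'⟩ := Q.exists_conj hN
    rw [← h P' ((mem_projLocus_iff_spAction hN hP' hpU).1 hQ), hNP] at hP'
    exact Subtype.ext (eq_of_conj_left hN hP'.symm)

theorem exists_open_forall_projLocus {p : SymCoord 3} (hp : p ∈ siegelSpace 3) :
    ∃ V, IsOpen V ∧ p ∈ V ∧ V ⊆ siegelSpace 3 ∧
      ∀ q ∈ V, ∀ Q : EllipticProj 3, q ∈ projLocus Q.1 → p ∈ projLocus Q.1 := by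
  obtain ⟨V, hV, hpV, hVU, h⟩ := isLocallyFiniteIn_projLocus.exists_open_forall isOpen_siegelSpace
    (fun P : EllipticProj 3 => isAnalyticSubset_projLocus P.1) hp
  exact ⟨V, hV, hpV, hVU, fun q hq Q hQ => h Q ⟨q, hQ, hq⟩⟩

/-- The irreducible components of a union of elliptic loci. -/
theorem isAnalyticComponent_iff {A : Set (SymCoord 3)} {s : Set (EllipticProj 3)}
    (hA : A = ⋃ P ∈ s, projLocus P.1) {C : Set (SymCoord 3)} :
    IsAnalyticComponent (siegelSpace 3) A C ↔ ∃ P ∈ s, C = projLocus P.1 := by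
  have hirr : ∀ P : EllipticProj 3, IsIrreducibleAnalytic (siegelSpace 3) (projLocus P.1) :=
    fun P => isIrreducibleAnalytic_projLocus P.2.1 P.2.2
  have hsub : ∀ P ∈ s, projLocus P.1 ⊆ A := fun P hP => by
    rw [hA]
    exact Set.subset_biUnion_of_mem (u := fun P : EllipticProj 3 => projLocus P.1) hP
  have hex : ∀ Z, IsIrreducibleAnalytic (siegelSpace 3) Z → Z ⊆ A → ∃ P ∈ s, Z ⊆ projLocus P.1 :=
    fun Z hZ hZA => hZ.exists_subset isOpen_siegelSpace (fun P => (hirr P).1)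
      isLocallyFiniteIn_projLocus (hZA.trans hA.subset)
  constructor
  · intro h
    obtain ⟨P, hP, hCP⟩ := hex C h.1.1 h.1.2
    exact ⟨P, hP, hCP.antisymm (h.2 ⟨hirr P, hsub P hP⟩ hCP)⟩
  · rintro ⟨P, hP, rfl⟩
    refine ⟨⟨hirr P, hsub P hP⟩, fun Z hZ hPZ => ?_⟩
    obtain ⟨Q, hQ, hZQ⟩ := hex Z hZ.1 hZ.2
    have := eq_of_projLocus_subset P.2.1 P.2.2 Q.2.1 Q.2.2 (hPZ.trans hZQ)
    rwa [this]

end EllipticConjugation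

/-! ### Local structure of the thetanull at the two normal forms. -/

section LocalStructure

variable {δ : ThetaChar 3} {p : SymCoord 3}

theorem projLocus_subset_of_odd {n : ℕ} {δ : ThetaChar (n + 1)} {i : Fin (n + 1)}
    (h : ¬ (δ.pull fun _ : Fin 1 => i).IsEven) :
    projLocus (stdProj i) ⊆ thetanullLocus δ := by
  intro q hq
  obtain ⟨hqU, hq0⟩ := mem_projLocus_stdProj.1 hq
  rw [mem_thetanullLocus_iff, thetaChar_split hqU hq0, thetaChar_zero_of_odd h, zero_mul]
  exact ⟨hqU, rfl⟩

theorem eq_or_eq_or_eq_succAbove (i : Fin 3) (j : Fin 2) (l : Fin 3) :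
    l = i ∨ l = i.succAbove j ∨ l = i.succAbove (j.succAbove 0) := by
  revert i j l
  decide

/-- A thetanull vanishing at a diagonal period matrix has exactly two odd factors. -/
theorem exists_odd_pair (hδ : δ.IsEven) (hp : p ∈ thetanullLocus δ)
    (hdiag : ∀ i, p ∈ projLocus (stdProj i)) : ∃ (i : Fin 3) (j : Fin 2),
      ¬ (δ.pull fun _ : Fin 1 => i).IsEven ∧ ¬ (δ.pull fun _ : Fin 1 => i.succAbove j).IsEven ∧
        thetaNullDeriv δ p (Pi.single s(i, i.succAbove j) 1) ≠ 0 := by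
  obtain ⟨hpU, hp0⟩ := mem_thetanullLocus_iff.1 hp
  have hsplit : ∀ i j, j ≠ i → p s(i, j) = 0 := fun i => (mem_projLocus_stdProj.1 (hdiag i)).2
  have hpull : ∀ {m : ℕ} {f : Fin m → Fin 3}, Function.Injective f → p.pullback f ∈ siegelSpace m :=
    fun hf => SymCoord.pullback_mem hf hpU
  have hsplit₂ : ∀ (i : Fin 3) (j k : Fin 2), k ≠ j → p.pullback i.succAbove s(j, k) = 0 :=
    fun i j k hkj => hsplit _ _ fun h => hkj (Fin.succAbove_right_injective h)
  -- If all three one-dimensional characteristics were even, the thetanull would be a product of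
  -- nonzero one-variable thetanulls.
  have hodd : ∃ i, ¬ (δ.pull fun _ : Fin 1 => i).IsEven := by
    by_contra! h
    have hβ := ((δ.isEven_split 0).1 hδ).1 (h 0)
    have hγ := ((ThetaChar.isEven_split 0 _).1 hβ).1 (h _)
    have hΩ := hpull (Fin.succAbove_right_injective (p := (0 : Fin 3)))
    rw [thetaChar_split hpU (hsplit 0), thetaChar_split hΩ (hsplit₂ 0 0)] at hp0
    refine mul_ne_zero (thetaChar_one_ne_zero (h 0) (hpull (Function.injective_of_subsingleton _)))
      (mul_ne_zero (thetaChar_one_ne_zero (h _) ?_) (thetaChar_one_ne_zero hγ ?_)) hp0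
    · exact SymCoord.pullback_mem (Function.injective_of_subsingleton _) hΩ
    · exact SymCoord.pullback_mem Fin.succAbove_right_injective hΩ
  obtain ⟨i, hi⟩ := hodd
  have hΩ := hpull (Fin.succAbove_right_injective (p := i))
  have hβ : ¬ (δ.pull i.succAbove).IsEven := fun h => hi (((δ.isEven_split i).1 hδ).2 h)
  -- As the total characteristic is even, the complement of an odd factor is odd, so exactly one of
  -- its two factors is odd.
  have hj : ∃ j, ¬ ((δ.pull i.succAbove).pull fun _ : Fin 1 => j).IsEven ∧
      ((δ.pull i.succAbove).pull j.succAbove).IsEven := by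
    by_cases h : ((δ.pull i.succAbove).pull fun _ : Fin 1 => (0 : Fin 2)).IsEven
    · refine ⟨1, ?_, ?_⟩
      · intro h'
        refine hβ ((ThetaChar.isEven_split 0 _).2 (iff_of_true h ?_))
        convert h' using 2
        decide
      · convert h using 2
        decide
    · refine ⟨0, h, ?_⟩
      by_contra h'
      exact hβ ((ThetaChar.isEven_split 0 _).2 (iff_of_false h h'))
  obtain ⟨j, hj, hk⟩ := hj
  refine ⟨i, j, hi, hj, ?_⟩
  rw [thetaNullDeriv_split hpU (hsplit i), thetaCoordDeriv_split_fst hΩ (hsplit₂ i j)]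
  refine mul_ne_zero (thetaCoordDeriv_one_ne_zero hi (hpull (Function.injective_of_subsingleton _)))
    (mul_ne_zero (inv_ne_zero Complex.two_pi_I_ne_zero)
      (mul_ne_zero (thetaCoordDeriv_one_ne_zero hj ?_) (thetaChar_one_ne_zero hk ?_)))
  · exact SymCoord.pullback_mem (Function.injective_of_subsingleton _) hΩ
  · exact SymCoord.pullback_mem Fin.succAbove_right_injective hΩ

/-- The line through `p` in the direction of the entry `(a, b)` stays in the slice of `k` as long as
neither index is `k`. On a slice inside the thetanull locus the derivative along it would vanish. -/
theorem not_projLocus_subset {k : Fin 3} (hp : p ∈ projLocus (stdProj k)) {a b : Fin 3}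
    (ha : a ≠ k) (hb : b ≠ k) (h : thetaNullDeriv δ p (Pi.single s(a, b) 1) ≠ 0) :
    ¬ projLocus (stdProj k) ⊆ thetanullLocus δ := by
  intro hsub
  obtain ⟨hpU, hp0⟩ := mem_projLocus_stdProj.1 hp
  set d : SymCoord 3 := Pi.single s(a, b) 1 with hd
  have hl : HasDerivAt (fun t : ℂ => p + t • d) d 0 := by
    simpa using ((hasDerivAt_id (0 : ℂ)).smul_const d).const_add p
  have h1 : HasDerivAt (fun t : ℂ => thetaChar δ (p + t • d) 0) (thetaNullDeriv δ p d) 0 := by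
    rw [← thetaNullFDeriv_apply δ hpU]
    exact (hasFDerivAt_thetaNull δ hpU).comp_hasDerivAt_of_eq (0 : ℂ) hl (by simp)
  have h2 : (fun t : ℂ => thetaChar δ (p + t • d) 0) =ᶠ[nhds 0] fun _ => 0 := by
    have hU : ∀ᶠ t in nhds (0 : ℂ), p + t • d ∈ siegelSpace 3 :=
      hl.continuousAt.eventually (isOpen_siegelSpace.mem_nhds (by simpa using hpU))
    filter_upwards [hU] with t ht
    refine (mem_thetanullLocus_iff.1 (hsub (mem_projLocus_stdProj.2 ⟨ht, fun j hj => ?_⟩))).2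
    have : s(k, j) ≠ s(a, b) := by
      rw [Ne, Sym2.eq_iff]
      rintro (⟨h, -⟩ | ⟨h, -⟩)
      · exact ha h.symm
      · exact hb h.symm
    rw [Pi.add_apply, Pi.smul_apply, hd, Pi.single_eq_of_ne this, smul_zero, add_zero, hp0 j hj]
  exact h (h1.unique ((hasDerivAt_const (0 : ℂ) (0 : ℂ)).congr_of_eventuallyEq h2))

/-- The local structure of the reducible thetanull locus at a diagonal period matrix. -/
theorem local_structure_diagonal (hδ : δ.IsEven) (hp : p ∈ thetanullLocus δ)
    (hdiag : ∀ i, p ∈ projLocus (stdProj i)) :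
    (∃ a b c : Fin 3, a ≠ b ∧ (∀ l, l = a ∨ l = b ∨ l = c) ∧
      projLocus (stdProj a) ⊆ thetanullLocus δ ∧ projLocus (stdProj b) ⊆ thetanullLocus δ ∧
        ¬ projLocus (stdProj c) ⊆ thetanullLocus δ) ∧
      HasNormalCrossingsAt (thetanullLocus δ) (thetanullLocus δ ∩ reducibleLocus 3) p := by
  obtain ⟨i, j, hi, hj, hne⟩ := exists_odd_pair hδ hp hdiag
  have hcov := eq_or_eq_or_eq_succAbove i j
  have hji : i.succAbove j ≠ i := Fin.succAbove_ne i j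
  set k := i.succAbove (j.succAbove 0)
  have hki : k ≠ i := Fin.succAbove_ne i _
  have hkj : k ≠ i.succAbove j := fun h =>
    Fin.succAbove_ne j 0 (Fin.succAbove_right_injective h)
  set a := i.succAbove j
  have hXi := projLocus_subset_of_odd hi
  have hXj := projLocus_subset_of_odd hj
  have hoff : ∀ i j, j ≠ i → p s(i, j) = 0 := fun i => (mem_projLocus_stdProj.1 (hdiag i)).2
  refine ⟨⟨i, a, k, hji.symm, hcov, hXi, hXj,
    not_projLocus_subset (hdiag k) hki.symm hkj.symm hne⟩, ?_⟩
  obtain ⟨V, hV, hpV, hVU, hloc⟩ := exists_open_forall_projLocus hp.1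
  -- The entry coupling the two odd factors is replaced by the thetanull; the slices of `i` and `a`
  -- are then the zero loci of the entries coupling them to the even index `k`. The slice of `k`
  -- adds nothing, being contained in the locus where both of these entries vanish.
  refine hasNormalCrossingsAt_of_coord hp (c := s(i, a)) (T := {s(i, k), s(a, k)}) ?_ hne
    (hoff _ _ hji) ?_ ?_ hV hpV ?_
  · simp [hki.symm, hkj.symm, hji.symm]
  · simp [hoff i k hki, hoff a k hkj]
  · intro q hq hqc d hd hqd
    rw [Finset.mem_insert, Finset.mem_singleton] at hd
    rcases hd with rfl | rfl
    · have : q ∈ projLocus (stdProj i) := by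
        refine mem_projLocus_stdProj.2 ⟨hq, fun l hl => ?_⟩
        rcases hcov l with rfl | rfl | rfl
        · exact absurd rfl hl
        · exact hqc
        · exact hqd
      exact ⟨hXi this, projLocus_stdProj_subset_reducibleLocus i this⟩
    · have : q ∈ projLocus (stdProj a) := by
        refine mem_projLocus_stdProj.2 ⟨hq, fun l hl => ?_⟩
        rcases hcov l with rfl | rfl | rfl
        · rw [Sym2.eq_swap]
          exact hqc
        · exact absurd rfl hl
        · exact hqd
      exact ⟨hXj this, projLocus_stdProj_subset_reducibleLocus a this⟩
  · intro q hq hqD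
    obtain ⟨Q, hQ⟩ := mem_reducibleLocus_three.1 hqD.2
    obtain ⟨l, rfl⟩ := exists_eq_stdElliptic hdiag (hloc q hq Q hQ)
    have h0 := (mem_projLocus_stdProj.1 hQ).2
    rcases hcov l with rfl | rfl | rfl
    · exact ⟨s(l, k), by simp, h0 k hki⟩
    · exact ⟨s(a, k), by simp, h0 k hkj⟩
    · exact ⟨s(i, k), by simp, by rw [Sym2.eq_swap]; exact h0 i hki.symm⟩

/-- The local structure of the reducible thetanull locus at a period matrix on a single elliptic
locus. -/
theorem local_structure_single (hδ : δ.IsEven) (hp : p ∈ thetanullLocus δ)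
    (hp0 : p ∈ projLocus (stdProj 0))
    (huniq : ∀ Q : EllipticProj 3, p ∈ projLocus Q.1 → Q = stdElliptic 0) :
    projLocus (stdProj 0) ⊆ thetanullLocus δ ∧
      HasNormalCrossingsAt (thetanullLocus δ) (thetanullLocus δ ∩ reducibleLocus 3) p := by
  obtain ⟨hpU, hF⟩ := mem_thetanullLocus_iff.1 hp
  have hoff := (mem_projLocus_stdProj.1 hp0).2
  have htwo : ¬ (thetaChar (δ.pull (Fin.succAbove 0)) (p.pullback (Fin.succAbove 0)) 0 = 0 ∧
      ∀ j, thetaCoordDeriv (δ.pull (Fin.succAbove 0)) (p.pullback (Fin.succAbove 0)) j = 0) := by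
    rintro ⟨h0, h1⟩
    obtain ⟨Q, hQ, hne⟩ := exists_projLocus_of_order_two hp0 h0 h1
    exact hne (congrArg Subtype.val (huniq Q hQ))
  have hτ : p.pullback (fun _ : Fin 1 => 0) ∈ siegelSpace 1 :=
    SymCoord.pullback_mem (Function.injective_of_subsingleton _) hpU
  have hΩ : p.pullback (Fin.succAbove 0) ∈ siegelSpace 2 :=
    SymCoord.pullback_mem Fin.succAbove_right_injective hpU
  -- If the factors were even, the two-variable thetanull would vanish, and by evenness to order
  -- two. That would produce a second elliptic locus through `p`.
  have hodd : ¬ (δ.pull fun _ : Fin 1 => 0).IsEven := by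
    intro h
    have hβ := ((δ.isEven_split 0).1 hδ).1 h
    rw [thetaChar_split hpU hoff, mul_eq_zero, or_iff_right (thetaChar_one_ne_zero h hτ)] at hF
    exact htwo ⟨hF, fun j => thetaP_zero_of_even hβ hΩ _⟩
  have hβ : ¬ (δ.pull (Fin.succAbove 0)).IsEven := fun h =>
    hodd (((δ.isEven_split 0).1 hδ).2 h)
  have hX := projLocus_subset_of_odd hodd
  refine ⟨hX, ?_⟩
  -- The odd theta function of the surface vanishes at the origin, so some first derivative is
  -- nonzero; otherwise a second elliptic locus would again pass through `p`.
  obtain ⟨j, hj⟩ : ∃ j, thetaCoordDeriv (δ.pull (Fin.succAbove 0))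
      (p.pullback (Fin.succAbove 0)) j ≠ 0 := by
    by_contra! h
    exact htwo ⟨thetaChar_zero_of_odd hβ _, h⟩
  have hne : thetaNullDeriv δ p (Pi.single s(0, Fin.succAbove 0 j) 1) ≠ 0 := by
    rw [thetaNullDeriv_split hpU hoff]
    exact mul_ne_zero (thetaCoordDeriv_one_ne_zero hodd hτ)
      (mul_ne_zero (inv_ne_zero Complex.two_pi_I_ne_zero) hj)
  have hcov := eq_or_eq_or_eq_succAbove 0 j
  have ha0 : Fin.succAbove 0 j ≠ 0 := Fin.succAbove_ne 0 j
  set k : Fin 3 := Fin.succAbove 0 (j.succAbove 0)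
  have hk0 : k ≠ 0 := Fin.succAbove_ne 0 _
  have hka : k ≠ Fin.succAbove 0 j := fun h =>
    Fin.succAbove_ne j 0 (Fin.succAbove_right_injective h)
  set a : Fin 3 := Fin.succAbove 0 j
  obtain ⟨V, hV, hpV, hVU, hloc⟩ := exists_open_forall_projLocus hpU
  -- The slice is given by two entries; one is replaced by the thetanull, and the other cuts out the
  -- slice in the thetanull locus.
  refine hasNormalCrossingsAt_of_coord hp (c := s(0, a)) (T := {s(0, k)}) ?_ hne
    (hoff _ ha0) ?_ ?_ hV hpV ?_
  · simp [hka.symm, hk0.symm]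
  · simp [hoff k hk0]
  · intro q hq hqc d hd hqd
    rw [Finset.mem_singleton] at hd
    subst hd
    have : q ∈ projLocus (stdProj 0) := by
      refine mem_projLocus_stdProj.2 ⟨hq, fun l hl => ?_⟩
      rcases hcov l with rfl | rfl | rfl
      · exact absurd rfl hl
      · exact hqc
      · exact hqd
    exact ⟨hX this, projLocus_stdProj_subset_reducibleLocus 0 this⟩
  · intro q hq hqD
    obtain ⟨Q, hQ⟩ := mem_reducibleLocus_three.1 hqD.2
    rw [huniq Q (hloc q hq Q hQ)] at hQ
    exact ⟨s(0, k), by simp, (mem_projLocus_stdProj.1 hQ).2 k hk0⟩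

end LocalStructure

/-! ### Globalization: components and normal crossings of the reducible thetanull locus. -/

section ReducibleThetanull

open Matrix

variable {δ : ThetaChar 3} {p : SymCoord 3}

theorem isAnalyticSubset_thetanullLocus {g : ℕ} (δ : ThetaChar g) :
    IsAnalyticSubset (siegelSpace g) (thetanullLocus δ) :=
  .of_fintype (fun _ h => h.1) fun p hp => ⟨siegelSpace g, isOpen_siegelSpace, hp, subset_rfl, Unit,
    inferInstance, fun _ q => thetaChar δ q 0,
    fun _ q hq => (hasFDerivAt_thetaNull δ hq).differentiableAt.differentiableWithinAt,
    fun q hq => by rw [mem_thetanullLocus_iff, and_iff_right hq]; simp⟩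

theorem reducibleLocus_three_eq_biUnion :
    reducibleLocus 3 = ⋃ P ∈ (Set.univ : Set (EllipticProj 3)), projLocus P.1 := by
  rw [reducibleLocus_three, Set.biUnion_univ]

theorem projLocus_subset_iff_spAction {N : Matrix (Fin 3 ⊕ Fin 3) (Fin 3 ⊕ Fin 3) ℤ}
    (hN : N ∈ symplecticGroup (Fin 3) ℤ) {δ' : ThetaChar 3}
    (hD : ∀ ω ∈ siegelSpace 3, (spAction N ω ∈ thetanullLocus δ' ↔ ω ∈ thetanullLocus δ))
    {P Q : Matrix (Fin 3 ⊕ Fin 3) (Fin 3 ⊕ Fin 3) ℤ} (h : N * P = Q * N) :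
    projLocus P ⊆ thetanullLocus δ ↔ projLocus Q ⊆ thetanullLocus δ' := by
  constructor
  · intro hs q hq
    have hm := spAction_mem (spInv_mem hN) hq.1
    have hqq := spAction_spInv' hN hq.1
    rw [← hqq] at hq ⊢
    exact (hD _ hm).2 (hs ((mem_projLocus_iff_spAction hN h hm).1 hq))
  · intro hs q hq
    exact (hD q hq.1).1 (hs ((mem_projLocus_iff_spAction hN h hq.1).2 hq))

/-- Near a point of the reducible locus in a thetanull, the reducible thetanull locus has normal
crossings, and it contains an elliptic locus through that point. -/
theorem local_structure (hδ : δ.IsEven) (hp : p ∈ thetanullLocus δ ∩ reducibleLocus 3) :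
    (∃ P : EllipticProj 3, p ∈ projLocus P.1 ∧ projLocus P.1 ⊆ thetanullLocus δ) ∧
      HasNormalCrossingsAt (thetanullLocus δ) (thetanullLocus δ ∩ reducibleLocus 3) p := by
  have hpU := hp.1.1
  obtain ⟨N, hN, h0, h⟩ := exists_normal_form hp.2
  obtain ⟨δ', hδ', hD⟩ := exists_transform_characteristic hδ hN
  have hp' := (hD p hpU).2 hp.1
  suffices h : (∃ i, spAction N p ∈ projLocus (stdProj i) ∧
      projLocus (stdProj i) ⊆ thetanullLocus δ') ∧ HasNormalCrossingsAt (thetanullLocus δ')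
        (thetanullLocus δ' ∩ reducibleLocus 3) (spAction N p) by
    obtain ⟨⟨i, hi, his⟩, hnc⟩ := h
    obtain ⟨P, hP⟩ := (stdElliptic i).exists_conj hN
    exact ⟨⟨P, (mem_projLocus_iff_spAction hN hP hpU).1 hi,
      (projLocus_subset_iff_spAction hN hD hP).2 his⟩, hnc.of_spAction hN hpU hD fun q hq =>
        and_congr (hD q hq) (spAction_mem_reducibleLocus_iff hN hq)⟩
  rcases h with h | h
  · obtain ⟨⟨a, -, -, -, -, ha, -⟩, hnc⟩ := local_structure_diagonal hδ' hp' h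
    exact ⟨⟨a, h a, ha⟩, hnc⟩
  · obtain ⟨hX, hnc⟩ := local_structure_single hδ' hp' h0 h
    exact ⟨⟨0, h0, hX⟩, hnc⟩

/-- Every point lies on some elliptic locus contained entirely in the thetanull locus, so loci that
meet it only partially contribute nothing new. This identifies the irreducible components. -/
theorem inter_reducibleLocus_eq_biUnion (hδ : δ.IsEven) :
    thetanullLocus δ ∩ reducibleLocus 3 =
      ⋃ P ∈ {P : EllipticProj 3 | projLocus P.1 ⊆ thetanullLocus δ}, projLocus P.1 := by
  ext p
  rw [Set.mem_iUnion₂]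
  constructor
  · intro hp
    obtain ⟨⟨P, hP, hPD⟩, -⟩ := local_structure hδ hp
    exact ⟨P, hPD, hP⟩
  · rintro ⟨P, hPD, hP⟩
    exact ⟨hPD hP, mem_reducibleLocus_three.2 ⟨P, hP⟩⟩

theorem isRegularPoint_projLocus (P : EllipticProj 3) (hp : p ∈ projLocus P.1) :
    IsRegularPoint (projLocus P.1) p := by
  obtain ⟨N, hN, hNP⟩ := exists_symplectic_one P.2.1 P.2.2
  exact (isRegularPoint_projLocus_stdProj (c := 1) (by decide)
    ((mem_projLocus_iff_spAction hN hNP hp.1).2 hp)).of_spAction hN hp.1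
      fun q hq => mem_projLocus_iff_spAction hN hNP hq

/-- The reducible thetanull locus is a simple normal crossings divisor in the thetanull locus. -/
theorem isSNCDivisorIn_thetanullLocus (hδ : δ.IsEven) :
    IsSNCDivisorIn (siegelSpace 3) (thetanullLocus δ) (thetanullLocus δ ∩ reducibleLocus 3) := by
  refine ⟨fun _ h => h.1, Set.inter_subset_left, ?_, fun p hp => (local_structure hδ hp).2, ?_⟩
  · refine (isAnalyticSubset_thetanullLocus δ).inter ?_
    rw [reducibleLocus_three_eq_biUnion]
    exact isLocallyFiniteIn_projLocus.isAnalyticSubset_biUnion isOpen_siegelSpace _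
      fun P => isAnalyticSubset_projLocus P.1
  · intro C hC p hp
    obtain ⟨P, -, rfl⟩ := (isAnalyticComponent_iff (inter_reducibleLocus_eq_biUnion hδ)).1 hC
    exact isRegularPoint_projLocus P hp

theorem projLocus_injective :
    Function.Injective fun P : EllipticProj 3 => projLocus P.1 := fun P Q h =>
  Subtype.ext (eq_of_projLocus_subset P.2.1 P.2.2 Q.2.1 Q.2.2 (Set.Subset.antisymm_iff.1 h).1)

/-- A singular point of the reducible locus can be transformed to a diagonal period matrix. -/
theorem exists_diagonal_of_singular (hp : p ∈ singularLocus (reducibleLocus 3)) :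
    ∃ N ∈ symplecticGroup (Fin 3) ℤ, ∀ i, spAction N p ∈ projLocus (stdProj i) := by
  obtain ⟨hpR, hsing⟩ := hp
  have hpU := hpR.1
  obtain ⟨N, hN, h0, h⟩ := exists_normal_form hpR
  refine ⟨N, hN, h.resolve_right fun h => hsing ?_⟩
  -- When a single elliptic locus passes through the point, the reducible locus coincides with it
  -- nearby and is therefore smooth.
  have hreg : IsRegularPoint (reducibleLocus 3) (spAction N p) := by
    obtain ⟨V, hV, hpV, -, hloc⟩ := exists_open_forall_projLocus h0.1
    refine (isRegularPoint_projLocus_stdProj (c := 1) (by decide) h0).congr hV hpV fun q hq =>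
      ⟨fun hq' => projLocus_stdProj_subset_reducibleLocus 0 hq', fun hq' => ?_⟩
    obtain ⟨Q, hQ⟩ := mem_reducibleLocus_three.1 hq'
    rwa [h Q (hloc q hq Q hQ)] at hQ
  exact hreg.of_spAction hN hpU fun q hq => spAction_mem_reducibleLocus_iff hN hq

/-- The components of the reducible locus through a singular point in a thetanull. -/
theorem ncard_components (hδ : δ.IsEven)
    (hp : p ∈ thetanullLocus δ ∩ singularLocus (reducibleLocus 3)) :
    {C | IsAnalyticComponent (siegelSpace 3) (reducibleLocus 3) C ∧ p ∈ C}.ncard = 3 ∧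
      {C | IsAnalyticComponent (siegelSpace 3) (reducibleLocus 3) C ∧ p ∈ C ∧
        C ⊆ thetanullLocus δ}.ncard = 2 := by
  have hpU := hp.1.1
  obtain ⟨N, hN, hdiag⟩ := exists_diagonal_of_singular hp.2
  obtain ⟨δ', hδ', hD⟩ := exists_transform_characteristic hδ hN
  -- These are the three projections through `p` before the point is moved to a diagonal period
  -- matrix.
  choose P hP using fun i : Fin 3 => (stdElliptic i).exists_conj hN
  have hPinj : Function.Injective fun i => projLocus (P i).1 := by
    refine projLocus_injective.comp fun i j hij => stdProj_injective (eq_of_conj_left hN ?_)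
    exact (hP i).symm.trans ((congrArg (fun Q : EllipticProj 3 => N * Q.1) hij).trans (hP j))
  have hcomp : {C | IsAnalyticComponent (siegelSpace 3) (reducibleLocus 3) C ∧ p ∈ C} =
      Set.range fun i => projLocus (P i).1 := by
    ext C
    rw [Set.mem_ofPred_eq, isAnalyticComponent_iff reducibleLocus_three_eq_biUnion, Set.mem_range]
    constructor
    · rintro ⟨⟨Q, -, rfl⟩, hpQ⟩
      obtain ⟨Q', hQ'⟩ := Q.exists_conj' hN
      obtain ⟨i, rfl⟩ := exists_eq_stdElliptic hdiag ((mem_projLocus_iff_spAction hN hQ' hpU).2 hpQ)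
      exact ⟨i, congrArg projLocus (eq_of_conj_right hN ((hP i).trans hQ'.symm))⟩
    · rintro ⟨i, rfl⟩
      exact ⟨⟨P i, Set.mem_univ _, rfl⟩, (mem_projLocus_iff_spAction hN (hP i) hpU).1 (hdiag i)⟩
  obtain ⟨⟨a, b, c, hab, hcov, ha, hb, hc⟩, -⟩ :=
    local_structure_diagonal hδ' ((hD p hpU).2 hp.1) hdiag
  have hsub : ∀ i, projLocus (P i).1 ⊆ thetanullLocus δ ↔
      projLocus (stdProj i) ⊆ thetanullLocus δ' := fun i =>
    projLocus_subset_iff_spAction hN hD (hP i)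
  have hcomp₂ : {C | IsAnalyticComponent (siegelSpace 3) (reducibleLocus 3) C ∧ p ∈ C ∧
      C ⊆ thetanullLocus δ} = {projLocus (P a).1, projLocus (P b).1} := by
    ext C
    have h1 := Set.ext_iff.1 hcomp C
    rw [Set.mem_ofPred_eq] at h1
    rw [Set.mem_ofPred_eq, ← and_assoc, h1, Set.mem_insert_iff, Set.mem_singleton_iff]
    constructor
    · rintro ⟨⟨i, rfl⟩, hi⟩
      rcases hcov i with rfl | rfl | rfl
      · exact Or.inl rfl
      · exact Or.inr rfl
      · exact absurd ((hsub _).1 hi) hc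
    · rintro (rfl | rfl)
      · exact ⟨⟨a, rfl⟩, (hsub a).2 ha⟩
      · exact ⟨⟨b, rfl⟩, (hsub b).2 hb⟩
  rw [hcomp, hcomp₂, Set.ncard_pair fun h => hab (hPinj h), ← Set.image_univ,
    Set.ncard_image_of_injective _ hPinj, Set.ncard_univ]
  simp

end ReducibleThetanull

end

theorem corollary5p4 (δ : ThetaChar 3) (hδ : δ.IsEven) :
    (∀ p ∈ thetanullLocus δ ∩ singularLocus (reducibleLocus 3),
      {C | IsAnalyticComponent (siegelSpace 3) (reducibleLocus 3) C ∧ p ∈ C}.ncard = 3 ∧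
      {C | IsAnalyticComponent (siegelSpace 3) (reducibleLocus 3) C ∧ p ∈ C ∧
        C ⊆ thetanullLocus δ}.ncard = 2) ∧
    IsSNCDivisorIn (siegelSpace 3) (thetanullLocus δ)
      (thetanullLocus δ ∩ reducibleLocus 3) := by
  exact ⟨fun _ hp => ncard_components hδ hp, isSNCDivisorIn_thetanullLocus hδ⟩
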